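/- **Trilinear estimates.** *Setup.* Let $\delta=10^{-4}$, $\langle r\rangle=(1+|r|^2)^{1/2}$. Fix an even smooth $\varphi:\mathbb R\to[0,1]$ supported in $[-8/5,8/5]$ and equal to $1$ on $[-5/4,5/4]$; let $\varphi_k(\xi)=\varphi(|\xi|/2^k)-\varphi(|\xi|/2^{k-1})$, let $P_k$ be the operator on $\mathbb R^3$ with Fourier multiplier $\varphi_k$ ($k\in\mathbb Z$), and let $\widetilde\varphi_0=\varphi(|\cdot|)$, $\widetilde\varphi_j=\varphi_j$ ($j\ge1$), $\widetilde\varphi_{[a,b]}=\sum_{j\in[a,b],\,j\geq 0}\widetilde\varphi_j$. Define $$\|h\|_{B^0_t}=\sup_{k\in\mathbb Z}\{\langle t\rangle^3\|P_kh\|_{L^\infty}+\|P_kh\|_{L^1}\},\qquad \|g\|_{Stat_\delta}=\sup_{t\in[0,T]}\langle t\rangle^{1-2\delta}\|\langle\nabla_x\rangle g(t)\|_{B^0_t},$$ $$\|g\|_{Osc_\delta}=\sup_{t\in[0,T]}\langle t\rangle^{-\delta}\|g(t)\|_{B^0_t}+\sup_{t\in[0,T]}\langle t\rangle^{1-2\delta}\|\nabla_{x,t}g(t)\|_{B^0_t}.$$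 *Bootstrap assumptions* (with parameters $T>0$, $\varepsilon_0,\varepsilon_1>0$). $f$ is a regular solution on $\mathbb R^3\times\mathbb R^3\times[0,T]$ of $$(\partial_t+v\cdot\nabla_x)f+E\cdot\nabla_vM_0+E\cdot\nabla_vf=0,\quad \rho=\int_{\mathbb R^3} f\,dv,\quad E=\nabla_x\Delta_x^{-1}\rho,\quad M_0(v)=\frac1{\pi^2(1+|v|^2)^2};$$ here regular means that $f$ is $C^1$, that $v\mapsto f(x,v,t)$ is integrable, and that $\rho$ is continuous with $\rho(t)\in L^2\cap L^\infty$ for every $t$. The initial data $f_0=f(0)$ satisfy $\|\langle v\rangle^{4.5}\partial_x^\alpha\partial_v^\beta f_0\|_{L^p_xL^\infty_v}\le\varepsilon_0$ for $p\in\{1,\infty\}$ and $|\alpha|+|\beta|\le1$. Moreover $\varepsilon_1\le\varepsilon_0^{3/4}$, and $\rho=\rho^{stat}+\Re\{e^{-it}\rho^{osc}\}$, where $\rho^{stat}$ (real) and $\rho^{osc}$ (complex) are continuous on $\mathbb R^3\times[0,T]$ and bounded in $x$ for each $t$, the functions $P_k\rho^{osc}$ are differentiable in $t$, and $\|\rho^{stat}\|_{Stat_\delta}+\|\rho^{osc}\|_{Osc_\delta}\le\varepsilon_1$.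 *Operators.* Let $0\le\tau\le s\le T$, $j\in\mathbb Z_{\geq 0}$, $k\in\mathbb Z$, $A>0$. Let $\mathcal K_{j,k}(y,v)$ be complex valued and measurable, and let $P_1(y,v)$, $P_2(y,v,\gamma)$, $\gamma\in[0,s]$, be $\mathbb R^3$-valued and differentiable in each of their variables (they may depend on $\tau,s$), with $$|\mathcal K_{j,k}(y,v)|\le A\,2^{3k}(1+2^k|y|)^{-8}\,2^{-3j}\,\widetilde\varphi_{[j-4,j+4]}(v),$$ $$|\partial_yP_1|+\langle s\rangle^{-1}|\partial_vP_1|\le A\varepsilon_1,\qquad |\partial_yP_2|+\langle s\rangle^{-1}|\partial_vP_2|+|\partial_\gamma P_2|\le A\varepsilon_1.$$ Let $C(x,y,v,\gamma)$ be complex valued and measurable. Define $$\mathcal Q_{j,k}(F,G;C)(x,\gamma,\tau,s)=\int_{\mathbb R^3}\!\int_{\mathbb R^3}\mathcal K_{j,k}(x-y,v)\,C(x,y,v,\gamma)\,F(y-(s-\tau)v+P_1(y,v),\tau)\,G(y-(s-\gamma)v+P_2(y,v,\gamma),\gamma)\,dy\,dv,$$ $$\mathcal B_{j,k}(F,G;C)(x,\tau,s)=\int_{t_3}^{t_4}\mathcal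 Q_{j,k}(F,G;C)(x,\gamma,\tau,s)\,d\gamma,\qquad \Lambda^\ast(C)=\sup_{\gamma\in[t_3,t_4]}\big\{\|C(\cdot,\gamma)\|_{L^\infty_{x,y,v}}+\|\langle\gamma\rangle\partial_\gamma C(\cdot,\gamma)\|_{L^\infty_{x,y,v}}\big\}.$$ Let $\mathcal R^1,\mathcal R^2$ be Fourier multiplier operators with $C^8$ symbols on $\mathbb R^3\setminus\{0\}$ satisfying $|\xi|^{|\alpha|}|D^\alpha_\xi\mathcal R^l(\xi)|\le1$ for $|\alpha|\le8$, $\xi\ne0$. *Claim.* For every $\varphi$ and $A$ as above there are $\overline\varepsilon\in(0,1]$ and $M>0$, depending only on $\varphi$ and $A$, such that under all of the above assumptions, with $\varepsilon_0\le\overline\varepsilon$, the following holds. (i) Let $m_2\ge0$ be an integer with $2^{m_2-1}\le s$, let $t_3\le t_4$ lie in $[2^{m_2}-1,2^{m_2+1}]\cap[0,s]$, and let $C$ be differentiable in $\gamma\in[0,s]$. Write $\mu_a=\min\{2^{-am_2},\langle\tau\rangle^{-a}\}$. Then, for all components of the fields and of their gradients and every $k_1\in\mathbb Z$, $$\|\mathcal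 B_{j,k}(\mathcal R^1\nabla E,\mathcal R^2E;C)(\cdot,\tau,s)\|_{B^0_s}\le M\varepsilon_1^2\,\mu_{1.1}\,\Lambda^\ast(C),$$ $$\|\mathcal B_{j,k}(\mathcal R^1E,\mathcal R^2\nabla E;C)(\cdot,\tau,s)\|_{B^0_s}\le M\varepsilon_1^2\,\mu_{1.1}\,\Lambda^\ast(C),$$ $$\|\mathcal B_{j,k}(\mathcal R^1E,\mathcal R^2E;C)(\cdot,\tau,s)\|_{B^0_s}\le M\varepsilon_1^2\,\mu_{0.1}\,\Lambda^\ast(C),$$ $$\|\mathcal B_{j,k}(\mathcal R^1\nabla E,\mathcal R^2\nabla E;C)(\cdot,\tau,s)\|_{B^0_s}\le M\varepsilon_1^2\,\mu_{2.1}\,\Lambda^\ast(C),$$ $$\|\mathcal B_{j,k}(\mathcal R^1\nabla^2P_{k_1}E,\mathcal R^2E;C)(\cdot,\tau,s)\|_{B^0_s}\le M\varepsilon_1^2\langle\tau\rangle^{-1}\mu_{1.1}\,\Lambda^\ast(C),$$ $$\|\mathcal B_{j,k}(\mathcal R^1\nabla^2P_{k_1}E,\mathcal R^2\nabla E;C)(\cdot,\tau,s)\|_{B^0_s}\le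 M\varepsilon_1^2\langle\tau\rangle^{-1}\mu_{2.1}\,\Lambda^\ast(C).$$ (ii) For all $k_1,k_2\in\mathbb Z$ and $\gamma\in[0,s]$ the function $\mathcal Q=\mathcal Q_{j,k}(P_{k_1}\mathcal R^1\rho,P_{k_2}\mathcal R^2\rho;C)(\cdot,\gamma,\tau,s)$ satisfies $$\|\mathcal Q\|_{L^1_x}+\langle s\rangle^3\|\mathcal Q\|_{L^\infty_x}\le M\,\frac{\varepsilon_1^2}{\langle\tau\rangle^{1-2\delta}2^{k_1}+\langle\tau\rangle^{-\delta}}\cdot\frac{\min\{2^{\min(k_1,k_2)},\langle\tau\rangle^{-1},\langle\gamma\rangle^{-1}\}^3}{\langle\gamma\rangle^{1-2\delta}2^{k_2}+\langle\gamma\rangle^{-\delta}}\,\|C(\cdot,\cdot,\cdot,\gamma)\|_{L^\infty_{x,y,v}}.$$ -/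

import Mathlib

open MeasureTheory Set
open scoped ENNReal ContDiff

noncomputable section

namespace VPPoisson

/-- The Euclidean space `ℝ³`. -/
abbrev E3 : Type := EuclideanSpace ℝ (Fin 3)

/-- The `a`-th vector of the canonical basis of `ℝ³`. -/
def basisVec (a : Fin 3) : E3 := EuclideanSpace.single a 1

/-- The partial derivative `∂_a g` of a function on `ℝ³`. -/
def pd (a : Fin 3) (g : E3 → ℂ) (x : E3) : ℂ := fderiv ℝ g x (basisVec a)

/-- The Japanese bracket `⟨r⟩ = (1 + r²)^{1/2}` of a real number. -/
def jap (r : ℝ) : ℝ := Real.sqrt (1 + r ^ 2)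

/-- The small parameter `δ = 10⁻⁴`. -/
def del : ℝ := 1 / 10 ^ 4

/-! ### Dyadic cutoffs and Fourier multipliers -/

/-- `φ : ℝ → [0,1]` is even and smooth, supported in `[-8/5, 8/5]` and equal to `1` in
`[-5/4, 5/4]`. -/
structure IsCutoff (φ : ℝ → ℝ) : Prop where
  smooth : ContDiff ℝ ∞ φ
  even : ∀ r, φ (-r) = φ r
  mem_unit : ∀ r, φ r ∈ Icc (0 : ℝ) 1
  supp : ∀ r, 8 / 5 < |r| → φ r = 0
  one : ∀ r, |r| ≤ 5 / 4 → φ r = 1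

/-- `φ_k(ξ) = φ(|ξ|/2^k) - φ(|ξ|/2^{k-1})`. -/
def phiK (φ : ℝ → ℝ) (k : ℤ) (ξ : E3) : ℝ :=
  φ (‖ξ‖ / (2 : ℝ) ^ k) - φ (‖ξ‖ / (2 : ℝ) ^ (k - 1))

/-- `φ̃_0 = φ_{≤ 0}` and `φ̃_j = φ_j` for `j ≥ 1`. -/
def phiT (φ : ℝ → ℝ) (j : ℕ) (v : E3) : ℝ :=
  if j = 0 then φ ‖v‖ else phiK φ (j : ℤ) v

/-- `φ̃_{[j-4, j+4]}`: the sum of `φ̃_i` over the integers `i ≥ 0` with `j - 4 ≤ i ≤ j + 4`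
(the truncated subtraction on `ℕ` is what is meant here). -/
def phiTWindow (φ : ℝ → ℝ) (j : ℕ) (v : E3) : ℝ :=
  ∑ i ∈ Finset.Icc (j - 4) (j + 4), phiT φ i v

/-- Inverse Fourier transform `(2π)⁻³ ∫ e^{i x·ξ} m(ξ) dξ`. -/
def invFourier (m : E3 → ℂ) (x : E3) : ℂ :=
  (((2 * Real.pi) ^ 3 : ℝ) : ℂ)⁻¹ *
    ∫ ξ : E3, Complex.exp (Complex.I * ((inner ℝ x ξ : ℝ) : ℂ)) * m ξ

/-- `P_k m(∇) h`: the operator with Fourier multiplier `φ_k(ξ) m(ξ)`, acting by convolution with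
its kernel `ℱ⁻¹(φ_k m)`. -/
def dyadicOp (φ : ℝ → ℝ) (k : ℤ) (m : E3 → ℂ) (h : E3 → ℂ) (x : E3) : ℂ :=
  ∫ y : E3, invFourier (fun ξ => (phiK φ k ξ : ℂ) * m ξ) (x - y) * h y

/-- The Littlewood–Paley projection `P_k`. -/
def lpProj (φ : ℝ → ℝ) (k : ℤ) (h : E3 → ℂ) : E3 → ℂ :=
  dyadicOp φ k (fun _ => 1) h

/-- The operator with Fourier multiplier `m = ∑_k φ_k m` (a multiplier that may be singular at the
origin), as the sum of its dyadic pieces. -/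
def multOp (φ : ℝ → ℝ) (m : E3 → ℂ) (h : E3 → ℂ) (x : E3) : ℂ :=
  ∑' k : ℤ, dyadicOp φ k m h x

/-- Hörmander–Michlin multipliers normalised by
`|ξ|^{|α|} |D^α m(ξ)| ≤ 1` for `|α| ≤ 8`, `ξ ≠ 0`. A mixed partial derivative of order `n` is
the `n`-th iterated derivative evaluated at `n` vectors of the canonical basis. -/
structure IsMichlin (m : E3 → ℂ) : Prop where
  smooth : ContDiffOn ℝ 8 m {0}ᶜ
  bound : ∀ n : ℕ, n ≤ 8 → ∀ i : Fin n → Fin 3, ∀ ξ : E3, ξ ≠ 0 →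
    ‖ξ‖ ^ n * ‖iteratedFDeriv ℝ n m ξ (fun l => basisVec (i l))‖ ≤ 1

/-! ### Norms -/

/-- `sup_k { ⟨t⟩³ ‖F_k‖_{L^∞} + ‖F_k‖_{L¹} }` for a family `F_k`, which stands for the
Littlewood–Paley pieces of one object. -/
def besovSup {V : Type*} [NormedAddCommGroup V] (t : ℝ) (F : ℤ → E3 → V) : ℝ≥0∞ :=
  ⨆ k : ℤ, (ENNReal.ofReal (jap t ^ 3) * eLpNorm (F k) ∞ volume + eLpNorm (F k) 1 volume)

/-- The norm `‖h‖_{B⁰_t} = sup_k { ⟨t⟩³ ‖P_k h‖_{L^∞} + ‖P_k h‖_{L¹} }`. -/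
def normB0 (φ : ℝ → ℝ) (t : ℝ) (h : E3 → ℂ) : ℝ≥0∞ :=
  besovSup t (fun k => lpProj φ k h)

/-- `‖g‖_{Stat_δ} = sup_{t ∈ [0,T]} ⟨t⟩^{1-2δ} ‖⟨∇⟩ g(t)‖_{B⁰_t}`. -/
def normStat (φ : ℝ → ℝ) (T : ℝ) (g : ℝ → E3 → ℂ) : ℝ≥0∞ :=
  ⨆ t ∈ Icc (0 : ℝ) T, ENNReal.ofReal (jap t ^ (1 - 2 * del)) *
    besovSup t (fun k => dyadicOp φ k (fun ξ => (jap ‖ξ‖ : ℂ)) (g t))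

/-- The length of the space-time gradient `∇_{x,t} P_k g` at `(x,t)`, with the time derivative taken
within `[0,T]`. -/
def gradXT (φ : ℝ → ℝ) (T : ℝ) (g : ℝ → E3 → ℂ) (k : ℤ) (t : ℝ) (x : E3) : ℝ :=
  Real.sqrt (∑ a : Fin 3, ‖pd a (lpProj φ k (g t)) x‖ ^ 2 +
    ‖derivWithin (fun r => lpProj φ k (g r) x) (Icc 0 T) t‖ ^ 2)

/-- `‖g‖_{Osc_δ} = sup_t ⟨t⟩^{-δ} ‖g(t)‖_{B⁰_t} + sup_t ⟨t⟩^{1-2δ} ‖∇_{x,t} g(t)‖_{B⁰_t}`,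
suprema over `t ∈ [0,T]`. -/
def normOsc (φ : ℝ → ℝ) (T : ℝ) (g : ℝ → E3 → ℂ) : ℝ≥0∞ :=
  (⨆ t ∈ Icc (0 : ℝ) T, ENNReal.ofReal (jap t ^ (-del)) * normB0 φ t (g t)) +
  ⨆ t ∈ Icc (0 : ℝ) T, ENNReal.ofReal (jap t ^ (1 - 2 * del)) *
    besovSup t (fun k => gradXT φ T g k t)

/-! ### The Vlasov–Poisson system near the Poisson equilibrium -/

/-- The Poisson equilibrium `M₀(v) = π⁻² (1 + |v|²)⁻²`. -/
def poissonEq (v : E3) : ℝ := 1 / (Real.pi ^ 2 * (1 + ‖v‖ ^ 2) ^ 2)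

/-- The density `ρ(x,t) = ∫ f(x,v,t) dv`; the arguments of `f` are in the order `t`, `x`, `v`. -/
def density (f : ℝ → E3 → E3 → ℝ) (t : ℝ) (x : E3) : ℝ := ∫ v : E3, f t x v

/-- The field `∇Δ⁻¹ r`, i.e. the convolution of `r` with `∇(-1/(4π|x|)) = x / (4π|x|³)`. -/
def gradInvLap (r : E3 → ℝ) (x : E3) : E3 :=
  (4 * Real.pi)⁻¹ • ∫ y : E3, (r y / ‖x - y‖ ^ 3) • (x - y)

/-- The electric field `E(t) = ∇Δ⁻¹ ρ(t)`. -/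
def elField (f : ℝ → E3 → E3 → ℝ) (t : ℝ) : E3 → E3 := gradInvLap (density f t)

/-- `f` is a regular solution on `[0,T]` of
`(∂_t + v·∇_x) f + E·∇_v M₀ + E·∇_v f = 0`, `ρ = ∫ f dv`, `E = ∇Δ⁻¹ρ`: it is `C¹` up to the
boundary, and its density is given by convergent integrals, is continuous, and lies at each time in
`L² ∩ L^∞` (so that the integral that defines `E` converges absolutely). -/
structure IsRegularSolution (T : ℝ) (f : ℝ → E3 → E3 → ℝ) : Prop where
  contDiff : ContDiffOn ℝ 1 (fun p : ℝ × E3 × E3 => f p.1 p.2.1 p.2.2) (Icc 0 T ×ˢ univ)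
  integrable : ∀ t ∈ Icc 0 T, ∀ x, Integrable (f t x) volume
  density_cont : ContinuousOn (fun p : ℝ × E3 => density f p.1 p.2) (Icc 0 T ×ˢ univ)
  density_bdd : ∀ t ∈ Icc 0 T, ∃ B : ℝ, ∀ x, |density f t x| ≤ B
  density_L2 : ∀ t ∈ Icc 0 T, MemLp (density f t) 2 volume
  eqn : ∀ t ∈ Icc 0 T, ∀ x v : E3,
    derivWithin (fun r => f r x v) (Icc 0 T) t + fderiv ℝ (fun y => f t y v) x v
      + fderiv ℝ poissonEq v (elField f t x) + fderiv ℝ (f t x) v (elField f t x) = 0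

/-- Both the `L^∞_x L^∞_v` and the `L¹_x L^∞_v` norm of `⟨v⟩^{4.5} h(x,v)` are at most `ε`. -/
def WeightedSmall (h : E3 → E3 → ℝ) (ε : ℝ) : Prop :=
  essSup (fun x => eLpNorm (fun v => jap ‖v‖ ^ (4.5 : ℝ) * h x v) ∞ volume) volume
      ≤ ENNReal.ofReal ε ∧
  ∫⁻ x, eLpNorm (fun v => jap ‖v‖ ^ (4.5 : ℝ) * h x v) ∞ volume ≤ ENNReal.ofReal ε

/-- The smallness condition on the initial data: `WeightedSmall` for `f₀` and for all its first
order partial derivatives in `x` and in `v`. -/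
structure InitialSmall (f₀ : E3 → E3 → ℝ) (ε : ℝ) : Prop where
  zeroth : WeightedSmall f₀ ε
  dx : ∀ a : Fin 3, WeightedSmall (fun x v => fderiv ℝ (fun y => f₀ y v) x (basisVec a)) ε
  dv : ∀ a : Fin 3, WeightedSmall (fun x v => fderiv ℝ (f₀ x) v (basisVec a)) ε

/-- The bootstrap assumptions with parameters `ε₀, ε₁` on `[0,T]`: `f` is a regular solution with
small initial data, and its density decomposes as `ρ = ρ^{stat} + Re(e^{-it} ρ^{osc})` with
`‖ρ^{stat}‖_{Stat_δ} + ‖ρ^{osc}‖_{Osc_δ} ≤ ε₁ ≤ ε₀^{3/4}`. The two components are continuous on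
`[0,T] × ℝ³` and bounded in `x`, and the time derivative in the second norm exists. -/
structure Bootstrap (φ : ℝ → ℝ) (T ε₀ ε₁ : ℝ) (f : ℝ → E3 → E3 → ℝ)
    (ρstat : ℝ → E3 → ℝ) (ρosc : ℝ → E3 → ℂ) : Prop where
  solution : IsRegularSolution T f
  initial : InitialSmall (f 0) ε₀
  eps_pos : 0 < ε₁
  eps_le : ε₁ ≤ ε₀ ^ (3 / 4 : ℝ)
  decomp : ∀ t ∈ Icc 0 T, ∀ x,
    density f t x = ρstat t x + (Complex.exp (-(Complex.I * (t : ℂ))) * ρosc t x).re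
  stat_cont : ContinuousOn (fun p : ℝ × E3 => ρstat p.1 p.2) (Icc 0 T ×ˢ univ)
  stat_bdd : ∀ t ∈ Icc 0 T, ∃ B : ℝ, ∀ x, |ρstat t x| ≤ B
  osc_cont : ContinuousOn (fun p : ℝ × E3 => ρosc p.1 p.2) (Icc 0 T ×ˢ univ)
  osc_bdd : ∀ t ∈ Icc 0 T, ∃ B : ℝ, ∀ x, ‖ρosc t x‖ ≤ B
  osc_diff : ∀ k : ℤ, ∀ x, DifferentiableOn ℝ (fun t => lpProj φ k (ρosc t) x) (Icc 0 T)
  norm_le : normStat φ T (fun t x => (ρstat t x : ℂ)) + normOsc φ T ρosc ≤ ENNReal.ofReal ε₁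

/-! ### The trilinear operators

The times `τ` and `s` are fixed, and the dependence of `K`, `P₁`, `P₂` and `C` on them is not
displayed. -/

/-- The assumptions on the kernel `K = K_{j,k}(·,·,τ,s)` and on the perturbations
`P₁ = P₁(·,·,τ,s)`, `P₂ = P₂(·,·,·,τ,s)` of the characteristics, with implicit constant `A`. -/
structure Admissible (φ : ℝ → ℝ) (A ε₁ s : ℝ) (j : ℕ) (k : ℤ) (K : E3 → E3 → ℂ)
    (P₁ : E3 → E3 → E3) (P₂ : E3 → E3 → ℝ → E3) : Prop where
  K_meas : Measurable (fun p : E3 × E3 => K p.1 p.2)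
  K_bound : ∀ y v, ‖K y v‖ ≤ A * ((2 : ℝ) ^ (3 * k) * ((1 + (2 : ℝ) ^ k * ‖y‖) ^ 8)⁻¹ *
    (((2 : ℝ) ^ (3 * j))⁻¹ * phiTWindow φ j v))
  P₁_diff_y : ∀ v, Differentiable ℝ (fun y => P₁ y v)
  P₁_diff_v : ∀ y, Differentiable ℝ (P₁ y)
  P₁_bound : ∀ y v,
    ‖fderiv ℝ (fun z => P₁ z v) y‖ + (jap s)⁻¹ * ‖fderiv ℝ (P₁ y) v‖ ≤ A * ε₁
  P₂_diff_y : ∀ γ ∈ Icc 0 s, ∀ v, Differentiable ℝ (fun y => P₂ y v γ)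
  P₂_diff_v : ∀ γ ∈ Icc 0 s, ∀ y, Differentiable ℝ (fun v => P₂ y v γ)
  P₂_diff_time : ∀ y v, DifferentiableOn ℝ (P₂ y v) (Icc 0 s)
  P₂_bound : ∀ γ ∈ Icc 0 s, ∀ y v,
    ‖fderiv ℝ (fun z => P₂ z v γ) y‖ + (jap s)⁻¹ * ‖fderiv ℝ (fun w => P₂ y w γ) v‖
      + ‖derivWithin (P₂ y v) (Icc 0 s) γ‖ ≤ A * ε₁

/-- The operator `Q_{j,k}(F, G; C)(x, γ, τ, s)`, integrated over `(y, v) ∈ ℝ³ × ℝ³`. Functions of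
space and time take the time as first argument; the arguments of `C` are `x`, `y`, `v`, `γ`. -/
def opQ (K : E3 → E3 → ℂ) (P₁ : E3 → E3 → E3) (P₂ : E3 → E3 → ℝ → E3)
    (F G : ℝ → E3 → ℂ) (C : E3 → E3 → E3 → ℝ → ℂ) (γ τ s : ℝ) (x : E3) : ℂ :=
  ∫ p : E3 × E3, K (x - p.1) p.2 * C x p.1 p.2 γ *
    F τ (p.1 - (s - τ) • p.2 + P₁ p.1 p.2) * G γ (p.1 - (s - γ) • p.2 + P₂ p.1 p.2 γ)

/-- The operator `B_{j,k}(F, G; C)(x, τ, s) = ∫_{t₃}^{t₄} Q_{j,k}(F, G; C)(x, γ, τ, s) dγ`. -/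
def opB (K : E3 → E3 → ℂ) (P₁ : E3 → E3 → E3) (P₂ : E3 → E3 → ℝ → E3)
    (F G : ℝ → E3 → ℂ) (C : E3 → E3 → E3 → ℝ → ℂ) (t₃ t₄ τ s : ℝ) (x : E3) : ℂ :=
  ∫ γ in t₃..t₄, opQ K P₁ P₂ F G C γ τ s x

/-- `‖C(·,·,·,γ)‖_{L^∞_{x,y,v}}`. -/
def supC (C : E3 → E3 → E3 → ℝ → ℂ) (γ : ℝ) : ℝ≥0∞ :=
  eLpNorm (fun p : E3 × E3 × E3 => C p.1 p.2.1 p.2.2 γ) ∞ volume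

/-- `Λ(C)(γ) = ‖C(·,·,·,γ)‖_{L^∞_{x,y,v}} + ‖⟨γ⟩ ∂_γ C(·,·,·,γ)‖_{L^∞_{x,y,v}}`. -/
def lamC (C : E3 → E3 → E3 → ℝ → ℂ) (s γ : ℝ) : ℝ≥0∞ :=
  supC C γ + supC (fun x y v r => (jap r : ℂ) * derivWithin (C x y v) (Icc 0 s) r) γ

/-- `Λ*(C) = sup_{γ ∈ [t₃,t₄]} Λ(C)(γ)`. -/
def lamStar (C : E3 → E3 → E3 → ℝ → ℂ) (s t₃ t₄ : ℝ) : ℝ≥0∞ :=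
  ⨆ γ ∈ Icc t₃ t₄, lamC C s γ

/-- `min{2^{-a m}, ⟨τ⟩^{-a}}`. -/
def rate (a : ℝ) (m : ℕ) (τ : ℝ) : ℝ :=
  min ((2 : ℝ) ^ (-a * (m : ℝ))) (jap τ ^ (-a))

/-- `𝓡 E_c`, for the component `E_c` of the electric field. -/
def mulE (φ : ℝ → ℝ) (R : E3 → ℂ) (f : ℝ → E3 → E3 → ℝ) (c : Fin 3) (t : ℝ) : E3 → ℂ :=
  multOp φ R (fun x => (elField f t x c : ℂ))

/-- `𝓡 ∂_a E_c`. -/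
def mulDE (φ : ℝ → ℝ) (R : E3 → ℂ) (f : ℝ → E3 → E3 → ℝ) (a c : Fin 3) (t : ℝ) : E3 → ℂ :=
  multOp φ R (pd a (fun x => (elField f t x c : ℂ)))

/-- `𝓡 ∂_a ∂_b P_k E_c`. -/
def mulDDPE (φ : ℝ → ℝ) (R : E3 → ℂ) (f : ℝ → E3 → E3 → ℝ) (k : ℤ) (a b c : Fin 3) (t : ℝ) :
    E3 → ℂ :=
  multOp φ R (pd a (pd b (lpProj φ k (fun x => (elField f t x c : ℂ)))))

/-- `P_k 𝓡 ρ`, the operator with Fourier multiplier `φ_k 𝓡` applied to the density. -/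
def mulPRho (φ : ℝ → ℝ) (R : E3 → ℂ) (f : ℝ → E3 → E3 → ℝ) (k : ℤ) (t : ℝ) : E3 → ℂ :=
  dyadicOp φ k R (fun x => (density f t x : ℂ))

end VPPoisson

end

open VPPoisson

/-!
The fields are Fourier multipliers applied to the density `ρ`, with symbols that are homogeneous of
degree `-1` (the field), `0` (its gradient) or `1` (its second derivatives): this is seen by writing the
kernel `x / (4π|x|³)` as a superposition of Gaussians (`cv_rk`, `Dens.dyadicOp_field`,
`Dens.dyadicOp_pd_field`). At the frequency `2^k` such a multiplier is the convolution with a kernel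
dominated by `2^{kd}` times the bump `2^{3k} (1 + 2^k|x|)^{-4}` (`exists_kerD_homog`). The bootstrap norms
provide the pieces of `ρ` to which it applies (`exists_pieces_fat`): a stationary piece of size
`ε₁ (1 + 2^k)⁻¹ ⟨t⟩^{-1+2δ}`, and an oscillating one, `e^{-it} g`, where `g` has the size
`ε₁ min(⟨t⟩^δ, 2^{-k} ⟨t⟩^{-1+2δ})` and `∂_t g` the size `ε₁ ⟨t⟩^{-1+2δ}`. Sizes are measured in
`‖·‖_{L¹} + ⟨t⟩³ ‖·‖_{L^∞}`.

The operators are dominated by an average over velocities, whose norm `TB` is that of `L¹` together with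
`⟨s⟩³ L^∞_y L¹_v` (`exists_normB0_le`, `Admissible.enorm_opB_le`). A function `f` of frequency `2^k`
at time `t`, transported along the perturbed characteristics, keeps its size in this norm
(`TB.comp_flow`): for `t` near `s` because of its own decay, for `t` far from `s` because the
characteristics disperse, the map from velocities to positions being antilipschitz with constant
`4/⟨s⟩`. Putting the better of two factors in `L^∞` yields the gain
`min(2^{k₁}, 2^{k₂}, ⟨τ⟩⁻¹, ⟨γ⟩⁻¹)³` (`TB.mul_comp_flow`). For a single time `γ` this is
already the second claim (`exists_opQ_le`).

For the first claim one integrates over times `γ ≈ n = 2^{m₂}`. The stationary pieces have enough decay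
for a trivial estimate. For the oscillating ones there are three regimes (`exists_osc_majorant`): if
`2^k ≥ n^{-7/8}`, then the decay `2^{-k} n^{-1+2δ}` is enough; if `2^k ≤ n^{-7/8}` and the velocities
`|v| ≈ 2^j` are at most of order `n^{3/4}`, one integrates by parts in `γ` against `e^{∓iγ}`; if they are
larger, the characteristic leaves a ball of radius `2^{-k}` after the time `2^{-k-j}`, which gives the
straight line estimate `lintegral_nconv_line_le`, and the latter is interpolated with the trivial
estimate. With `N = max(n, ⟨τ⟩)` and `μ = min(2^{k₁}, 2^{k₂}, 1/N)` all cases are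
bounded by `N^{1/8+2δ} 2^{-k₂/100} μ^{9/4}` (`gain`).

As `μ^{9/4}` is at most the product of `min(2^{k₁}, 1/N)^{9/8}` and `min(2^{k₂}, 1/N)^{9/8}`, the sum over
the two frequencies factorises into geometric sums, whose largest terms are those with `2^k ≈ 1/N`
(`SpaceFam.tb_mul`, `exists_tsum_half_le`). For symbols of degrees `d₁`, `d₂` the outcome is the power
`-(2.125 + d₁ + d₂)` of `N`, up to a loss of `2/100 + 3δ`, and this is less than `-(2.1 + d₁ + d₂)`. When
the first factor is restricted to one frequency, only three terms of its sum remain, and the factor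
`⟨τ⟩⁻¹` comes from the decay of its pieces.
-/

namespace VPPoisson

open scoped FourierTransform

/-! ### Inverse Fourier transforms and their decay -/

lemma finrank_E3 : Module.finrank ℝ E3 = 3 := by simp [E3]

/-- The dyadic bump `2^{3k} (1 + 2^k |x|)^{-4}`, an `L¹`-normalised majorant at frequency `2^k`. -/
noncomputable def bump (k : ℤ) (x : E3) : ℝ :=
  (2 : ℝ) ^ (3 * k) * ((1 + (2 : ℝ) ^ k * ‖x‖) ^ 4)⁻¹

/-- The convolution `W * h`; it is spelled as in `dyadicOp`, so that
`dyadicOp φ k m = cv (ker φ k m)` holds by definition. -/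
noncomputable def cv (W h : E3 → ℂ) (x : E3) : ℂ := ∫ y : E3, W (x - y) * h y

/-- The convolution kernel of `dyadicOp φ k m`. -/
noncomputable def ker (φ : ℝ → ℝ) (k : ℤ) (m : E3 → ℂ) : E3 → ℂ :=
  invFourier (fun ξ => (phiK φ k ξ : ℂ) * m ξ)

/-- `W` is a continuous kernel dominated by `B` times the bump at frequency `2^k`. -/
structure Ker (k : ℤ) (B : ℝ) (W : E3 → ℂ) : Prop where
  cont : Continuous W
  bound : ∀ x, ‖W x‖ ≤ B * bump k x

lemma zpow_two_pos (k : ℤ) : (0 : ℝ) < 2 ^ k := zpow_pos two_pos k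

lemma bump_pos (k : ℤ) (x : E3) : 0 < bump k x := by
  have := zpow_two_pos k
  have := zpow_two_pos (3 * k)
  unfold bump; positivity

lemma bump_le (k : ℤ) (x : E3) : bump k x ≤ 2 ^ (3 * k) := by
  have := zpow_two_pos k
  have := zpow_two_pos (3 * k)
  unfold bump
  apply mul_le_of_le_one_right this.le
  apply inv_le_one_of_one_le₀
  apply one_le_pow₀
  have : 0 ≤ (2 : ℝ) ^ k * ‖x‖ := by positivity
  linarith

lemma bump_eq (k : ℤ) (x : E3) : bump k x = 2 ^ (3 * k) * bump 0 ((2 : ℝ) ^ k • x) := by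
  have := zpow_two_pos k
  simp [bump, norm_smul]

lemma continuous_bump (k : ℤ) : Continuous (bump k) := by
  unfold bump
  refine continuous_const.mul (Continuous.inv₀ (by fun_prop) fun x => ?_)
  have := zpow_two_pos k
  positivity

lemma integrable_bump_zero : Integrable (bump 0) := by
  have h := integrable_one_add_norm (E := E3) (μ := volume) (r := 4) (by rw [finrank_E3]; norm_num)
  refine h.congr (Filter.Eventually.of_forall fun x => ?_)
  have : (0 : ℝ) < 1 + ‖x‖ := by positivity
  simp only [bump, mul_zero, zpow_zero, one_mul]
  rw [Real.rpow_neg this.le]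
  norm_cast

/-- The common value `∫ (1 + |x|)^{-4} dx` of the integrals of all bumps. -/
noncomputable def bumpMass : ℝ := ∫ x : E3, bump 0 x

lemma integrable_bump (k : ℤ) : Integrable (bump k) := by
  have h := (integrable_bump_zero.comp_smul (zpow_two_pos k).ne').const_mul ((2 : ℝ) ^ (3 * k))
  exact h.congr (Filter.Eventually.of_forall fun x => (bump_eq k x).symm)

lemma integral_bump (k : ℤ) : ∫ x, bump k x = bumpMass := by
  have h2 := zpow_two_pos k
  simp_rw [bump_eq k, integral_const_mul]
  rw [Measure.integral_comp_smul, finrank_E3, abs_of_pos (by positivity), smul_eq_mul, ← mul_assoc,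
    zpow_mul', ← zpow_natCast]
  rw [show ((3 : ℕ) : ℤ) = 3 from rfl, mul_inv_cancel₀ (by positivity), one_mul, bumpMass]

lemma bumpMass_pos : 0 < bumpMass := by
  unfold bumpMass
  rw [integral_pos_iff_support_of_nonneg (fun x => (bump_pos 0 x).le) integrable_bump_zero]
  have : Function.support (bump 0) = univ := by
    ext x; simp [(bump_pos 0 x).ne']
  rw [this]
  exact Measure.measure_univ_pos.2 (NeZero.ne volume)

lemma lintegral_bump (k : ℤ) : ∫⁻ x, ENNReal.ofReal (bump k x) = ENNReal.ofReal bumpMass := by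
  rw [← integral_bump k, ofReal_integral_eq_lintegral_ofReal (integrable_bump k)
    (Filter.Eventually.of_forall fun x => (bump_pos k x).le)]

lemma Ker.integrable {k : ℤ} {B : ℝ} {W : E3 → ℂ} (h : Ker k B W) : Integrable W :=
  ((integrable_bump k).const_mul B).mono' h.cont.aestronglyMeasurable
    (Filter.Eventually.of_forall h.bound)

lemma Ker.nonneg {k : ℤ} {B : ℝ} {W : E3 → ℂ} (h : Ker k B W) : 0 ≤ B := by
  have h1 := (norm_nonneg _).trans (h.bound 0)
  exact nonneg_of_mul_nonneg_left h1 (bump_pos k 0)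

lemma Ker.mono {k : ℤ} {B B' : ℝ} {W : E3 → ℂ} (h : Ker k B W) (hB : B ≤ B') : Ker k B' W :=
  ⟨h.cont, fun x => (h.bound x).trans (by have := bump_pos k x; gcongr)⟩

lemma invFourier_eq_fourier (m : E3 → ℂ) (x : E3) :
    invFourier m x = (((2 * Real.pi) ^ 3 : ℝ) : ℂ)⁻¹ * 𝓕 m (-(2 * Real.pi)⁻¹ • x) := by
  rw [invFourier, Real.fourier_eq']
  congr 2
  ext ξ
  rw [smul_eq_mul]
  congr 2
  rw [inner_smul_right, real_inner_comm]
  have := Real.pi_pos.ne'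
  rw [mul_comm Complex.I]
  congr 2
  field_simp

lemma continuous_invFourier {m : E3 → ℂ} (hm : Integrable m) : Continuous (invFourier m) := by
  have h : Continuous (𝓕 m) := by
    have := VectorFourier.fourierIntegral_continuous (e := Real.fourierChar) (μ := volume)
      (L := innerₗ E3) Real.continuous_fourierChar (by exact continuous_inner) hm
    exact this
  have : invFourier m = fun x =>
      (((2 * Real.pi) ^ 3 : ℝ) : ℂ)⁻¹ * 𝓕 m (-(2 * Real.pi)⁻¹ • x) :=
    funext (invFourier_eq_fourier m)
  rw [this]
  fun_prop

/-- A `C⁴` symbol supported in the ball of radius `2`, whose derivatives are at most `D`, has a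
kernel bounded by `C D (1 + |x|)^{-4}`. -/
lemma exists_norm_invFourier_le : ∃ C : ℝ, 0 < C ∧ ∀ (D : ℝ) (μ : E3 → ℂ), ContDiff ℝ 4 μ →
    (∀ ξ, 2 < ‖ξ‖ → μ ξ = 0) → (∀ n ≤ 4, ∀ ξ, ‖iteratedFDeriv ℝ n μ ξ‖ ≤ D) →
    Ker 0 (C * D) (invFourier μ) := by
  set V : ℝ := volume.real (Metric.closedBall (0 : E3) 2) with hV
  have hV0 : 0 ≤ V := measureReal_nonneg
  set c : ℝ := ((2 * Real.pi) ^ 3)⁻¹ with hc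
  have hpi := Real.pi_pos
  have hc0 : 0 < c := by positivity
  -- the summand `+ 1` only makes the constant positive
  refine ⟨8 * (c * (V + (2 * Real.pi) ^ 4 * (2 ^ 4 * (5 * V))) + 1), by positivity, ?_⟩
  intro D μ hμ hsupp hD
  have hD0 : 0 ≤ D := (norm_nonneg _).trans (hD 0 (by norm_num) 0)
  have hts : tsupport μ ⊆ Metric.closedBall 0 2 := by
    apply closure_minimal _ Metric.isClosed_closedBall
    intro ξ hξ
    by_contra h
    exact hξ (hsupp ξ (by simpa using h))
  have hcs : HasCompactSupport μ :=
    HasCompactSupport.of_support_subset_isCompact (isCompact_closedBall 0 2)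
      (subset_closure.trans hts)
  have hzero : ∀ n : ℕ, ∀ ξ ∉ Metric.closedBall (0 : E3) 2, ‖iteratedFDeriv ℝ n μ ξ‖ = 0 := by
    intro n ξ hξ
    rw [norm_eq_zero]
    by_contra h
    exact hξ (hts (support_iteratedFDeriv_subset n h))
  have hint : ∀ n : ℕ, n ≤ 4 → Integrable (fun v => ‖iteratedFDeriv ℝ n μ v‖) := by
    intro n hn
    refine Continuous.integrable_of_hasCompactSupport
      (hμ.continuous_iteratedFDeriv (by exact_mod_cast hn)).norm ?_
    exact HasCompactSupport.of_support_subset_isCompact (isCompact_closedBall 0 2)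
      (fun ξ hξ => by by_contra h; exact hξ (hzero n ξ h))
  have hle : ∀ n : ℕ, n ≤ 4 → ∫ v, ‖iteratedFDeriv ℝ n μ v‖ ≤ D * V := by
    intro n hn
    rw [← setIntegral_eq_integral_of_forall_compl_eq_zero (hzero n)]
    calc _ ≤ ∫ v in Metric.closedBall (0 : E3) 2, D :=
          integral_mono (hint n hn).integrableOn (integrableOn_const measure_closedBall_lt_top.ne)
            (fun v => hD n hn v)
      _ = D * V := by simp [hV, mul_comm]
  have hint0 : Integrable μ := hμ.continuous.integrable_of_hasCompactSupport hcs
  have key0 : ∀ w, ‖𝓕 μ w‖ ≤ D * V := by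
    intro w
    have h1 := VectorFourier.norm_fourierIntegral_le_integral_norm Real.fourierChar volume
      (innerₗ E3) μ w
    refine h1.trans ?_
    simpa using hle 0 (by norm_num)
  -- four derivatives of the symbol give the decay `|w|⁻⁴`
  have key4 : ∀ w, ‖w‖ ^ 4 * ‖𝓕 μ w‖ ≤ 2 ^ 4 * (5 * (D * V)) := by
    intro w
    have h1 := Real.pow_mul_norm_iteratedFDeriv_fourier_le (K := 0) (N := 4) (f := μ)
      (by exact_mod_cast hμ) (by
        intro k n hk hn
        have hk' : k = 0 := by simpa using hk
        have hn' : n ≤ 4 := by exact_mod_cast hn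
        subst hk'
        simpa using hint n hn') (k := 0) (n := 4) le_rfl le_rfl w
    simp only [norm_iteratedFDeriv_zero, pow_zero, one_mul] at h1
    refine h1.trans ?_
    have e : ∑ p ∈ Finset.range (0 + 1) ×ˢ Finset.range (4 + 1),
        ∫ (v : E3), ‖v‖ ^ p.1 * ‖iteratedFDeriv ℝ p.2 μ v‖ ≤ 5 * (D * V) := by
      rw [Finset.sum_product]
      simp only [zero_add, Finset.sum_range_one, pow_zero, one_mul]
      refine (Finset.sum_le_card_nsmul _ _ (D * V) fun n hn => hle n ?_).trans ?_
      · simp at hn; omega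
      · simp
    have e' : ((2 : ℝ) * ((0 : ℕ) : ℝ) + 2) ^ 4 = 2 ^ 4 := by norm_num
    rw [e']
    exact mul_le_mul_of_nonneg_left e (by positivity)
  refine ⟨continuous_invFourier hint0, fun x => ?_⟩
  rw [invFourier_eq_fourier]
  set w := -(2 * Real.pi)⁻¹ • x with hw
  have hxw : ‖x‖ = 2 * Real.pi * ‖w‖ := by
    rw [hw, norm_smul, norm_neg, norm_inv, Real.norm_of_nonneg (by positivity)]
    field_simp
  have hn : ‖(((2 * Real.pi) ^ 3 : ℝ) : ℂ)⁻¹ * 𝓕 μ w‖ = c * ‖𝓕 μ w‖ := by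
    rw [norm_mul, norm_inv, Complex.norm_real, Real.norm_of_nonneg (by positivity)]
  rw [hn]
  simp only [bump, mul_zero, zpow_zero, one_mul]
  rw [← div_eq_mul_inv, le_div_iff₀ (by positivity)]
  have h8 : (1 + ‖x‖) ^ 4 ≤ 8 * (1 + ‖x‖ ^ 4) := by
    have := norm_nonneg x
    nlinarith [sq_nonneg (‖x‖ - 1), sq_nonneg (‖x‖ ^ 2 - 1), sq_nonneg (‖x‖ ^ 2 - ‖x‖)]
  have h4 : ‖x‖ ^ 4 * ‖𝓕 μ w‖ ≤ (2 * Real.pi) ^ 4 * (2 ^ 4 * (5 * (D * V))) := by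
    rw [hxw, mul_pow, mul_assoc]
    exact mul_le_mul_of_nonneg_left (key4 w) (by positivity)
  have h5 := key0 w
  calc c * ‖𝓕 μ w‖ * (1 + ‖x‖) ^ 4 ≤ c * ‖𝓕 μ w‖ * (8 * (1 + ‖x‖ ^ 4)) := by gcongr
    _ = 8 * (c * (‖𝓕 μ w‖ + ‖x‖ ^ 4 * ‖𝓕 μ w‖)) := by ring
    _ ≤ 8 * (c * (D * V + (2 * Real.pi) ^ 4 * (2 ^ 4 * (5 * (D * V))))) := by gcongr
    _ ≤ 8 * (c * (V + (2 * Real.pi) ^ 4 * (2 ^ 4 * (5 * V))) + 1) * D := by nlinarith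

lemma invFourier_comp_smul (k : ℤ) (μ : E3 → ℂ) (x : E3) :
    invFourier (fun ξ => μ (((2 : ℝ) ^ k)⁻¹ • ξ)) x
      = (((2 : ℝ) ^ (3 * k) : ℝ) : ℂ) * invFourier μ ((2 : ℝ) ^ k • x) := by
  have h2 := zpow_two_pos k
  unfold invFourier
  rw [mul_left_comm]
  congr 1
  have h := Measure.integral_comp_smul (volume : Measure E3)
    (fun ξ => Complex.exp (Complex.I * ((inner ℝ ((2 : ℝ) ^ k • x) ξ : ℝ) : ℂ)) * μ ξ)
    (((2 : ℝ) ^ k)⁻¹)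
  have e : ∀ ξ : E3, inner ℝ ((2 : ℝ) ^ k • x) (((2 : ℝ) ^ k)⁻¹ • ξ) = inner ℝ x ξ := by
    intro ξ
    rw [inner_smul_left, inner_smul_right]
    simp
    field_simp
  simp only [e] at h
  rw [h, finrank_E3, Complex.real_smul]
  congr 2
  rw [abs_of_pos (by positivity), zpow_mul', ← zpow_natCast, inv_zpow, inv_inv]
  rfl

lemma Ker.rescale {k : ℤ} {B : ℝ} {μ : E3 → ℂ} (h : Ker 0 B (invFourier μ)) :
    Ker k B (invFourier (fun ξ => μ (((2 : ℝ) ^ k)⁻¹ • ξ))) := by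
  have h2 := zpow_two_pos (3 * k)
  have e : invFourier (fun ξ => μ (((2 : ℝ) ^ k)⁻¹ • ξ)) =
    fun x => (((2 : ℝ) ^ (3 * k) : ℝ) : ℂ) * invFourier μ ((2 : ℝ) ^ k • x) :=
    funext fun x => invFourier_comp_smul k μ x
  rw [e]
  refine ⟨continuous_const.mul (h.cont.comp (continuous_const_smul _)), fun x => ?_⟩
  rw [norm_mul, Complex.norm_real, Real.norm_of_nonneg h2.le, bump_eq, mul_left_comm]
  gcongr
  exact h.bound _

/-! ### Convolution algebra -/

lemma fourier_inversion_E3 {μ : E3 → ℂ} (hc : Continuous μ) (hi : Integrable μ)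
    (hW : Integrable (invFourier μ)) (ξ : E3) :
    ∫ z : E3, Complex.exp (-(Complex.I * ((inner ℝ z ξ : ℝ) : ℂ))) * invFourier μ z = μ ξ := by
  have hpi := Real.pi_pos
  have hF : Integrable (𝓕 μ) := by
    have h1 := (hW.comp_smul (R := -(2 * Real.pi)) (by
      simp [hpi.ne'])).const_mul (((2 * Real.pi) ^ 3 : ℝ) : ℂ)
    refine h1.congr (Filter.Eventually.of_forall fun x => ?_)
    simp only [invFourier_eq_fourier]
    rw [← mul_assoc, mul_inv_cancel₀ (by exact_mod_cast (by positivity)), one_mul, smul_smul]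
    rw [show -(2 * Real.pi)⁻¹ * -(2 * Real.pi) = 1 by field_simp, one_smul]
  have h := congrFun (hc.fourierInv_fourier_eq hi hF) ξ
  rw [← h, Real.fourierInv_eq']
  have h3 := Measure.integral_comp_smul (volume : Measure E3)
    (fun v => Complex.exp (((2 * Real.pi * inner ℝ v ξ : ℝ) : ℂ) * Complex.I) • 𝓕 μ v)
    (-(2 * Real.pi)⁻¹)
  rw [finrank_E3] at h3
  have habs : |((-(2 * Real.pi)⁻¹) ^ 3)⁻¹| = (2 * Real.pi) ^ 3 := by
    rw [abs_inv, abs_pow, abs_neg, abs_inv, abs_of_pos (by positivity), inv_pow,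
      inv_inv]
  rw [habs] at h3
  have h4 : ∫ v : E3, Complex.exp (((2 * Real.pi * inner ℝ v ξ : ℝ) : ℂ) * Complex.I) • 𝓕 μ v
      = (((2 * Real.pi) ^ 3 : ℝ) : ℂ)⁻¹ * ∫ (x : E3),
        Complex.exp (((2 * Real.pi * inner ℝ (-(2 * Real.pi)⁻¹ • x) ξ : ℝ) : ℂ) * Complex.I) •
          𝓕 μ (-(2 * Real.pi)⁻¹ • x) := by
    rw [h3, Complex.real_smul, ← mul_assoc,
      inv_mul_cancel₀ (by exact_mod_cast (by positivity)), one_mul]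
  rw [h4, ← integral_const_mul]
  congr 1
  ext z
  rw [invFourier_eq_fourier, smul_eq_mul, mul_left_comm]
  congr 3
  rw [inner_smul_left]
  simp
  field_simp

/-- The convolution theorem for inverse Fourier transforms. -/
lemma cv_invFourier {μ₁ μ₂ : E3 → ℂ} (hc₁ : Continuous μ₁) (hi₁ : Integrable μ₁)
    (hW₁ : Integrable (invFourier μ₁)) (hi₂ : Integrable μ₂) (x : E3) :
    cv (invFourier μ₁) (invFourier μ₂) x = invFourier (fun ξ => μ₁ ξ * μ₂ ξ) x := by
  have e1 : ∀ y : E3, invFourier μ₁ (x - y) * invFourier μ₂ y =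
      (((2 * Real.pi) ^ 3 : ℝ) : ℂ)⁻¹ * ∫ ξ : E3,
        invFourier μ₁ (x - y) * (Complex.exp (Complex.I * ((inner ℝ y ξ : ℝ) : ℂ)) * μ₂ ξ) := by
    intro y
    rw [integral_const_mul, mul_left_comm]
    rfl
  unfold cv
  simp_rw [e1]
  rw [integral_const_mul]
  conv_rhs => rw [invFourier]
  congr 1
  have hint : Integrable (Function.uncurry fun (y ξ : E3) =>
      invFourier μ₁ (x - y) * (Complex.exp (Complex.I * ((inner ℝ y ξ : ℝ) : ℂ)) * μ₂ ξ))
      (volume.prod volume) := by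
    have h1 : Integrable (fun p : E3 × E3 => invFourier μ₁ (x - p.1) * μ₂ p.2)
        (volume.prod volume) :=
      (hW₁.comp_sub_left x).mul_prod hi₂
    have h2 : AEStronglyMeasurable (fun p : E3 × E3 =>
        Complex.exp (Complex.I * ((inner ℝ p.1 p.2 : ℝ) : ℂ))) (volume.prod volume) := by
      apply Continuous.aestronglyMeasurable
      fun_prop
    refine (h1.bdd_mul (c := 1) h2 (Filter.Eventually.of_forall fun p => ?_)).congr
      (Filter.Eventually.of_forall fun p => ?_)
    · rw [mul_comm, Complex.norm_exp_ofReal_mul_I]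
    · simp only [Function.uncurry]
      ring
  rw [integral_integral_swap hint]
  congr 1
  ext ξ
  have hinv := fourier_inversion_E3 hc₁ hi₁ hW₁ ξ
  rw [← hinv]
  have h5 := integral_sub_left_eq_self (μ := (volume : Measure E3)) (fun z : E3 =>
    Complex.exp (-(Complex.I * ((inner ℝ z ξ : ℝ) : ℂ))) * invFourier μ₁ z) x
  rw [← h5, ← mul_assoc, ← integral_const_mul, ← integral_mul_const]
  congr 1
  ext y
  have : Complex.exp (Complex.I * ((inner ℝ y ξ : ℝ) : ℂ)) =
      Complex.exp (Complex.I * ((inner ℝ x ξ : ℝ) : ℂ)) *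
        Complex.exp (-(Complex.I * ((inner ℝ (x - y) ξ : ℝ) : ℂ))) := by
    rw [← Complex.exp_add, inner_sub_left]
    congr 1
    push_cast
    ring
  rw [this]
  ring

lemma cv_assoc {W₁ W₂ h : E3 → ℂ} {x : E3}
    (hint : Integrable (fun p : E3 × E3 => W₁ (x - p.1) * (W₂ (p.1 - p.2) * h p.2))
      (volume.prod volume)) :
    cv W₁ (cv W₂ h) x = cv (cv W₁ W₂) h x := by
  unfold cv
  simp_rw [← integral_const_mul]
  rw [integral_integral_swap (f := fun y z => W₁ (x - y) * (W₂ (y - z) * h z)) hint]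
  congr 1
  ext z
  rw [← integral_mul_const]
  have h5 := integral_sub_right_eq_self (μ := (volume : Measure E3)) (fun y : E3 =>
    W₁ (x - z - y) * W₂ y * h z) z
  rw [← h5]
  congr 1
  ext y
  rw [sub_sub_sub_cancel_right]
  ring

lemma cv_assoc_of_bdd {W₁ W₂ h : E3 → ℂ} (h₁ : Integrable W₁) (h₂ : Integrable W₂)
    (hm : AEStronglyMeasurable h volume) {B : ℝ} (hB : ∀ x, ‖h x‖ ≤ B) (x : E3) :
    cv W₁ (cv W₂ h) x = cv (cv W₁ W₂) h x := by
  apply cv_assoc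
  have e : Integrable (fun p : E3 × E3 => W₁ (x - p.1) * W₂ (p.1 - p.2)) (volume.prod volume) := by
    have h3 : Integrable (fun p : E3 × E3 => W₁ (x - p.1) * W₂ (-p.2)) (volume.prod volume) :=
      (h₁.comp_sub_left x).mul_prod h₂.comp_neg
    have h4 := (measurePreserving_prod_sub (volume : Measure E3)
      (volume : Measure E3)).integrable_comp_of_integrable h3
    refine h4.congr (Filter.Eventually.of_forall fun p => ?_)
    simp
  have h5 : AEStronglyMeasurable (fun p : E3 × E3 => h p.2) (volume.prod volume) := hm.comp_snd
  refine (e.bdd_mul (c := B) h5 (Filter.Eventually.of_forall fun p => hB _)).congr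
    (Filter.Eventually.of_forall fun p => ?_)
  simp only
  ring

/-! ### Dyadic symbols and their kernels -/

lemma phiK_eq (φ : ℝ → ℝ) (k : ℤ) (ξ : E3) :
    phiK φ k ξ = phiK φ 0 (((2 : ℝ) ^ k)⁻¹ • ξ) := by
  have h := zpow_two_pos k
  simp only [phiK, norm_smul, norm_inv, Real.norm_of_nonneg h.le, zpow_zero, div_one]
  rw [zpow_sub₀ two_ne_zero]
  congr 2
  · rw [div_eq_inv_mul]
  · norm_num
    field_simp

lemma IsCutoff.eq_zero {φ : ℝ → ℝ} (hφ : IsCutoff φ) {r : ℝ} (h : 8 / 5 < r) : φ r = 0 :=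
  hφ.supp r (h.trans_le (le_abs_self r))

lemma IsCutoff.eq_one {φ : ℝ → ℝ} (hφ : IsCutoff φ) {r : ℝ} (h0 : 0 ≤ r) (h : r ≤ 5 / 4) :
    φ r = 1 :=
  hφ.one r (by rwa [abs_of_nonneg h0])

lemma phiK_zero_apply (φ : ℝ → ℝ) (ξ : E3) : phiK φ 0 ξ = φ ‖ξ‖ - φ (2 * ‖ξ‖) := by
  simp only [phiK, zpow_zero, div_one]
  norm_num
  ring_nf

lemma phiK_zero_of_small {φ : ℝ → ℝ} (hφ : IsCutoff φ) {ξ : E3} (h : ‖ξ‖ ≤ 5 / 8) :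
    phiK φ 0 ξ = 0 := by
  have := norm_nonneg ξ
  rw [phiK_zero_apply, hφ.eq_one this (by linarith), hφ.eq_one (by linarith) (by linarith), sub_self]

lemma phiK_zero_of_large {φ : ℝ → ℝ} (hφ : IsCutoff φ) {ξ : E3} (h : 8 / 5 < ‖ξ‖) :
    phiK φ 0 ξ = 0 := by
  rw [phiK_zero_apply, hφ.eq_zero h, hφ.eq_zero (by linarith), sub_self]

/-- Neighbouring dyadic cutoffs sum to `1` on the support of `φ_k`. -/
lemma phiK_mul_sum {φ : ℝ → ℝ} (hφ : IsCutoff φ) (k : ℤ) (ξ : E3) :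
    phiK φ k ξ * ∑ i ∈ Finset.Icc (k - 1) (k + 1), phiK φ i ξ = phiK φ k ξ := by
  have e : Finset.Icc (k - 1) (k + 1) = {k - 1, k, k + 1} := by
    ext i; simp; omega
  rw [e, Finset.sum_insert (by simp; omega), Finset.sum_insert (by simp), Finset.sum_singleton]
  by_cases h : phiK φ k ξ = 0
  · rw [h, zero_mul]
  have h2 := zpow_two_pos k
  rw [phiK_eq] at h
  have h1 : ¬ ‖((2 : ℝ) ^ k)⁻¹ • ξ‖ ≤ 5 / 8 := fun h' => h (phiK_zero_of_small hφ h')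
  have h3 : ¬ 8 / 5 < ‖((2 : ℝ) ^ k)⁻¹ • ξ‖ := fun h' => h (phiK_zero_of_large hφ h')
  rw [norm_smul, norm_inv, Real.norm_of_nonneg h2.le, ← div_eq_inv_mul, not_le] at h1
  rw [norm_smul, norm_inv, Real.norm_of_nonneg h2.le, ← div_eq_inv_mul, not_lt] at h3
  have e1 : φ (‖ξ‖ / (2 : ℝ) ^ (k + 1)) = 1 := by
    apply hφ.eq_one
    · positivity
    · rw [zpow_add₀ two_ne_zero, zpow_one, ← div_div]
      linarith
  have e2 : φ (‖ξ‖ / (2 : ℝ) ^ (k - 1 - 1)) = 0 := by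
    apply hφ.eq_zero
    rw [show k - 1 - 1 = k - 2 by ring, zpow_sub₀ two_ne_zero, ← div_mul]
    norm_num
    linarith
  have : phiK φ (k - 1) ξ + (phiK φ k ξ + phiK φ (k + 1) ξ) = 1 := by
    simp only [phiK, add_sub_cancel_right]
    rw [e1, e2]
    ring
  rw [this, mul_one]

lemma phiK_mul_eq_zero {φ : ℝ → ℝ} (hφ : IsCutoff φ) {k l : ℤ} (h : l ∉ Finset.Icc (k - 1) (k + 1))
    (ξ : E3) : phiK φ k ξ * phiK φ l ξ = 0 := by
  wlog hkl : k ≤ l generalizing k l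
  · rw [mul_comm]
    refine this ?_ (le_of_not_ge hkl)
    simp only [Finset.mem_Icc, not_and, not_le] at h ⊢
    omega
  simp only [Finset.mem_Icc, not_and, not_le] at h
  have hl : k + 2 ≤ l := by have := h (by omega); omega
  have h2 := zpow_two_pos k
  by_cases hk : phiK φ k ξ = 0
  · rw [hk, zero_mul]
  have h3 : ¬ 8 / 5 < ‖((2 : ℝ) ^ k)⁻¹ • ξ‖ := fun h' => hk (by
    rw [phiK_eq]; exact phiK_zero_of_large hφ h')
  rw [phiK_eq φ l, phiK_zero_of_small hφ, mul_zero]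
  rw [norm_smul, norm_inv, Real.norm_of_nonneg h2.le, ← div_eq_inv_mul, not_lt,
    div_le_iff₀ h2] at h3
  rw [norm_smul, norm_inv, Real.norm_of_nonneg (zpow_two_pos l).le, ← div_eq_inv_mul,
    div_le_iff₀ (zpow_two_pos l)]
  have h4 : (2 : ℝ) ^ (k + 2) ≤ 2 ^ l := zpow_le_zpow_right₀ one_le_two hl
  rw [zpow_add₀ two_ne_zero] at h4
  norm_num at h4
  linarith

lemma contDiff_radial {φ : ℝ → ℝ} (hφ : IsCutoff φ) {c : ℝ} (hc : 0 < c) :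
    ContDiff ℝ ∞ (fun ξ : E3 => φ (c * ‖ξ‖)) := by
  rw [contDiff_iff_contDiffAt]
  intro ξ
  by_cases h : ξ = 0
  · have : (fun ξ : E3 => φ (c * ‖ξ‖)) =ᶠ[nhds ξ] fun _ => 1 := by
      subst h
      have : ∀ᶠ η in nhds (0 : E3), c * ‖η‖ < 1 := by
        have hc : ContinuousAt (fun η : E3 => c * ‖η‖) 0 := by fun_prop
        apply hc.eventually_lt continuousAt_const
        simp
      filter_upwards [this] with η hη
      exact hφ.eq_one (by positivity) (by linarith)
    exact contDiffAt_const.congr_of_eventuallyEq this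
  · exact hφ.smooth.contDiffAt.comp ξ (contDiffAt_const.mul (contDiffAt_norm ℝ h))

lemma contDiff_phiK_zero {φ : ℝ → ℝ} (hφ : IsCutoff φ) :
    ContDiff ℝ ∞ (fun ξ : E3 => (phiK φ 0 ξ : ℂ)) := by
  have h1 := (contDiff_radial hφ one_pos).sub (contDiff_radial hφ two_pos)
  have h2 := Complex.ofRealCLM.contDiff.comp h1
  convert h2 using 2 with ξ
  simp [phiK_zero_apply]

lemma contDiff_mul_of_eq_zero_near {n : ℕ∞ω} {ψ m : E3 → ℂ} (hψ : ContDiff ℝ n ψ)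
    (h0 : ∀ ξ, ‖ξ‖ ≤ 5 / 8 → ψ ξ = 0) (hm : ContDiffOn ℝ n m {0}ᶜ) :
    ContDiff ℝ n (fun ξ => ψ ξ * m ξ) := by
  rw [contDiff_iff_contDiffAt]
  intro ξ
  by_cases h : ξ = 0
  · have : (fun ξ : E3 => ψ ξ * m ξ) =ᶠ[nhds ξ] fun _ => 0 := by
      subst h
      filter_upwards [Metric.ball_mem_nhds (0 : E3) (show (0 : ℝ) < 5 / 8 by norm_num)] with η hη
      rw [h0 η (by simpa using (le_of_lt (by simpa using hη : ‖η‖ < 5 / 8))), zero_mul]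
    exact contDiffAt_const.congr_of_eventuallyEq this
  · exact hψ.contDiffAt.mul (hm.contDiffAt (isOpen_compl_singleton.mem_nhds h))

/-- Multiplying a fixed smooth function on an annulus with a symbol whose derivatives are bounded
by `D` there gives derivatives `≲ D`. -/
lemma exists_iteratedFDeriv_mul_le {ψ : E3 → ℂ} (hψ : ContDiff ℝ 4 ψ)
    (h0 : ∀ ξ, ‖ξ‖ ≤ 5 / 8 → ψ ξ = 0) (h1 : ∀ ξ, 8 / 5 < ‖ξ‖ → ψ ξ = 0) :
    ∃ C : ℝ, 0 < C ∧ ∀ (D : ℝ) (m : E3 → ℂ), ContDiffOn ℝ 4 m {0}ᶜ →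
      (∀ n ≤ 4, ∀ ξ, 1 / 2 ≤ ‖ξ‖ → ‖ξ‖ ≤ 2 → ‖iteratedFDeriv ℝ n m ξ‖ ≤ D) →
      ∀ n ≤ 4, ∀ ξ, ‖iteratedFDeriv ℝ n (fun η => ψ η * m η) ξ‖ ≤ C * D := by
  have hcs : HasCompactSupport ψ := by
    apply HasCompactSupport.of_support_subset_isCompact (isCompact_closedBall (0 : E3) 2)
    intro ξ hξ
    by_contra h
    exact hξ (h1 ξ (by simp at h; linarith))
  have hM : ∀ n : ℕ, ∃ M : ℝ, n ≤ 4 → ∀ ξ, ‖iteratedFDeriv ℝ n ψ ξ‖ ≤ M := by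
    intro n
    by_cases hn : n ≤ 4
    · obtain ⟨M, hM⟩ := (hcs.iteratedFDeriv (𝕜 := ℝ) n).exists_bound_of_continuous
        (hψ.continuous_iteratedFDeriv (by exact_mod_cast hn))
      exact ⟨M, fun _ => hM⟩
    · exact ⟨0, fun h => absurd h hn⟩
  choose M hM using hM
  set M' := ∑ i ∈ Finset.range 5, |M i| with hM'
  have hM'0 : 0 ≤ M' := by positivity
  have hMM : ∀ n ≤ 4, ∀ ξ, ‖iteratedFDeriv ℝ n ψ ξ‖ ≤ M' := by
    intro n hn ξ
    refine (hM n hn ξ).trans ((le_abs_self _).trans ?_)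
    exact Finset.single_le_sum (f := fun i => |M i|) (fun i _ => abs_nonneg _)
      (Finset.mem_range.2 (by omega))
  refine ⟨16 * M' + 1, by positivity, fun D m hm hD n hn ξ => ?_⟩
  have hD0 : 0 ≤ D := by
    obtain ⟨η, hη⟩ := exists_norm_eq E3 zero_le_one
    exact (norm_nonneg _).trans (hD 0 (by norm_num) η (by rw [hη]; norm_num) (by rw [hη]; norm_num))
  by_cases hξ : 1 / 2 ≤ ‖ξ‖ ∧ ‖ξ‖ ≤ 2
  · have hξ0 : ξ ∈ ({0}ᶜ : Set E3) := by
      rintro rfl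
      norm_num at hξ
    have ho : IsOpen ({0}ᶜ : Set E3) := isOpen_compl_singleton
    have h2 := norm_iteratedFDerivWithin_mul_le (𝕜 := ℝ) (N := 4) (s := ({0}ᶜ : Set E3))
      hψ.contDiffOn hm ho.uniqueDiffOn hξ0 (n := n) (by exact_mod_cast hn)
    rw [iteratedFDerivWithin_of_isOpen n ho hξ0] at h2
    refine h2.trans ?_
    calc _ ≤ ∑ i ∈ Finset.range (n + 1), (n.choose i : ℝ) * M' * D := by
          apply Finset.sum_le_sum
          intro i hi
          simp only [Finset.mem_range] at hi
          rw [iteratedFDerivWithin_of_isOpen i ho hξ0, iteratedFDerivWithin_of_isOpen (n - i) ho hξ0]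
          gcongr
          · exact hMM i (by omega) ξ
          · exact hD (n - i) (by omega) ξ hξ.1 hξ.2
      _ = (2 : ℝ) ^ n * M' * D := by
          rw [← Finset.sum_mul, ← Finset.sum_mul]
          congr 2
          exact_mod_cast Nat.sum_range_choose n
      _ ≤ 16 * M' * D := by
          gcongr
          calc (2 : ℝ) ^ n ≤ 2 ^ 4 := pow_le_pow_right₀ one_le_two hn
            _ = 16 := by norm_num
      _ ≤ (16 * M' + 1) * D := by nlinarith
  · have hz : (fun η => ψ η * m η) =ᶠ[nhds ξ] fun _ => 0 := by
      rw [not_and_or, not_le, not_le] at hξ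
      rcases hξ with hξ | hξ
      · filter_upwards [(isOpen_lt continuous_norm continuous_const).mem_nhds hξ] with η hη
        rw [h0 η (le_of_lt (lt_trans hη (by norm_num))), zero_mul]
      · filter_upwards [(isOpen_lt continuous_const continuous_norm).mem_nhds hξ] with η hη
        rw [h1 η (lt_trans (by norm_num) hη), zero_mul]
    have : iteratedFDeriv ℝ n (fun η => ψ η * m η) ξ = iteratedFDeriv ℝ n (fun _ => (0 : ℂ)) ξ :=
      (hz.iteratedFDeriv ℝ n).eq_of_nhds
    rw [this]
    have h3 : iteratedFDeriv ℝ n (fun _ : E3 => (0 : ℂ)) ξ = 0 := by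
      simp
    rw [h3, norm_zero]
    positivity

/-- A symbol that is smooth away from the origin and homogeneous of degree `d`. -/
structure Homog (d : ℤ) (m : E3 → ℂ) : Prop where
  smooth : ContDiffOn ℝ ∞ m {0}ᶜ
  scale : ∀ r : ℝ, 0 < r → ∀ ξ, m (r • ξ) = ((r ^ d : ℝ) : ℂ) * m ξ

lemma Homog.one : Homog 0 (fun _ => 1) := ⟨contDiffOn_const, fun r hr ξ => by simp⟩

lemma Homog.mul {d e : ℤ} {m n : E3 → ℂ} (hm : Homog d m) (hn : Homog e n) :
    Homog (d + e) (fun ξ => m ξ * n ξ) :=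
  ⟨hm.smooth.mul hn.smooth, fun r hr ξ => by
    rw [hm.scale r hr, hn.scale r hr, zpow_add₀ hr.ne']; push_cast; ring⟩

/-- The symbol `i ξ_a` of `∂_a`. -/
noncomputable def dSym (a : Fin 3) (ξ : E3) : ℂ := Complex.I * (ξ a : ℂ)

/-- The symbol `-i ξ_a / |ξ|²` of `∂_a Δ⁻¹`. -/
noncomputable def rSym (a : Fin 3) (ξ : E3) : ℂ := -(Complex.I * (ξ a : ℂ)) / ((‖ξ‖ ^ 2 : ℝ) : ℂ)

lemma contDiff_coord (a : Fin 3) : ContDiff ℝ ∞ (fun ξ : E3 => (ξ a : ℂ)) := by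
  exact Complex.ofRealCLM.contDiff.comp
    (EuclideanSpace.proj a : EuclideanSpace ℝ (Fin 3) →L[ℝ] ℝ).contDiff

lemma homog_dSym (a : Fin 3) : Homog 1 (dSym a) :=
  ⟨(contDiff_const.mul (contDiff_coord a)).contDiffOn, fun r hr ξ => by simp [dSym]; ring⟩

lemma homog_rSym (a : Fin 3) : Homog (-1) (rSym a) := by
  refine ⟨?_, fun r hr ξ => ?_⟩
  · unfold rSym
    simp_rw [div_eq_mul_inv]
    refine ContDiffOn.mul ?_ (ContDiffOn.inv ?_ ?_)
    · exact (contDiff_const.mul (contDiff_coord a)).neg.contDiffOn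
    · exact (Complex.ofRealCLM.contDiff.comp (contDiff_norm_sq ℝ)).contDiffOn
    · intro ξ hξ
      simpa using hξ
  · simp only [rSym, PiLp.smul_apply, smul_eq_mul, norm_smul, Real.norm_of_nonneg hr.le]
    push_cast
    have : (r : ℂ) ≠ 0 := by exact_mod_cast hr.ne'
    rw [zpow_neg_one]
    by_cases h : ξ = 0
    · simp [h]
    have : (‖ξ‖ : ℂ) ≠ 0 := by simpa using h
    field_simp

/-- The convolution kernel of a dyadic symbol `φ_k R m`, for `m` homogeneous of degree `d`. -/
lemma exists_ker_le {φ : ℝ → ℝ} (hφ : IsCutoff φ) {d : ℤ} {m : E3 → ℂ} (hm : Homog d m) :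
    ∃ C : ℝ, 0 < C ∧ ∀ (k : ℤ) (D : ℝ) (R : E3 → ℂ), ContDiffOn ℝ 4 R {0}ᶜ →
      (∀ n ≤ 4, ∀ ξ, 1 / 2 ≤ ‖ξ‖ → ‖ξ‖ ≤ 2 →
        ‖iteratedFDeriv ℝ n (fun η => R ((2 : ℝ) ^ k • η)) ξ‖ ≤ D) →
      Ker k (C * D * (2 : ℝ) ^ (k * d)) (ker φ k (fun ξ => R ξ * m ξ)) := by
  obtain ⟨C₁, hC₁, H₁⟩ := exists_norm_invFourier_le
  set ψ : E3 → ℂ := fun ξ => (phiK φ 0 ξ : ℂ) * m ξ with hψ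
  have hψs : ContDiff ℝ ∞ ψ := contDiff_mul_of_eq_zero_near (contDiff_phiK_zero hφ)
    (fun ξ h => by rw [phiK_zero_of_small hφ h, Complex.ofReal_zero]) hm.smooth
  have hψ0 : ∀ ξ, ‖ξ‖ ≤ 5 / 8 → ψ ξ = 0 := fun ξ h => by
    simp [hψ, phiK_zero_of_small hφ h]
  have hψ1 : ∀ ξ, 8 / 5 < ‖ξ‖ → ψ ξ = 0 := fun ξ h => by
    simp [hψ, phiK_zero_of_large hφ h]
  have hψ4 : ContDiff ℝ 4 ψ := hψs.of_le (by norm_cast)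
  obtain ⟨C₂, hC₂, H₂⟩ := exists_iteratedFDeriv_mul_le hψ4 hψ0 hψ1
  refine ⟨C₁ * C₂, by positivity, fun k D R hR hD => ?_⟩
  have h2 := zpow_two_pos k
  have hRk : ContDiffOn ℝ 4 (fun η => R ((2 : ℝ) ^ k • η)) {0}ᶜ := by
    apply hR.comp (contDiff_const_smul _).contDiffOn
    intro ξ hξ
    simpa [h2.ne'] using hξ
  -- at frequency `1`, where the symbol is supported in an annulus; rescaling and the homogeneity of
  -- `m` give the factor `2^{kd}` afterwards
  have h3 : Ker 0 (C₁ * (C₂ * D)) (invFourier fun ξ => ψ ξ * R ((2 : ℝ) ^ k • ξ)) := by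
    apply H₁
    · exact contDiff_mul_of_eq_zero_near hψ4 hψ0 hRk
    · intro ξ hξ
      rw [hψ1 ξ (by linarith), zero_mul]
    · exact H₂ D _ hRk hD
  have h4 := h3.rescale (k := k)
  have e : ker φ k (fun ξ => R ξ * m ξ) = fun x => (((2 : ℝ) ^ (k * d) : ℝ) : ℂ) *
      invFourier (fun ξ => ψ (((2 : ℝ) ^ k)⁻¹ • ξ) *
        R ((2 : ℝ) ^ k • (((2 : ℝ) ^ k)⁻¹ • ξ))) x := by
    ext x
    unfold ker invFourier
    rw [mul_left_comm]
    congr 1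
    rw [← integral_const_mul]
    refine integral_congr_ae (Filter.Eventually.of_forall fun ξ => ?_)
    have e1 : m ξ = (((2 : ℝ) ^ (k * d) : ℝ) : ℂ) * m (((2 : ℝ) ^ k)⁻¹ • ξ) := by
      rw [zpow_mul, ← hm.scale _ h2, smul_inv_smul₀ h2.ne']
    simp only [smul_inv_smul₀ h2.ne', hψ]
    rw [e1, phiK_eq φ k ξ]
    ring
  rw [e]
  have h5 := zpow_two_pos (k * d)
  refine ⟨continuous_const.mul h4.cont, fun x => ?_⟩
  rw [norm_mul, Complex.norm_real, Real.norm_of_nonneg h5.le]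
  calc _ ≤ (2 : ℝ) ^ (k * d) * (C₁ * (C₂ * D) * bump k x) := by
        gcongr; exact h4.bound x
    _ = _ := by ring

lemma norm_multilinear_le_of_basis {n : ℕ}
    (L : ContinuousMultilinearMap ℝ (fun _ : Fin n => E3) ℂ) {B : ℝ}
    (h : ∀ i : Fin n → Fin 3, ‖L (fun l => basisVec (i l))‖ ≤ B) : ‖L‖ ≤ 3 ^ n * B := by
  have hB : 0 ≤ B := (norm_nonneg _).trans (h fun _ => 0)
  refine ContinuousMultilinearMap.opNorm_le_bound (by positivity) fun v => ?_
  have e : v = fun l => ∑ a : Fin 3, (v l a) • basisVec a := by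
    ext l a
    simp [basisVec, Finset.sum_apply, Pi.single_apply]
  have e2 : L v = ∑ r : Fin n → Fin 3, L (fun l => (v l (r l)) • basisVec (r l)) := by
    conv_lhs => rw [e]
    exact L.toMultilinearMap.map_sum (fun l a => (v l a) • basisVec a)
  rw [e2]
  refine (norm_sum_le _ _).trans ?_
  calc _ ≤ ∑ r : Fin n → Fin 3, (∏ l, ‖v l‖) * B := by
        apply Finset.sum_le_sum
        intro r _
        have e3 : L (fun l => (v l (r l)) • basisVec (r l)) =
            (∏ l, v l (r l)) • L (fun l => basisVec (r l)) := L.map_smul_univ _ _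
        rw [e3, norm_smul, norm_prod]
        gcongr with l
        · exact PiLp.norm_apply_le (v l) (r l)
        · exact h r
    _ = 3 ^ n * B * ∏ l, ‖v l‖ := by
        simp
        ring

lemma norm_iteratedFDeriv_comp_smul_le {R : E3 → ℂ} (hR : ContDiffOn ℝ 4 R {0}ᶜ) {r : ℝ}
    (hr : 0 < r) {n : ℕ} (hn : n ≤ 4) {ξ : E3} (hξ : ξ ≠ 0) :
    ‖iteratedFDeriv ℝ n (fun η => R (r • η)) ξ‖ ≤ r ^ n * ‖iteratedFDeriv ℝ n R (r • ξ)‖ := by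
  have ho : IsOpen ({0}ᶜ : Set E3) := isOpen_compl_singleton
  set g : E3 →L[ℝ] E3 := r • ContinuousLinearMap.id ℝ E3 with hg
  have hpre : g ⁻¹' ({0}ᶜ : Set E3) = {0}ᶜ := by
    ext η; simp [hg, hr.ne']
  have h1 := g.iteratedFDerivWithin_comp_right hR ho.uniqueDiffOn (by
    rw [hpre]; exact ho.uniqueDiffOn) (x := ξ) (by simp [hg, hr.ne', hξ]) (i := n)
    (by exact_mod_cast hn)
  rw [hpre, iteratedFDerivWithin_of_isOpen n ho (by simpa using hξ),
    iteratedFDerivWithin_of_isOpen n ho (by simp [hg, hr.ne', hξ])] at h1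
  have e : (R ∘ g) = fun η => R (r • η) := by ext η; simp [hg]
  rw [e] at h1
  rw [h1]
  refine (ContinuousMultilinearMap.norm_compContinuousLinearMap_le _ _).trans ?_
  have h2 : ‖g‖ ≤ r := by
    rw [hg]
    rw [norm_smul, Real.norm_of_nonneg hr.le]
    exact mul_le_of_le_one_right hr.le ContinuousLinearMap.norm_id_le
  have e3 : g ξ = r • ξ := by simp [hg]
  rw [mul_comm, e3]
  gcongr
  rw [Finset.prod_const, Finset.card_univ, Fintype.card_fin]
  gcongr

lemma IsMichlin.annulus_le {R : E3 → ℂ} (hR : IsMichlin R) (k : ℤ) {n : ℕ} (hn : n ≤ 4) {ξ : E3}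
    (hξ : 1 / 2 ≤ ‖ξ‖) : ‖iteratedFDeriv ℝ n (fun η => R ((2 : ℝ) ^ k • η)) ξ‖ ≤ 1296 := by
  have h2 := zpow_two_pos k
  have hξ0 : ξ ≠ 0 := by
    rintro rfl
    norm_num at hξ
  have hpos : 0 < ‖ξ‖ := norm_pos_iff.2 hξ0
  refine (norm_iteratedFDeriv_comp_smul_le (hR.smooth.of_le (by norm_num)) h2 hn hξ0).trans ?_
  have h3 : ‖iteratedFDeriv ℝ n R ((2 : ℝ) ^ k • ξ)‖ ≤ 3 ^ n * (((2 : ℝ) ^ k * ‖ξ‖) ^ n)⁻¹ := by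
    apply norm_multilinear_le_of_basis
    intro i
    have h4 := hR.bound n (by omega) i ((2 : ℝ) ^ k • ξ) (by simp [h2.ne', hξ0])
    rw [norm_smul, Real.norm_of_nonneg h2.le] at h4
    rw [← one_div, le_div_iff₀ (by positivity), mul_comm]
    exact h4
  calc _ ≤ ((2 : ℝ) ^ k) ^ n * (3 ^ n * (((2 : ℝ) ^ k * ‖ξ‖) ^ n)⁻¹) := by gcongr
    _ = (3 / ‖ξ‖) ^ n := by
        rw [mul_pow, div_pow]
        field_simp
    _ ≤ 6 ^ n := by
        gcongr
        rw [div_le_iff₀ hpos]; linarith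
    _ ≤ 6 ^ 4 := pow_le_pow_right₀ (by norm_num) hn
    _ = 1296 := by norm_num

lemma jap_pos (r : ℝ) : 0 < jap r := Real.sqrt_pos.2 (by positivity)

lemma one_le_jap (r : ℝ) : 1 ≤ jap r := Real.one_le_sqrt.2 (by nlinarith [sq_nonneg r])

/-- The symbol `⟨ξ⟩⁻¹` of `⟨∇⟩⁻¹`. -/
noncomputable def japInv (ξ : E3) : ℂ := (((jap ‖ξ‖)⁻¹ : ℝ) : ℂ)

/-- Derivatives of `(a + b |ξ|²)^{-1/2}` on the unit annulus, uniformly in the parameters. -/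
lemma exists_iteratedFDeriv_rpow_le : ∃ C : ℝ, 0 < C ∧ ∀ a b : ℝ, 0 ≤ a → a ≤ 1 → 0 ≤ b → b ≤ 1 →
    (a = 1 ∨ b = 1) → ∀ n ≤ 4, ∀ ξ : E3, 1 / 2 ≤ ‖ξ‖ → ‖ξ‖ ≤ 2 →
      ‖iteratedFDeriv ℝ n (fun η : E3 => (((a + b * ‖η‖ ^ 2) ^ (-(1 / 2) : ℝ) : ℝ) : ℂ)) ξ‖ ≤ C := by
  set g : ℝ → ℂ := fun r => ((r ^ (-(1 / 2) : ℝ) : ℝ) : ℂ) with hg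
  have hgs : ContDiffOn ℝ ∞ g (Ioi 0) := by
    apply Complex.ofRealCLM.contDiff.comp_contDiffOn
    intro r hr
    exact (Real.contDiffAt_rpow_const_of_ne (ne_of_gt hr)).contDiffWithinAt
  have ho : IsOpen (Ioi (0 : ℝ)) := isOpen_Ioi
  have hM : ∀ n : ℕ, ∃ M : ℝ, ∀ r ∈ Icc (1 / 4 : ℝ) 5, ‖iteratedFDerivWithin ℝ n g (Ioi 0) r‖ ≤ M := by
    intro n
    apply isCompact_Icc.exists_bound_of_continuousOn
    refine (hgs.continuousOn_iteratedFDerivWithin (m := n) (by exact_mod_cast le_top)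
      ho.uniqueDiffOn).mono fun r hr => ?_
    exact lt_of_lt_of_le (by norm_num) hr.1
  choose M hM using hM
  have hQ : ∀ n : ℕ, ∃ Q : ℝ, ∀ ξ ∈ Metric.closedBall (0 : E3) 2,
      ‖iteratedFDeriv ℝ n (fun η : E3 => ‖η‖ ^ 2) ξ‖ ≤ Q := by
    intro n
    apply (isCompact_closedBall _ _).exists_bound_of_continuousOn
    exact ((contDiff_norm_sq ℝ).continuous_iteratedFDeriv (n := ∞)
      (by exact_mod_cast le_top)).continuousOn
  choose Q hQ using hQ
  set M' := ∑ i ∈ Finset.range 5, |M i|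
  set Q' := 1 + ∑ i ∈ Finset.range 5, |Q i|
  have hM'0 : 0 ≤ M' := by positivity
  have hQ'1 : 1 ≤ Q' := le_add_of_nonneg_right (by positivity)
  refine ⟨24 * M' * Q' ^ 4 + 1, by positivity, ?_⟩
  intro a b ha ha1 hb hb1 hab n hn ξ hξ1 hξ2
  have hξ0 : ξ ∈ ({0}ᶜ : Set E3) := by
    rintro rfl
    norm_num at hξ1
  have hoE : IsOpen ({0}ᶜ : Set E3) := isOpen_compl_singleton
  set f : E3 → ℝ := fun η => a + b * ‖η‖ ^ 2 with hf
  have hfs : ContDiff ℝ ∞ f := contDiff_const.add (contDiff_const.mul (contDiff_norm_sq ℝ))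
  have hmaps : MapsTo f {0}ᶜ (Ioi 0) := by
    intro η hη
    have : 0 < ‖η‖ := norm_pos_iff.2 hη
    simp only [hf, mem_Ioi]
    rcases hab with rfl | rfl <;> positivity
  have hfr : f ξ ∈ Icc (1 / 4 : ℝ) 5 := by
    simp only [hf, mem_Icc]
    have h1 : 1 / 4 ≤ ‖ξ‖ ^ 2 := by nlinarith
    have h2 : ‖ξ‖ ^ 2 ≤ 4 := by nlinarith [norm_nonneg ξ]
    constructor
    · rcases hab with rfl | rfl <;> nlinarith
    · nlinarith
  have h := norm_iteratedFDerivWithin_comp_le (𝕜 := ℝ) (N := ∞) (n := n) hgs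
    hfs.contDiffOn (by exact_mod_cast le_top) ho.uniqueDiffOn hoE.uniqueDiffOn hmaps hξ0
    (C := M') (D := Q') (fun i hi => ?_) (fun i hi1 hi => ?_)
  · rw [iteratedFDerivWithin_of_isOpen n hoE hξ0] at h
    refine le_trans (le_of_eq rfl) (h.trans ?_)
    have h1 : (n.factorial : ℝ) ≤ 24 := by
      have : n.factorial ≤ Nat.factorial 4 := Nat.factorial_le hn
      exact_mod_cast this
    have h2 : Q' ^ n ≤ Q' ^ 4 := pow_le_pow_right₀ hQ'1 hn
    calc _ ≤ 24 * M' * Q' ^ 4 := by gcongr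
      _ ≤ _ := by linarith
  · refine (hM i _ hfr).trans ((le_abs_self _).trans ?_)
    exact Finset.single_le_sum (f := fun i => |M i|) (fun i _ => abs_nonneg _)
      (Finset.mem_range.2 (by omega))
  · rw [iteratedFDerivWithin_of_isOpen i hoE hξ0]
    have e : iteratedFDeriv ℝ i f ξ = b • iteratedFDeriv ℝ i (fun η : E3 => ‖η‖ ^ 2) ξ := by
      have h3 : ContDiff ℝ i (fun η : E3 => ‖η‖ ^ 2) := contDiff_norm_sq ℝ
      have e1 : f = (fun _ => a) + (b • fun η : E3 => ‖η‖ ^ 2) := by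
        ext η; simp [hf]
      rw [e1, iteratedFDeriv_add_apply (f := fun _ : E3 => a) contDiffAt_const
          (g := b • fun η : E3 => ‖η‖ ^ 2) (contDiffAt_const.smul h3.contDiffAt),
        iteratedFDeriv_const_of_ne (by omega), iteratedFDeriv_const_smul_apply h3.contDiffAt]
      simp
    rw [e, norm_smul, Real.norm_of_nonneg hb]
    have h4 : ‖iteratedFDeriv ℝ i (fun η : E3 => ‖η‖ ^ 2) ξ‖ ≤ Q' := by
      refine (hQ i ξ (by simpa using hξ2)).trans ((le_abs_self _).trans ?_)
      refine le_trans ?_ (le_add_of_nonneg_left zero_le_one)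
      exact Finset.single_le_sum (f := fun i => |Q i|) (fun i _ => abs_nonneg _)
        (Finset.mem_range.2 (by omega))
    calc _ ≤ 1 * Q' := by gcongr
      _ ≤ Q' ^ i := by rw [one_mul]; exact le_self_pow₀ hQ'1 (by omega)

/-- The kernels of `φ_k ⟨ξ⟩⁻¹`. After rescaling to frequency `1` the symbol is `(a + b|η|²)^{-1/2}`, up to a
factor `2^{-k}` if `k > 0`, with one of `a`, `b` equal to `1` and the other one in `[0,1]`. -/
lemma exists_ker_japInv_le {φ : ℝ → ℝ} (hφ : IsCutoff φ) :
    ∃ C : ℝ, 0 < C ∧ ∀ k : ℤ, Ker k (C * (1 + (2 : ℝ) ^ k)⁻¹) (ker φ k japInv) := by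
  obtain ⟨C₁, hC₁, H₁⟩ := exists_ker_le hφ Homog.one
  obtain ⟨C₂, hC₂, H₂⟩ := exists_iteratedFDeriv_rpow_le
  have hsm : ContDiffOn ℝ 4 japInv {0}ᶜ := by
    apply ContDiff.contDiffOn
    have h1 : ContDiff ℝ 4 (fun ξ : E3 => (Real.sqrt (1 + ‖ξ‖ ^ 2))⁻¹) := by
      refine ContDiff.inv (ContDiff.sqrt (contDiff_const.add (contDiff_norm_sq ℝ)) fun ξ => ?_)
        fun ξ => ?_
      · positivity
      · positivity
    exact Complex.ofRealCLM.contDiff.comp h1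
  have key : ∀ (k : ℤ), ∀ n ≤ 4, ∀ ξ : E3, 1 / 2 ≤ ‖ξ‖ → ‖ξ‖ ≤ 2 →
      ‖iteratedFDeriv ℝ n (fun η => japInv ((2 : ℝ) ^ k • η)) ξ‖ ≤ 2 * C₂ * (1 + (2 : ℝ) ^ k)⁻¹ := by
    intro k n hn ξ h1 h2
    have hk := zpow_two_pos k
    rcases le_or_gt k 0 with hk0 | hk0
    · have hk1 : (2 : ℝ) ^ k ≤ 1 := zpow_le_one_of_nonpos₀ one_le_two hk0
      have e : (fun η : E3 => japInv ((2 : ℝ) ^ k • η)) = fun η : E3 =>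
          (((1 + ((2 : ℝ) ^ k) ^ 2 * ‖η‖ ^ 2) ^ (-(1 / 2) : ℝ) : ℝ) : ℂ) := by
        ext η
        rw [japInv, jap, norm_smul, Real.norm_of_nonneg hk.le, mul_pow, Real.rpow_neg (by positivity),
          Real.sqrt_eq_rpow]
      rw [e]
      refine (H₂ 1 (((2 : ℝ) ^ k) ^ 2) zero_le_one le_rfl (by positivity) (by
        exact pow_le_one₀ hk.le hk1) (Or.inl rfl) n hn ξ h1 h2).trans ?_
      rw [← div_eq_mul_inv, le_div_iff₀ (by positivity)]
      nlinarith
    · have hk1 : 1 ≤ (2 : ℝ) ^ k := one_le_zpow₀ one_le_two hk0.le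
      have hki : ((2 : ℝ) ^ k)⁻¹ ≤ 1 := inv_le_one_of_one_le₀ hk1
      have e : (fun η : E3 => japInv ((2 : ℝ) ^ k • η)) = ((2 : ℝ) ^ k)⁻¹ • fun η : E3 =>
          ((((((2 : ℝ) ^ k)⁻¹) ^ 2 + 1 * ‖η‖ ^ 2) ^ (-(1 / 2) : ℝ) : ℝ) : ℂ) := by
        ext η
        simp only [Pi.smul_apply, Complex.real_smul]
        rw [← Complex.ofReal_mul, japInv, jap, norm_smul, Real.norm_of_nonneg hk.le, mul_pow,
          Real.rpow_neg (by positivity), ← Real.sqrt_eq_rpow, ← mul_inv]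
        congr 2
        rw [show 1 + ((2 : ℝ) ^ k) ^ 2 * ‖η‖ ^ 2 =
          ((2 : ℝ) ^ k) ^ 2 * ((((2 : ℝ) ^ k)⁻¹) ^ 2 + 1 * ‖η‖ ^ 2) by field_simp,
          Real.sqrt_mul (by positivity), Real.sqrt_sq hk.le]
      have hξ0 : ξ ≠ 0 := by
        rintro rfl
        norm_num at h1
      have hpos : 0 < ‖ξ‖ := norm_pos_iff.2 hξ0
      have hcd : ContDiffAt ℝ n (fun η : E3 =>
          ((((((2 : ℝ) ^ k)⁻¹) ^ 2 + 1 * ‖η‖ ^ 2) ^ (-(1 / 2) : ℝ) : ℝ) : ℂ)) ξ := by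
        apply Complex.ofRealCLM.contDiff.contDiffAt.comp
        refine ContDiffAt.rpow_const_of_ne ?_ (by positivity)
        exact contDiffAt_const.add (contDiffAt_const.mul (contDiff_norm_sq ℝ).contDiffAt)
      rw [e, iteratedFDeriv_const_smul_apply hcd, norm_smul, norm_inv, Real.norm_of_nonneg hk.le]
      calc _ ≤ ((2 : ℝ) ^ k)⁻¹ * C₂ := by
            gcongr
            exact H₂ _ 1 (by positivity) (pow_le_one₀ (by positivity) hki) zero_le_one le_rfl
              (Or.inr rfl) n hn ξ h1 h2
        _ ≤ _ := by
            rw [mul_comm, ← div_eq_mul_inv, ← div_eq_mul_inv, div_le_div_iff₀ hk (by positivity)]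
            nlinarith
  refine ⟨C₁ * (2 * C₂), by positivity, fun k => ?_⟩
  have h := H₁ k _ japInv hsm (key k)
  simp only [mul_one, mul_zero, zpow_zero] at h
  rw [mul_assoc C₁]
  exact h

/-! ### Calculus of dyadic kernels -/

lemma basisVec_apply (a b : Fin 3) : (basisVec a) b = if b = a then 1 else 0 := by
  simp [basisVec]

lemma sum_smul_basisVec (v : E3) : v = ∑ a : Fin 3, v a • basisVec a := by
  ext a
  simp [basisVec_apply]

lemma clm_eq_sum (L : E3 →L[ℝ] ℂ) : L = ∑ a : Fin 3,
    ContinuousLinearMap.smulRightL ℝ E3 ℂ (EuclideanSpace.proj a : E3 →L[ℝ] ℝ) (L (basisVec a)) := by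
  ext v
  conv_lhs => rw [sum_smul_basisVec v]
  simp

lemma norm_clm_le_sum (L : E3 →L[ℝ] ℂ) : ‖L‖ ≤ ∑ a : Fin 3, ‖L (basisVec a)‖ := by
  refine L.opNorm_le_bound (by positivity) fun v => ?_
  conv_lhs => rw [sum_smul_basisVec v]
  rw [map_sum, Finset.sum_mul]
  refine (norm_sum_le _ _).trans (Finset.sum_le_sum fun a _ => ?_)
  rw [map_smul, norm_smul, mul_comm]
  gcongr
  exact PiLp.norm_apply_le v a

lemma norm_basisVec (a : Fin 3) : ‖basisVec a‖ = 1 := by simp [basisVec]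

lemma norm_pd_le (a : Fin 3) (g : E3 → ℂ) (x : E3) : ‖pd a g x‖ ≤ ‖fderiv ℝ g x‖ := by
  have := (fderiv ℝ g x).le_opNorm (basisVec a)
  rwa [norm_basisVec, mul_one] at this

lemma hasFDerivAt_invFourier {μ : E3 → ℂ} (hμ : Integrable μ)
    (hμ' : Integrable fun ξ => ‖ξ‖ * ‖μ ξ‖) (x : E3) :
    ∃ L : E3 →L[ℝ] ℂ, HasFDerivAt (invFourier μ) L x ∧
      ∀ a, L (basisVec a) = invFourier (fun ξ => dSym a ξ * μ ξ) x := by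
  set F : E3 → E3 → ℂ := fun x ξ => Complex.exp (Complex.I * ((inner ℝ x ξ : ℝ) : ℂ)) * μ ξ with hF
  set F' : E3 → E3 → E3 →L[ℝ] ℂ := fun x ξ =>
    (Complex.exp (Complex.I * ((inner ℝ x ξ : ℝ) : ℂ)) * Complex.I * μ ξ) •
      (Complex.ofRealCLM.comp (innerSL ℝ ξ)) with hF'
  have hexp : ∀ x ξ : E3, ‖Complex.exp (Complex.I * ((inner ℝ x ξ : ℝ) : ℂ))‖ = 1 := by
    intro x ξ
    rw [mul_comm, Complex.norm_exp_ofReal_mul_I]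
  have hFm : ∀ x, AEStronglyMeasurable (F x) volume := by
    intro x
    refine AEStronglyMeasurable.mul ?_ hμ.aestronglyMeasurable
    exact Continuous.aestronglyMeasurable (by fun_prop)
  have hnorm : ∀ x ξ, ‖F' x ξ‖ ≤ ‖ξ‖ * ‖μ ξ‖ := by
    intro x ξ
    rw [hF']
    simp only
    rw [norm_smul, norm_mul, norm_mul, hexp, Complex.norm_I, one_mul, one_mul, mul_comm]
    gcongr
    refine (ContinuousLinearMap.opNorm_comp_le _ _).trans ?_
    simp [innerSL_apply_norm]
  have hF'm : AEStronglyMeasurable (F' x) volume := by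
    refine AEStronglyMeasurable.smul (AEStronglyMeasurable.mul ?_ hμ.aestronglyMeasurable) ?_
    · exact Continuous.aestronglyMeasurable (by fun_prop)
    · exact Continuous.aestronglyMeasurable (by fun_prop)
  have hFi : Integrable (F x) := by
    refine hμ.mono (hFm x) (Filter.Eventually.of_forall fun ξ => ?_)
    rw [hF]
    simp only
    rw [norm_mul, hexp, one_mul]
  have hF'i : Integrable (F' x) :=
    hμ'.mono' hF'm (Filter.Eventually.of_forall fun ξ => hnorm x ξ)
  have hd : ∀ ξ x, HasFDerivAt (fun x => F x ξ) (F' x ξ) x := by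
    intro ξ x
    have h1 : HasFDerivAt (fun x : E3 => Complex.I * ((inner ℝ x ξ : ℝ) : ℂ))
        (Complex.I • (Complex.ofRealCLM.comp (innerSL ℝ ξ))) x := by
      have h2 : HasFDerivAt (fun x : E3 => ((inner ℝ x ξ : ℝ) : ℂ))
          (Complex.ofRealCLM.comp (innerSL ℝ ξ)) x := by
        have h3 := (Complex.ofRealCLM.comp (innerSL ℝ ξ)).hasFDerivAt (x := x)
        refine h3.congr_of_eventuallyEq (Filter.Eventually.of_forall fun y => ?_)
        simp [real_inner_comm]
      exact h2.const_mul Complex.I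
    have h4 := (h1.cexp).mul_const (μ ξ)
    refine h4.congr_fderiv ?_
    rw [hF']
    ext v
    simp
    ring
  have h := hasFDerivAt_integral_of_dominated_of_fderiv_le (μ := volume) (𝕜 := ℝ) (F := F)
    (F' := F') (x₀ := x) (s := univ) (bound := fun ξ => ‖ξ‖ * ‖μ ξ‖) Filter.univ_mem
    (Filter.Eventually.of_forall hFm) hFi hF'm
    (Filter.Eventually.of_forall fun ξ y _ => hnorm y ξ) hμ'
    (Filter.Eventually.of_forall fun ξ y _ => hd ξ y)
  refine ⟨_, h.const_mul (((2 * Real.pi) ^ 3 : ℝ) : ℂ)⁻¹, fun a => ?_⟩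
  rw [smul_apply, ContinuousLinearMap.integral_apply hF'i, smul_eq_mul,
    invFourier]
  congr 1
  refine integral_congr_ae (Filter.Eventually.of_forall fun ξ => ?_)
  have e : (inner ℝ ξ (basisVec a) : ℝ) = ξ a := by
    rw [basisVec, EuclideanSpace.inner_single_right]
    simp
  simp only [hF', smul_apply, ContinuousLinearMap.comp_apply,
    innerSL_apply_apply, smul_eq_mul, Complex.ofRealCLM_apply, e, dSym]
  ring

lemma continuous_phiK_mul {φ : ℝ → ℝ} (hφ : IsCutoff φ) (k : ℤ) {m : E3 → ℂ}
    (hm : ContinuousOn m {0}ᶜ) : Continuous (fun ξ => (phiK φ k ξ : ℂ) * m ξ) := by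
  have h2 := zpow_two_pos k
  have h1 : ContDiff ℝ 0 (fun ξ => (phiK φ 0 ξ : ℂ) * m ((2 : ℝ) ^ k • ξ)) := by
    apply contDiff_mul_of_eq_zero_near ((contDiff_phiK_zero hφ).of_le (by norm_cast))
    · intro ξ h
      rw [phiK_zero_of_small hφ h, Complex.ofReal_zero]
    · rw [contDiffOn_zero]
      apply hm.comp (continuous_const_smul _).continuousOn
      intro ξ hξ
      simpa [h2.ne'] using hξ
  have h3 := h1.continuous.comp (continuous_const_smul (((2 : ℝ) ^ k)⁻¹))
  refine h3.congr fun ξ => ?_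
  simp only [Function.comp, smul_inv_smul₀ h2.ne', phiK_eq φ k ξ]

lemma hasCompactSupport_phiK_mul {φ : ℝ → ℝ} (hφ : IsCutoff φ) (k : ℤ) (m : E3 → ℂ) :
    HasCompactSupport (fun ξ => (phiK φ k ξ : ℂ) * m ξ) := by
  have h2 := zpow_two_pos k
  apply HasCompactSupport.of_support_subset_isCompact
    (isCompact_closedBall (0 : E3) (8 / 5 * (2 : ℝ) ^ k))
  intro ξ hξ
  by_contra h
  apply hξ
  simp only [Metric.mem_closedBall, dist_zero_right, not_le] at h
  beta_reduce
  rw [phiK_eq, phiK_zero_of_large hφ, Complex.ofReal_zero, zero_mul]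
  rw [norm_smul, norm_inv, Real.norm_of_nonneg h2.le, ← div_eq_inv_mul, lt_div_iff₀ h2]
  exact h

lemma integrable_phiK_mul {φ : ℝ → ℝ} (hφ : IsCutoff φ) (k : ℤ) {m : E3 → ℂ}
    (hm : ContinuousOn m {0}ᶜ) : Integrable (fun ξ => (phiK φ k ξ : ℂ) * m ξ) :=
  (continuous_phiK_mul hφ k hm).integrable_of_hasCompactSupport (hasCompactSupport_phiK_mul hφ k m)

lemma cv_ker_ker {φ : ℝ → ℝ} (hφ : IsCutoff φ) {k l : ℤ} {m n : E3 → ℂ}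
    (hm : ContinuousOn m {0}ᶜ) (hn : ContinuousOn n {0}ᶜ) (hW : Integrable (ker φ k m)) :
    cv (ker φ k m) (ker φ l n) =
      invFourier (fun ξ => (phiK φ k ξ * m ξ) * (phiK φ l ξ * n ξ)) :=
  funext fun x => cv_invFourier (continuous_phiK_mul hφ k hm) (integrable_phiK_mul hφ k hm) hW
    (integrable_phiK_mul hφ l hn) x

lemma invFourier_finset_sum {ι : Type*} (s : Finset ι) {μ : ι → E3 → ℂ}
    (h : ∀ i ∈ s, Integrable (μ i)) (x : E3) :
    invFourier (fun ξ => ∑ i ∈ s, μ i ξ) x = ∑ i ∈ s, invFourier (μ i) x := by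
  unfold invFourier
  rw [← Finset.mul_sum, ← integral_finsetSum]
  · simp_rw [Finset.mul_sum]
  · intro i hi
    refine (h i hi).bdd_mul (c := 1) (Continuous.aestronglyMeasurable (by fun_prop))
      (Filter.Eventually.of_forall fun ξ => ?_)
    rw [mul_comm, Complex.norm_exp_ofReal_mul_I]

/-- Inserting the neighbouring projections: `φ_k m n = ∑_{|i-k| ≤ 1} (φ_i m) (φ_k n)`. -/
lemma ker_mul_eq_sum {φ : ℝ → ℝ} (hφ : IsCutoff φ) {k : ℤ} {m n : E3 → ℂ}
    (hm : ContinuousOn m {0}ᶜ) (hn : ContinuousOn n {0}ᶜ)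
    (hW : ∀ i, Integrable (ker φ i m)) (x : E3) :
    ker φ k (fun ξ => m ξ * n ξ) x =
      ∑ i ∈ Finset.Icc (k - 1) (k + 1), cv (ker φ i m) (ker φ k n) x := by
  simp_rw [cv_ker_ker hφ hm hn (hW _)]
  rw [← invFourier_finset_sum]
  · unfold ker
    congr 1
    ext ξ
    rw [← Finset.sum_mul, ← Finset.sum_mul]
    have h := congrArg (fun r : ℝ => (r : ℂ)) (phiK_mul_sum hφ k ξ)
    simp only [Complex.ofReal_mul, Complex.ofReal_sum] at h
    linear_combination (-(m ξ * n ξ)) * h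
  · intro i _
    refine Continuous.integrable_of_hasCompactSupport
      ((continuous_phiK_mul hφ i hm).mul (continuous_phiK_mul hφ k hn)) ?_
    exact (hasCompactSupport_phiK_mul hφ i m).mul_right

/-- The same with the projections applied first. -/
lemma ker_eq_sum_cv_proj {φ : ℝ → ℝ} (hφ : IsCutoff φ) {k : ℤ} {m : E3 → ℂ}
    (hm : ContinuousOn m {0}ᶜ) (hW : Integrable (ker φ k m)) (x : E3) :
    ker φ k m x = ∑ i ∈ Finset.Icc (k - 1) (k + 1), cv (ker φ k m) (ker φ i (fun _ => 1)) x := by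
  simp_rw [cv_ker_ker hφ hm continuousOn_const hW]
  rw [← invFourier_finset_sum]
  · unfold ker
    congr 1
    ext ξ
    rw [← Finset.mul_sum]
    simp_rw [mul_one]
    have h := congrArg (fun r : ℝ => (r : ℂ)) (phiK_mul_sum hφ k ξ)
    simp only [Complex.ofReal_mul, Complex.ofReal_sum] at h
    linear_combination (-(m ξ)) * h
  · intro i _
    refine Continuous.integrable_of_hasCompactSupport
      ((continuous_phiK_mul hφ k hm).mul (continuous_phiK_mul hφ i continuousOn_const)) ?_
    exact (hasCompactSupport_phiK_mul hφ k m).mul_right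

lemma cv_ker_ker_eq_zero {φ : ℝ → ℝ} (hφ : IsCutoff φ) {k l : ℤ} {m n : E3 → ℂ}
    (hm : ContinuousOn m {0}ᶜ) (hn : ContinuousOn n {0}ᶜ) (hW : Integrable (ker φ k m))
    (h : l ∉ Finset.Icc (k - 1) (k + 1)) : cv (ker φ k m) (ker φ l n) = 0 := by
  rw [cv_ker_ker hφ hm hn hW]
  ext x
  have e : (fun ξ => ((phiK φ k ξ : ℂ) * m ξ) * ((phiK φ l ξ : ℂ) * n ξ)) = fun _ => 0 := by
    ext ξ
    have h1 : (phiK φ k ξ : ℂ) * (phiK φ l ξ : ℂ) = 0 := by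
      exact_mod_cast phiK_mul_eq_zero hφ h ξ
    linear_combination (m ξ * n ξ) * h1
  rw [e]
  simp [invFourier]

lemma pd_ker {φ : ℝ → ℝ} (hφ : IsCutoff φ) (k : ℤ) {m : E3 → ℂ} (hm : ContinuousOn m {0}ᶜ)
    (x : E3) : ∃ L : E3 →L[ℝ] ℂ, HasFDerivAt (ker φ k m) L x ∧
      ∀ a, L (basisVec a) = ker φ k (fun ξ => dSym a ξ * m ξ) x := by
  have hi : Integrable (fun ξ => ‖ξ‖ * ‖(phiK φ k ξ : ℂ) * m ξ‖) := by
    apply Continuous.integrable_of_hasCompactSupport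
    · exact continuous_norm.mul (continuous_phiK_mul hφ k hm).norm
    · exact (hasCompactSupport_phiK_mul hφ k m).norm.mul_left
  obtain ⟨L, hL, hL'⟩ := hasFDerivAt_invFourier (integrable_phiK_mul hφ k hm) hi x
  refine ⟨L, hL, fun a => ?_⟩
  rw [hL' a, ker]
  congr 1
  ext ξ
  ring

/-- A `C¹` kernel at frequency `2^k`: it and `2^{-k}` times its gradient are dominated by `B` times
the bump. -/
structure KerD (k : ℤ) (B : ℝ) (W : E3 → ℂ) : Prop extends Ker k B W where
  diff : Differentiable ℝ W
  contd : Continuous (fderiv ℝ W)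
  dbound : ∀ x, ‖fderiv ℝ W x‖ ≤ B * 2 ^ k * bump k x

lemma continuous_fderiv_of_pd {W : E3 → ℂ} (h : ∀ a, Continuous (pd a W)) :
    Continuous (fderiv ℝ W) := by
  have e : fderiv ℝ W = fun x => ∑ a : Fin 3, ContinuousLinearMap.smulRightL ℝ E3 ℂ
      (EuclideanSpace.proj a : E3 →L[ℝ] ℝ) (pd a W x) := funext fun x => clm_eq_sum _
  rw [e]
  exact continuous_finsetSum _ fun a _ => (ContinuousLinearMap.continuous _).comp (h a)

lemma pd_ker_eq {φ : ℝ → ℝ} (hφ : IsCutoff φ) (k : ℤ) {m : E3 → ℂ} (hm : ContinuousOn m {0}ᶜ)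
    (a : Fin 3) : pd a (ker φ k m) = ker φ k (fun ξ => dSym a ξ * m ξ) := by
  ext x
  obtain ⟨L, hL, hL'⟩ := pd_ker hφ k hm x
  rw [pd, hL.fderiv, hL' a]

lemma IsMichlin.contDiffOn {R : E3 → ℂ} (hR : IsMichlin R) : ContDiffOn ℝ 4 R {0}ᶜ :=
  hR.smooth.of_le (by norm_num)

lemma isMichlin_one : IsMichlin (fun _ => 1) := by
  refine ⟨contDiffOn_const, fun n _ i ξ _ => ?_⟩
  rcases Nat.eq_zero_or_pos n with rfl | hn
  · simp
  · rw [iteratedFDeriv_const_of_ne (by omega)]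
    simp

/-- Kernel bounds for the dyadic pieces of `R m`, uniformly over all normalised Michlin symbols
`R`, when `m` is homogeneous of degree `d`. -/
lemma exists_kerD_homog {φ : ℝ → ℝ} (hφ : IsCutoff φ) {d : ℤ} {m : E3 → ℂ} (hm : Homog d m) :
    ∃ C : ℝ, 0 < C ∧ ∀ R, IsMichlin R → ∀ k : ℤ,
      KerD k (C * (2 : ℝ) ^ (k * d)) (ker φ k (fun ξ => R ξ * m ξ)) := by
  obtain ⟨C₀, hC₀, H₀⟩ := exists_ker_le hφ hm
  choose C hC H using fun a => exists_ker_le hφ ((homog_dSym a).mul hm)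
  set S := C₀ * 1296 + ∑ a, C a * 1296 with hS
  have hS0 : 0 < S := by
    have : 0 ≤ ∑ a, C a * 1296 := Finset.sum_nonneg fun a _ => by have := hC a; positivity
    positivity
  refine ⟨S, hS0, fun R hR k => ?_⟩
  have hk := zpow_two_pos k
  have hkd := zpow_two_pos (k * d)
  have hb : ∀ n ≤ 4, ∀ ξ : E3, 1 / 2 ≤ ‖ξ‖ → ‖ξ‖ ≤ 2 →
      ‖iteratedFDeriv ℝ n (fun η => R ((2 : ℝ) ^ k • η)) ξ‖ ≤ 1296 :=
    fun n hn ξ h1 _ => hR.annulus_le k hn h1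
  have hc : ContinuousOn (fun ξ => R ξ * m ξ) {0}ᶜ :=
    hR.contDiffOn.continuousOn.mul hm.smooth.continuousOn
  have h0 := H₀ k 1296 R hR.contDiffOn hb
  have ha : ∀ a, Ker k (C a * 1296 * (2 : ℝ) ^ (k * (1 + d))) (pd a (ker φ k fun ξ => R ξ * m ξ)) := by
    intro a
    have h1 := H a k 1296 R hR.contDiffOn hb
    rw [pd_ker_eq hφ k hc]
    convert h1 using 3
    ring
  refine ⟨h0.mono ?_, fun x => ?_, continuous_fderiv_of_pd fun a => (ha a).cont, fun x => ?_⟩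
  · gcongr
    rw [hS]
    have : 0 ≤ ∑ a, C a * 1296 := Finset.sum_nonneg fun a _ => by have := hC a; positivity
    linarith
  · obtain ⟨L, hL, _⟩ := pd_ker hφ k hc x
    exact hL.differentiableAt
  · refine (norm_clm_le_sum _).trans ?_
    have e : (2 : ℝ) ^ (k * (1 + d)) = 2 ^ (k * d) * 2 ^ k := by
      rw [← zpow_add₀ two_ne_zero]; congr 1; ring
    calc _ ≤ ∑ a, C a * 1296 * (2 : ℝ) ^ (k * (1 + d)) * bump k x :=
          Finset.sum_le_sum fun a _ => (ha a).bound x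
      _ = (∑ a, C a * 1296) * ((2 : ℝ) ^ (k * d) * 2 ^ k * bump k x) := by
          rw [e, Finset.sum_mul]
          exact Finset.sum_congr rfl fun a _ => by ring
      _ ≤ S * ((2 : ℝ) ^ (k * d) * 2 ^ k * bump k x) := by
          have := bump_pos k x
          gcongr
          rw [hS]
          have : 0 ≤ C₀ * 1296 := by positivity
          linarith
      _ = _ := by ring

lemma exists_ker_of_contDiffOn {φ : ℝ → ℝ} (hφ : IsCutoff φ) {R : E3 → ℂ}
    (hR : ContDiffOn ℝ 4 R {0}ᶜ) (k : ℤ) : ∃ B, Ker k B (ker φ k R) := by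
  obtain ⟨C, hC, H⟩ := exists_ker_le hφ Homog.one
  have h2 := zpow_two_pos k
  have ho : IsOpen ({0}ᶜ : Set E3) := isOpen_compl_singleton
  have hRk : ContDiffOn ℝ 4 (fun η => R ((2 : ℝ) ^ k • η)) {0}ᶜ := by
    apply hR.comp (contDiff_const_smul _).contDiffOn
    intro ξ hξ
    simpa [h2.ne'] using hξ
  have hM : ∀ n : ℕ, ∃ M : ℝ, n ≤ 4 → ∀ ξ : E3, 1 / 2 ≤ ‖ξ‖ → ‖ξ‖ ≤ 2 →
      ‖iteratedFDeriv ℝ n (fun η => R ((2 : ℝ) ^ k • η)) ξ‖ ≤ M := by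
    intro n
    by_cases hn : n ≤ 4
    · have hK : IsCompact (Metric.closedBall (0 : E3) 2 ∩ {ξ | 1 / 2 ≤ ‖ξ‖}) :=
        (isCompact_closedBall 0 2).inter_right (isClosed_le continuous_const continuous_norm)
      have hsub : Metric.closedBall (0 : E3) 2 ∩ {ξ | 1 / 2 ≤ ‖ξ‖} ⊆ {0}ᶜ := by
        rintro ξ ⟨_, h⟩ rfl
        norm_num at h
      obtain ⟨M, hM⟩ := hK.exists_bound_of_continuousOn
        ((hRk.continuousOn_iteratedFDerivWithin (m := n) (by exact_mod_cast hn)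
          ho.uniqueDiffOn).mono hsub)
      refine ⟨M, fun _ ξ h1 h2 => ?_⟩
      have h3 := hM ξ ⟨by simpa using h2, h1⟩
      rwa [iteratedFDerivWithin_of_isOpen n ho (hsub ⟨by simpa using h2, h1⟩)] at h3
    · exact ⟨0, fun h => absurd h hn⟩
  choose M hM using hM
  have h := H k (∑ i ∈ Finset.range 5, |M i|) R hR (fun n hn ξ h1 h2 =>
    (hM n hn ξ h1 h2).trans ((le_abs_self _).trans
      (Finset.single_le_sum (f := fun i => |M i|) (fun i _ => abs_nonneg _)
        (Finset.mem_range.2 (by omega)))))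
  simp only [mul_one] at h
  exact ⟨_, h⟩

lemma bump_le_of_near (k : ℤ) {x y : E3} (h : (2 : ℝ) ^ k * ‖x - y‖ ≤ 1) :
    bump k x ≤ 16 * bump k y := by
  have hk := zpow_two_pos k
  have hk3 := zpow_two_pos (3 * k)
  unfold bump
  rw [mul_left_comm]
  gcongr
  rw [← one_div, div_le_iff₀ (by positivity), mul_assoc, ← one_div, div_mul_eq_mul_div, one_mul,
    mul_div_assoc', le_div_iff₀ (by positivity), one_mul]
  have h1 : ‖y‖ ≤ ‖x‖ + ‖x - y‖ := by
    have := norm_sub_le x (x - y)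
    simpa using this
  have h2 : 1 + (2 : ℝ) ^ k * ‖y‖ ≤ 2 * (1 + (2 : ℝ) ^ k * ‖x‖) := by
    have h3 : (2 : ℝ) ^ k * ‖y‖ ≤ (2 : ℝ) ^ k * ‖x‖ + (2 : ℝ) ^ k * ‖x - y‖ := by
      rw [← mul_add]; gcongr
    have : 0 ≤ (2 : ℝ) ^ k * ‖x‖ := by positivity
    linarith
  calc (1 + (2 : ℝ) ^ k * ‖y‖) ^ 4 ≤ (2 * (1 + (2 : ℝ) ^ k * ‖x‖)) ^ 4 := by gcongr
    _ = _ := by ring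

lemma integrable_cv {W h : E3 → ℂ} (hW : Integrable W) (hm : AEStronglyMeasurable h volume) {B : ℝ}
    (hB : ∀ᵐ x, ‖h x‖ ≤ B) (x : E3) : Integrable (fun y => W (x - y) * h y) :=
  (hW.comp_sub_left x).mul_bdd (c := B) hm hB

/-- A convolution with a `C¹` kernel may be differentiated under the integral. -/
lemma KerD.hasFDerivAt_cv {k : ℤ} {B : ℝ} {W h : E3 → ℂ} (hW : KerD k B W)
    (hm : AEStronglyMeasurable h volume) {D : ℝ} (hD : ∀ᵐ x, ‖h x‖ ≤ D) (x : E3) :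
    ∃ L : E3 →L[ℝ] ℂ, HasFDerivAt (cv W h) L x ∧ ∀ a, L (basisVec a) = cv (pd a W) h x := by
  have hk := zpow_two_pos k
  have hD0 : 0 ≤ D := by
    obtain ⟨y, hy⟩ := hD.exists
    exact (norm_nonneg _).trans hy
  have hB0 := hW.toKer.nonneg
  have hF'm : ∀ x, AEStronglyMeasurable (fun y => h y • fderiv ℝ W (x - y)) volume := fun x =>
    hm.smul (hW.contd.comp (continuous_const.sub continuous_id)).aestronglyMeasurable
  have hbi : Integrable (fun y => D * (B * 2 ^ k * (16 * bump k (x - y)))) := by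
    have := (integrable_bump k).comp_sub_left x
    exact ((this.const_mul 16).const_mul _).const_mul _
  have hle : ∀ᵐ y, ∀ z ∈ Metric.ball x (((2 : ℝ) ^ k)⁻¹),
      ‖h y • fderiv ℝ W (z - y)‖ ≤ D * (B * 2 ^ k * (16 * bump k (x - y))) := by
    filter_upwards [hD] with y hy z hz
    rw [norm_smul]
    gcongr
    refine (hW.dbound _).trans ?_
    gcongr
    apply bump_le_of_near
    rw [sub_sub_sub_cancel_right, ← dist_eq_norm, mul_comm, ← le_div_iff₀ hk, one_div]
    exact (Metric.mem_ball.1 hz).le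
  have hF'i : Integrable (fun y => h y • fderiv ℝ W (x - y)) :=
    hbi.mono' (hF'm x) (by
      filter_upwards [hle] with y hy
      exact hy x (Metric.mem_ball_self (by positivity)))
  have key := hasFDerivAt_integral_of_dominated_of_fderiv_le (μ := volume) (𝕜 := ℝ)
    (F := fun x y => W (x - y) * h y) (F' := fun x y => h y • fderiv ℝ W (x - y)) (x₀ := x)
    (s := Metric.ball x (((2 : ℝ) ^ k)⁻¹)) (bound := fun y => D * (B * 2 ^ k * (16 * bump k (x - y))))
    (Metric.ball_mem_nhds _ (by positivity))
    (Filter.Eventually.of_forall fun z => (integrable_cv hW.toKer.integrable hm hD z).aestronglyMeasurable)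
    (integrable_cv hW.toKer.integrable hm hD x) (hF'm x) hle hbi
    (Filter.Eventually.of_forall fun y z _ => by
      have h1 : HasFDerivAt (fun z => W (z - y)) (fderiv ℝ W (z - y)) z := by
        have := (hW.diff (z - y)).hasFDerivAt.comp z ((hasFDerivAt_id z).sub_const y)
        rw [ContinuousLinearMap.comp_id] at this
        exact this
      exact h1.mul_const (h y))
  refine ⟨_, key, fun a => ?_⟩
  rw [ContinuousLinearMap.integral_apply hF'i]
  refine integral_congr_ae (Filter.Eventually.of_forall fun y => ?_)
  simp [pd, mul_comm]

lemma KerD.pd_cv {k : ℤ} {B : ℝ} {W h : E3 → ℂ} (hW : KerD k B W)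
    (hm : AEStronglyMeasurable h volume) {D : ℝ} (hD : ∀ᵐ x, ‖h x‖ ≤ D) (a : Fin 3) :
    pd a (cv W h) = cv (pd a W) h := by
  ext x
  obtain ⟨L, hL, hL'⟩ := hW.hasFDerivAt_cv hm hD x
  rw [pd, hL.fderiv, hL' a]

/-! ### The field kernel `x / (4π|x|³)` as a Fourier multiplier -/

/-- The `c`-th component of `∇(-1/(4π|x|)) = x / (4π|x|³)`. -/
noncomputable def rk (c : Fin 3) (y : E3) : ℂ := (((4 * Real.pi)⁻¹ * (y c / ‖y‖ ^ 3) : ℝ) : ℂ)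

lemma measurable_rk (c : Fin 3) : Measurable (rk c) := by
  have h1 : Measurable (fun y : E3 => y c) :=
    (EuclideanSpace.proj c : EuclideanSpace ℝ (Fin 3) →L[ℝ] ℝ).continuous.measurable
  unfold rk
  exact Complex.measurable_ofReal.comp
    (measurable_const.mul (h1.div (measurable_norm.pow_const 3)))

lemma norm_rk_le (c : Fin 3) (y : E3) : ‖rk c y‖ ≤ (‖y‖ ^ 2)⁻¹ := by
  have hpi := Real.pi_gt_three
  rw [rk, Complex.norm_real, norm_mul, norm_div, norm_pow, norm_norm, Real.norm_of_nonneg (by positivity)]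
  by_cases h : y = 0
  · simp [h]
  have hy : 0 < ‖y‖ := norm_pos_iff.2 h
  have h1 : ‖y c‖ ≤ ‖y‖ := PiLp.norm_apply_le y c
  have h2 : (4 * Real.pi)⁻¹ ≤ 1 := inv_le_one_of_one_le₀ (by linarith)
  calc _ ≤ 1 * (‖y‖ / ‖y‖ ^ 3) := by gcongr
    _ = (‖y‖ ^ 2)⁻¹ := by field_simp

/-- The singular part of `|y|^{-2}`. -/
noncomputable def nearSq (y : E3) : ℝ := (Metric.ball (0 : E3) 1).indicator (fun y => (‖y‖ ^ 2)⁻¹) y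

lemma integrable_nearSq : Integrable nearSq := by
  unfold nearSq
  rw [integrable_indicator_iff Metric.isOpen_ball.measurableSet]
  rw [integrableOn_fun_norm_addHaar (volume : Measure E3) (f := fun r : ℝ => (r ^ 2)⁻¹), finrank_E3]
  have h : IntegrableOn (fun _ : ℝ => (1 : ℝ)) (Ioo 0 1) := by simp
  refine h.congr_fun (fun r hr => ?_) measurableSet_Ioo
  have : r ≠ 0 := hr.1.ne'
  simp [this]

lemma nearSq_nonneg (y : E3) : 0 ≤ nearSq y := indicator_nonneg (fun _ _ => by positivity) _

lemma bump_zero_eq (y : E3) : bump 0 y = ((1 + ‖y‖) ^ 4)⁻¹ := by simp [bump]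

lemma inv_sq_le (y : E3) : (‖y‖ ^ 2)⁻¹ ≤ nearSq y + 1 := by
  by_cases h : y ∈ Metric.ball (0 : E3) 1
  · rw [nearSq, indicator_of_mem h]; linarith
  · have h2 : 1 ≤ ‖y‖ := by simpa using h
    have := nearSq_nonneg y
    have : (‖y‖ ^ 2)⁻¹ ≤ 1 := inv_le_one_of_one_le₀ (one_le_pow₀ h2)
    linarith

lemma inv_sq_mul_le (y : E3) {r B : ℝ} (hr : |r| ≤ B) :
    (‖y‖ ^ 2)⁻¹ * |r| ≤ B * nearSq y + 16 * bump 0 y + r ^ 2 := by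
  have hB := (abs_nonneg r).trans hr
  have hb := bump_pos 0 y
  by_cases h : y ∈ Metric.ball (0 : E3) 1
  · rw [nearSq, indicator_of_mem h]
    have : (‖y‖ ^ 2)⁻¹ * |r| ≤ (‖y‖ ^ 2)⁻¹ * B := by gcongr
    nlinarith [sq_nonneg r]
  · have h2 : 1 ≤ ‖y‖ := by simpa using h
    have h0 := mul_nonneg hB (nearSq_nonneg y)
    have h3 : ((‖y‖ ^ 2)⁻¹) ^ 2 ≤ 16 * bump 0 y := by
      have e : ((‖y‖ ^ 2)⁻¹) ^ 2 = (‖y‖ ^ 4)⁻¹ := by rw [inv_pow]; congr 1; ring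
      rw [bump_zero_eq, ← div_eq_mul_inv, le_div_iff₀ (by positivity), e,
        inv_mul_le_iff₀ (by positivity)]
      calc (1 + ‖y‖) ^ 4 ≤ (2 * ‖y‖) ^ 4 := by gcongr; linarith
        _ = _ := by ring
    have h4 : (‖y‖ ^ 2)⁻¹ * |r| ≤ ((‖y‖ ^ 2)⁻¹) ^ 2 + |r| ^ 2 := by
      nlinarith [sq_nonneg ((‖y‖ ^ 2)⁻¹ - |r|), sq_nonneg ((‖y‖ ^ 2)⁻¹), sq_nonneg |r|]
    rw [sq_abs] at h4
    linarith

lemma gamma_three_half : Real.Gamma (3 / 2) = Real.sqrt Real.pi / 2 := by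
  have h := Real.Gamma_add_one (s := 1 / 2) (by norm_num)
  rw [Real.Gamma_one_half_eq] at h
  rw [show (3 / 2 : ℝ) = 1 / 2 + 1 by norm_num, h]
  ring

/-- `∫₀^∞ u^{1/2} e^{-u r²} du = (√π/2) r^{-3}`. -/
lemma integral_rpow_gauss {r : ℝ} (hr : 0 < r) :
    ∫ u in Ioi (0 : ℝ), u ^ (1 / 2 : ℝ) * Real.exp (-(r ^ 2 * u)) = Real.sqrt Real.pi / 2 / r ^ 3 := by
  have h := Real.integral_rpow_mul_exp_neg_mul_Ioi (a := 3 / 2) (r := r ^ 2) (by norm_num)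
    (by positivity)
  rw [show (3 / 2 - 1 : ℝ) = 1 / 2 by norm_num] at h
  rw [h, gamma_three_half, one_div, Real.inv_rpow (by positivity), ← Real.rpow_natCast r 2,
    ← Real.rpow_mul hr.le, ← Real.rpow_natCast r 3]
  norm_num
  field_simp

lemma integrableOn_rpow_gauss {r : ℝ} (hr : 0 < r) :
    IntegrableOn (fun u : ℝ => u ^ (1 / 2 : ℝ) * Real.exp (-(r ^ 2 * u))) (Ioi 0) := by
  have h := integrableOn_rpow_mul_exp_neg_mul_rpow (p := 1) (s := 1 / 2) (b := r ^ 2) (by norm_num)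
    one_pos (by positivity)
  refine h.congr_fun (fun u _ => ?_) measurableSet_Ioi
  simp

lemma integral_inv_sq_exp {r : ℝ} (hr : 0 < r) :
    IntegrableOn (fun u : ℝ => u ^ (-2 : ℝ) * Real.exp (-(r / u))) (Ioi 0) ∧
    ∫ u in Ioi (0 : ℝ), u ^ (-2 : ℝ) * Real.exp (-(r / u)) = 1 / r := by
  have h1 := integrableOn_Ioi_comp_rpow_iff (fun x : ℝ => Real.exp (-(r * x))) (p := -1)
    (by norm_num)
  have h2 := integral_comp_rpow_Ioi (fun x : ℝ => Real.exp (-(r * x))) (p := -1) (by norm_num)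
  have e : ∀ u ∈ Ioi (0 : ℝ), (|(-1 : ℝ)| * u ^ (-1 - 1 : ℝ)) • Real.exp (-(r * u ^ (-1 : ℝ))) =
      u ^ (-2 : ℝ) * Real.exp (-(r / u)) := by
    intro u hu
    rw [Real.rpow_neg_one]
    norm_num [div_eq_mul_inv]
  constructor
  · refine (h1.2 ?_).congr_fun e measurableSet_Ioi
    simpa using (exp_neg_integrableOn_Ioi 0 hr)
  · rw [← setIntegral_congr_fun measurableSet_Ioi e, h2]
    have h3 := Real.integral_rpow_mul_exp_neg_mul_Ioi (a := 1) (r := r) one_pos hr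
    simpa using h3

lemma integrable_gauss {u : ℝ} (hu : 0 < u) :
    Integrable (fun y : E3 => Real.exp (-(u * ‖y‖ ^ 2))) := by
  have h := (GaussianFourier.integrable_cexp_neg_mul_sq_norm_add (V := E3) (b := (u : ℂ))
    (by simpa using hu) 0 0).norm
  refine h.congr (Filter.Eventually.of_forall fun y => ?_)
  simp only [zero_mul, add_zero]
  rw [show (-(u : ℂ) * (‖y‖ : ℂ) ^ 2) = ((-(u * ‖y‖ ^ 2) : ℝ) : ℂ) by push_cast; ring,
    ← Complex.ofReal_exp, Complex.norm_real, Real.norm_of_nonneg (Real.exp_pos _).le]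

lemma integrable_norm_mul_gauss {u : ℝ} (hu : 0 < u) :
    Integrable (fun y : E3 => ‖y‖ * Real.exp (-(u * ‖y‖ ^ 2))) := by
  refine ((integrable_gauss (half_pos hu)).const_mul (1 + 2 / u)).mono'
    (Continuous.aestronglyMeasurable (by fun_prop)) (Filter.Eventually.of_forall fun y => ?_)
  rw [Real.norm_of_nonneg (by positivity)]
  have e : Real.exp (-(u * ‖y‖ ^ 2)) =
      Real.exp (-(u / 2 * ‖y‖ ^ 2)) * Real.exp (-(u / 2 * ‖y‖ ^ 2)) := by
    rw [← Real.exp_add]; congr 1; ring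
  rw [e, ← mul_assoc]
  gcongr
  rw [Real.exp_neg, ← div_eq_mul_inv, div_le_iff₀ (Real.exp_pos _)]
  have h1 := Real.add_one_le_exp (u / 2 * ‖y‖ ^ 2)
  calc ‖y‖ ≤ 1 + ‖y‖ ^ 2 := by nlinarith [sq_nonneg (‖y‖ - 1)]
    _ ≤ (1 + 2 / u) * (u / 2 * ‖y‖ ^ 2 + 1) := by
        have : 2 / u * (u / 2 * ‖y‖ ^ 2) = ‖y‖ ^ 2 := by field_simp
        have h3 : 0 ≤ 2 / u := by positivity
        have h4 : 0 ≤ u / 2 * ‖y‖ ^ 2 := by positivity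
        nlinarith
    _ ≤ _ := by gcongr

/-- First moments of Gaussians on the Fourier side: `y_c e^{-u|y|²}` is a multiple of a derivative of the
Gaussian, so one integrates by parts. -/
lemma integral_coord_gauss {u : ℝ} (hu : 0 < u) (c : Fin 3) (ξ : E3) :
    ∫ y : E3, Complex.exp (-(Complex.I * ((inner ℝ y ξ : ℝ) : ℂ))) *
      ((y c * Real.exp (-(u * ‖y‖ ^ 2)) : ℝ) : ℂ) =
    -(Complex.I * (ξ c : ℂ)) * (((2 * u)⁻¹ * (Real.pi / u) ^ (3 / 2 : ℝ) *
      Real.exp (-(‖ξ‖ ^ 2 / (4 * u))) : ℝ) : ℂ) := by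
  set f : E3 → ℂ := fun y => Complex.exp (-(Complex.I * ((inner ℝ y ξ : ℝ) : ℂ))) with hf
  set g : E3 → ℂ := fun y => ((Real.exp (-(u * ‖y‖ ^ 2)) : ℝ) : ℂ) with hg
  have hfn : ∀ y, ‖f y‖ = 1 := by
    intro y
    rw [hf]
    simp only
    rw [show -(Complex.I * ((inner ℝ y ξ : ℝ) : ℂ)) = ((-(inner ℝ y ξ) : ℝ) : ℂ) * Complex.I by
      push_cast; ring, Complex.norm_exp_ofReal_mul_I]
  have hfd : ∀ y, HasFDerivAt f (-(f y * Complex.I) • (Complex.ofRealCLM.comp (innerSL ℝ ξ))) y := by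
    intro y
    have h3 := (Complex.ofRealCLM.comp (innerSL ℝ ξ)).hasFDerivAt (x := y)
    have h2 : HasFDerivAt (fun x : E3 => ((inner ℝ x ξ : ℝ) : ℂ))
        (Complex.ofRealCLM.comp (innerSL ℝ ξ)) y := by
      refine h3.congr_of_eventuallyEq (Filter.Eventually.of_forall fun y => ?_)
      simp [real_inner_comm]
    refine ((h2.const_mul Complex.I).fun_neg.cexp).congr_fderiv ?_
    ext v
    simp [hf]
    ring
  have hgd : ∀ y, HasFDerivAt g ((-(2 * u * Real.exp (-(u * ‖y‖ ^ 2)) : ℝ) : ℂ) •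
      (Complex.ofRealCLM.comp (innerSL ℝ y))) y := by
    intro y
    have h1 : HasFDerivAt (fun y : E3 => ‖y‖ ^ 2) (2 • (innerSL ℝ y)) y :=
      (hasStrictFDerivAt_norm_sq y).hasFDerivAt
    have h2 := ((h1.const_mul u).fun_neg).exp
    have h3 := Complex.ofRealCLM.hasFDerivAt.comp y h2
    refine h3.congr_fderiv ?_
    ext v
    simp
    ring
  have hfe : ∀ y, fderiv ℝ f y (basisVec c) = -(Complex.I * (ξ c : ℂ)) * f y := by
    intro y
    have e : (inner ℝ ξ (basisVec c) : ℝ) = ξ c := by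
      rw [basisVec, EuclideanSpace.inner_single_right]; simp
    rw [(hfd y).fderiv, smul_apply, ContinuousLinearMap.comp_apply, innerSL_apply_apply, e]
    simp
    ring
  have hge : ∀ y, fderiv ℝ g y (basisVec c) =
      (-(2 * u : ℝ) : ℂ) * ((y c * Real.exp (-(u * ‖y‖ ^ 2)) : ℝ) : ℂ) := by
    intro y
    have e : (inner ℝ y (basisVec c) : ℝ) = y c := by
      rw [basisVec, EuclideanSpace.inner_single_right]; simp
    rw [(hgd y).fderiv, smul_apply, ContinuousLinearMap.comp_apply, innerSL_apply_apply, e]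
    simp
    ring
  have hfc : Continuous f := by fun_prop
  have hgi : Integrable g := (integrable_gauss hu).ofReal
  have hfg : Integrable (fun y => f y * g y) :=
    hgi.bdd_mul (c := 1) hfc.aestronglyMeasurable (Filter.Eventually.of_forall fun y => (hfn y).le)
  have hcg : Integrable (fun y : E3 => ((y c * Real.exp (-(u * ‖y‖ ^ 2)) : ℝ) : ℂ)) := by
    refine ((integrable_norm_mul_gauss hu).mono' (f := fun y : E3 => y c * Real.exp (-(u * ‖y‖ ^ 2)))
      ?_ (Filter.Eventually.of_forall fun y => ?_)).ofReal
    · apply Continuous.aestronglyMeasurable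
      fun_prop
    · rw [norm_mul, Real.norm_of_nonneg (Real.exp_pos _).le]
      gcongr
      exact PiLp.norm_apply_le y c
  have hfcg : Integrable (fun y => f y * ((y c * Real.exp (-(u * ‖y‖ ^ 2)) : ℝ) : ℂ)) :=
    hcg.bdd_mul (c := 1) hfc.aestronglyMeasurable (Filter.Eventually.of_forall fun y => (hfn y).le)
  have key := integral_mul_fderiv_eq_neg_fderiv_mul_of_integrable (μ := (volume : Measure E3))
    (f := f) (g := g) (v := basisVec c)
    ((hfg.const_mul (-(Complex.I * (ξ c : ℂ)))).congr (Filter.Eventually.of_forall fun y => by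
      simp only [hfe]; ring))
    ((hfcg.const_mul (-(2 * u : ℝ) : ℂ)).congr (Filter.Eventually.of_forall fun y => by
      simp only [hge]; ring)) hfg (fun x _ => (hfd x).differentiableAt)
    (fun x _ => (hgd x).differentiableAt)
  simp_rw [hfe, hge] at key
  have e1 : ∀ y, f y * ((-(2 * u : ℝ) : ℂ) * ((y c * Real.exp (-(u * ‖y‖ ^ 2)) : ℝ) : ℂ)) =
      (-(2 * u : ℝ) : ℂ) * (f y * ((y c * Real.exp (-(u * ‖y‖ ^ 2)) : ℝ) : ℂ)) := fun y => by ring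
  simp_rw [e1, mul_assoc _ (f _) (g _)] at key
  rw [integral_const_mul, integral_const_mul] at key
  have hG := GaussianFourier.integral_cexp_neg_mul_sq_norm_add (V := E3) (b := (u : ℂ))
    (by simpa using hu) (-Complex.I) ξ
  have e2 : ∀ y : E3, Complex.exp (-(u : ℂ) * (‖y‖ : ℂ) ^ 2 + -Complex.I * ((inner ℝ ξ y : ℝ) : ℂ)) =
      f y * g y := by
    intro y
    rw [hf, hg]
    simp only
    rw [Complex.ofReal_exp, ← Complex.exp_add, real_inner_comm]
    congr 1
    push_cast
    ring
  simp_rw [e2] at hG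
  have e3 : ((Real.pi : ℂ) / (u : ℂ)) ^ ((Module.finrank ℝ E3 : ℂ) / 2) *
      Complex.exp ((-Complex.I) ^ 2 * (‖ξ‖ : ℂ) ^ 2 / (4 * (u : ℂ))) =
      (((Real.pi / u) ^ (3 / 2 : ℝ) * Real.exp (-(‖ξ‖ ^ 2 / (4 * u))) : ℝ) : ℂ) := by
    rw [finrank_E3, Complex.ofReal_mul, Complex.ofReal_cpow (by positivity), Complex.ofReal_exp]
    congr 2
    · push_cast; rfl
    · push_cast; norm_num
    · push_cast; rw [neg_sq, Complex.I_sq]; ring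
  rw [e3] at hG
  rw [hG] at key
  have hu' : (u : ℂ) ≠ 0 := by exact_mod_cast hu.ne'
  have h5 : ∫ y : E3, f y * ((y c * Real.exp (-(u * ‖y‖ ^ 2)) : ℝ) : ℂ) =
      -((2 * u : ℝ) : ℂ)⁻¹ * ((-(2 * u : ℝ) : ℂ) *
        ∫ y : E3, f y * ((y c * Real.exp (-(u * ‖y‖ ^ 2)) : ℝ) : ℂ)) := by
    rw [← mul_assoc]
    have : -((2 * u : ℝ) : ℂ)⁻¹ * (-(2 * u : ℝ) : ℂ) = 1 := by
      push_cast; field_simp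
    rw [this, one_mul]
  rw [h5, key]
  push_cast
  ring


lemma rk_eq_integral (c : Fin 3) {y : E3} (hy : y ≠ 0) : rk c y =
    ∫ u in Ioi (0 : ℝ), (((2 * Real.pi * Real.sqrt Real.pi)⁻¹ * (y c *
      (u ^ (1 / 2 : ℝ) * Real.exp (-(‖y‖ ^ 2 * u)))) : ℝ) : ℂ) := by
  have hpi := Real.pi_pos
  have hs : 0 < Real.sqrt Real.pi := Real.sqrt_pos.2 hpi
  have h := integral_rpow_gauss (norm_pos_iff.2 hy)
  have hn : 0 < ‖y‖ := norm_pos_iff.2 hy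
  rw [integral_complex_ofReal, integral_const_mul, integral_const_mul, h, rk]
  congr 1
  field_simp
  ring

/-- Convolving a kernel whose symbol `μ` vanishes near the origin with `x / (4π|x|³)` multiplies
the symbol by that of `∇Δ⁻¹`. The proof writes `|x|^{-3}` as a superposition of Gaussians. -/
lemma cv_rk {k : ℤ} {B : ℝ} {μ : E3 → ℂ} (hμ : Integrable μ) {r₀ : ℝ} (hr₀ : 0 < r₀)
    (h0 : ∀ ξ, ‖ξ‖ ≤ r₀ → μ ξ = 0)
    (hW : Ker k B (invFourier μ)) (c : Fin 3) (x : E3) :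
    cv (invFourier μ) (rk c) x = invFourier (fun ξ => μ ξ * rSym c ξ) x := by
  have hpi := Real.pi_pos
  have hs : 0 < Real.sqrt Real.pi := Real.sqrt_pos.2 hpi
  set κ : ℝ := (2 * Real.pi * Real.sqrt Real.pi)⁻¹ with hκ
  have hcoord : Continuous (fun y : E3 => y c) :=
    (EuclideanSpace.proj c : EuclideanSpace ℝ (Fin 3) →L[ℝ] ℝ).continuous
  set W := invFourier μ with hWdef
  have hWc : Continuous fun y => W (x - y) := hW.cont.comp (continuous_const.sub continuous_id)
  -- the Gaussian superposition
  have e1 : cv W (rk c) x = ∫ y : E3, ∫ u in Ioi (0 : ℝ), W (x - y) *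
      ((κ * (y c * (u ^ (1 / 2 : ℝ) * Real.exp (-(‖y‖ ^ 2 * u)))) : ℝ) : ℂ) := by
    unfold cv
    apply integral_congr_ae
    have : ∀ᵐ y : E3, y ≠ 0 := by
      rw [ae_iff]; simp
    filter_upwards [this] with y hy
    rw [integral_const_mul, rk_eq_integral c hy]
  have hm1 : AEStronglyMeasurable (fun p : E3 × ℝ => W (x - p.1) *
      ((κ * (p.1 c * (p.2 ^ (1 / 2 : ℝ) * Real.exp (-(‖p.1‖ ^ 2 * p.2)))) : ℝ) : ℂ))
      ((volume : Measure E3).prod (volume.restrict (Ioi 0))) := by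
    apply AEStronglyMeasurable.mul
    · exact (hWc.comp continuous_fst).aestronglyMeasurable
    · apply Measurable.aestronglyMeasurable
      apply Complex.measurable_ofReal.comp
      apply measurable_const.mul
      apply (hcoord.comp continuous_fst).measurable.mul
      apply (measurable_snd.pow_const _).mul
      apply Real.measurable_exp.comp
      exact (((continuous_fst.norm.pow 2).mul continuous_snd).neg).measurable
  have hi1 : Integrable (Function.uncurry fun (y : E3) (u : ℝ) => W (x - y) *
      ((κ * (y c * (u ^ (1 / 2 : ℝ) * Real.exp (-(‖y‖ ^ 2 * u)))) : ℝ) : ℂ))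
      ((volume : Measure E3).prod (volume.restrict (Ioi 0))) := by
    refine (integrable_prod_iff hm1).2 ?_
    have hne : ∀ᵐ y : E3, y ≠ 0 := by rw [ae_iff]; simp
    constructor
    · filter_upwards [hne] with y hy
      have h := (integrableOn_rpow_gauss (norm_pos_iff.2 hy)).const_mul (y c)
      exact ((h.const_mul κ).ofReal (𝕜 := ℂ)).const_mul (W (x - y))
    · have hmaj : Integrable (fun y => ‖W (x - y)‖ * (nearSq y + 1)) := by
        simp_rw [mul_add, mul_one]
        refine Integrable.add ?_ (hW.integrable.comp_sub_left x).norm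
        refine integrable_nearSq.bdd_mul (c := B * 2 ^ (3 * k)) hWc.norm.aestronglyMeasurable
          (Filter.Eventually.of_forall fun y => ?_)
        rw [norm_norm]
        refine (hW.bound _).trans ?_
        have := hW.nonneg
        gcongr
        exact bump_le k _
      refine hmaj.mono' hm1.norm.integral_prod_right' ?_
      filter_upwards [hne] with y hy
      have hn : 0 < ‖y‖ := norm_pos_iff.2 hy
      rw [Real.norm_of_nonneg (integral_nonneg fun u => norm_nonneg _)]
      have e2 : ∀ u ∈ Ioi (0 : ℝ), ‖W (x - y) *
          ((κ * (y c * (u ^ (1 / 2 : ℝ) * Real.exp (-(‖y‖ ^ 2 * u)))) : ℝ) : ℂ)‖ =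
          (‖W (x - y)‖ * (κ * ‖y c‖)) * (u ^ (1 / 2 : ℝ) * Real.exp (-(‖y‖ ^ 2 * u))) := by
        intro u hu
        have hu' : (0 : ℝ) < u := hu
        rw [norm_mul, Complex.norm_real, norm_mul, norm_mul, Real.norm_of_nonneg (r := κ) (by positivity),
          Real.norm_of_nonneg (r := _ * Real.exp _) (by positivity)]
        ring
      rw [setIntegral_congr_fun measurableSet_Ioi e2, integral_const_mul, integral_rpow_gauss hn]
      have h3 : κ * ‖y c‖ * (Real.sqrt Real.pi / 2 / ‖y‖ ^ 3) ≤ (‖y‖ ^ 2)⁻¹ := by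
        have h4 : ‖y c‖ ≤ ‖y‖ := PiLp.norm_apply_le y c
        calc _ ≤ κ * ‖y‖ * (Real.sqrt Real.pi / 2 / ‖y‖ ^ 3) := by gcongr
          _ = (4 * Real.pi)⁻¹ * (‖y‖ ^ 2)⁻¹ := by rw [hκ]; field_simp; norm_num
          _ ≤ 1 * (‖y‖ ^ 2)⁻¹ := by
              gcongr
              exact inv_le_one_of_one_le₀ (by linarith [Real.pi_gt_three])
          _ = _ := one_mul _
      calc _ = ‖W (x - y)‖ * (κ * ‖y c‖ * (Real.sqrt Real.pi / 2 / ‖y‖ ^ 3)) := by ring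
        _ ≤ ‖W (x - y)‖ * (nearSq y + 1) := by
            gcongr
            exact h3.trans (inv_sq_le y)
  rw [e1, integral_integral_swap hi1]
  -- for fixed `u`, pass to the Fourier side
  have e3 : ∀ u ∈ Ioi (0 : ℝ), (∫ y : E3, W (x - y) *
      ((κ * (y c * (u ^ (1 / 2 : ℝ) * Real.exp (-(‖y‖ ^ 2 * u)))) : ℝ) : ℂ)) =
      ∫ ξ : E3, (((2 * Real.pi) ^ 3 : ℝ) : ℂ)⁻¹ *
        (Complex.exp (Complex.I * ((inner ℝ x ξ : ℝ) : ℂ)) * μ ξ * (-(Complex.I * (ξ c : ℂ)))) *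
        ((4⁻¹ * (u ^ (-2 : ℝ) * Real.exp (-(‖ξ‖ ^ 2 / 4 / u))) : ℝ) : ℂ) := by
    intro u hu
    have hu' : (0 : ℝ) < u := hu
    have hgi : Integrable (fun y : E3 => ((y c * Real.exp (-(u * ‖y‖ ^ 2)) : ℝ) : ℂ)) := by
      refine ((integrable_norm_mul_gauss hu').mono'
        (f := fun y : E3 => y c * Real.exp (-(u * ‖y‖ ^ 2))) ?_
        (Filter.Eventually.of_forall fun y => ?_)).ofReal
      · exact Continuous.aestronglyMeasurable (by fun_prop)
      · rw [norm_mul, Real.norm_of_nonneg (Real.exp_pos _).le]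
        gcongr
        exact PiLp.norm_apply_le y c
    have hi2 : Integrable (Function.uncurry fun (y ξ : E3) =>
        Complex.exp (Complex.I * ((inner ℝ (x - y) ξ : ℝ) : ℂ)) *
          (((y c * Real.exp (-(u * ‖y‖ ^ 2)) : ℝ) : ℂ) * μ ξ)) (volume.prod volume) := by
      refine (hgi.mul_prod hμ).bdd_mul (c := 1) (Continuous.aestronglyMeasurable ?_)
        (Filter.Eventually.of_forall fun p => ?_)
      · fun_prop
      · rw [mul_comm, Complex.norm_exp_ofReal_mul_I]
    calc _ = ∫ y : E3, ((κ * u ^ (1 / 2 : ℝ) : ℝ) : ℂ) * (((2 * Real.pi) ^ 3 : ℝ) : ℂ)⁻¹ *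
          ∫ ξ : E3, Complex.exp (Complex.I * ((inner ℝ (x - y) ξ : ℝ) : ℂ)) *
          (((y c * Real.exp (-(u * ‖y‖ ^ 2)) : ℝ) : ℂ) * μ ξ) := by
          congr 1
          ext y
          rw [hWdef, invFourier]
          have : ∀ ξ : E3, Complex.exp (Complex.I * ((inner ℝ (x - y) ξ : ℝ) : ℂ)) *
            (((y c * Real.exp (-(u * ‖y‖ ^ 2)) : ℝ) : ℂ) * μ ξ) =
            ((y c * Real.exp (-(u * ‖y‖ ^ 2)) : ℝ) : ℂ) *
              (Complex.exp (Complex.I * ((inner ℝ (x - y) ξ : ℝ) : ℂ)) * μ ξ) := fun ξ => by ring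
          simp_rw [this]
          rw [integral_const_mul, mul_comm (‖y‖ ^ 2) u]
          push_cast
          ring
      _ = ((κ * u ^ (1 / 2 : ℝ) : ℝ) : ℂ) * (((2 * Real.pi) ^ 3 : ℝ) : ℂ)⁻¹ * ∫ ξ : E3, ∫ y : E3,
          Complex.exp (Complex.I * ((inner ℝ (x - y) ξ : ℝ) : ℂ)) *
          (((y c * Real.exp (-(u * ‖y‖ ^ 2)) : ℝ) : ℂ) * μ ξ) := by
          rw [integral_const_mul, integral_integral_swap hi2]
      _ = _ := by
          rw [← integral_const_mul]
          congr 1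
          ext ξ
          have e4 : ∀ y : E3, Complex.exp (Complex.I * ((inner ℝ (x - y) ξ : ℝ) : ℂ)) *
            (((y c * Real.exp (-(u * ‖y‖ ^ 2)) : ℝ) : ℂ) * μ ξ) =
            (Complex.exp (Complex.I * ((inner ℝ x ξ : ℝ) : ℂ)) * μ ξ) *
            (Complex.exp (-(Complex.I * ((inner ℝ y ξ : ℝ) : ℂ))) *
              ((y c * Real.exp (-(u * ‖y‖ ^ 2)) : ℝ) : ℂ)) := by
            intro y
            have : Complex.exp (Complex.I * ((inner ℝ (x - y) ξ : ℝ) : ℂ)) =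
              Complex.exp (Complex.I * ((inner ℝ x ξ : ℝ) : ℂ)) *
              Complex.exp (-(Complex.I * ((inner ℝ y ξ : ℝ) : ℂ))) := by
              rw [← Complex.exp_add, inner_sub_left]
              congr 1
              push_cast
              ring
            rw [this]
            ring
          simp_rw [e4]
          rw [integral_const_mul, integral_coord_gauss hu']
          have e5 : κ * u ^ (1 / 2 : ℝ) * ((2 * u)⁻¹ * (Real.pi / u) ^ (3 / 2 : ℝ)) =
              4⁻¹ * u ^ (-2 : ℝ) := by
            rw [Real.div_rpow hpi.le hu'.le, hκ]
            have p1 : Real.pi ^ (3 / 2 : ℝ) = Real.pi * Real.sqrt Real.pi := by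
              rw [show (3 / 2 : ℝ) = 1 + 1 / 2 by norm_num, Real.rpow_add hpi, Real.rpow_one,
                Real.sqrt_eq_rpow]
            have p2 : u ^ (3 / 2 : ℝ) = u * u ^ (1 / 2 : ℝ) := by
              rw [show (3 / 2 : ℝ) = 1 + 1 / 2 by norm_num, Real.rpow_add hu', Real.rpow_one]
            have p3 : u ^ (-2 : ℝ) = (u ^ 2)⁻¹ := by
              rw [Real.rpow_neg hu'.le]; norm_cast
            have p4 : 0 < u ^ (1 / 2 : ℝ) := Real.rpow_pos_of_pos hu' _
            rw [p1, p2, p3]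
            field_simp
            norm_num
          rw [show ‖ξ‖ ^ 2 / 4 / u = ‖ξ‖ ^ 2 / (4 * u) by rw [div_div], ← mul_assoc 4⁻¹, ← e5]
          push_cast
          ring
  rw [setIntegral_congr_fun measurableSet_Ioi e3]
  -- integrate out `u`
  have hm2 : AEStronglyMeasurable (Function.uncurry fun (u : ℝ) (ξ : E3) =>
      (((2 * Real.pi) ^ 3 : ℝ) : ℂ)⁻¹ *
        (Complex.exp (Complex.I * ((inner ℝ x ξ : ℝ) : ℂ)) * μ ξ * (-(Complex.I * (ξ c : ℂ)))) *
        ((4⁻¹ * (u ^ (-2 : ℝ) * Real.exp (-(‖ξ‖ ^ 2 / 4 / u))) : ℝ) : ℂ))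
      ((volume.restrict (Ioi 0)).prod volume) := by
    apply AEStronglyMeasurable.mul
    · have h1 : AEStronglyMeasurable (fun ξ : E3 => (((2 * Real.pi) ^ 3 : ℝ) : ℂ)⁻¹ *
        (Complex.exp (Complex.I * ((inner ℝ x ξ : ℝ) : ℂ)) * μ ξ * (-(Complex.I * (ξ c : ℂ)))))
        volume := by
        refine AEStronglyMeasurable.const_mul (AEStronglyMeasurable.mul
          (AEStronglyMeasurable.mul ?_ hμ.aestronglyMeasurable) ?_) _
        · exact Continuous.aestronglyMeasurable (by fun_prop)
        · exact Continuous.aestronglyMeasurable (by fun_prop)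
      exact h1.comp_snd
    · apply Measurable.aestronglyMeasurable
      apply Complex.measurable_ofReal.comp
      apply measurable_const.mul
      apply (measurable_fst.pow_const _).mul
      apply Real.measurable_exp.comp
      exact (((measurable_snd.norm.pow_const 2).div_const 4).div measurable_fst).neg
  have hnn : ∀ ξ : E3, ∀ u ∈ Ioi (0 : ℝ), ‖(((2 * Real.pi) ^ 3 : ℝ) : ℂ)⁻¹ *
        (Complex.exp (Complex.I * ((inner ℝ x ξ : ℝ) : ℂ)) * μ ξ * (-(Complex.I * (ξ c : ℂ)))) *
        ((4⁻¹ * (u ^ (-2 : ℝ) * Real.exp (-(‖ξ‖ ^ 2 / 4 / u))) : ℝ) : ℂ)‖ =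
      (((2 * Real.pi) ^ 3)⁻¹ * (‖μ ξ‖ * ‖ξ c‖) * 4⁻¹) *
        (u ^ (-2 : ℝ) * Real.exp (-(‖ξ‖ ^ 2 / 4 / u))) := by
    intro ξ u hu
    have hu' : (0 : ℝ) < u := hu
    rw [norm_mul, norm_mul, norm_mul, norm_mul, norm_neg, norm_mul, norm_inv, Complex.norm_real,
      Complex.norm_real, Complex.norm_real, Complex.norm_I, mul_comm Complex.I ((inner ℝ x ξ : ℝ) : ℂ),
      Complex.norm_exp_ofReal_mul_I, Real.norm_of_nonneg (r := (2 * Real.pi) ^ 3) (by positivity),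
      Real.norm_of_nonneg (r := 4⁻¹ * _) (by positivity)]
    ring
  -- since `μ` vanishes near the origin, the factor `|ξ|⁻¹` that the `u`-integral leaves is bounded
  have hi3 : Integrable (Function.uncurry fun (u : ℝ) (ξ : E3) =>
      (((2 * Real.pi) ^ 3 : ℝ) : ℂ)⁻¹ *
        (Complex.exp (Complex.I * ((inner ℝ x ξ : ℝ) : ℂ)) * μ ξ * (-(Complex.I * (ξ c : ℂ)))) *
        ((4⁻¹ * (u ^ (-2 : ℝ) * Real.exp (-(‖ξ‖ ^ 2 / 4 / u))) : ℝ) : ℂ))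
      ((volume.restrict (Ioi 0)).prod volume) := by
    rw [integrable_prod_iff' hm2]
    constructor
    · refine Filter.Eventually.of_forall fun ξ => ?_
      by_cases hξ : ξ = 0
      · subst hξ
        simp [Function.uncurry]
      · have hξ' : 0 < ‖ξ‖ := norm_pos_iff.2 hξ
        simp only [Function.uncurry_apply_pair]
        exact Integrable.const_mul (((integral_inv_sq_exp (r := ‖ξ‖ ^ 2 / 4) (by positivity)).1.const_mul
          4⁻¹).ofReal (𝕜 := ℂ)) _
    · refine (hμ.norm.const_mul (((2 * Real.pi) ^ 3)⁻¹ * r₀⁻¹)).mono'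
        hm2.norm.prod_swap.integral_prod_right' (Filter.Eventually.of_forall fun ξ => ?_)
      rw [Real.norm_of_nonneg (integral_nonneg fun u => norm_nonneg _)]
      simp only [Function.uncurry_apply_pair]
      rw [setIntegral_congr_fun measurableSet_Ioi (hnn ξ), integral_const_mul]
      by_cases hξ : ‖ξ‖ ≤ r₀
      · rw [h0 ξ hξ]; simp
      · push Not at hξ
        have hξ' : 0 < ‖ξ‖ := hr₀.trans hξ
        rw [(integral_inv_sq_exp (r := ‖ξ‖ ^ 2 / 4) (by positivity)).2]
        have h4 : ‖ξ c‖ ≤ ‖ξ‖ := PiLp.norm_apply_le ξ c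
        calc _ ≤ ((2 * Real.pi) ^ 3)⁻¹ * (‖μ ξ‖ * ‖ξ‖) * 4⁻¹ * (1 / (‖ξ‖ ^ 2 / 4)) := by gcongr
          _ = ((2 * Real.pi) ^ 3)⁻¹ * ‖ξ‖⁻¹ * ‖μ ξ‖ := by field_simp
          _ ≤ _ := by gcongr
  rw [integral_integral_swap hi3, invFourier, ← integral_const_mul]
  congr 1
  ext ξ
  rw [integral_const_mul, integral_complex_ofReal, integral_const_mul]
  by_cases hξ : ξ = 0
  · rw [h0 ξ (by rw [hξ, norm_zero]; exact hr₀.le)]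
    simp
  · have hξ' : 0 < ‖ξ‖ := norm_pos_iff.2 hξ
    rw [(integral_inv_sq_exp (r := ‖ξ‖ ^ 2 / 4) (by positivity)).2, rSym]
    rw [show 4⁻¹ * (1 / (‖ξ‖ ^ 2 / 4)) = (‖ξ‖ ^ 2)⁻¹ by field_simp]
    push_cast
    ring

/-! ### The electric field of a density -/

/-- The properties of the density at a fixed time on which the estimates of the field depend. -/
structure Dens (h : E3 → ℝ) : Prop where
  cont : Continuous h
  bdd : ∃ B : ℝ, ∀ x, |h x| ≤ B
  L2 : MemLp h 2 volume

lemma Dens.exists_majorant {h : E3 → ℝ} (hd : Dens h) : ∃ D : ℝ, ∀ x,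
    Integrable (fun y => (‖x - y‖ ^ 2)⁻¹ * |h y|) ∧ ∫ y, (‖x - y‖ ^ 2)⁻¹ * |h y| ≤ D := by
  obtain ⟨B, hB⟩ := hd.bdd
  have h2 : Integrable (fun y => h y ^ 2) := hd.L2.integrable_sq
  refine ⟨(∫ y, (B * nearSq y + 16 * bump 0 y)) + ∫ y, h y ^ 2, fun x => ?_⟩
  have hi0 : Integrable (fun y => B * nearSq y + 16 * bump 0 y) :=
    (integrable_nearSq.const_mul B).add ((integrable_bump 0).const_mul 16)
  have hi := hi0.comp_sub_left x
  have hi' := hi.add h2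
  have hle : ∀ y, (‖x - y‖ ^ 2)⁻¹ * |h y| ≤
      (B * nearSq (x - y) + 16 * bump 0 (x - y)) + h y ^ 2 :=
    fun y => inv_sq_mul_le (x - y) (hB y)
  have hint : Integrable (fun y => (‖x - y‖ ^ 2)⁻¹ * |h y|) := by
    refine hi'.mono' ?_ (Filter.Eventually.of_forall fun y => ?_)
    · refine Measurable.aestronglyMeasurable ?_
      exact ((measurable_const.sub measurable_id).norm.pow_const 2).inv.mul hd.cont.abs.measurable
    · rw [Real.norm_of_nonneg (by positivity)]
      exact hle y
  refine ⟨hint, (integral_mono hint hi' hle).trans (le_of_eq ?_)⟩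
  simp only [Pi.add_apply]
  rw [integral_add hi h2, integral_sub_left_eq_self (fun y => B * nearSq y + 16 * bump 0 y)]

lemma Dens.integrable_rk {h : E3 → ℝ} (hd : Dens h) (c : Fin 3) (x : E3) :
    Integrable (fun y => rk c (x - y) * (h y : ℂ)) := by
  obtain ⟨D, hD⟩ := hd.exists_majorant
  refine (hD x).1.mono' ?_ (Filter.Eventually.of_forall fun y => ?_)
  · exact (((measurable_rk c).comp (measurable_const.sub measurable_id)).mul
      (Complex.measurable_ofReal.comp hd.cont.measurable)).aestronglyMeasurable
  · rw [norm_mul, Complex.norm_real, Real.norm_eq_abs]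
    gcongr
    exact norm_rk_le c _

lemma Dens.gradInvLap_eq {h : E3 → ℝ} (hd : Dens h) (c : Fin 3) (x : E3) :
    (gradInvLap h x c : ℂ) = cv (rk c) (fun y => (h y : ℂ)) x := by
  obtain ⟨D, hD⟩ := hd.exists_majorant
  have hi : Integrable (fun y : E3 => (h y / ‖x - y‖ ^ 3) • (x - y)) := by
    refine (hD x).1.mono' ?_ (Filter.Eventually.of_forall fun y => ?_)
    · refine Measurable.aestronglyMeasurable ?_
      exact (hd.cont.measurable.div ((measurable_const.sub measurable_id).norm.pow_const 3)).smul
        (measurable_const.sub measurable_id)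
    · rw [norm_smul, norm_div, norm_pow, norm_norm, Real.norm_eq_abs]
      by_cases hxy : ‖x - y‖ = 0
      · simp [hxy]
      · have : 0 < ‖x - y‖ := lt_of_le_of_ne (norm_nonneg _) (Ne.symm hxy)
        apply le_of_eq
        field_simp
  have e := (EuclideanSpace.proj c : EuclideanSpace ℝ (Fin 3) →L[ℝ] ℝ).integral_comp_comm hi
  have e2 : gradInvLap h x c = (4 * Real.pi)⁻¹ * ∫ y : E3, (h y / ‖x - y‖ ^ 3) * (x - y) c := by
    rw [gradInvLap, PiLp.smul_apply, smul_eq_mul]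
    congr 1
    exact e.symm
  rw [e2, ← integral_const_mul, ← integral_complex_ofReal, cv]
  congr 1
  ext y
  rw [rk]
  push_cast
  ring

lemma Dens.exists_cv_rk_le {h : E3 → ℝ} (hd : Dens h) (c : Fin 3) :
    ∃ D : ℝ, ∀ x, ‖cv (rk c) (fun y => (h y : ℂ)) x‖ ≤ D := by
  obtain ⟨D, hD⟩ := hd.exists_majorant
  refine ⟨D, fun x => (norm_integral_le_of_norm_le (hD x).1 ?_).trans (hD x).2⟩
  refine Filter.Eventually.of_forall fun y => ?_
  rw [norm_mul, Complex.norm_real, Real.norm_eq_abs]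
  gcongr
  exact norm_rk_le c _

/-- The field is continuous: the kernel is split into a part that is continuous and square
integrable and a part that is integrable. -/
lemma Dens.continuous_cv_rk {h : E3 → ℝ} (hd : Dens h) (c : Fin 3) :
    Continuous (cv (rk c) (fun y => (h y : ℂ))) := by
  obtain ⟨B, hB⟩ := hd.bdd
  have hpi := Real.pi_gt_three
  have h2 : Integrable (fun y => h y ^ 2) := hd.L2.integrable_sq
  have hcoord : Continuous (fun y : E3 => y c) :=
    (EuclideanSpace.proj c : EuclideanSpace ℝ (Fin 3) →L[ℝ] ℝ).continuous
  -- `F` is the kernel with the singularity at the origin removed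
  set F : E3 → ℂ := fun z => (((4 * Real.pi)⁻¹ * (z c / max ‖z‖ 1 ^ 3) : ℝ) : ℂ) with hF
  have hFc : Continuous F := by
    refine Complex.continuous_ofReal.comp (continuous_const.mul (hcoord.div ?_ fun z => ?_))
    · fun_prop
    · have : 0 < max ‖z‖ 1 := lt_max_of_lt_right one_pos
      positivity
  have hFb : ∀ z, ‖F z‖ ≤ 4 * ((1 + ‖z‖) ^ 2)⁻¹ := by
    intro z
    have h1 : 0 < max ‖z‖ 1 := lt_max_of_lt_right one_pos
    have h3 : ‖z c‖ ≤ max ‖z‖ 1 := (PiLp.norm_apply_le z c).trans (le_max_left _ _)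
    rw [hF]
    simp only
    rw [Complex.norm_real, norm_mul, norm_div, norm_pow, Real.norm_of_nonneg (r := (4 * Real.pi)⁻¹)
      (by positivity), Real.norm_of_nonneg h1.le]
    have h4 : (4 * Real.pi)⁻¹ ≤ 1 := inv_le_one_of_one_le₀ (by linarith)
    have h5 : 1 + ‖z‖ ≤ 2 * max ‖z‖ 1 := by linarith [le_max_left ‖z‖ 1, le_max_right ‖z‖ 1]
    calc _ ≤ 1 * (max ‖z‖ 1 / max ‖z‖ 1 ^ 3) := by gcongr
      _ = (max ‖z‖ 1 ^ 2)⁻¹ := by field_simp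
      _ = 4 * ((2 * max ‖z‖ 1) ^ 2)⁻¹ := by field_simp; norm_num
      _ ≤ _ := by gcongr
  have hn : ∀ z, ‖rk c z - F z‖ ≤ 5 * nearSq z := by
    intro z
    by_cases hz : z ∈ Metric.ball (0 : E3) 1
    · rw [nearSq, indicator_of_mem hz]
      have hz1 : ‖z‖ < 1 := by simpa using hz
      have h6 : ‖F z‖ ≤ 4 * (‖z‖ ^ 2)⁻¹ := by
        rcases eq_or_ne z 0 with rfl | h0
        · simp [hF]
        · refine (hFb z).trans ?_
          have := norm_pos_iff.2 h0
          gcongr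
          linarith
      have h7 := norm_rk_le c z
      have := norm_sub_le (rk c z) (F z)
      linarith
    · have hz1 : 1 ≤ ‖z‖ := by simpa using hz
      rw [nearSq, indicator_of_notMem hz, hF, rk]
      simp [max_eq_left hz1]
  have hmF : Measurable F := hFc.measurable
  have hiN : ∀ x, Integrable (fun y => (rk c (x - y) - F (x - y)) * (h y : ℂ)) := by
    intro x
    refine ((integrable_nearSq.const_mul (5 * B)).comp_sub_left x).mono' ?_
      (Filter.Eventually.of_forall fun y => ?_)
    · exact ((((measurable_rk c).sub hmF).comp (measurable_const.sub measurable_id)).mul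
        (Complex.measurable_ofReal.comp hd.cont.measurable)).aestronglyMeasurable
    · rw [norm_mul, Complex.norm_real, Real.norm_eq_abs]
      have := hn (x - y)
      have h0 := nearSq_nonneg (x - y)
      calc _ ≤ 5 * nearSq (x - y) * B := by gcongr; exact hB y
        _ = _ := by ring
  have e : cv (rk c) (fun y => (h y : ℂ)) = fun x =>
      (∫ y, (rk c y - F y) * (h (x - y) : ℂ)) + ∫ y, F (x - y) * (h y : ℂ) := by
    ext x
    have e1 := integral_sub_left_eq_self (μ := (volume : Measure E3))
      (fun y => (rk c y - F y) * (h (x - y) : ℂ)) x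
    simp only [sub_sub_cancel] at e1
    have hiF : Integrable (fun y => F (x - y) * (h y : ℂ)) := by
      refine ((hd.integrable_rk c x).sub (hiN x)).congr (Filter.Eventually.of_forall fun y => ?_)
      simp only [Pi.sub_apply]
      ring
    rw [← e1, ← integral_add (hiN x) hiF, cv]
    congr 1
    ext y
    ring
  rw [e]
  refine Continuous.add ?_ ?_
  · refine continuous_of_dominated (bound := fun y => 5 * nearSq y * B) (fun x => ?_) (fun x => ?_) ?_ ?_
    · exact (((measurable_rk c).sub hmF).mul (Complex.measurable_ofReal.comp
        (hd.cont.measurable.comp (measurable_const.sub measurable_id)))).aestronglyMeasurable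
    · refine Filter.Eventually.of_forall fun y => ?_
      rw [norm_mul, Complex.norm_real, Real.norm_eq_abs]
      have h0 := nearSq_nonneg y
      gcongr
      · exact hn y
      · exact hB _
    · exact (integrable_nearSq.const_mul 5).mul_const B
    · refine Filter.Eventually.of_forall fun y => ?_
      exact continuous_const.mul (Complex.continuous_ofReal.comp
        (hd.cont.comp (continuous_id.sub continuous_const)))
  · rw [continuous_iff_continuousAt]
    intro x₀
    refine continuousAt_of_dominated (bound := fun y => 8 * (16 * bump 0 (x₀ - y)) + 8 * h y ^ 2)
      (Filter.Eventually.of_forall fun x => ?_) ?_ ?_ ?_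
    · exact ((hmF.comp (measurable_const.sub measurable_id)).mul
        (Complex.measurable_ofReal.comp hd.cont.measurable)).aestronglyMeasurable
    · filter_upwards [Metric.ball_mem_nhds x₀ one_pos] with x hx
      refine Filter.Eventually.of_forall fun y => ?_
      rw [norm_mul, Complex.norm_real (h y), Real.norm_eq_abs (h y)]
      have h8 : bump 0 (x - y) ≤ 16 * bump 0 (x₀ - y) := by
        apply bump_le_of_near
        rw [zpow_zero, one_mul, sub_sub_sub_cancel_right, ← dist_eq_norm]
        exact (Metric.mem_ball.1 hx).le
      have h9 : ((1 + ‖x - y‖) ^ 2)⁻¹ ^ 2 = bump 0 (x - y) := by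
        rw [bump_zero_eq, inv_pow, ← pow_mul]
      have h10 : ‖F (x - y)‖ * |h y| ≤ 4 * ((1 + ‖x - y‖) ^ 2)⁻¹ * |h y| := by
        gcongr
        exact hFb _
      have h11 := sq_abs (h y)
      nlinarith [sq_nonneg (((1 + ‖x - y‖) ^ 2)⁻¹ - |h y|)]
    · exact ((((integrable_bump 0).comp_sub_left x₀).const_mul 16).const_mul 8).add (h2.const_mul 8)
    · refine Filter.Eventually.of_forall fun y => ?_
      exact ((hFc.comp (continuous_id.sub continuous_const)).mul continuous_const).continuousAt

/-- A dyadic piece of the field in terms of the density. -/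
lemma Dens.dyadicOp_field {φ : ℝ → ℝ} (hφ : IsCutoff φ) {h : E3 → ℝ} (hd : Dens h) {k : ℤ} {B : ℝ}
    {m : E3 → ℂ} (hm : ContinuousOn m {0}ᶜ) (hW : Ker k B (ker φ k m)) (c : Fin 3) :
    cv (ker φ k m) (cv (rk c) (fun y => (h y : ℂ))) =
      cv (ker φ k (fun ξ => m ξ * rSym c ξ)) (fun y => (h y : ℂ)) := by
  obtain ⟨D, hD⟩ := hd.exists_majorant
  have h2 := zpow_two_pos k
  have e : cv (ker φ k m) (rk c) = ker φ k (fun ξ => m ξ * rSym c ξ) := by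
    ext x
    have := cv_rk (integrable_phiK_mul hφ k hm) (r₀ := 5 / 8 * (2 : ℝ) ^ k) (by positivity)
      (fun ξ hξ => ?_) hW c x
    · rw [ker, this, ker]
      congr 1
      ext ξ
      ring
    · rw [phiK_eq, phiK_zero_of_small hφ, Complex.ofReal_zero, zero_mul]
      rw [norm_smul, norm_inv, Real.norm_of_nonneg h2.le, inv_mul_le_iff₀ h2]
      linarith
  rw [← e]
  ext x
  apply cv_assoc
  have hmeas : AEStronglyMeasurable (fun p : E3 × E3 => ker φ k m (x - p.1) *
      (rk c (p.1 - p.2) * (h p.2 : ℂ))) (volume.prod volume) := by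
    refine Measurable.aestronglyMeasurable ?_
    exact (hW.cont.measurable.comp (measurable_const.sub measurable_fst)).mul
      (((measurable_rk c).comp (measurable_fst.sub measurable_snd)).mul
        (Complex.measurable_ofReal.comp (hd.cont.measurable.comp measurable_snd)))
  refine (integrable_prod_iff hmeas).2 ⟨Filter.Eventually.of_forall fun y => ?_, ?_⟩
  · exact (hd.integrable_rk c y).const_mul (ker φ k m (x - y))
  · refine ((hW.integrable.comp_sub_left x).norm.mul_const D).mono'
      hmeas.norm.integral_prod_right' (Filter.Eventually.of_forall fun y => ?_)
    rw [Real.norm_of_nonneg (integral_nonneg fun _ => norm_nonneg _)]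
    simp_rw [norm_mul (ker φ k m (x - y))]
    rw [integral_const_mul]
    gcongr
    refine (integral_mono (hd.integrable_rk c y).norm (hD y).1 fun z => ?_).trans (hD y).2
    simp only
    rw [norm_mul, Complex.norm_real, Real.norm_eq_abs]
    gcongr
    exact norm_rk_le c _

/-- The kernel of the low frequency cutoff `φ(|ξ|)`. -/
noncomputable def lowKer (φ : ℝ → ℝ) : E3 → ℂ := invFourier (fun ξ => (φ ‖ξ‖ : ℂ))

lemma contDiff_low {φ : ℝ → ℝ} (hφ : IsCutoff φ) : ContDiff ℝ ∞ (fun ξ : E3 => (φ ‖ξ‖ : ℂ)) := by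
  have h := Complex.ofRealCLM.contDiff.comp (contDiff_radial hφ one_pos)
  convert h using 2 with ξ
  simp

lemma exists_ker_of_smooth {μ : E3 → ℂ} (hμ : ContDiff ℝ ∞ μ) (h0 : ∀ ξ, 2 < ‖ξ‖ → μ ξ = 0) :
    ∃ B, Ker 0 B (invFourier μ) := by
  obtain ⟨C, hC, H⟩ := exists_norm_invFourier_le
  have hcs : HasCompactSupport μ := by
    apply HasCompactSupport.of_support_subset_isCompact (isCompact_closedBall (0 : E3) 2)
    intro ξ hξ
    by_contra h
    exact hξ (h0 ξ (by simpa using h))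
  have hM : ∀ n : ℕ, ∃ M : ℝ, ∀ ξ, ‖iteratedFDeriv ℝ n μ ξ‖ ≤ M := by
    intro n
    exact (hcs.iteratedFDeriv (𝕜 := ℝ) n).exists_bound_of_continuous
      (hμ.continuous_iteratedFDeriv (by exact_mod_cast le_top))
  choose M hM using hM
  exact ⟨_, H (∑ i ∈ Finset.range 5, |M i|) μ (hμ.of_le (by norm_cast)) h0 fun n hn ξ =>
    (hM n ξ).trans ((le_abs_self _).trans (Finset.single_le_sum (f := fun i => |M i|)
      (fun i _ => abs_nonneg _) (Finset.mem_range.2 (by omega))))⟩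

lemma low_eq_zero {φ : ℝ → ℝ} (hφ : IsCutoff φ) (ξ : E3) (h : 2 < ‖ξ‖) : (φ ‖ξ‖ : ℂ) = 0 := by
  rw [hφ.eq_zero (by linarith), Complex.ofReal_zero]

lemma integrable_low {φ : ℝ → ℝ} (hφ : IsCutoff φ) : Integrable (fun ξ : E3 => (φ ‖ξ‖ : ℂ)) := by
  refine (contDiff_low hφ).continuous.integrable_of_hasCompactSupport ?_
  apply HasCompactSupport.of_support_subset_isCompact (isCompact_closedBall (0 : E3) 2)
  intro ξ hξ
  by_contra h
  exact hξ (low_eq_zero hφ ξ (by simpa using h))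

lemma exists_kerD_low {φ : ℝ → ℝ} (hφ : IsCutoff φ) : ∃ B, KerD 0 B (lowKer φ) := by
  obtain ⟨B, hB⟩ := exists_ker_of_smooth (contDiff_low hφ) (low_eq_zero hφ)
  have hi := integrable_low hφ
  have hi' : Integrable (fun ξ : E3 => ‖ξ‖ * ‖(φ ‖ξ‖ : ℂ)‖) := by
    refine (hi.norm.const_mul 2).mono' ?_ (Filter.Eventually.of_forall fun ξ => ?_)
    · exact (continuous_norm.mul (contDiff_low hφ).continuous.norm).aestronglyMeasurable
    · rw [Real.norm_of_nonneg (by positivity)]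
      by_cases h : 2 < ‖ξ‖
      · rw [low_eq_zero hφ ξ h]; simp
      · gcongr
        exact not_lt.1 h
  have hpd : ∀ a, pd a (lowKer φ) = invFourier (fun ξ => dSym a ξ * (φ ‖ξ‖ : ℂ)) := by
    intro a
    ext x
    obtain ⟨L, hL, hL'⟩ := hasFDerivAt_invFourier hi hi' x
    rw [pd, lowKer, hL.fderiv, hL']
  have hpB : ∀ a, ∃ B, Ker 0 B (pd a (lowKer φ)) := by
    intro a
    rw [hpd a]
    refine exists_ker_of_smooth ?_ fun ξ h => by rw [low_eq_zero hφ ξ h, mul_zero]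
    exact (contDiff_const.mul (contDiff_coord a)).mul (contDiff_low hφ)
  choose Ba hBa using hpB
  have hnn : ∀ a, 0 ≤ Ba a := fun a => (hBa a).nonneg
  have hs : 0 ≤ ∑ a, Ba a := Finset.sum_nonneg fun a _ => hnn a
  refine ⟨B + ∑ a, Ba a, ⟨hB.mono (by linarith), fun x => ?_,
    continuous_fderiv_of_pd fun a => (hBa a).cont, fun x => ?_⟩⟩
  · obtain ⟨L, hL, hL'⟩ := hasFDerivAt_invFourier hi hi' x
    exact hL.differentiableAt
  · refine (norm_clm_le_sum _).trans ?_
    have hb := bump_pos 0 x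
    have := hB.nonneg
    calc _ ≤ ∑ a, Ba a * bump 0 x := Finset.sum_le_sum fun a _ => (hBa a).bound x
      _ = (∑ a, Ba a) * bump 0 x := by rw [Finset.sum_mul]
      _ ≤ _ := by rw [zpow_zero, mul_one]; gcongr; linarith

lemma integral_lowKer {φ : ℝ → ℝ} (hφ : IsCutoff φ) : ∫ z, lowKer φ z = 1 := by
  obtain ⟨B, hB⟩ := exists_kerD_low hφ
  have h := fourier_inversion_E3 (contDiff_low hφ).continuous (integrable_low hφ)
    hB.toKer.integrable 0
  simp only [inner_zero_right, Complex.ofReal_zero, mul_zero, neg_zero, Complex.exp_zero, one_mul,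
    norm_zero] at h
  rw [lowKer, h, hφ.eq_one le_rfl (by norm_num), Complex.ofReal_one]

/-- Telescoping the dyadic decomposition. -/
lemma low_rescale_eq {φ : ℝ → ℝ} (hφ : IsCutoff φ) (n : ℕ) (x : E3) :
    (((2 : ℝ) ^ (3 * (n : ℤ)) : ℝ) : ℂ) * lowKer φ ((2 : ℝ) ^ (n : ℤ) • x) =
      lowKer φ x + ∑ i ∈ Finset.range n, ker φ (i + 1 : ℕ) (fun _ => 1) x := by
  rw [lowKer, ← invFourier_comp_smul]
  have e : ∀ (n : ℕ) (ξ : E3), (φ ‖((2 : ℝ) ^ (n : ℤ))⁻¹ • ξ‖ : ℂ) = (φ ‖ξ‖ : ℂ) +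
      ∑ i ∈ Finset.range n, (phiK φ (i + 1 : ℕ) ξ : ℂ) * 1 := by
    intro n
    induction n with
    | zero => intro ξ; simp
    | succ n ih =>
      intro ξ
      rw [Finset.sum_range_succ, ← add_assoc, ← ih ξ, phiK, mul_one]
      have h2 : ∀ m : ℤ, ‖((2 : ℝ) ^ m)⁻¹ • ξ‖ = ‖ξ‖ / 2 ^ m := fun m => by
        rw [norm_smul, norm_inv, Real.norm_of_nonneg (zpow_two_pos m).le, div_eq_inv_mul]
      rw [h2, h2, show (((n + 1 : ℕ) : ℤ) - 1) = (n : ℤ) by push_cast; ring]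
      push_cast
      ring
  simp_rw [e n]
  unfold invFourier ker
  simp_rw [mul_add, Finset.mul_sum]
  have hex : ∀ {μ : E3 → ℂ}, Integrable μ → Integrable (fun ξ : E3 =>
      Complex.exp (Complex.I * ((inner ℝ x ξ : ℝ) : ℂ)) * μ ξ) := by
    intro μ hμ
    refine hμ.bdd_mul (c := 1) (Continuous.aestronglyMeasurable (by fun_prop))
      (Filter.Eventually.of_forall fun ξ => ?_)
    rw [mul_comm, Complex.norm_exp_ofReal_mul_I]
  have hk : ∀ i ∈ Finset.range n, Integrable (fun ξ : E3 =>
      Complex.exp (Complex.I * ((inner ℝ x ξ : ℝ) : ℂ)) * ((phiK φ (i + 1 : ℕ) ξ : ℂ) * 1)) :=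
    fun i _ => hex (integrable_phiK_mul hφ _ continuousOn_const)
  rw [integral_add (hex (integrable_low hφ)) (integrable_finsetSum _ hk), integral_finsetSum _ hk,
    mul_add, Finset.mul_sum]
  rfl

/-- Littlewood–Paley decomposition of a bounded continuous function: the partial sums are averages of
`g` over the scales `2^{-n}`. -/
lemma tendsto_low_add_sum {φ : ℝ → ℝ} (hφ : IsCutoff φ) {g : E3 → ℂ} (hg : Continuous g) {B : ℝ}
    (hB : ∀ x, ‖g x‖ ≤ B) (x : E3) :
    Filter.Tendsto (fun n : ℕ => cv (lowKer φ) g x +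
      ∑ i ∈ Finset.range n, lpProj φ (i + 1 : ℕ) g x) Filter.atTop (nhds (g x)) := by
  obtain ⟨B', hW⟩ := exists_kerD_low hφ
  have hWi := hW.toKer.integrable
  have hgm := hg.aestronglyMeasurable (μ := volume)
  have hgb : ∀ᵐ x, ‖g x‖ ≤ B := Filter.Eventually.of_forall hB
  have hki : ∀ i : ℕ, Integrable (ker φ (i + 1 : ℕ) (fun _ => 1)) := fun i => by
    obtain ⟨b, hb⟩ := exists_ker_of_contDiffOn hφ (R := fun _ => 1) contDiffOn_const (i + 1 : ℕ)
    exact hb.integrable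
  have e : ∀ n : ℕ, cv (lowKer φ) g x + ∑ i ∈ Finset.range n, lpProj φ (i + 1 : ℕ) g x =
      ∫ z, lowKer φ z * g (x - ((2 : ℝ) ^ (n : ℤ))⁻¹ • z) := by
    intro n
    have h2 := zpow_two_pos n
    have h1 : cv (lowKer φ) g x + ∑ i ∈ Finset.range n, lpProj φ (i + 1 : ℕ) g x =
        ∫ y, ((((2 : ℝ) ^ (3 * (n : ℤ)) : ℝ) : ℂ) * lowKer φ ((2 : ℝ) ^ (n : ℤ) • (x - y))) * g y := by
      simp_rw [low_rescale_eq hφ n, add_mul, Finset.sum_mul]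
      rw [integral_add (integrable_cv hWi hgm hgb x)
        (integrable_finsetSum _ fun i _ => integrable_cv (hki i) hgm hgb x),
        integral_finsetSum _ fun i _ => integrable_cv (hki i) hgm hgb x]
      rfl
    rw [h1, ← integral_sub_left_eq_self _ (volume : Measure E3) x]
    simp only [sub_sub_cancel]
    have h3 := Measure.integral_comp_smul (volume : Measure E3)
      (fun z => lowKer φ z * g (x - ((2 : ℝ) ^ (n : ℤ))⁻¹ • z)) ((2 : ℝ) ^ (n : ℤ))
    simp_rw [inv_smul_smul₀ h2.ne'] at h3
    simp_rw [mul_assoc]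
    rw [integral_const_mul, h3, finrank_E3, abs_of_pos (by positivity), Complex.real_smul, ← mul_assoc,
      ← Complex.ofReal_mul, zpow_mul', ← zpow_natCast (_ : ℝ) 3, Nat.cast_ofNat,
      mul_inv_cancel₀ (by positivity), Complex.ofReal_one, one_mul]
  simp_rw [e]
  have hlim : g x = ∫ z, lowKer φ z * g x := by
    rw [integral_mul_const, integral_lowKer hφ, one_mul]
  rw [hlim]
  refine tendsto_integral_of_dominated_convergence (fun z => ‖lowKer φ z‖ * B) (fun n => ?_)
    (hWi.norm.mul_const B) (fun n => Filter.Eventually.of_forall fun z => ?_)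
    (Filter.Eventually.of_forall fun z => ?_)
  · exact (hW.cont.mul (hg.comp (continuous_const.sub
      (continuous_const_smul _)))).aestronglyMeasurable
  · rw [norm_mul]
    gcongr
    exact hB _
  · refine Filter.Tendsto.const_mul _ ?_
    have h4 : Filter.Tendsto (fun n : ℕ => x - ((2 : ℝ) ^ (n : ℤ))⁻¹ • z) Filter.atTop (nhds x) := by
      have h5 : Filter.Tendsto (fun n : ℕ => ((2 : ℝ) ^ (n : ℤ))⁻¹) Filter.atTop (nhds 0) := by
        simp_rw [zpow_natCast]
        exact (tendsto_pow_atTop_atTop_of_one_lt one_lt_two).inv_tendsto_atTop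
      have h6 := (h5.smul_const z).const_sub x
      simpa using h6
    exact (hg.tendsto x).comp h4

lemma norm_cv_le {k : ℤ} {B D : ℝ} {W h : E3 → ℂ} (hW : Ker k B W) (hD : ∀ x, ‖h x‖ ≤ D) (x : E3) :
    ‖cv W h x‖ ≤ B * bumpMass * D := by
  have hD0 := (norm_nonneg _).trans (hD 0)
  have hB0 := hW.nonneg
  have hi : Integrable (fun y => B * bump k (x - y) * D) :=
    (((integrable_bump k).comp_sub_left x).const_mul B).mul_const D
  refine (norm_integral_le_of_norm_le hi (Filter.Eventually.of_forall fun y => ?_)).trans ?_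
  · rw [norm_mul]
    gcongr
    · exact mul_nonneg hB0 (bump_pos _ _).le
    · exact hW.bound _
    · exact hD y
  · rw [integral_mul_const, integral_const_mul, integral_sub_left_eq_self (bump k), integral_bump]

lemma cv_ker_eq_sum_proj {φ : ℝ → ℝ} (hφ : IsCutoff φ) {k : ℤ} {m h : E3 → ℂ}
    (hm : ContinuousOn m {0}ᶜ) (hW : Integrable (ker φ k m)) (hh : AEStronglyMeasurable h volume)
    {D : ℝ} (hD : ∀ x, ‖h x‖ ≤ D) (x : E3) :
    cv (ker φ k m) h x = ∑ i ∈ Finset.Icc (k - 1) (k + 1), cv (ker φ k m) (lpProj φ i h) x := by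
  have hone : ∀ i, Integrable (ker φ i (fun _ => 1)) := fun i => by
    obtain ⟨b, hb⟩ := exists_ker_of_contDiffOn hφ (R := fun _ => 1) contDiffOn_const i
    exact hb.integrable
  have e : ∀ i, cv (ker φ k m) (lpProj φ i h) x = cv (cv (ker φ k m) (ker φ i fun _ => 1)) h x :=
    fun i => cv_assoc_of_bdd hW (hone i) hh hD x
  simp_rw [e]
  have hint : ∀ i, Integrable (cv (ker φ k m) (ker φ i fun _ => 1)) := by
    intro i
    exact (hone i).integrable_convolution (ContinuousLinearMap.mul ℂ ℂ).flip hW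
  have e2 : cv (ker φ k m) h x = ∫ y, ∑ i ∈ Finset.Icc (k - 1) (k + 1),
      cv (ker φ k m) (ker φ i fun _ => 1) (x - y) * h y := by
    unfold cv
    congr 1
    ext y
    rw [← Finset.sum_mul, ker_eq_sum_cv_proj hφ hm hW]
    rfl
  rw [e2, integral_finsetSum _ fun i _ =>
    integrable_cv (hint i) hh (Filter.Eventually.of_forall hD) x]
  rfl

/-- The bound for a homogeneous multiplier of a function with bounded dyadic pieces. -/
lemma exists_norm_cv_homog_le {φ : ℝ → ℝ} (hφ : IsCutoff φ) {d : ℤ} {m : E3 → ℂ} (hm : Homog d m) :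
    ∃ C : ℝ, 0 < C ∧ ∀ (k : ℤ) (h : E3 → ℂ) (B D : ℝ), AEStronglyMeasurable h volume →
      (∀ x, ‖h x‖ ≤ B) → (∀ i ∈ Finset.Icc (k - 1) (k + 1), ∀ x, ‖lpProj φ i h x‖ ≤ D) →
      ∀ x, ‖cv (ker φ k m) h x‖ ≤ C * (2 : ℝ) ^ (k * d) * D := by
  obtain ⟨C, hC, H⟩ := exists_kerD_homog hφ hm
  have hM := bumpMass_pos
  refine ⟨3 * (C * bumpMass), by positivity, fun k h B D hh hB hD x => ?_⟩
  have hW := (H _ isMichlin_one k).toKer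
  simp only [one_mul] at hW
  rw [cv_ker_eq_sum_proj hφ hm.smooth.continuousOn hW.integrable hh hB x]
  refine (norm_sum_le _ _).trans ?_
  refine (Finset.sum_le_card_nsmul _ _ (C * (2 : ℝ) ^ (k * d) * bumpMass * D)
    fun i hi => norm_cv_le hW (hD i hi) x).trans (le_of_eq ?_)
  rw [Int.card_Icc]
  rw [show k + 1 + 1 - (k - 1) = 3 by ring]
  simp
  ring

/-- The field of a density whose dyadic pieces decay like `2^{-k}` is differentiable with bounded gradient:
the pieces of the field gain one derivative over those of the density, so that their gradients are
summable over `k > 0`, and the part of low frequency is smooth. -/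
lemma Dens.exists_fderiv_field {φ : ℝ → ℝ} (hφ : IsCutoff φ) {h : E3 → ℝ} (hd : Dens h) {D : ℝ}
    (hD : ∀ (k : ℕ) (x : E3), ‖lpProj φ k (fun y => (h y : ℂ)) x‖ ≤ D * ((2 : ℝ) ^ k)⁻¹) (c : Fin 3) :
    Differentiable ℝ (cv (rk c) (fun y => (h y : ℂ))) ∧
      ∃ D', ∀ x, ‖fderiv ℝ (cv (rk c) (fun y => (h y : ℂ))) x‖ ≤ D' := by
  set ρ : E3 → ℂ := fun y => (h y : ℂ) with hρ
  obtain ⟨B, hB⟩ := hd.bdd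
  have hB' : ∀ x, ‖ρ x‖ ≤ B := fun x => by rw [hρ, Complex.norm_real]; exact hB x
  have hρm : AEStronglyMeasurable ρ volume :=
    (Complex.continuous_ofReal.comp hd.cont).aestronglyMeasurable
  obtain ⟨DE, hDE⟩ := hd.exists_cv_rk_le c
  have hEc := hd.continuous_cv_rk c
  set E := cv (rk c) ρ with hE
  obtain ⟨BL, hL⟩ := exists_kerD_low hφ
  have hD0 : 0 ≤ D := by
    have := (norm_nonneg _).trans (hD 0 0)
    simpa using this
  have hr : ContinuousOn (rSym c) {0}ᶜ := (homog_rSym c).smooth.continuousOn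
  obtain ⟨C₀, hC₀, H₀⟩ := exists_norm_cv_homog_le hφ (homog_rSym c)
  choose Ca hCa Ha using fun a => exists_norm_cv_homog_le hφ ((homog_dSym a).mul (homog_rSym c))
  obtain ⟨CD, hCD, HD⟩ := exists_kerD_homog hφ (homog_rSym c)
  have hpiece : ∀ k : ℤ, lpProj φ k E = cv (ker φ k (rSym c)) ρ := by
    intro k
    obtain ⟨b, hb⟩ := exists_ker_of_contDiffOn hφ (R := fun _ => 1) contDiffOn_const k
    have := hd.dyadicOp_field hφ continuousOn_const hb c
    simp only [one_mul] at this
    exact this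
  have hKD : ∀ k : ℤ, KerD k (CD * (2 : ℝ) ^ (k * (-1))) (ker φ k (rSym c)) := fun k => by
    have := HD _ isMichlin_one k
    simpa only [one_mul] using this
  have hL' : ∀ (n : ℕ) (x : E3), ∃ L : E3 →L[ℝ] ℂ, HasFDerivAt (lpProj φ (n + 1 : ℕ) E) L x ∧
      ‖L‖ ≤ (∑ a, Ca a) * D * (1 / 2) ^ n := by
    intro n x
    obtain ⟨L, hL1, hL2⟩ := (hKD (n + 1 : ℕ)).hasFDerivAt_cv hρm (Filter.Eventually.of_forall hB') x
    rw [← hpiece] at hL1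
    refine ⟨L, hL1, (norm_clm_le_sum L).trans ?_⟩
    rw [Finset.sum_mul, Finset.sum_mul]
    refine Finset.sum_le_sum fun a _ => ?_
    rw [hL2 a, pd_ker_eq hφ _ hr]
    refine (Ha a (n + 1 : ℕ) ρ B (D * (1 / 2) ^ n) hρm hB' (fun i hi y => ?_) x).trans (le_of_eq ?_)
    · rw [Finset.mem_Icc] at hi
      obtain ⟨j, rfl⟩ : ∃ j : ℕ, i = j := ⟨i.toNat, by omega⟩
      refine (hD j y).trans ?_
      gcongr
      rw [← inv_pow, one_div]
      apply pow_le_pow_of_le_one (by norm_num) (by norm_num)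
      omega
    · simp
      ring
  choose L hL1 hL2 using hL'
  have hs : Summable fun n : ℕ => (∑ a, Ca a) * D * (1 / 2 : ℝ) ^ n :=
    (summable_geometric_of_lt_one (by norm_num) (by norm_num)).mul_left _
  have hsum0 : ∀ x, Summable fun n : ℕ => lpProj φ (n + 1 : ℕ) E x := by
    intro x
    refine Summable.of_norm_bounded (g := fun n : ℕ => C₀ * D * (1 / 2 : ℝ) ^ n)
      ((summable_geometric_of_lt_one (by norm_num) (by norm_num)).mul_left _) fun n => ?_
    rw [hpiece]
    refine (H₀ (n + 1 : ℕ) ρ B D hρm hB' (fun i hi y => ?_) x).trans ?_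
    · rw [Finset.mem_Icc] at hi
      obtain ⟨j, rfl⟩ : ∃ j : ℕ, i = j := ⟨i.toNat, by omega⟩
      refine (hD j y).trans (mul_le_of_le_one_right hD0 (inv_le_one_of_one_le₀ ?_))
      exact one_le_pow₀ one_le_two
    · rw [mul_assoc, mul_assoc, mul_comm D]
      gcongr
      rw [mul_neg_one, zpow_neg, zpow_natCast, ← inv_pow, one_div]
      exact pow_le_pow_of_le_one (by norm_num) (by norm_num) (by omega)
  have key : ∀ x, E x = cv (lowKer φ) E x + ∑' n : ℕ, lpProj φ (n + 1 : ℕ) E x := by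
    intro x
    refine tendsto_nhds_unique (tendsto_low_add_sum hφ hEc hDE x) ?_
    exact ((hsum0 x).hasSum.tendsto_sum_nat).const_add _
  have hder : ∀ x, ∃ M : E3 →L[ℝ] ℂ, HasFDerivAt E M x ∧
      ‖M‖ ≤ (∑ a : Fin 3, BL * bumpMass * DE) + ∑' n : ℕ, (∑ a, Ca a) * D * (1 / 2 : ℝ) ^ n := by
    intro x
    obtain ⟨M₀, h1, h2⟩ := hL.hasFDerivAt_cv hEc.aestronglyMeasurable
      (Filter.Eventually.of_forall hDE) x
    have h3 := hasFDerivAt_tsum hs (fun n x => hL1 n x) hL2 (hsum0 x) x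
    refine ⟨M₀ + ∑' n, L n x, ?_, (norm_add_le _ _).trans (add_le_add ?_ ?_)⟩
    · exact (h1.add h3).congr_of_eventuallyEq (Filter.Eventually.of_forall key)
    · refine (norm_clm_le_sum _).trans (Finset.sum_le_sum fun a _ => ?_)
      rw [h2 a]
      refine norm_cv_le (k := 0) ⟨?_, fun y => ?_⟩ hDE x
      · exact hL.contd.clm_apply continuous_const
      · refine (norm_pd_le a _ y).trans ((hL.dbound y).trans ?_)
        rw [zpow_zero, mul_one]
    · exact tsum_of_norm_bounded hs.hasSum fun n => hL2 n x
  choose M hM hM' using hder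
  exact ⟨fun x => (hM x).differentiableAt, _, fun x => by rw [(hM x).fderiv]; exact hM' x⟩

/-- A dyadic multiplier of a partial derivative of a bounded function with bounded gradient. -/
lemma cv_ker_pd {φ : ℝ → ℝ} (hφ : IsCutoff φ) {k : ℤ} {B D D' : ℝ} {m g : E3 → ℂ}
    (hm : ContinuousOn m {0}ᶜ) (hW : KerD k B (ker φ k m)) (hg : Differentiable ℝ g)
    (hD : ∀ x, ‖g x‖ ≤ D) (hD' : ∀ x, ‖fderiv ℝ g x‖ ≤ D') (a : Fin 3) :
    cv (ker φ k m) (pd a g) = cv (ker φ k (fun ξ => dSym a ξ * m ξ)) g := by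
  ext x
  have hpm : AEStronglyMeasurable (pd a g) volume :=
    (measurable_fderiv_apply_const ℝ g (basisVec a)).aestronglyMeasurable
  have hgm : AEStronglyMeasurable g volume := hg.continuous.aestronglyMeasurable
  have hpd : ∀ y, HasFDerivAt (fun y => ker φ k m (x - y)) (-fderiv ℝ (ker φ k m) (x - y)) y := by
    intro y
    have h1 := (hW.diff (x - y)).hasFDerivAt.comp y ((hasFDerivAt_id y).const_sub x)
    rw [ContinuousLinearMap.comp_neg, ContinuousLinearMap.comp_id] at h1
    exact h1
  have hf : ∀ y, fderiv ℝ (fun y => ker φ k m (x - y)) y (basisVec a) =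
      -ker φ k (fun ξ => dSym a ξ * m ξ) (x - y) := by
    intro y
    rw [(hpd y).fderiv, ← pd_ker_eq hφ k hm]
    rfl
  have hWd : Integrable (ker φ k (fun ξ => dSym a ξ * m ξ)) := by
    rw [← pd_ker_eq hφ k hm]
    refine Ker.integrable (k := k) (B := B * 2 ^ k) ⟨?_, fun y => ?_⟩
    · exact hW.contd.clm_apply continuous_const
    · exact (norm_pd_le a _ y).trans (hW.dbound y)
  have key := integral_mul_fderiv_eq_neg_fderiv_mul_of_integrable (μ := (volume : Measure E3))
    (f := fun y => ker φ k m (x - y)) (g := g) (v := basisVec a) ?_ ?_ ?_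
    (fun y _ => (hpd y).differentiableAt) (fun y _ => hg y)
  · unfold cv
    refine key.trans ?_
    simp_rw [hf, neg_mul]
    rw [integral_neg, neg_neg]
  · simp_rw [hf, neg_mul]
    exact (integrable_cv hWd hgm (Filter.Eventually.of_forall hD) x).neg
  · exact integrable_cv hW.toKer.integrable hpm
      (Filter.Eventually.of_forall fun y => (norm_pd_le a g y).trans (hD' y)) x
  · exact integrable_cv hW.toKer.integrable hgm (Filter.Eventually.of_forall hD) x

/-- Dyadic pieces of `R ∂_a E_c` in terms of the density. -/
lemma Dens.dyadicOp_pd_field {φ : ℝ → ℝ} (hφ : IsCutoff φ) {h : E3 → ℝ} (hd : Dens h) {D : ℝ}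
    (hD : ∀ (k : ℕ) (x : E3), ‖lpProj φ k (fun y => (h y : ℂ)) x‖ ≤ D * ((2 : ℝ) ^ k)⁻¹)
    {R : E3 → ℂ} (hR : IsMichlin R) (k : ℤ) (a c : Fin 3) :
    cv (ker φ k R) (pd a (cv (rk c) (fun y => (h y : ℂ)))) =
      cv (ker φ k (fun ξ => R ξ * (dSym a ξ * rSym c ξ))) (fun y => (h y : ℂ)) := by
  obtain ⟨h1, D', h2⟩ := hd.exists_fderiv_field hφ hD c
  obtain ⟨DE, hDE⟩ := hd.exists_cv_rk_le c
  obtain ⟨C, hC, H⟩ := exists_kerD_homog hφ Homog.one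
  obtain ⟨C', hC', H'⟩ := exists_kerD_homog hφ (homog_dSym a)
  have hRc := hR.contDiffOn.continuousOn
  have hW := H R hR k
  simp only [mul_one] at hW
  have hW' := (H' R hR k).toKer
  rw [cv_ker_pd hφ hRc hW h1 hDE h2 a]
  have e : (fun ξ => dSym a ξ * R ξ) = fun ξ => R ξ * dSym a ξ := funext fun ξ => mul_comm _ _
  rw [e, hd.dyadicOp_field hφ (m := fun ξ => R ξ * dSym a ξ)
    (hRc.mul (homog_dSym a).smooth.continuousOn) hW' c]
  congr 2
  ext ξ
  ring

/-- Dyadic pieces of `R ∂_a ∂_b P_l E_c` in terms of the density. -/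
lemma Dens.dyadicOp_pd_pd_proj_field {φ : ℝ → ℝ} (hφ : IsCutoff φ) {h : E3 → ℝ} (hd : Dens h)
    {R : E3 → ℂ} (hR : IsMichlin R) (k l : ℤ) (a b c : Fin 3) :
    cv (ker φ k R) (pd a (pd b (lpProj φ l (cv (rk c) (fun y => (h y : ℂ)))))) =
      cv (cv (ker φ k R) (ker φ l (fun ξ => dSym a ξ * (dSym b ξ * rSym c ξ))))
        (fun y => (h y : ℂ)) := by
  set ρ : E3 → ℂ := fun y => (h y : ℂ) with hρ
  obtain ⟨B, hB⟩ := hd.bdd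
  have hB' : ∀ x, ‖ρ x‖ ≤ B := fun x => by rw [hρ, Complex.norm_real]; exact hB x
  have hB'' := Filter.Eventually.of_forall (f := ae (volume : Measure E3)) hB'
  have hρm : AEStronglyMeasurable ρ volume :=
    (Complex.continuous_ofReal.comp hd.cont).aestronglyMeasurable
  obtain ⟨b', hb'⟩ := exists_ker_of_contDiffOn hφ (R := fun _ => 1) contDiffOn_const l
  obtain ⟨C₁, hC₁, H₁⟩ := exists_kerD_homog hφ (homog_rSym c)
  obtain ⟨C₂, hC₂, H₂⟩ := exists_kerD_homog hφ ((homog_dSym b).mul (homog_rSym c))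
  obtain ⟨C₃, hC₃, H₃⟩ := exists_kerD_homog hφ
    ((homog_dSym a).mul ((homog_dSym b).mul (homog_rSym c)))
  obtain ⟨C, hC, H⟩ := exists_kerD_homog hφ Homog.one
  have h1 := H₁ _ isMichlin_one l
  have h2 := H₂ _ isMichlin_one l
  have h3 := H₃ _ isMichlin_one l
  have h4 := H R hR k
  simp only [one_mul, mul_one] at h1 h2 h3 h4
  have e1 : lpProj φ l (cv (rk c) ρ) = cv (ker φ l (rSym c)) ρ := by
    have := hd.dyadicOp_field hφ continuousOn_const hb' c
    simp only [one_mul] at this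
    exact this
  rw [e1, h1.pd_cv hρm hB'', pd_ker_eq hφ l (homog_rSym c).smooth.continuousOn, h2.pd_cv hρm hB'',
    pd_ker_eq hφ l ((homog_dSym b).mul (homog_rSym c)).smooth.continuousOn]
  ext x
  exact cv_assoc_of_bdd h4.toKer.integrable h3.toKer.integrable hρm hB' x

/-! ### Dyadic pieces of the density -/

/-- `h` has `L¹` norm at most `β` and `L^∞` norm at most `β ⟨t⟩⁻³`. -/
structure Bn (t β : ℝ) (h : E3 → ℂ) : Prop where
  meas : Measurable h
  int : ∫⁻ x, ‖h x‖ₑ ≤ ENNReal.ofReal β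
  sup : ∀ᵐ x, ‖h x‖ ≤ β * (jap t ^ 3)⁻¹

lemma Bn.nonneg {t β : ℝ} {h : E3 → ℂ} (H : Bn t β h) : 0 ≤ β := by
  obtain ⟨x, hx⟩ := H.sup.exists
  have := jap_pos t
  exact nonneg_of_mul_nonneg_left ((norm_nonneg _).trans hx) (by positivity)

lemma Bn.mono {t β β' : ℝ} {h : E3 → ℂ} (H : Bn t β h) (hb : β ≤ β') : Bn t β' h := by
  have := jap_pos t
  refine ⟨H.meas, H.int.trans (ENNReal.ofReal_le_ofReal hb), ?_⟩
  filter_upwards [H.sup] with x hx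
  exact hx.trans (by gcongr)

lemma Bn.add {t β β' : ℝ} {h h' : E3 → ℂ} (H : Bn t β h) (H' : Bn t β' h') :
    Bn t (β + β') (fun x => h x + h' x) := by
  refine ⟨H.meas.add H'.meas, ?_, ?_⟩
  · rw [ENNReal.ofReal_add H.nonneg H'.nonneg]
    refine le_trans ?_ (add_le_add H.int H'.int)
    rw [← lintegral_add_left H.meas.enorm]
    exact lintegral_mono fun x => enorm_add_le _ _
  · filter_upwards [H.sup, H'.sup] with x h1 h2
    rw [add_mul]
    exact (norm_add_le _ _).trans (add_le_add h1 h2)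

lemma Bn.zero (t : ℝ) : Bn t 0 (fun _ => 0) := ⟨measurable_const, by simp, by simp⟩

lemma Bn.sum {ι : Type*} {t : ℝ} (s : Finset ι) {β : ι → ℝ} {h : ι → E3 → ℂ}
    (H : ∀ i ∈ s, Bn t (β i) (h i)) : Bn t (∑ i ∈ s, β i) (fun x => ∑ i ∈ s, h i x) := by
  classical
  induction s using Finset.induction_on with
  | empty => simpa using Bn.zero t
  | insert a s ha ih =>
    simp_rw [Finset.sum_insert ha]
    exact (H a (Finset.mem_insert_self _ _)).add
      (ih fun i hi => H i (Finset.mem_insert_of_mem hi))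

lemma lintegral_enorm_sub_le {k : ℤ} {B : ℝ} {W : E3 → ℂ} (hW : Ker k B W) :
    ∫⁻ x, ‖W x‖ₑ ≤ ENNReal.ofReal (B * bumpMass) := by
  rw [ENNReal.ofReal_mul hW.nonneg, ← lintegral_bump k, ← lintegral_const_mul _
    (continuous_bump k).measurable.ennreal_ofReal]
  refine lintegral_mono fun x => ?_
  rw [← ENNReal.ofReal_mul hW.nonneg, ← ofReal_norm]
  exact ENNReal.ofReal_le_ofReal (hW.bound x)

/-- Young's inequality for the `L¹` norm of a convolution of nonnegative functions. -/
lemma lintegral_conv_le {f g : E3 → ℝ≥0∞} (hf : Measurable f) (hg : Measurable g) :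
    ∫⁻ x, ∫⁻ y, f (x - y) * g y = (∫⁻ x, f x) * ∫⁻ y, g y := by
  rw [lintegral_lintegral_swap]
  · rw [← lintegral_const_mul _ hg]
    congr 1
    ext y
    rw [lintegral_mul_const _ (show Measurable fun x => f (x - y) from
      hf.comp (measurable_id.sub_const y)), lintegral_sub_right_eq_self f y]
  · exact ((hf.comp (measurable_fst.sub measurable_snd)).mul (hg.comp measurable_snd)).aemeasurable

lemma measurable_cv {W h : E3 → ℂ} (hW : Measurable W) (hh : Measurable h) : Measurable (cv W h) := by
  have : StronglyMeasurable (Function.uncurry fun x y : E3 => W (x - y) * h y) :=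
    ((hW.comp (measurable_fst.sub measurable_snd)).mul (hh.comp measurable_snd)).stronglyMeasurable
  exact this.integral_prod_right.measurable

lemma enorm_cv_le (W h : E3 → ℂ) (x : E3) : ‖cv W h x‖ₑ ≤ ∫⁻ y, ‖W (x - y)‖ₑ * ‖h y‖ₑ := by
  refine (enorm_integral_le_lintegral_enorm _).trans (le_of_eq ?_)
  simp_rw [enorm_mul]

lemma Bn.cv {k : ℤ} {t β B : ℝ} {W h : E3 → ℂ} (hW : Ker k B W) (H : Bn t β h) :
    Bn t (B * bumpMass * β) (cv W h) := by
  have hM := bumpMass_pos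
  have hB := hW.nonneg
  refine ⟨measurable_cv hW.cont.measurable H.meas, ?_, Filter.Eventually.of_forall fun x => ?_⟩
  · refine (lintegral_mono (enorm_cv_le W h)).trans ?_
    rw [lintegral_conv_le (f := fun x => ‖W x‖ₑ) (g := fun x => ‖h x‖ₑ) hW.cont.measurable.enorm
      H.meas.enorm, ENNReal.ofReal_mul (by positivity)]
    exact mul_le_mul' (lintegral_enorm_sub_le hW) H.int
  · have hi : Integrable (fun y => B * bump k (x - y) * (β * (jap t ^ 3)⁻¹)) :=
      (((integrable_bump k).comp_sub_left x).const_mul B).mul_const _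
    refine (norm_integral_le_of_norm_le hi ?_).trans (le_of_eq ?_)
    · filter_upwards [H.sup] with y hy
      rw [norm_mul]
      gcongr
      · exact mul_nonneg hB (bump_pos _ _).le
      · exact hW.bound _
    · rw [integral_mul_const, integral_const_mul, integral_sub_left_eq_self (bump k), integral_bump]
      ring

/-- One term of the supremum in the norm `B⁰_t`. -/
lemma besov_bound {V : Type*} [NormedAddCommGroup V] {t c ε : ℝ} {F : ℤ → E3 → V} (hc : 0 < c)
    (hε : 0 ≤ ε) (h : ENNReal.ofReal c * besovSup t F ≤ ENNReal.ofReal ε) (k : ℤ) :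
    (∫⁻ x, ‖F k x‖ₑ ≤ ENNReal.ofReal (ε / c)) ∧ ∀ᵐ x, ‖F k x‖ ≤ ε / c * (jap t ^ 3)⁻¹ := by
  have hj := jap_pos t
  have hj3 : 0 < jap t ^ 3 := by positivity
  have h1 : besovSup t F ≤ ENNReal.ofReal (ε / c) := by
    rw [ENNReal.ofReal_div_of_pos hc, ENNReal.le_div_iff_mul_le
      (Or.inl (by simpa using hc)) (Or.inl ENNReal.ofReal_ne_top), mul_comm]
    exact h
  have h2 := (le_iSup (fun k : ℤ => (ENNReal.ofReal (jap t ^ 3) * eLpNorm (F k) ∞ volume +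
    eLpNorm (F k) 1 volume)) k).trans h1
  constructor
  · rw [← eLpNorm_one_eq_lintegral_enorm]
    exact le_add_self.trans h2
  · have h3 := le_self_add.trans h2
    rw [eLpNorm_exponent_top] at h3
    filter_upwards [ae_le_eLpNormEssSup (f := F k) (μ := volume)] with x hx
    have h4 : ENNReal.ofReal (jap t ^ 3) * ‖F k x‖ₑ ≤ ENNReal.ofReal (ε / c) :=
      (mul_le_mul_right hx _).trans h3
    rw [← ofReal_norm, ← ENNReal.ofReal_mul hj3.le, ENNReal.ofReal_le_ofReal_iff (by positivity)] at h4
    rwa [← div_eq_mul_inv, le_div_iff₀ hj3, mul_comm]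

lemma japInv_mul (ξ : E3) : japInv ξ * (jap ‖ξ‖ : ℂ) = 1 := by
  have := (jap_pos ‖ξ‖).ne'
  rw [japInv, ← Complex.ofReal_mul, inv_mul_cancel₀ this, Complex.ofReal_one]

lemma continuous_japInv : Continuous japInv := by
  refine Complex.continuous_ofReal.comp (Continuous.inv₀ ?_ fun ξ => (jap_pos _).ne')
  unfold jap
  fun_prop

lemma contDiff_jap : ContDiff ℝ ∞ (fun ξ : E3 => (jap ‖ξ‖ : ℂ)) := by
  have h : ContDiff ℝ ∞ (fun ξ : E3 => Real.sqrt (1 + ‖ξ‖ ^ 2)) :=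
    ContDiff.sqrt (contDiff_const.add (contDiff_norm_sq ℝ)) fun ξ => by positivity
  exact Complex.ofRealCLM.contDiff.comp h

lemma cv_sum_left {ι : Type*} (s : Finset ι) {W : ι → E3 → ℂ} {h : E3 → ℂ}
    (hW : ∀ i ∈ s, Integrable (W i)) (hh : AEStronglyMeasurable h volume) {B : ℝ}
    (hB : ∀ x, ‖h x‖ ≤ B) (x : E3) :
    cv (fun z => ∑ i ∈ s, W i z) h x = ∑ i ∈ s, cv (W i) h x := by
  unfold cv
  rw [← integral_finsetSum _ fun i hi =>
    integrable_cv (hW i hi) hh (Filter.Eventually.of_forall hB) x]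
  simp_rw [Finset.sum_mul]

lemma integrable_cv_ker {W V : E3 → ℂ} (hW : Integrable W) (hV : Integrable V) :
    Integrable (cv W V) :=
  hV.integrable_convolution (ContinuousLinearMap.mul ℂ ℂ).flip hW

/-- The gain of one derivative for the stationary part: `P_k h` from `P_k ⟨∇⟩ h`, by `⟨ξ⟩⁻¹ ⟨ξ⟩ = 1`. -/
lemma exists_bn_of_jap {φ : ℝ → ℝ} (hφ : IsCutoff φ) : ∃ C : ℝ, 0 < C ∧
    ∀ (k : ℤ) (t β B : ℝ) (h : E3 → ℂ), AEStronglyMeasurable h volume → (∀ x, ‖h x‖ ≤ B) →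
      Bn t β (dyadicOp φ k (fun ξ => (jap ‖ξ‖ : ℂ)) h) →
      Bn t (C * (1 + (2 : ℝ) ^ k)⁻¹ * β) (lpProj φ k h) := by
  obtain ⟨C, hC, H⟩ := exists_ker_japInv_le hφ
  have hM := bumpMass_pos
  refine ⟨6 * (C * bumpMass), by positivity, fun k t β B h hh hB Hb => ?_⟩
  have hk := zpow_two_pos k
  obtain ⟨b, hb⟩ := exists_ker_of_contDiffOn hφ
    (contDiff_jap.of_le (by norm_cast)).contDiffOn (R := fun ξ => (jap ‖ξ‖ : ℂ)) k
  have e : lpProj φ k h = fun x => ∑ i ∈ Finset.Icc (k - 1) (k + 1),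
      cv (ker φ i japInv) (dyadicOp φ k (fun ξ => (jap ‖ξ‖ : ℂ)) h) x := by
    ext x
    have e1 : ker φ k (fun _ => 1) = fun z => ∑ i ∈ Finset.Icc (k - 1) (k + 1),
        cv (ker φ i japInv) (ker φ k fun ξ => (jap ‖ξ‖ : ℂ)) z := by
      ext z
      rw [← ker_mul_eq_sum hφ continuous_japInv.continuousOn contDiff_jap.continuous.continuousOn
        (fun i => (H i).integrable)]
      simp_rw [japInv_mul]
    change cv (ker φ k fun _ => 1) h x = _
    rw [e1, cv_sum_left _ (fun i _ => integrable_cv_ker (H i).integrable hb.integrable) hh hB]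
    refine Finset.sum_congr rfl fun i _ => ?_
    exact (cv_assoc_of_bdd (H i).integrable hb.integrable hh hB x).symm
  rw [e]
  refine (Bn.sum _ fun i _ => Hb.cv (H i)).mono ?_
  have hβ := Hb.nonneg
  refine (Finset.sum_le_card_nsmul _ _ (C * (2 * (1 + (2 : ℝ) ^ k)⁻¹) * bumpMass * β)
    fun i hi => ?_).trans (le_of_eq ?_)
  · gcongr
    rw [Finset.mem_Icc] at hi
    have h1 : (2 : ℝ) ^ (k - 1) ≤ 2 ^ i := zpow_le_zpow_right₀ one_le_two hi.1
    rw [zpow_sub_one₀ two_ne_zero] at h1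
    rw [inv_eq_one_div, inv_eq_one_div, mul_one_div, div_le_div_iff₀ (by positivity) (by positivity)]
    linarith
  · rw [Int.card_Icc]
    rw [show k + 1 + 1 - (k - 1) = 3 by ring]
    simp
    ring

lemma sum_rSym_mul_dSym {ξ : E3} (hξ : ξ ≠ 0) : ∑ a : Fin 3, rSym a ξ * dSym a ξ = 1 := by
  have h : (‖ξ‖ : ℂ) ≠ 0 := by simpa using hξ
  have h2 : ‖ξ‖ ^ 2 = ∑ a : Fin 3, ξ a ^ 2 := by
    rw [EuclideanSpace.norm_sq_eq]
    simp
  have e : ∀ a : Fin 3, rSym a ξ * dSym a ξ = ((ξ a ^ 2 : ℝ) : ℂ) / ((‖ξ‖ ^ 2 : ℝ) : ℂ) := by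
    intro a
    rw [rSym, dSym, div_mul_eq_mul_div]
    congr 1
    push_cast
    linear_combination (-(ξ a : ℂ) ^ 2) * Complex.I_sq
  simp_rw [e]
  rw [← Finset.sum_div, ← Complex.ofReal_sum, ← h2]
  push_cast
  field_simp

/-- The gain of one derivative for the oscillatory part: `P_k h` from `∇ P_k h`, because
`∑ₐ rSym a · dSym a = 1`. -/
lemma exists_bn_of_grad {φ : ℝ → ℝ} (hφ : IsCutoff φ) : ∃ C : ℝ, 0 < C ∧
    ∀ (k : ℤ) (t β B : ℝ) (h : E3 → ℂ), AEStronglyMeasurable h volume → (∀ x, ‖h x‖ ≤ B) →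
      (∀ a, Bn t β (pd a (lpProj φ k h))) →
      Bn t (C * ((2 : ℝ) ^ k)⁻¹ * β) (lpProj φ k h) := by
  choose C hC H' using fun a => exists_kerD_homog hφ (homog_rSym a)
  have hM := bumpMass_pos
  refine ⟨6 * ((∑ a, C a) * bumpMass), ?_, fun k t β B h hh hB Hb => ?_⟩
  · have : 0 < ∑ a, C a := Finset.sum_pos (fun a _ => hC a) Finset.univ_nonempty
    positivity
  have H : ∀ a i, KerD i (C a * ((2 : ℝ) ^ i)⁻¹) (ker φ i (rSym a)) := by
    intro a i
    have := H' a _ isMichlin_one i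
    simpa only [one_mul, mul_neg_one, zpow_neg] using this
  have hone := fun k => (exists_kerD_homog hφ Homog.one).choose_spec.2 _ isMichlin_one k
  simp only [mul_one] at hone
  have hdi : ∀ a, Integrable (ker φ k (dSym a)) := by
    intro a
    obtain ⟨c, -, hc⟩ := exists_kerD_homog hφ (homog_dSym a)
    have := (hc _ isMichlin_one k).toKer.integrable
    simpa only [one_mul] using this
  have hpd : ∀ a, pd a (lpProj φ k h) = cv (ker φ k (dSym a)) h := by
    intro a
    have h1 := (hone k).pd_cv hh (Filter.Eventually.of_forall hB) a
    rw [pd_ker_eq hφ k continuousOn_const] at h1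
    simp only [mul_one] at h1
    exact h1
  have e : lpProj φ k h = fun x => ∑ a : Fin 3, ∑ i ∈ Finset.Icc (k - 1) (k + 1),
      cv (ker φ i (rSym a)) (pd a (lpProj φ k h)) x := by
    ext x
    have e1 : ker φ k (fun _ => 1) = fun z => ∑ a : Fin 3, ∑ i ∈ Finset.Icc (k - 1) (k + 1),
        cv (ker φ i (rSym a)) (ker φ k (dSym a)) z := by
      ext z
      have e2 : ∀ a, ∑ i ∈ Finset.Icc (k - 1) (k + 1), cv (ker φ i (rSym a)) (ker φ k (dSym a)) z =
          ker φ k (fun ξ => rSym a ξ * dSym a ξ) z := fun a =>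
        (ker_mul_eq_sum hφ (homog_rSym a).smooth.continuousOn (homog_dSym a).smooth.continuousOn
          (fun i => (H a i).toKer.integrable) z).symm
      simp_rw [e2]
      unfold ker
      rw [← invFourier_finset_sum]
      · congr 1
        ext ξ
        rw [← Finset.mul_sum]
        by_cases hξ : ξ = 0
        · rw [phiK_eq, phiK_zero_of_small hφ (by rw [hξ, smul_zero, norm_zero]; norm_num)]
          simp
        · rw [sum_rSym_mul_dSym hξ]
      · intro a _
        exact integrable_phiK_mul hφ k
          ((homog_rSym a).smooth.continuousOn.mul (homog_dSym a).smooth.continuousOn)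
    simp_rw [hpd]
    change cv (ker φ k fun _ => 1) h x = _
    have hint : ∀ a i, Integrable (cv (ker φ i (rSym a)) (ker φ k (dSym a))) :=
      fun a i => integrable_cv_ker (H a i).toKer.integrable (hdi a)
    rw [e1, cv_sum_left _ (fun a _ => integrable_finsetSum _ fun i _ => hint a i) hh hB]
    refine Finset.sum_congr rfl fun a _ => ?_
    rw [cv_sum_left _ (fun i _ => hint a i) hh hB]
    refine Finset.sum_congr rfl fun i _ => ?_
    exact (cv_assoc_of_bdd (H a i).toKer.integrable (hdi a) hh hB x).symm
  rw [e]
  refine (Bn.sum _ fun a _ => Bn.sum _ fun i _ => (Hb a).cv (H a i).toKer).mono ?_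
  have hβ := (Hb 0).nonneg
  have hk := zpow_two_pos k
  calc _ ≤ ∑ a : Fin 3, 3 * (C a * (2 * ((2 : ℝ) ^ k)⁻¹) * bumpMass * β) := by
        refine Finset.sum_le_sum fun a _ => ?_
        refine (Finset.sum_le_card_nsmul _ _ (C a * (2 * ((2 : ℝ) ^ k)⁻¹) * bumpMass * β)
          fun i hi => ?_).trans (le_of_eq ?_)
        · have := hC a
          gcongr
          rw [Finset.mem_Icc] at hi
          have h1 : (2 : ℝ) ^ (k - 1) ≤ 2 ^ i := zpow_le_zpow_right₀ one_le_two hi.1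
          rw [zpow_sub_one₀ two_ne_zero] at h1
          have := zpow_two_pos i
          rw [inv_eq_one_div, inv_eq_one_div, mul_one_div, div_le_div_iff₀ (by positivity)
            (by positivity)]
          linarith
        · rw [Int.card_Icc]
          rw [show k + 1 + 1 - (k - 1) = 3 by ring]
          simp
    _ = _ := by
        simp_rw [← Finset.mul_sum, ← Finset.sum_mul]
        ring

/-- The time `t` moved to the nearest point of `[0,T]`. -/
noncomputable def clamp (T t : ℝ) : ℝ := max 0 (min T t)

lemma clamp_mem {T : ℝ} (hT : 0 ≤ T) (t : ℝ) : clamp T t ∈ Icc 0 T :=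
  ⟨le_max_left _ _, max_le hT (min_le_left _ _)⟩

lemma clamp_eq {T t : ℝ} (ht : t ∈ Icc 0 T) : clamp T t = t := by
  rw [clamp, min_eq_right ht.2, max_eq_right ht.1]

lemma continuous_clamp (T : ℝ) : Continuous (clamp T) := by
  unfold clamp
  fun_prop

lemma continuous_clamped {V : Type*} [TopologicalSpace V] {T : ℝ} (hT : 0 ≤ T) {h : ℝ → E3 → V}
    (hh : ContinuousOn (fun p : ℝ × E3 => h p.1 p.2) (Icc 0 T ×ˢ univ)) :
    Continuous (fun p : ℝ × E3 => h (clamp T p.1) p.2) := by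
  have h1 : Continuous (fun p : ℝ × E3 => (clamp T p.1, p.2)) :=
    ((continuous_clamp T).comp continuous_fst).prodMk continuous_snd
  exact hh.comp_continuous h1 fun p => ⟨clamp_mem hT _, mem_univ _⟩

lemma measurable_cv_param {W : E3 → ℂ} (hW : Measurable W) {h : ℝ → E3 → ℂ}
    (hh : Measurable (fun p : ℝ × E3 => h p.1 p.2)) :
    Measurable (fun p : ℝ × E3 => cv W (h p.1) p.2) := by
  have : StronglyMeasurable (Function.uncurry fun (p : ℝ × E3) (y : E3) => W (p.2 - y) * h p.1 y) :=
    ((hW.comp ((measurable_snd.comp measurable_fst).sub measurable_snd)).mul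
      (hh.comp ((measurable_fst.comp measurable_fst).prodMk measurable_snd))).stronglyMeasurable
  exact this.integral_prod_right.measurable

/-- The derivative with respect to a parameter on an interval, set to zero outside the interior, is
jointly measurable: it is a limit of difference quotients. -/
lemma measurable_derivWithin_param {α : Type*} [MeasurableSpace α] {u : α → ℝ → ℂ} {a b : ℝ}
    (hu : Measurable (fun p : α × ℝ => u p.1 p.2)) (hd : ∀ x, DifferentiableOn ℝ (u x) (Icc a b)) :
    Measurable (fun p : α × ℝ => (Ioo a b).indicator (fun r => derivWithin (u p.1) (Icc a b) r) p.2) := by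
  set F : ℕ → α × ℝ → ℂ := fun n p =>
    ((univ : Set α) ×ˢ Ioo a b).indicator (fun p => ((n : ℂ) + 1) *
      (u p.1 (p.2 + ((n : ℝ) + 1)⁻¹) - u p.1 p.2)) p with hF
  have hFm : ∀ n, Measurable (F n) := by
    intro n
    refine Measurable.indicator ?_ (MeasurableSet.univ.prod measurableSet_Ioo)
    refine measurable_const.mul (Measurable.sub ?_ hu)
    exact hu.comp (measurable_fst.prodMk (measurable_snd.add_const _))
  refine measurable_of_tendsto_metrizable hFm (tendsto_pi_nhds.2 fun p => ?_)
  by_cases hp : p.2 ∈ Ioo a b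
  · have hmem : p ∈ (univ : Set α) ×ˢ Ioo a b := ⟨mem_univ _, hp⟩
    simp only [hF, indicator_of_mem hp, indicator_of_mem hmem]
    have hn : Icc a b ∈ nhds p.2 := Icc_mem_nhds hp.1 hp.2
    have h1 : HasDerivAt (u p.1) (derivWithin (u p.1) (Icc a b) p.2) p.2 :=
      ((hd p.1 p.2 (Ioo_subset_Icc_self hp)).hasDerivWithinAt).hasDerivAt hn
    have h2 := h1.tendsto_slope
    have h3 : Filter.Tendsto (fun n : ℕ => p.2 + ((n : ℝ) + 1)⁻¹) Filter.atTop
        (nhdsWithin p.2 {p.2}ᶜ) := by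
      refine tendsto_nhdsWithin_iff.2 ⟨?_, Filter.Eventually.of_forall fun n => ?_⟩
      · have h4 : Filter.Tendsto (fun n : ℕ => ((n : ℝ) + 1)⁻¹) Filter.atTop (nhds 0) := by
          have := tendsto_one_div_add_atTop_nhds_zero_nat (𝕜 := ℝ)
          simpa only [one_div] using this
        simpa using h4.const_add p.2
      · have : (0 : ℝ) < ((n : ℝ) + 1)⁻¹ := by positivity
        simp only [mem_compl_iff, mem_singleton_iff]
        linarith
    refine (h2.comp h3).congr fun n => ?_
    simp only [Function.comp, slope_def_module, add_sub_cancel_left, inv_inv]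
    rw [Complex.real_smul]
    push_cast
    ring
  · have hmem : p ∉ (univ : Set α) ×ˢ Ioo a b := fun h => hp h.2
    simp only [hF, indicator_of_notMem hp, indicator_of_notMem hmem]
    exact tendsto_const_nhds

/-- The decay rate `⟨t⟩^{-1+2δ}`. -/
noncomputable def drift (t : ℝ) : ℝ := (jap t ^ (1 - 2 * del))⁻¹

/-- The rate `min(⟨t⟩^δ, 2^{-k} ⟨t⟩^{-1+2δ})` of the oscillatory part at frequency `2^k`. -/
noncomputable def oscRate (k : ℤ) (t : ℝ) : ℝ := min (jap t ^ del) (((2 : ℝ) ^ k)⁻¹ * drift t)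

lemma drift_pos (t : ℝ) : 0 < drift t := inv_pos.2 (Real.rpow_pos_of_pos (jap_pos t) _)

lemma oscRate_pos (k : ℤ) (t : ℝ) : 0 < oscRate k t :=
  lt_min (Real.rpow_pos_of_pos (jap_pos t) _) (mul_pos (inv_pos.2 (zpow_two_pos k)) (drift_pos t))

/-- A function of time and space, with time derivative `g'` in the interior of `[0,T]`, and bounds
for both. -/
structure OscPiece (T : ℝ) (β β' : ℝ → ℝ) (g g' : ℝ → E3 → ℂ) : Prop where
  meas : Measurable (fun p : ℝ × E3 => g p.1 p.2)
  meas' : Measurable (fun p : ℝ × E3 => g' p.1 p.2)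
  bn : ∀ t ∈ Icc 0 T, Bn t (β t) (g t)
  bn' : ∀ t ∈ Ioo 0 T, Bn t (β' t) (g' t)
  cont : ∀ x, ContinuousOn (fun t => g t x) (Icc 0 T)
  deriv : ∀ x, ∀ t ∈ Ioo 0 T, HasDerivAt (fun r => g r x) (g' t x) t

lemma Bn.conj {t β : ℝ} {h : E3 → ℂ} (H : Bn t β h) :
    Bn t β (fun x => (starRingEnd ℂ) (h x)) := by
  refine ⟨Complex.continuous_conj.measurable.comp H.meas, ?_, ?_⟩
  · refine le_trans (le_of_eq ?_) H.int
    congr 1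
    ext x
    rw [← ofReal_norm, ← ofReal_norm, Complex.norm_conj]
  · filter_upwards [H.sup] with x hx
    rwa [Complex.norm_conj]

lemma OscPiece.conj {T : ℝ} {β β' : ℝ → ℝ} {g g' : ℝ → E3 → ℂ} (H : OscPiece T β β' g g') :
    OscPiece T β β' (fun t x => (starRingEnd ℂ) (g t x)) (fun t x => (starRingEnd ℂ) (g' t x)) :=
  ⟨Complex.continuous_conj.measurable.comp H.meas, Complex.continuous_conj.measurable.comp H.meas',
    fun t ht => (H.bn t ht).conj, fun t ht => (H.bn' t ht).conj,
    fun x => Complex.continuous_conj.comp_continuousOn (H.cont x),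
    fun x t ht => (H.deriv x t ht).star⟩

lemma conj_ker_one (φ : ℝ → ℝ) (k : ℤ) (x : E3) :
    (starRingEnd ℂ) (ker φ k (fun _ => 1) x) = ker φ k (fun _ => 1) x := by
  rw [ker, invFourier, map_mul, map_inv₀, Complex.conj_ofReal, ← integral_conj]
  congr 1
  rw [← integral_neg_eq_self]
  congr 1
  ext ξ
  rw [map_mul, map_mul, ← Complex.exp_conj, map_mul, Complex.conj_I, Complex.conj_ofReal,
    Complex.conj_ofReal, map_one, inner_neg_right, phiK, phiK, norm_neg]
  push_cast
  ring_nf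

lemma conj_lpProj (φ : ℝ → ℝ) (k : ℤ) (h : E3 → ℂ) (x : E3) :
    (starRingEnd ℂ) (lpProj φ k h x) = lpProj φ k (fun y => (starRingEnd ℂ) (h y)) x := by
  change (starRingEnd ℂ) (∫ y, ker φ k (fun _ => 1) (x - y) * h y) =
    ∫ y, ker φ k (fun _ => 1) (x - y) * (starRingEnd ℂ) (h y)
  rw [← integral_conj]
  congr 1
  ext y
  rw [map_mul, conj_ker_one]

/-- The decomposition of the projections of the density into stationary and oscillatory parts. -/
lemma lpProj_decomp {φ : ℝ → ℝ} (hφ : IsCutoff φ) (k : ℤ) {r : E3 → ℝ} {σ : E3 → ℝ} {o : E3 → ℂ}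
    (hσ : Continuous σ) (ho : Continuous o) {B B' : ℝ} (hB : ∀ x, |σ x| ≤ B)
    (hB' : ∀ x, ‖o x‖ ≤ B') (t : ℝ)
    (e : ∀ x, r x = σ x + (Complex.exp (-(Complex.I * (t : ℂ))) * o x).re) (x : E3) :
    lpProj φ k (fun y => (r y : ℂ)) x = lpProj φ k (fun y => (σ y : ℂ)) x +
      (Complex.exp (-(Complex.I * (t : ℂ))) / 2 * lpProj φ k o x +
      Complex.exp (Complex.I * (t : ℂ)) / 2 * (starRingEnd ℂ) (lpProj φ k o x)) := by
  obtain ⟨b, hb⟩ := exists_ker_of_contDiffOn hφ (R := fun _ => 1) contDiffOn_const k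
  rw [conj_lpProj]
  have hi : ∀ {h : E3 → ℂ}, Continuous h → ∀ {B : ℝ}, (∀ x, ‖h x‖ ≤ B) →
      Integrable (fun y => ker φ k (fun _ => 1) (x - y) * h y) := fun hc _ hB =>
    integrable_cv hb.integrable hc.aestronglyMeasurable (Filter.Eventually.of_forall hB) x
  have i1 := hi (Complex.continuous_ofReal.comp hσ) (B := B) (fun x => by
    rw [Function.comp, Complex.norm_real]; exact hB x)
  have i2 := (hi ho hB').const_mul (Complex.exp (-(Complex.I * (t : ℂ))) / 2)
  have i3 := (hi (Complex.continuous_conj.comp ho) (B := B') (fun x => by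
    rw [Function.comp, Complex.norm_conj]; exact hB' x)).const_mul
      (Complex.exp (Complex.I * (t : ℂ)) / 2)
  change (∫ y, ker φ k (fun _ => 1) (x - y) * (r y : ℂ)) =
    (∫ y, ker φ k (fun _ => 1) (x - y) * (σ y : ℂ)) +
    (_ * (∫ y, ker φ k (fun _ => 1) (x - y) * o y) +
    _ * ∫ y, ker φ k (fun _ => 1) (x - y) * (starRingEnd ℂ) (o y))
  rw [← integral_const_mul, ← integral_const_mul]
  refine Eq.trans ?_ ((integral_add i1 (i2.add i3)).trans (congrArg _ (integral_add i2 i3)))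
  congr 1
  ext y
  simp only [Pi.add_apply, Function.comp]
  rw [e y, Complex.ofReal_add, Complex.re_eq_add_conj, map_mul, ← Complex.exp_conj, map_neg, map_mul,
    Complex.conj_I, Complex.conj_ofReal, neg_mul, neg_neg]
  ring

lemma measurable_derivWithin_param_swap {α : Type*} [MeasurableSpace α] {u : ℝ → α → ℂ} {a b : ℝ}
    (hu : Measurable (fun p : ℝ × α => u p.1 p.2))
    (hd : ∀ x, DifferentiableOn ℝ (fun t => u t x) (Icc a b)) :
    Measurable (fun p : ℝ × α =>
      (Ioo a b).indicator (fun r => derivWithin (fun t => u t p.2) (Icc a b) r) p.1) := by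
  have h1 : Measurable (fun p : α × ℝ => u p.2 p.1) := hu.comp measurable_swap
  exact (measurable_derivWithin_param (u := fun x t => u t x) h1 hd).comp measurable_swap

/-- Bounds for the stationary and oscillatory dyadic pieces of the density. The weight `⟨∇⟩` in the
stationary norm turns into `(1 + 2^k)⁻¹`, and the two parts of the oscillatory norm give the two
members of the minimum in `oscRate`. -/
lemma exists_pieces {φ : ℝ → ℝ} (hφ : IsCutoff φ) : ∃ C : ℝ, 0 < C ∧
    ∀ (T ε₀ ε₁ : ℝ) (f : ℝ → E3 → E3 → ℝ) (ρstat : ℝ → E3 → ℝ) (ρosc : ℝ → E3 → ℂ), 0 < T →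
      Bootstrap φ T ε₀ ε₁ f ρstat ρosc → ∃ S g g' : ℤ → ℝ → E3 → ℂ,
        (∀ k, Measurable (fun p : ℝ × E3 => S k p.1 p.2)) ∧
        (∀ k, ∀ t ∈ Icc 0 T, Bn t (C * ε₁ * ((1 + (2 : ℝ) ^ k)⁻¹ * drift t)) (S k t)) ∧
        (∀ k, OscPiece T (fun t => C * ε₁ * oscRate k t) (fun t => C * ε₁ * drift t) (g k) (g' k)) ∧
        ∀ k, ∀ t ∈ Icc 0 T, ∀ x, lpProj φ k (fun y => (density f t y : ℂ)) x = S k t x +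
          (Complex.exp (-(Complex.I * (t : ℂ))) / 2 * g k t x +
            Complex.exp (Complex.I * (t : ℂ)) / 2 * (starRingEnd ℂ) (g k t x)) := by
  obtain ⟨C₁, hC₁, H₁⟩ := exists_bn_of_jap hφ
  obtain ⟨C₂, hC₂, H₂⟩ := exists_bn_of_grad hφ
  refine ⟨C₁ + C₂ + 1, by positivity, fun T ε₀ ε₁ f ρstat ρosc hT hb => ?_⟩
  have hε := hb.eps_pos
  have hker : ∀ k, Measurable (ker φ k (fun _ => 1)) := fun k => by
    obtain ⟨b, hb⟩ := exists_ker_of_contDiffOn hφ (R := fun _ => 1) contDiffOn_const k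
    exact hb.cont.measurable
  -- outside `[0,T]` the functions are continued as constants, which makes them jointly measurable
  have hsc := continuous_clamped hT.le hb.stat_cont
  have hoc := continuous_clamped hT.le hb.osc_cont
  have hsl : ∀ t ∈ Icc 0 T, Continuous (ρstat t) := fun t ht => by
    have h1 : Continuous fun x : E3 => (t, x) := by fun_prop
    have h2 := hsc.comp h1
    simpa only [Function.comp_def, clamp_eq ht] using h2
  have hol : ∀ t ∈ Icc 0 T, Continuous (ρosc t) := fun t ht => by
    have h1 : Continuous fun x : E3 => (t, x) := by fun_prop
    have h2 := hoc.comp h1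
    simpa only [Function.comp_def, clamp_eq ht] using h2
  have hmS : ∀ k, Measurable (fun p : ℝ × E3 =>
      lpProj φ k (fun y => (ρstat (clamp T p.1) y : ℂ)) p.2) := fun k =>
    measurable_cv_param (hker k) (h := fun t y => (ρstat (clamp T t) y : ℂ))
      (Complex.continuous_ofReal.comp hsc).measurable
  have hmO : ∀ k, Measurable (fun p : ℝ × E3 => lpProj φ k (ρosc (clamp T p.1)) p.2) := fun k =>
    measurable_cv_param (hker k) (h := fun t y => ρosc (clamp T t) y) hoc.measurable
  have hdiff : ∀ k x, DifferentiableOn ℝ (fun t => lpProj φ k (ρosc (clamp T t)) x) (Icc 0 T) :=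
    fun k x => (hb.osc_diff k x).congr fun t ht => by rw [clamp_eq ht]
  have hmD : ∀ k, Measurable (fun p : ℝ × E3 => (Ioo 0 T).indicator (fun r =>
      derivWithin (fun t => lpProj φ k (ρosc (clamp T t)) p.2) (Icc 0 T) r) p.1) := fun k =>
    measurable_derivWithin_param_swap (u := fun t (x : E3) => lpProj φ k (ρosc (clamp T t)) x)
      (hmO k) (hdiff k)
  -- the three parts of the norm that the hypothesis bounds, at one time
  have hn1 : ∀ t ∈ Icc 0 T, ENNReal.ofReal (jap t ^ (1 - 2 * del)) *
      besovSup t (fun k => dyadicOp φ k (fun ξ => (jap ‖ξ‖ : ℂ)) (fun x => (ρstat t x : ℂ))) ≤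
      ENNReal.ofReal ε₁ := fun t ht =>
    (le_iSup₂ (f := fun (t : ℝ) (_ : t ∈ Icc 0 T) => ENNReal.ofReal (jap t ^ (1 - 2 * del)) *
      besovSup t (fun k => dyadicOp φ k (fun ξ => (jap ‖ξ‖ : ℂ)) (fun x => (ρstat t x : ℂ)))) t ht).trans
      (le_self_add.trans hb.norm_le)
  have hn2 : ∀ t ∈ Icc 0 T, ENNReal.ofReal (jap t ^ (-del)) *
      besovSup t (fun k => lpProj φ k (ρosc t)) ≤ ENNReal.ofReal ε₁ := fun t ht =>
    (le_iSup₂ (f := fun (t : ℝ) (_ : t ∈ Icc 0 T) => ENNReal.ofReal (jap t ^ (-del)) *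
      besovSup t (fun k => lpProj φ k (ρosc t))) t ht).trans
      (le_self_add.trans (le_add_self.trans hb.norm_le))
  have hn3 : ∀ t ∈ Icc 0 T, ENNReal.ofReal (jap t ^ (1 - 2 * del)) *
      besovSup t (fun k => gradXT φ T ρosc k t) ≤ ENNReal.ofReal ε₁ := fun t ht =>
    (le_iSup₂ (f := fun (t : ℝ) (_ : t ∈ Icc 0 T) => ENNReal.ofReal (jap t ^ (1 - 2 * del)) *
      besovSup t (fun k => gradXT φ T ρosc k t)) t ht).trans
      (le_add_self.trans (le_add_self.trans hb.norm_le))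
  have hrp : ∀ t r : ℝ, 0 < jap t ^ r := fun t r => Real.rpow_pos_of_pos (jap_pos t) r
  have hSb : ∀ k, ∀ t ∈ Icc 0 T, Bn t ((C₁ + C₂ + 1) * ε₁ * ((1 + (2 : ℝ) ^ k)⁻¹ * drift t))
      (lpProj φ k (fun y => (ρstat t y : ℂ))) := by
    intro k t ht
    obtain ⟨B, hB⟩ := hb.stat_bdd t ht
    obtain ⟨i1, i2⟩ := besov_bound (hrp t _) hε.le (hn1 t ht) k
    obtain ⟨b, hbk⟩ := exists_ker_of_contDiffOn hφ
      (contDiff_jap.of_le (by norm_cast)).contDiffOn (R := fun ξ => (jap ‖ξ‖ : ℂ)) k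
    have hm : Measurable (fun y => (ρstat t y : ℂ)) :=
      (Complex.continuous_ofReal.comp (hsl t ht)).measurable
    refine (H₁ k t _ B _ hm.aestronglyMeasurable (fun x => ?_)
      ⟨measurable_cv hbk.cont.measurable hm, i1, i2⟩).mono ?_
    · rw [Complex.norm_real]; exact hB x
    · have := zpow_two_pos k
      have h1 := drift_pos t
      rw [div_eq_mul_inv]
      change _ * (ε₁ * drift t) ≤ _
      calc _ = C₁ * ε₁ * ((1 + (2 : ℝ) ^ k)⁻¹ * drift t) := by ring
        _ ≤ _ := by gcongr; linarith
  have hpdm : ∀ k t a, Measurable (pd a (lpProj φ k (ρosc t))) := fun k t a =>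
    measurable_fderiv_apply_const ℝ _ (basisVec a)
  have hgO : ∀ k, OscPiece T (fun t => (C₁ + C₂ + 1) * ε₁ * oscRate k t)
      (fun t => (C₁ + C₂ + 1) * ε₁ * drift t) (fun t => lpProj φ k (ρosc (clamp T t)))
      (fun t x => (Ioo 0 T).indicator (fun r =>
        derivWithin (fun t => lpProj φ k (ρosc (clamp T t)) x) (Icc 0 T) r) t) := by
    intro k
    -- the gradient in space and time dominates each of its components
    have hgr : ∀ t ∈ Icc 0 T, ∀ h : E3 → ℂ, Measurable h → (∀ x, ‖h x‖ ≤ gradXT φ T ρosc k t x) →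
        Bn t (ε₁ * drift t) h := by
      intro t ht h hm hle
      obtain ⟨i1, i2⟩ := besov_bound (hrp t _) hε.le (hn3 t ht) k
      have hle' : ∀ x, ‖h x‖ ≤ ‖gradXT φ T ρosc k t x‖ := fun x =>
        (hle x).trans (le_abs_self _)
      refine ⟨hm, le_trans (lintegral_mono fun x => ?_) i1, ?_⟩
      · exact enorm_le_iff_norm_le.2 (hle' x)
      · filter_upwards [i2] with x hx
        exact (hle' x).trans hx
    refine ⟨hmO k, hmD k, fun t ht => ?_, fun t ht => ?_, fun x => (hdiff k x).continuousOn,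
      fun x t ht => ?_⟩
    · obtain ⟨B, hB⟩ := hb.osc_bdd t ht
      rw [clamp_eq ht]
      obtain ⟨i1, i2⟩ := besov_bound (hrp t _) hε.le (hn2 t ht) k
      have b1 : Bn t (ε₁ / jap t ^ (-del)) (lpProj φ k (ρosc t)) :=
        ⟨measurable_cv (hker k) (hol t ht).measurable, i1, i2⟩
      have b2 := H₂ k t (ε₁ * drift t) B (ρosc t) (hol t ht).aestronglyMeasurable hB fun a =>
        hgr t ht _ (hpdm k t a) fun x => by
          apply Real.le_sqrt_of_sq_le
          have := Finset.single_le_sum (f := fun a => ‖pd a (lpProj φ k (ρosc t)) x‖ ^ 2)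
            (fun i _ => sq_nonneg _) (Finset.mem_univ a)
          have h2 := sq_nonneg ‖derivWithin (fun r => lpProj φ k (ρosc r) x) (Icc 0 T) t‖
          linarith
      have h1 := drift_pos t
      have hk := zpow_two_pos k
      rw [Real.rpow_neg (jap_pos t).le, div_inv_eq_mul] at b1
      unfold oscRate
      have hj := hrp t del
      rcases min_choice (jap t ^ del) (((2 : ℝ) ^ k)⁻¹ * drift t) with h | h <;> rw [h]
      · refine b1.mono ?_
        calc _ = 1 * ε₁ * jap t ^ del := by ring
          _ ≤ _ := by gcongr; linarith
      · refine b2.mono ?_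
        calc _ = C₂ * ε₁ * (((2 : ℝ) ^ k)⁻¹ * drift t) := by ring
          _ ≤ _ := by gcongr; linarith
    · have ht' := Ioo_subset_Icc_self ht
      have hm : Measurable fun x : E3 => (Ioo 0 T).indicator (fun r =>
          derivWithin (fun t => lpProj φ k (ρosc (clamp T t)) x) (Icc 0 T) r) t :=
        (hmD k).comp measurable_prodMk_left
      refine (hgr t ht' _ hm fun x => ?_).mono ?_
      · rw [indicator_of_mem ht]
        apply Real.le_sqrt_of_sq_le
        have : 0 ≤ ∑ a : Fin 3, ‖pd a (lpProj φ k (ρosc t)) x‖ ^ 2 :=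
          Finset.sum_nonneg fun a _ => sq_nonneg _
        have e : derivWithin (fun t => lpProj φ k (ρosc (clamp T t)) x) (Icc 0 T) t =
            derivWithin (fun t => lpProj φ k (ρosc t) x) (Icc 0 T) t :=
          derivWithin_congr (fun r hr => by rw [clamp_eq hr]) (by rw [clamp_eq ht'])
        rw [e]
        linarith
      · have h1 := drift_pos t
        calc _ = 1 * ε₁ * drift t := by ring
          _ ≤ _ := by gcongr; linarith
    · rw [indicator_of_mem ht]
      exact ((hdiff k x t (Ioo_subset_Icc_self ht)).hasDerivWithinAt).hasDerivAt
        (Icc_mem_nhds ht.1 ht.2)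
  refine ⟨fun k t => lpProj φ k (fun y => (ρstat (clamp T t) y : ℂ)),
    fun k t => lpProj φ k (ρosc (clamp T t)), fun k t x => (Ioo 0 T).indicator (fun r =>
      derivWithin (fun t => lpProj φ k (ρosc (clamp T t)) x) (Icc 0 T) r) t, hmS, fun k t ht => ?_,
    hgO, fun k t ht x => ?_⟩
  · beta_reduce
    rw [clamp_eq ht]
    exact hSb k t ht
  · obtain ⟨B, hB⟩ := hb.stat_bdd t ht
    obtain ⟨B', hB'⟩ := hb.osc_bdd t ht
    beta_reduce
    rw [clamp_eq ht]
    exact lpProj_decomp hφ k (hsl t ht) (hol t ht) hB hB' t (hb.decomp t ht) x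

/-! ### Velocity weights, characteristics and bilinear bounds -/

/-- The region of velocities in which `φ̃_{[j-4,j+4]}` is supported. -/
def win (j : ℕ) : Set E3 := {v | ‖v‖ ≤ 2 ^ (j + 5) ∧ (6 ≤ j → (2 : ℝ) ^ (j - 5) ≤ ‖v‖)}

/-- The velocity weight `9 · 2^{-3j}` in the window `win j`, which dominates the velocity factor of
the kernels. -/
noncomputable def wt (j : ℕ) (v : E3) : ℝ≥0∞ :=
  (win j).indicator (fun _ => ENNReal.ofReal (9 * ((2 : ℝ) ^ (3 * j))⁻¹)) v

lemma measurableSet_win (j : ℕ) : MeasurableSet (win j) := by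
  have h1 : MeasurableSet {v : E3 | ‖v‖ ≤ 2 ^ (j + 5)} :=
    measurableSet_le measurable_norm measurable_const
  have h2 : MeasurableSet {v : E3 | 6 ≤ j → (2 : ℝ) ^ (j - 5) ≤ ‖v‖} := by
    by_cases h : 6 ≤ j
    · simp only [h, true_imp_iff]
      exact measurableSet_le measurable_const measurable_norm
    · simp [h]
  exact h1.inter h2

lemma measurable_wt (j : ℕ) : Measurable (wt j) := measurable_const.indicator (measurableSet_win j)

lemma wt_le (j : ℕ) (v : E3) : wt j v ≤ ENNReal.ofReal 9 := by
  refine (indicator_le_self' (fun _ _ => zero_le) v).trans (ENNReal.ofReal_le_ofReal ?_)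
  exact mul_le_of_le_one_right (by norm_num) (inv_le_one_of_one_le₀ (one_le_pow₀ one_le_two))

/-- A bound for the total mass of the velocity weights. -/
noncomputable def wtMass : ℝ := 9 * 2 ^ 15 * volume.real (Metric.ball (0 : E3) 1)

lemma wtMass_nonneg : 0 ≤ wtMass := by unfold wtMass; positivity

lemma lintegral_wt_le (j : ℕ) : ∫⁻ v, wt j v ≤ ENNReal.ofReal wtMass := by
  unfold wt
  rw [lintegral_indicator (measurableSet_win j), setLIntegral_const]
  have h1 : volume (win j) ≤ ENNReal.ofReal (((2 : ℝ) ^ (j + 5)) ^ 3) * volume (Metric.ball (0 : E3) 1) := by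
    have h2 := Measure.addHaar_closedBall (volume : Measure E3) (0 : E3)
      (r := (2 : ℝ) ^ (j + 5)) (by positivity)
    rw [finrank_E3] at h2
    rw [← h2]
    refine measure_mono fun v hv => ?_
    simpa using hv.1
  refine (mul_le_mul_right h1 _).trans (le_of_eq ?_)
  rw [← mul_assoc, ← ENNReal.ofReal_mul (by positivity), wtMass,
    ENNReal.ofReal_mul (p := 9 * 2 ^ 15) (by positivity), measureReal_def,
    ENNReal.ofReal_toReal measure_ball_lt_top.ne]
  congr 2
  field_simp
  ring

lemma abs_phiT_le {φ : ℝ → ℝ} (hφ : IsCutoff φ) (i : ℕ) (v : E3) : |phiT φ i v| ≤ 1 := by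
  unfold phiT phiK
  split_ifs
  · have := hφ.mem_unit ‖v‖
    rw [abs_le]
    constructor <;> linarith [this.1, this.2]
  · have h1 := hφ.mem_unit (‖v‖ / (2 : ℝ) ^ (i : ℤ))
    have h2 := hφ.mem_unit (‖v‖ / (2 : ℝ) ^ ((i : ℤ) - 1))
    rw [abs_le]
    constructor <;> linarith [h1.1, h1.2, h2.1, h2.2]

lemma phiT_support {φ : ℝ → ℝ} (hφ : IsCutoff φ) {i : ℕ} {v : E3} (h : phiT φ i v ≠ 0) :
    ‖v‖ ≤ 2 ^ (i + 1) ∧ (1 ≤ i → 5 / 8 * (2 : ℝ) ^ i ≤ ‖v‖) := by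
  unfold phiT at h
  split_ifs at h with hi
  · subst hi
    refine ⟨?_, fun h => by omega⟩
    by_contra h'
    exact h (hφ.eq_zero (by norm_num at h' ⊢; linarith))
  · rw [phiK_eq] at h
    have h2 := zpow_two_pos i
    have e : ‖((2 : ℝ) ^ (i : ℤ))⁻¹ • v‖ = ‖v‖ / 2 ^ i := by
      rw [norm_smul, norm_inv, Real.norm_of_nonneg h2.le, zpow_natCast, div_eq_inv_mul]
    have hp : (0 : ℝ) < 2 ^ i := by positivity
    constructor
    · by_contra h'
      refine h (phiK_zero_of_large hφ ?_)
      rw [e, lt_div_iff₀ hp]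
      rw [pow_succ] at h'
      linarith
    · intro _
      by_contra h'
      refine h (phiK_zero_of_small hφ ?_)
      rw [e, div_le_iff₀ hp]
      linarith

lemma abs_window_le {φ : ℝ → ℝ} (hφ : IsCutoff φ) (j : ℕ) (v : E3) :
    |phiTWindow φ j v| ≤ (win j).indicator (fun _ => 9) v := by
  by_cases hv : v ∈ win j
  · rw [indicator_of_mem hv]
    unfold phiTWindow
    refine (Finset.abs_sum_le_sum_abs _ _).trans ?_
    refine (Finset.sum_le_card_nsmul _ _ 1 fun i _ => abs_phiT_le hφ i v).trans ?_
    rw [nsmul_eq_mul, mul_one, Nat.card_Icc]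
    have : j + 4 + 1 - (j - 4) ≤ 9 := by omega
    exact_mod_cast this
  · rw [indicator_of_notMem hv]
    unfold phiTWindow
    rw [Finset.sum_eq_zero, abs_zero]
    intro i hi
    by_contra h
    rw [Finset.mem_Icc] at hi
    obtain ⟨h1, h2⟩ := phiT_support hφ h
    refine hv ⟨h1.trans (pow_le_pow_right₀ one_le_two (by omega)), fun hj => ?_⟩
    refine le_trans ?_ (h2 (by omega))
    have h3 : (2 : ℝ) ^ (j - 4) ≤ 2 ^ i := pow_le_pow_right₀ one_le_two (by omega)
    have h4 : (2 : ℝ) ^ (j - 4) = 2 ^ (j - 5) * 2 := by rw [← pow_succ]; congr 1; omega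
    have : (0 : ℝ) < 2 ^ (j - 5) := by positivity
    linarith

lemma Admissible.enorm_K_le {φ : ℝ → ℝ} (hφ : IsCutoff φ) {A ε₁ s : ℝ} (hA : 0 < A) {j : ℕ} {k : ℤ}
    {K : E3 → E3 → ℂ} {P₁ : E3 → E3 → E3} {P₂ : E3 → E3 → ℝ → E3}
    (H : Admissible φ A ε₁ s j k K P₁ P₂) (y v : E3) :
    ‖K y v‖ₑ ≤ ENNReal.ofReal (A * bump k y) * wt j v := by
  have hk := zpow_two_pos k
  have hk3 := zpow_two_pos (3 * k)
  have hb := bump_pos k y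
  have h1 : ‖K y v‖ ≤ A * bump k y * (((2 : ℝ) ^ (3 * j))⁻¹ * |phiTWindow φ j v|) := by
    refine (H.K_bound y v).trans ?_
    rw [mul_assoc A]
    refine mul_le_mul_of_nonneg_left ?_ hA.le
    have h2 : (2 : ℝ) ^ (3 * k) * ((1 + (2 : ℝ) ^ k * ‖y‖) ^ 8)⁻¹ ≤ bump k y := by
      unfold bump
      have h3 : 0 ≤ (2 : ℝ) ^ k * ‖y‖ := by positivity
      have h4 : (1 + (2 : ℝ) ^ k * ‖y‖) ^ 4 ≤ (1 + (2 : ℝ) ^ k * ‖y‖) ^ 8 :=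
        pow_le_pow_right₀ (by linarith) (by norm_num)
      gcongr
    calc _ ≤ (2 : ℝ) ^ (3 * k) * ((1 + (2 : ℝ) ^ k * ‖y‖) ^ 8)⁻¹ *
          (((2 : ℝ) ^ (3 * j))⁻¹ * |phiTWindow φ j v|) := by gcongr; exact le_abs_self _
      _ ≤ _ := by gcongr
  have h3 := abs_window_le hφ j v
  by_cases hv : v ∈ win j
  · rw [indicator_of_mem hv] at h3
    rw [wt, indicator_of_mem hv, ← ENNReal.ofReal_mul (by positivity), ← ofReal_norm]
    refine ENNReal.ofReal_le_ofReal (h1.trans ?_)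
    rw [mul_comm 9]
    gcongr
  · rw [indicator_of_notMem hv] at h3
    have h4 : |phiTWindow φ j v| = 0 := le_antisymm h3 (abs_nonneg _)
    rw [h4, mul_zero, mul_zero] at h1
    rw [norm_le_zero_iff.1 h1]
    simp

/-- `H` is bounded by `β` in the norm `‖·‖_{L¹_{y,v}} + ⟨s⟩³ ‖·‖_{L^∞_y L¹_v}` with the velocity
weight of index `j`; this is the quantity that controls the operators. -/
def TB (s : ℝ) (j : ℕ) (β : ℝ≥0∞) (H : E3 → E3 → ℝ≥0∞) : Prop :=
  (∫⁻ y, ∫⁻ v, wt j v * H y v ≤ β) ∧ ∀ y, ENNReal.ofReal (jap s ^ 3) * ∫⁻ v, wt j v * H y v ≤ β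

lemma TB.mono {s : ℝ} {j : ℕ} {β β' : ℝ≥0∞} {H H' : E3 → E3 → ℝ≥0∞} (h : TB s j β H)
    (hβ : β ≤ β') (hH : ∀ y, ∀ v ∈ win j, H' y v ≤ H y v) : TB s j β' H' := by
  have h1 : ∀ y v, wt j v * H' y v ≤ wt j v * H y v := by
    intro y v
    by_cases hv : v ∈ win j
    · exact mul_le_mul_right (hH y v hv) _
    · simp [wt, indicator_of_notMem hv]
  refine ⟨le_trans (lintegral_mono fun y => lintegral_mono fun v => h1 y v) (h.1.trans hβ),
    fun y => ?_⟩
  exact le_trans (mul_le_mul_right (lintegral_mono fun v => h1 y v) _) ((h.2 y).trans hβ)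

lemma measurable_wt_mul {j : ℕ} {H : E3 → E3 → ℝ≥0∞} (hH : Measurable (fun p : E3 × E3 => H p.1 p.2)) :
    Measurable (fun p : E3 × E3 => wt j p.2 * H p.1 p.2) :=
  ((measurable_wt j).comp measurable_snd).mul hH

lemma TB.const_mul {s : ℝ} {j : ℕ} {β : ℝ≥0∞} {H : E3 → E3 → ℝ≥0∞} (h : TB s j β H) {c : ℝ≥0∞}
    (hc : c ≠ ⊤) : TB s j (c * β) (fun y v => c * H y v) := by
  have e : ∀ y, ∫⁻ v, wt j v * (c * H y v) = c * ∫⁻ v, wt j v * H y v := by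
    intro y
    rw [← lintegral_const_mul' _ _ hc]
    congr 1
    ext v
    ring
  constructor
  · simp_rw [e]
    rw [lintegral_const_mul' _ _ hc]
    exact mul_le_mul_right h.1 _
  · intro y
    rw [e, mul_left_comm]
    exact mul_le_mul_right (h.2 y) _

lemma TB.add {s : ℝ} {j : ℕ} {β β' : ℝ≥0∞} {H H' : E3 → E3 → ℝ≥0∞} (h : TB s j β H)
    (h' : TB s j β' H') (hm : Measurable (fun p : E3 × E3 => H p.1 p.2)) :
    TB s j (β + β') (fun y v => H y v + H' y v) := by
  have hm' := measurable_wt_mul (j := j) hm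
  have e : ∀ y, ∫⁻ v, wt j v * (H y v + H' y v) = (∫⁻ v, wt j v * H y v) + ∫⁻ v, wt j v * H' y v := by
    intro y
    simp_rw [mul_add]
    exact lintegral_add_left (hm'.comp measurable_prodMk_left) _
  constructor
  · simp_rw [e]
    rw [lintegral_add_left hm'.lintegral_prod_right']
    exact add_le_add h.1 h'.1
  · intro y
    rw [e, mul_add]
    exact add_le_add (h.2 y) (h'.2 y)

lemma TB.tsum {ι : Type*} [Countable ι] {s : ℝ} {j : ℕ} {β : ι → ℝ≥0∞} {H : ι → E3 → E3 → ℝ≥0∞}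
    (h : ∀ i, TB s j (β i) (H i)) (hm : ∀ i, Measurable (fun p : E3 × E3 => H i p.1 p.2)) :
    TB s j (∑' i, β i) (fun y v => ∑' i, H i y v) := by
  have hm' := fun i => measurable_wt_mul (j := j) (hm i)
  have e : ∀ y, ∫⁻ v, wt j v * ∑' i, H i y v = ∑' i, ∫⁻ v, wt j v * H i y v := by
    intro y
    simp_rw [← ENNReal.tsum_mul_left]
    exact lintegral_tsum fun i => ((hm' i).comp measurable_prodMk_left).aemeasurable
  constructor
  · simp_rw [e]
    rw [lintegral_tsum fun i => (hm' i).lintegral_prod_right'.aemeasurable]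
    exact ENNReal.tsum_le_tsum fun i => (h i).1
  · intro y
    rw [e, ← ENNReal.tsum_mul_left]
    exact ENNReal.tsum_le_tsum fun i => (h i).2 y

lemma lintegral_swap_param {G : ℝ → E3 → E3 → ℝ≥0∞} (S : Set ℝ)
    (hm : Measurable (fun p : ℝ × E3 × E3 => G p.1 p.2.1 p.2.2)) :
    (∀ y, ∫⁻ v, ∫⁻ γ in S, G γ y v = ∫⁻ γ in S, ∫⁻ v, G γ y v) ∧
      Measurable (fun p : ℝ × E3 => ∫⁻ v, G p.1 p.2 v) := by
  constructor
  · intro y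
    have hp : Measurable (fun q : E3 × ℝ => (q.2, y, q.1)) := by fun_prop
    rw [lintegral_lintegral_swap]
    exact (hm.comp hp).aemeasurable
  · have hp : Measurable (fun q : (ℝ × E3) × E3 => (q.1.1, q.1.2, q.2)) := by fun_prop
    have : Measurable (fun q : (ℝ × E3) × E3 => G q.1.1 q.1.2 q.2) := hm.comp hp
    exact this.lintegral_prod_right'

lemma TB.setLIntegral {s : ℝ} {j : ℕ} {β : ℝ≥0∞} {H : ℝ → E3 → E3 → ℝ≥0∞} {S : Set ℝ}
    (hS : MeasurableSet S) (h : ∀ γ ∈ S, TB s j β (H γ))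
    (hm : Measurable (fun p : ℝ × E3 × E3 => H p.1 p.2.1 p.2.2)) :
    TB s j (volume S * β) (fun y v => ∫⁻ γ in S, H γ y v) := by
  have hw : Measurable (fun p : ℝ × E3 × E3 => wt j p.2.2) :=
    (measurable_wt j).comp (measurable_snd.comp measurable_snd)
  obtain ⟨e', hmi⟩ := lintegral_swap_param (G := fun γ y v => wt j v * H γ y v) S (hw.mul hm)
  have e : ∀ y, ∫⁻ v, wt j v * ∫⁻ γ in S, H γ y v = ∫⁻ γ in S, ∫⁻ v, wt j v * H γ y v := by
    intro y
    rw [← e' y]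
    congr 1
    ext v
    have h2 : Measurable fun γ => H γ y v :=
      hm.comp (measurable_id.prodMk (measurable_const (a := (y, v))))
    exact (lintegral_const_mul _ h2).symm
  constructor
  · simp_rw [e]
    have hsw : Measurable (Function.uncurry fun (y : E3) (γ : ℝ) => ∫⁻ v, wt j v * H γ y v) :=
      hmi.comp measurable_swap
    rw [lintegral_lintegral_swap hsw.aemeasurable]
    refine (setLIntegral_mono' hS fun γ hγ => (h γ hγ).1).trans ?_
    rw [setLIntegral_const, mul_comm]
  · intro y
    have hy : Measurable fun γ => ∫⁻ v, wt j v * H γ y v := hmi.comp measurable_prodMk_right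
    rw [e, ← lintegral_const_mul _ hy]
    refine (setLIntegral_mono' hS fun γ hγ => (h γ hγ).2 y).trans ?_
    rw [setLIntegral_const, mul_comm]

/-- An antilipschitz map of `ℝ³` distorts integrals by a bounded factor. -/
lemma lintegral_comp_le_of_antilipschitz {c : NNReal} {Y : E3 → E3} (hY : AntilipschitzWith c Y)
    (hm : Measurable Y) {f : E3 → ℝ≥0∞} (hf : Measurable f) :
    ∫⁻ y, f (Y y) ≤ (c : ℝ≥0∞) ^ 3 * ∫⁻ z, f z := by
  -- antilipschitz maps are controlled by the Hausdorff measure, a multiple of Lebesgue measure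
  have hle : Measure.map Y volume ≤ ((c : ℝ≥0∞) ^ 3) • (volume : Measure E3) := by
    have hh : (Measure.hausdorffMeasure (3 : ℝ) : Measure E3).IsAddHaarMeasure :=
      inferInstanceAs (Measure.hausdorffMeasure ((3 : ℕ) : ℝ) :
        Measure (EuclideanSpace ℝ (Fin 3))).IsAddHaarMeasure
    have hv := Measure.isAddLeftInvariant_eq_smul (volume : Measure E3)
      (Measure.hausdorffMeasure (3 : ℝ) : Measure E3)
    set κ := Measure.addHaarScalarFactor (volume : Measure E3)
      (Measure.hausdorffMeasure (3 : ℝ) : Measure E3) with hκ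
    refine Measure.le_iff.2 fun S hS => ?_
    rw [Measure.map_apply hm hS, Measure.smul_apply, hv, Measure.smul_apply, Measure.smul_apply]
    have h1 := hY.hausdorffMeasure_preimage_le (d := 3) (by norm_num) S
    have e : (c : ℝ≥0∞) ^ (3 : ℝ) = (c : ℝ≥0∞) ^ 3 := by
      rw [← ENNReal.rpow_natCast]; norm_num
    rw [e] at h1
    simp only [smul_eq_mul, ENNReal.smul_def]
    calc _ ≤ (κ : ℝ≥0∞) * ((c : ℝ≥0∞) ^ 3 * Measure.hausdorffMeasure 3 S) := mul_le_mul_right h1 _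
      _ = _ := by ring
  rw [← lintegral_map hf hm]
  refine (lintegral_mono' hle le_rfl).trans ?_
  rw [lintegral_smul_measure, smul_eq_mul]

/-- The size `min(2^k, ⟨t⟩⁻¹)`, the cube root of the gain in `L^∞` compared with `L¹`. -/
noncomputable def mm (k : ℤ) (t : ℝ) : ℝ := min ((2 : ℝ) ^ k) (jap t)⁻¹

lemma mm_pos (k : ℤ) (t : ℝ) : 0 < mm k t := lt_min (zpow_two_pos k) (inv_pos.2 (jap_pos t))

/-- A nonnegative function with `L¹` norm at most `β` and supremum at most
`β min(2^k, ⟨t⟩⁻¹)³`. -/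
structure Maj (t : ℝ) (k : ℤ) (β : ℝ) (f : E3 → ℝ≥0∞) : Prop where
  nonneg : 0 ≤ β
  meas : Measurable f
  int : ∫⁻ z, f z ≤ ENNReal.ofReal β
  sup : ∀ z, f z ≤ ENNReal.ofReal (β * mm k t ^ 3)

/-- The convolution `|W| * |h|`. -/
noncomputable def nconv (W h : E3 → ℂ) (z : E3) : ℝ≥0∞ := ∫⁻ y, ‖W (z - y)‖ₑ * ‖h y‖ₑ

lemma measurable_nconv {W h : E3 → ℂ} (hW : Measurable W) (hh : Measurable h) :
    Measurable (nconv W h) := by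
  have : Measurable (fun p : E3 × E3 => ‖W (p.1 - p.2)‖ₑ * ‖h p.2‖ₑ) :=
    (hW.comp (measurable_fst.sub measurable_snd)).enorm.mul (hh.comp measurable_snd).enorm
  exact this.lintegral_prod_right'

/-- The supremum of `|W| * |h|` is bounded in two ways: by `‖W‖_∞ ‖h‖_{L¹}`, which gives `2^{3k}`, and by
`‖W‖_{L¹} ‖h‖_∞`, which gives `⟨t⟩⁻³`. -/
lemma maj_nconv {k : ℤ} {t β B : ℝ} {W h : E3 → ℂ} (hW : Ker k B W) (H : Bn t β h) :
    Maj t k ((bumpMass + 1) * B * β) (nconv W h) := by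
  have hM := bumpMass_pos
  have hB := hW.nonneg
  have hβ := H.nonneg
  have hj := jap_pos t
  have hk := zpow_two_pos k
  refine ⟨by positivity, measurable_nconv hW.cont.measurable H.meas, ?_, fun z => ?_⟩
  · unfold nconv
    rw [lintegral_conv_le (f := fun x => ‖W x‖ₑ) (g := fun x => ‖h x‖ₑ) hW.cont.measurable.enorm
      H.meas.enorm, ENNReal.ofReal_mul (by positivity)]
    refine mul_le_mul' ((lintegral_enorm_sub_le hW).trans (ENNReal.ofReal_le_ofReal ?_)) H.int
    rw [mul_comm]
    gcongr
    linarith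
  · unfold nconv mm
    rcases min_choice ((2 : ℝ) ^ k) (jap t)⁻¹ with e | e <;> rw [e]
    · calc _ ≤ ∫⁻ y, ENNReal.ofReal (B * 2 ^ (3 * k)) * ‖h y‖ₑ := by
            refine lintegral_mono fun y => ?_
            refine mul_le_mul_left ?_ _
            rw [← ofReal_norm]
            refine ENNReal.ofReal_le_ofReal ((hW.bound _).trans ?_)
            gcongr
            exact bump_le _ _
        _ = ENNReal.ofReal (B * 2 ^ (3 * k)) * ∫⁻ y, ‖h y‖ₑ := lintegral_const_mul _ H.meas.enorm
        _ ≤ ENNReal.ofReal (B * 2 ^ (3 * k)) * ENNReal.ofReal β := mul_le_mul_right H.int _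
        _ = ENNReal.ofReal (B * 2 ^ (3 * k) * β) := (ENNReal.ofReal_mul (by positivity)).symm
        _ ≤ _ := by
            refine ENNReal.ofReal_le_ofReal ?_
            have e2 : (2 : ℝ) ^ (3 * k) = ((2 : ℝ) ^ k) ^ 3 := by
              rw [← zpow_natCast, ← zpow_mul, mul_comm]; rfl
            rw [e2]
            calc _ = 1 * B * β * ((2 : ℝ) ^ k) ^ 3 := by ring
              _ ≤ _ := by gcongr; linarith
    · calc _ ≤ ∫⁻ y, ‖W (z - y)‖ₑ * ENNReal.ofReal (β * (jap t ^ 3)⁻¹) := by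
            refine lintegral_mono_ae ?_
            filter_upwards [H.sup] with y hy
            refine mul_le_mul_right ?_ _
            rw [← ofReal_norm]
            exact ENNReal.ofReal_le_ofReal hy
        _ = (∫⁻ y, ‖W y‖ₑ) * ENNReal.ofReal (β * (jap t ^ 3)⁻¹) := by
            have hm : Measurable fun y => ‖W (z - y)‖ₑ :=
              (hW.cont.measurable.comp (measurable_const.sub measurable_id)).enorm
            rw [lintegral_mul_const _ hm, lintegral_sub_left_eq_self (fun y => ‖W y‖ₑ)]
        _ ≤ ENNReal.ofReal (B * bumpMass) * ENNReal.ofReal (β * (jap t ^ 3)⁻¹) :=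
            mul_le_mul_left (lintegral_enorm_sub_le hW) _
        _ = ENNReal.ofReal (B * bumpMass * (β * (jap t ^ 3)⁻¹)) :=
            (ENNReal.ofReal_mul (by positivity)).symm
        _ ≤ _ := by
            refine ENNReal.ofReal_le_ofReal ?_
            rw [inv_pow]
            calc _ = bumpMass * B * β * (jap t ^ 3)⁻¹ := by ring
              _ ≤ _ := by gcongr; linarith

/-- A perturbed characteristic map `Y(y,v) = y - (s-t) v + P(y,v)`, as far as its effect on
integrals in `y` and in `v` is concerned. -/
structure IsFlow (s t : ℝ) (Y : E3 → E3 → E3) : Prop where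
  meas : Measurable (fun p : E3 × E3 => Y p.1 p.2)
  anti_y : ∀ v, AntilipschitzWith 2 (fun y => Y y v)
  anti_v : ∀ y v v', ((s - t) - jap s / 16) * ‖v - v'‖ ≤ ‖Y y v - Y y v'‖

/-- Small perturbations of free transport are flows; `1/16` is small enough for both antilipschitz
bounds. -/
lemma IsFlow.of_perturbation {s t a : ℝ} (hst : t ≤ s) (ha : a ≤ 1 / 16) {P : E3 → E3 → E3}
    (hy : ∀ v, Differentiable ℝ (fun y => P y v)) (hv : ∀ y, Differentiable ℝ (P y))
    (hb : ∀ y v, ‖fderiv ℝ (fun z => P z v) y‖ + (jap s)⁻¹ * ‖fderiv ℝ (P y) v‖ ≤ a) :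
    IsFlow s t (fun y v => y - (s - t) • v + P y v) := by
  have hj := jap_pos s
  have hb1 : ∀ y v, ‖fderiv ℝ (fun z => P z v) y‖ ≤ 1 / 16 := fun y v => by
    have := hb y v
    have : 0 ≤ (jap s)⁻¹ * ‖fderiv ℝ (P y) v‖ := by positivity
    linarith
  have hb2 : ∀ y v, ‖fderiv ℝ (P y) v‖ ≤ jap s / 16 := fun y v => by
    have h1 := hb y v
    have h2 := norm_nonneg (fderiv ℝ (fun z => P z v) y)
    have h3 : (jap s)⁻¹ * ‖fderiv ℝ (P y) v‖ ≤ 1 / 16 := by linarith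
    rw [inv_mul_le_iff₀ hj] at h3
    linarith
  refine ⟨?_, fun v => ?_, fun y v v' => ?_⟩
  · have hP : Measurable (Function.uncurry P) :=
      measurable_uncurry_of_continuous_of_measurable (fun v => (hy v).continuous)
        fun y => (hv y).continuous.measurable
    exact (measurable_fst.sub (measurable_snd.const_smul (s - t))).add hP
  · refine AntilipschitzWith.of_le_mul_dist fun y y' => ?_
    have h := convex_univ.norm_image_sub_le_of_norm_fderiv_le (𝕜 := ℝ)
      (fun x _ => (hy v) x) (fun x _ => hb1 x v) (mem_univ y') (mem_univ y)
    rw [dist_eq_norm, dist_eq_norm]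
    have e : y - y' = (y - (s - t) • v + P y v - (y' - (s - t) • v + P y' v)) -
      (P y v - P y' v) := by abel
    have h2 := norm_sub_le (y - (s - t) • v + P y v - (y' - (s - t) • v + P y' v)) (P y v - P y' v)
    rw [← e] at h2
    have h3 := norm_nonneg (y - y')
    simp only [NNReal.coe_ofNat]
    linarith
  · have h := convex_univ.norm_image_sub_le_of_norm_fderiv_le (𝕜 := ℝ)
      (fun x _ => (hv y) x) (fun x _ => hb2 y x) (mem_univ v') (mem_univ v)
    have e : (s - t) • (v - v') = (P y v - P y v') -
        (y - (s - t) • v + P y v - (y - (s - t) • v' + P y v')) := by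
      rw [smul_sub]; abel
    have h2 := norm_sub_le (P y v - P y v')
      (y - (s - t) • v + P y v - (y - (s - t) • v' + P y v'))
    rw [← e, norm_smul, Real.norm_of_nonneg (sub_nonneg.2 hst)] at h2
    linarith

/-- The constant in the bounds of `TB.comp_flow` and `TB.mul_comp_flow`. -/
noncomputable def tbConst : ℝ := 8 * wtMass + 576

lemma tbConst_pos : 0 < tbConst := by
  have := wtMass_nonneg
  unfold tbConst
  linarith

/-- Transport along the characteristics: for `t` far from `s` the dispersion in `v` is used, for
`t` close to `s` the decay of `f`. -/
lemma TB.comp_flow {s t : ℝ} (h0 : 0 ≤ t) (hts : t ≤ s) {Y : E3 → E3 → E3} (hY : IsFlow s t Y)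
    (j : ℕ) {k : ℤ} {β : ℝ} {f : E3 → ℝ≥0∞} (hf : Maj t k β f) :
    TB s j (ENNReal.ofReal (tbConst * β)) (fun y v => f (Y y v)) := by
  have hj := jap_pos s
  have hjt := jap_pos t
  have hw := wtMass_nonneg
  have hβ := hf.nonneg
  have hs2 : jap s ^ 2 = 1 + s ^ 2 := Real.sq_sqrt (by positivity)
  have ht2 : jap t ^ 2 = 1 + t ^ 2 := Real.sq_sqrt (by positivity)
  have hcomp : Measurable (fun p : E3 × E3 => f (Y p.1 p.2)) := hf.meas.comp hY.meas
  constructor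
  · have hsw : Measurable (Function.uncurry fun y v => wt j v * f (Y y v)) :=
      measurable_wt_mul (H := fun y v => f (Y y v)) hcomp
    rw [lintegral_lintegral_swap hsw.aemeasurable]
    calc _ ≤ ∫⁻ v, wt j v * ENNReal.ofReal (8 * β) := by
          refine lintegral_mono fun v => ?_
          have hm : Measurable fun y => f (Y y v) := hcomp.comp measurable_prodMk_right
          rw [lintegral_const_mul _ hm]
          refine mul_le_mul_right ?_ _
          refine (lintegral_comp_le_of_antilipschitz (hY.anti_y v)
            (hY.meas.comp measurable_prodMk_right) hf.meas).trans ?_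
          rw [ENNReal.ofReal_mul (by norm_num)]
          refine mul_le_mul' (le_of_eq ?_) hf.int
          norm_num
      _ = (∫⁻ v, wt j v) * ENNReal.ofReal (8 * β) := lintegral_mul_const _ (measurable_wt j)
      _ ≤ ENNReal.ofReal wtMass * ENNReal.ofReal (8 * β) := mul_le_mul_left (lintegral_wt_le j) _
      _ = ENNReal.ofReal (wtMass * (8 * β)) := (ENNReal.ofReal_mul hw).symm
      _ ≤ _ := by
          refine ENNReal.ofReal_le_ofReal ?_
          unfold tbConst
          nlinarith
  · intro y
    -- far from `s`, the map `v ↦ Y y v` is antilipschitz with constant `4/⟨s⟩`, and the change of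
    -- variables gains `⟨s⟩⁻³`; otherwise `⟨s⟩ ≤ 2⟨t⟩`, and the supremum of `f` has the decay `⟨t⟩⁻³`
    by_cases hc : t ≤ s / 2 ∧ 1 ≤ s
    · obtain ⟨hc1, hc2⟩ := hc
      have h1 : jap s ≤ 3 / 2 * s := by
        apply le_of_sq_le_sq _ (by positivity)
        nlinarith
      have hanti : AntilipschitzWith (4 / jap s).toNNReal (Y y) := by
        refine AntilipschitzWith.of_le_mul_dist fun v v' => ?_
        rw [dist_eq_norm, dist_eq_norm, Real.coe_toNNReal _ (by positivity), div_mul_eq_mul_div,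
          le_div_iff₀ hj]
        have h2 := hY.anti_v y v v'
        have h3 : jap s / 4 * ‖v - v'‖ ≤ ((s - t) - jap s / 16) * ‖v - v'‖ := by
          gcongr
          linarith
        linarith
      have h4 := lintegral_comp_le_of_antilipschitz hanti (hY.meas.comp measurable_prodMk_left) hf.meas
      calc _ ≤ ENNReal.ofReal (jap s ^ 3) * (ENNReal.ofReal 9 * (((4 / jap s).toNNReal : ℝ≥0∞) ^ 3 *
            ENNReal.ofReal β)) := by
            refine mul_le_mul_right ?_ _
            refine (lintegral_mono fun v => mul_le_mul_left (wt_le j v) _).trans ?_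
            have hm : Measurable fun v => f (Y y v) := hcomp.comp measurable_prodMk_left
            rw [lintegral_const_mul _ hm]
            exact mul_le_mul_right (h4.trans (mul_le_mul_right hf.int _)) _
        _ = ENNReal.ofReal (jap s ^ 3 * (9 * ((4 / jap s) ^ 3 * β))) := by
            rw [ENNReal.ofReal_mul (p := jap s ^ 3) (by positivity),
              ENNReal.ofReal_mul (p := 9) (by positivity),
              ENNReal.ofReal_mul (p := (4 / jap s) ^ 3) (by positivity),
              ENNReal.ofReal_pow (p := 4 / jap s) (by positivity) 3]
            rfl
        _ ≤ _ := by
            refine ENNReal.ofReal_le_ofReal ?_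
            have : jap s ^ 3 * (9 * ((4 / jap s) ^ 3 * β)) = 576 * β := by field_simp; ring
            rw [this]
            unfold tbConst
            nlinarith
    · have h1 : jap s ≤ 2 * jap t := by
        apply le_of_sq_le_sq _ (by positivity)
        rw [mul_pow, hs2, ht2]
        by_cases h2 : t ≤ s / 2
        · have h3 : s < 1 := by
            by_contra h3
            exact hc ⟨h2, not_lt.1 h3⟩
          nlinarith
        · nlinarith
      calc _ ≤ ENNReal.ofReal (jap s ^ 3) * (ENNReal.ofReal wtMass *
            ENNReal.ofReal (β * (jap t)⁻¹ ^ 3)) := by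
            refine mul_le_mul_right ?_ _
            refine (lintegral_mono fun v => mul_le_mul_right ((hf.sup _).trans
              (ENNReal.ofReal_le_ofReal (mul_le_mul_of_nonneg_left
                (pow_le_pow_left₀ (mm_pos k t).le (min_le_right _ _) 3) hβ))) _).trans ?_
            rw [lintegral_mul_const _ (measurable_wt j)]
            exact mul_le_mul_left (lintegral_wt_le j) _
        _ = ENNReal.ofReal (jap s ^ 3 * (wtMass * (β * (jap t)⁻¹ ^ 3))) := by
            rw [ENNReal.ofReal_mul (p := jap s ^ 3) (by positivity), ENNReal.ofReal_mul hw]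
        _ ≤ _ := by
            refine ENNReal.ofReal_le_ofReal ?_
            calc _ ≤ (2 * jap t) ^ 3 * (wtMass * (β * (jap t)⁻¹ ^ 3)) := by gcongr
              _ = 8 * wtMass * β := by field_simp; ring
              _ ≤ _ := by unfold tbConst; nlinarith

/-- Bilinear transport: the factor with the smaller supremum is estimated by it, the other one by
`TB.comp_flow`. -/
lemma TB.mul_comp_flow {s τ t : ℝ} (hτ : 0 ≤ τ) (hτs : τ ≤ s) (h0 : 0 ≤ t) (hts : t ≤ s)
    {Y₁ Y₂ : E3 → E3 → E3} (hY₁ : IsFlow s τ Y₁) (hY₂ : IsFlow s t Y₂) (j : ℕ) {k₁ k₂ : ℤ}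
    {β₁ β₂ : ℝ} {f₁ f₂ : E3 → ℝ≥0∞} (hf₁ : Maj τ k₁ β₁ f₁) (hf₂ : Maj t k₂ β₂ f₂) :
    TB s j (ENNReal.ofReal (tbConst * (β₁ * β₂ * min (mm k₁ τ) (mm k₂ t) ^ 3)))
      (fun y v => f₁ (Y₁ y v) * f₂ (Y₂ y v)) := by
  have hβ₁ := hf₁.nonneg
  have hβ₂ := hf₂.nonneg
  have hc := tbConst_pos
  have hm₁ := mm_pos k₁ τ
  have hm₂ := mm_pos k₂ t
  rcases min_choice (mm k₁ τ) (mm k₂ t) with e | e <;> rw [e]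
  · have h := (TB.comp_flow h0 hts hY₂ j hf₂).const_mul
      (c := ENNReal.ofReal (β₁ * mm k₁ τ ^ 3)) ENNReal.ofReal_ne_top
    refine h.mono (le_of_eq ?_) fun y v _ => mul_le_mul_left (hf₁.sup _) _
    rw [← ENNReal.ofReal_mul (by positivity)]
    congr 1
    ring
  · have h := (TB.comp_flow hτ hτs hY₁ j hf₁).const_mul
      (c := ENNReal.ofReal (β₂ * mm k₂ t ^ 3)) ENNReal.ofReal_ne_top
    refine h.mono (le_of_eq ?_) fun y v _ => ?_
    · rw [← ENNReal.ofReal_mul (by positivity)]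
      congr 1
      ring
    · rw [mul_comm]
      exact mul_le_mul_left (hf₂.sup _) _

/-! ### Time integrals along a characteristic -/

/-- The fundamental theorem of calculus with an extended nonnegative bound for the integral of the
derivative, so that no integrability has to be known. -/
lemma enorm_sub_le_lintegral_deriv {u : ℝ → ℂ} {a b : ℝ} (hab : a ≤ b)
    (hc : ContinuousOn u (Icc a b)) (hd : ∀ γ ∈ Ioo a b, DifferentiableAt ℝ u γ) :
    ‖u b - u a‖ₑ ≤ ∫⁻ γ in Ioo a b, ‖deriv u γ‖ₑ := by
  by_cases h : ∫⁻ γ in Ioo a b, ‖deriv u γ‖ₑ = ⊤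
  · rw [h]; exact le_top
  · have hi : IntegrableOn (deriv u) (Ioo a b) :=
      ⟨(measurable_deriv u).aestronglyMeasurable, lt_top_iff_ne_top.2 h⟩
    have hi' : IntervalIntegrable (deriv u) volume a b := by
      rw [intervalIntegrable_iff_integrableOn_Ioo_of_le hab]
      exact hi
    have h1 := intervalIntegral.integral_eq_sub_of_hasDerivAt_of_le hab hc
      (fun γ hγ => (hd γ hγ).hasDerivAt) hi'
    rw [← h1, intervalIntegral.integral_of_le hab, integral_Ioc_eq_integral_Ioo]
    exact enorm_integral_le_lintegral_enorm _

/-- Integration by parts against `e^{iσt}`, `σ = ±1`. -/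
lemma enorm_integral_osc_le {u : ℝ → ℂ} {a b σ : ℝ} (hσ : |σ| = 1) (hab : a ≤ b)
    (hc : ContinuousOn u (Icc a b)) (hd : ∀ γ ∈ Ioo a b, DifferentiableAt ℝ u γ) :
    ‖∫ γ in Ioo a b, u γ * Complex.exp (Complex.I * ((σ * γ : ℝ) : ℂ))‖ₑ ≤
      ‖u a‖ₑ + ‖u b‖ₑ + ∫⁻ γ in Ioo a b, ‖deriv u γ‖ₑ := by
  set e : ℝ → ℂ := fun γ => Complex.exp (Complex.I * ((σ * γ : ℝ) : ℂ)) with he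
  have hσ0 : (σ : ℂ) ≠ 0 := by
    have : σ ≠ 0 := fun h => by rw [h, abs_zero] at hσ; norm_num at hσ
    exact_mod_cast this
  have hen : ∀ γ, ‖e γ‖ₑ = 1 := fun γ => by
    rw [he, ← ofReal_norm]
    simp only
    rw [mul_comm, Complex.norm_exp_ofReal_mul_I, ENNReal.ofReal_one]
  have hed : ∀ γ, HasDerivAt e (e γ * (Complex.I * σ)) γ := by
    intro γ
    have h1 : HasDerivAt (fun γ : ℝ => Complex.I * ((σ * γ : ℝ) : ℂ)) (Complex.I * σ) γ := by
      have h2 : HasDerivAt (fun γ : ℝ => σ * γ) σ γ := by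
        simpa using (hasDerivAt_id γ).const_mul σ
      exact h2.ofReal_comp.const_mul Complex.I
    exact h1.cexp
  have hec : Continuous e := continuous_iff_continuousAt.2 fun γ => (hed γ).continuousAt
  have hIσ : ‖(Complex.I * σ)⁻¹‖ₑ = 1 := by
    rw [← ofReal_norm, norm_inv, norm_mul, Complex.norm_I, Complex.norm_real, Real.norm_eq_abs, hσ]
    simp
  by_cases h : ∫⁻ γ in Ioo a b, ‖deriv u γ‖ₑ = ⊤
  · rw [h]; simp
  · have hi : IntegrableOn (deriv u) (Ioo a b) :=
      ⟨(measurable_deriv u).aestronglyMeasurable, lt_top_iff_ne_top.2 h⟩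
    have hi2 : IntegrableOn (fun γ => deriv u γ * e γ * (Complex.I * σ)⁻¹) (Ioo a b) := by
      have : IntegrableOn (fun γ => deriv u γ * e γ) (Ioo a b) := by
        refine Integrable.mul_bdd (c := 1) hi hec.aestronglyMeasurable
          (Filter.Eventually.of_forall fun γ => ?_)
        have := hen γ
        rw [← ofReal_norm, ENNReal.ofReal_eq_one] at this
        exact this.le
      exact this.mul_const _
    have hi1 : IntegrableOn (fun γ => u γ * e γ) (Ioo a b) :=
      ((hc.mul hec.continuousOn).integrableOn_Icc).mono_set Ioo_subset_Icc_self
    have hder : ∀ γ ∈ Ioo a b, HasDerivAt (fun γ => u γ * e γ * (Complex.I * σ)⁻¹)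
        (u γ * e γ + deriv u γ * e γ * (Complex.I * σ)⁻¹) γ := by
      intro γ hγ
      have h1 := ((hd γ hγ).hasDerivAt.mul (hed γ)).mul_const (Complex.I * (σ : ℂ))⁻¹
      refine h1.congr_deriv ?_
      have : Complex.I * (σ : ℂ) ≠ 0 := mul_ne_zero Complex.I_ne_zero hσ0
      field_simp
      ring
    have hcon : ContinuousOn (fun γ => u γ * e γ * (Complex.I * σ)⁻¹) (Icc a b) :=
      (hc.mul hec.continuousOn).mul continuousOn_const
    have h1 := intervalIntegral.integral_eq_sub_of_hasDerivAt_of_le hab hcon hder (by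
        rw [intervalIntegrable_iff_integrableOn_Ioo_of_le hab]
        exact hi1.add hi2)
    rw [intervalIntegral.integral_of_le hab, integral_Ioc_eq_integral_Ioo, integral_add hi1 hi2] at h1
    have h2 : ∫ γ in Ioo a b, u γ * e γ = u b * e b * (Complex.I * σ)⁻¹ -
        u a * e a * (Complex.I * σ)⁻¹ - ∫ γ in Ioo a b, deriv u γ * e γ * (Complex.I * σ)⁻¹ := by
      rw [← h1]; ring
    rw [h2]
    refine (enorm_sub_le).trans (add_le_add ((enorm_sub_le).trans ?_) ?_)
    · rw [enorm_mul, enorm_mul, enorm_mul, enorm_mul, hen, hen, hIσ]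
      simp only [mul_one]
      rw [add_comm]
    · refine (enorm_integral_le_lintegral_enorm _).trans (le_of_eq ?_)
      congr 1
      ext γ
      rw [enorm_mul, enorm_mul, hen, hIσ, mul_one, mul_one]

/-- The amplitude of an oscillatory time integral: it is bounded by `Λ`, and `⟨γ⟩` times its
derivative is almost everywhere bounded by `Λ`. -/
structure Amp (t₃ t₄ : ℝ) (Λ : ℝ≥0∞) (c : ℝ → ℂ) : Prop where
  meas : Measurable c
  cont : ContinuousOn c (Icc t₃ t₄)
  diff : ∀ γ ∈ Ioo t₃ t₄, DifferentiableAt ℝ c γ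
  bound : ∀ γ ∈ Icc t₃ t₄, ‖c γ‖ₑ ≤ Λ
  dbound : ∀ᵐ γ ∂volume.restrict (Ioo t₃ t₄), ‖deriv c γ‖ₑ ≤ Λ * ENNReal.ofReal (jap γ)⁻¹

/-- A differentiable curve with speed at most `V`. -/
structure IsPath (t₃ t₄ V : ℝ) (Z : ℝ → E3) : Prop where
  meas : Measurable Z
  cont : ContinuousOn Z (Icc t₃ t₄)
  diff : ∀ γ ∈ Ioo t₃ t₄, DifferentiableAt ℝ Z γ
  bound : ∀ γ ∈ Ioo t₃ t₄, ‖deriv Z γ‖ ≤ V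

lemma measurable_nconv_param {α : Type*} [MeasurableSpace α] {W : E3 → ℂ} (hW : Measurable W)
    {h : α → E3 → ℂ} (hh : Measurable (fun p : α × E3 => h p.1 p.2)) :
    Measurable (fun p : α × E3 => nconv W (h p.1) p.2) := by
  have h1 : Measurable (fun q : (α × E3) × E3 => W (q.1.2 - q.2)) :=
    hW.comp ((measurable_snd.comp measurable_fst).sub measurable_snd)
  have h2 : Measurable (fun q : (α × E3) × E3 => h q.1.1 q.2) :=
    hh.comp ((measurable_fst.comp measurable_fst).prodMk measurable_snd)
  exact (h1.enorm.mul h2.enorm).lintegral_prod_right'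

lemma enorm_integral_amp_le {t₃ t₄ : ℝ} {Λ : ℝ≥0∞} {c : ℝ → ℂ} (hc : Amp t₃ t₄ Λ c) {F : ℝ → ℂ}
    {m : ℝ → ℝ≥0∞} (hm : Measurable m) (h : ∀ γ ∈ Ioo t₃ t₄, ‖F γ‖ₑ ≤ m γ) :
    ‖∫ γ in Ioo t₃ t₄, c γ * F γ‖ₑ ≤ Λ * ∫⁻ γ in Ioo t₃ t₄, m γ := by
  refine (enorm_integral_le_lintegral_enorm _).trans ?_
  rw [← lintegral_const_mul _ hm]
  refine setLIntegral_mono' measurableSet_Ioo fun γ hγ => ?_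
  rw [enorm_mul]
  exact mul_le_mul' (hc.bound γ (Ioo_subset_Icc_self hγ)) (h γ hγ)

/-- The length of the gradient of a kernel, as a complex valued kernel. -/
noncomputable def gradKer (W : E3 → ℂ) (z : E3) : ℂ := (‖fderiv ℝ W z‖ : ℂ)

lemma enorm_gradKer (W : E3 → ℂ) (z : E3) : ‖gradKer W z‖ₑ = ‖fderiv ℝ W z‖ₑ := by
  rw [gradKer, ← ofReal_norm, Complex.norm_real, norm_norm, ofReal_norm]

lemma KerD.gradKer {k : ℤ} {B : ℝ} {W : E3 → ℂ} (h : KerD k B W) :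
    Ker k (B * 2 ^ k) (gradKer W) :=
  ⟨Complex.continuous_ofReal.comp h.contd.norm, fun x => by
    rw [VPPoisson.gradKer, Complex.norm_real, norm_norm]; exact h.dbound x⟩

/-- The majorant of an oscillatory time integral that integration by parts gives. -/
noncomputable def ibpMaj (W : E3 → ℂ) (g g' : ℝ → E3 → ℂ) (t₃ t₄ V : ℝ) (Z : ℝ → E3) : ℝ≥0∞ :=
  nconv W (g t₃) (Z t₃) + nconv W (g t₄) (Z t₄) + ∫⁻ γ in Ioo t₃ t₄,
    (ENNReal.ofReal (jap γ)⁻¹ * nconv W (g γ) (Z γ) + nconv W (g' γ) (Z γ) +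
      ENNReal.ofReal V * nconv (gradKer W) (g γ) (Z γ))

/-- Measurability of the integrand that integration by parts produces, with abstract factors. -/
lemma measurable_add_three {w : ℝ → ℝ≥0∞} {a b g g' : ℝ → E3 → ℂ}
    (hw : Measurable fun q : ℝ × E3 => w q.1) (ha : Measurable fun q : ℝ × E3 => a q.1 q.2)
    (hb : Measurable fun q : ℝ × E3 => b q.1 q.2) (hg : Measurable fun q : ℝ × E3 => g q.1 q.2)
    (hg' : Measurable fun q : ℝ × E3 => g' q.1 q.2) (V : ℝ) :
    Measurable (Function.uncurry fun γ z => w γ * (‖a γ z‖ₑ * ‖g γ z‖ₑ) + ‖a γ z‖ₑ * ‖g' γ z‖ₑ +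
      ENNReal.ofReal V * (‖b γ z‖ₑ * ‖g γ z‖ₑ)) :=
  ((hw.mul (ha.enorm.mul hg.enorm)).add (ha.enorm.mul hg'.enorm)).add
    ((hb.enorm.mul hg.enorm).const_mul _)

/-- Tonelli's theorem for the majorant that integration by parts produces. -/
lemma lintegral_ibp_majorant {w : ℝ → ℝ≥0∞} {a b g g' : ℝ → E3 → ℂ}
    (hw : Measurable fun q : ℝ × E3 => w q.1) (ha : Measurable fun q : ℝ × E3 => a q.1 q.2)
    (hb : Measurable fun q : ℝ × E3 => b q.1 q.2) (hg : Measurable fun q : ℝ × E3 => g q.1 q.2)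
    (hg' : Measurable fun q : ℝ × E3 => g' q.1 q.2) (V : ℝ) (Λ : ℝ≥0∞) {t₃ t₄ : ℝ} :
    ∫⁻ z, (Λ * (‖a t₃ z‖ₑ * ‖g t₃ z‖ₑ) + Λ * (‖a t₄ z‖ₑ * ‖g t₄ z‖ₑ) +
      Λ * ∫⁻ γ in Ioo t₃ t₄, (w γ * (‖a γ z‖ₑ * ‖g γ z‖ₑ) + ‖a γ z‖ₑ * ‖g' γ z‖ₑ +
        ENNReal.ofReal V * (‖b γ z‖ₑ * ‖g γ z‖ₑ))) =
    Λ * ((∫⁻ z, ‖a t₃ z‖ₑ * ‖g t₃ z‖ₑ) + (∫⁻ z, ‖a t₄ z‖ₑ * ‖g t₄ z‖ₑ) +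
      ∫⁻ γ in Ioo t₃ t₄, (w γ * (∫⁻ z, ‖a γ z‖ₑ * ‖g γ z‖ₑ) + (∫⁻ z, ‖a γ z‖ₑ * ‖g' γ z‖ₑ) +
        ENNReal.ofReal V * ∫⁻ z, ‖b γ z‖ₑ * ‖g γ z‖ₑ)) := by
  have hag : ∀ γ, Measurable fun z => ‖a γ z‖ₑ * ‖g γ z‖ₑ := fun γ =>
    ((ha.of_uncurry_left (x := γ)).enorm).mul ((hg.of_uncurry_left (x := γ)).enorm)
  have hag' : ∀ γ, Measurable fun z => ‖a γ z‖ₑ * ‖g' γ z‖ₑ := fun γ =>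
    ((ha.of_uncurry_left (x := γ)).enorm).mul ((hg'.of_uncurry_left (x := γ)).enorm)
  have hbg : ∀ γ, Measurable fun z => ‖b γ z‖ₑ * ‖g γ z‖ₑ := fun γ =>
    ((hb.of_uncurry_left (x := γ)).enorm).mul ((hg.of_uncurry_left (x := γ)).enorm)
  have hM := measurable_add_three hw ha hb hg hg' V
  have hI : Measurable fun z => ∫⁻ γ in Ioo t₃ t₄, (w γ * (‖a γ z‖ₑ * ‖g γ z‖ₑ) +
      ‖a γ z‖ₑ * ‖g' γ z‖ₑ + ENNReal.ofReal V * (‖b γ z‖ₑ * ‖g γ z‖ₑ)) :=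
    hM.lintegral_prod_left'
  rw [lintegral_add_right _ (hI.const_mul Λ), lintegral_add_right _ ((hag t₄).const_mul Λ),
    lintegral_const_mul _ (hag t₃), lintegral_const_mul _ (hag t₄), lintegral_const_mul _ hI,
    ← lintegral_lintegral_swap (μ := volume.restrict (Ioo t₃ t₄)) (ν := volume) hM.aemeasurable,
    mul_add, mul_add]
  congr 2
  refine lintegral_congr fun γ => ?_
  rw [lintegral_add_right _ ((hbg γ).const_mul _), lintegral_add_right _ (hag' γ),
    lintegral_const_mul _ (hag γ), lintegral_const_mul _ (hbg γ)]

/-- Integration by parts in time, for the convolution of an oscillating function with a kernel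
along a path. -/
lemma enorm_integral_cv_le_ibp {T t₃ t₄ V σ B : ℝ} {k : ℤ} (hσ : |σ| = 1) (h0 : 0 ≤ t₃) (h34 : t₃ ≤ t₄)
    (h4 : t₄ ≤ T) {W : E3 → ℂ} (hW : KerD k B W) {β β' : ℝ → ℝ} {D : ℝ}
    {g g' : ℝ → E3 → ℂ} (hg : OscPiece T β β' g g') (hD : ∀ γ ∈ Icc t₃ t₄, β γ ≤ D)
    {Λ : ℝ≥0∞} (hΛ : Λ ≠ ⊤) {c : ℝ → ℂ} (hc : Amp t₃ t₄ Λ c) {Z : ℝ → E3} (hZ : IsPath t₃ t₄ V Z) :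
    ‖∫ γ in Ioo t₃ t₄, c γ * (Complex.exp (Complex.I * ((σ * γ : ℝ) : ℂ)) * cv W (g γ) (Z γ))‖ₑ ≤
      Λ * ibpMaj W g g' t₃ t₄ V Z := by
  have hWm := hW.toKer.cont.measurable
  set e : ℝ → ℂ := fun γ => Complex.exp (Complex.I * ((σ * γ : ℝ) : ℂ)) with he
  have hec : Continuous e := by
    rw [he]; fun_prop
  have hen : ∀ γ, ‖e γ‖ₑ = 1 := fun γ => by
    rw [he, ← ofReal_norm]
    simp only
    rw [mul_comm, Complex.norm_exp_ofReal_mul_I, ENNReal.ofReal_one]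
  have hsub : ∀ γ ∈ Icc t₃ t₄, γ ∈ Icc 0 T := fun γ hγ => ⟨h0.trans hγ.1, hγ.2.trans h4⟩
  have hsub' : ∀ γ ∈ Ioo t₃ t₄, γ ∈ Ioo 0 T := fun γ hγ => ⟨h0.trans_lt hγ.1, hγ.2.trans_le h4⟩
  set u : E3 → ℝ → ℂ := fun z γ => c γ * (W (Z γ - z) * g γ z) with hu
  have hZz : Measurable (fun q : ℝ × E3 => Z q.1 - q.2) :=
    (hZ.meas.comp measurable_fst).sub measurable_snd
  have hWZ : Measurable (fun q : ℝ × E3 => W (Z q.1 - q.2)) := hWm.comp hZz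
  have hfm : Measurable (Function.uncurry fun γ z => u z γ * e γ) :=
    ((hc.meas.comp measurable_fst).mul (hWZ.mul hg.meas)).mul (hec.measurable.comp measurable_fst)
  have hfi : Integrable (Function.uncurry fun γ z => u z γ * e γ)
      ((volume.restrict (Ioo t₃ t₄)).prod volume) := by
    refine ⟨hfm.aestronglyMeasurable, ?_⟩
    rw [hasFiniteIntegral_iff_enorm, lintegral_prod _ hfm.enorm.aemeasurable]
    have hb : ∀ γ ∈ Ioo t₃ t₄, ∫⁻ z, ‖Function.uncurry (fun γ z => u z γ * e γ) (γ, z)‖ₑ ≤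
        Λ * ENNReal.ofReal ((bumpMass + 1) * B * D * mm k γ ^ 3) := by
      intro γ hγ
      have hγ' := Ioo_subset_Icc_self hγ
      calc _ = ∫⁻ z, ‖c γ‖ₑ * (‖W (Z γ - z)‖ₑ * ‖g γ z‖ₑ) := by
            congr 1
            ext z
            simp only [Function.uncurry_apply_pair, hu]
            rw [enorm_mul, hen, mul_one, enorm_mul, enorm_mul]
        _ = ‖c γ‖ₑ * nconv W (g γ) (Z γ) := by
            rw [lintegral_const_mul' _ _ enorm_ne_top]; rfl
        _ ≤ _ := by
            refine mul_le_mul' (hc.bound γ hγ') (((maj_nconv hW.toKer (hg.bn γ (hsub γ hγ'))).sup _).trans ?_)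
            refine ENNReal.ofReal_le_ofReal ?_
            have := hW.toKer.nonneg
            have := bumpMass_pos
            have := mm_pos k γ
            gcongr
            exact hD γ hγ'
    refine (setLIntegral_mono' measurableSet_Ioo hb).trans_lt ?_
    refine (setLIntegral_mono' (g := fun _ => Λ * ENNReal.ofReal ((bumpMass + 1) * B * D *
      ((2 : ℝ) ^ k) ^ 3)) measurableSet_Ioo fun γ hγ => ?_).trans_lt ?_
    · refine mul_le_mul_right (ENNReal.ofReal_le_ofReal ?_) _
      have := hW.toKer.nonneg
      have := bumpMass_pos
      have := mm_pos k γ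
      have hγ' := Ioo_subset_Icc_self hγ
      have : 0 ≤ D := (hg.bn γ (hsub γ hγ')).nonneg.trans (hD γ hγ')
      gcongr
      exact min_le_left _ _
    · rw [setLIntegral_const]
      refine ENNReal.mul_lt_top (ENNReal.mul_lt_top (lt_top_iff_ne_top.2 hΛ) ENNReal.ofReal_lt_top) ?_
      simp
  -- with the order of integration reversed, the integration by parts takes place for fixed `z`; the
  -- time derivative of `u z` hits the amplitude, the kernel along the path, or the density piece
  have e1 : ∫ γ in Ioo t₃ t₄, c γ * (e γ * cv W (g γ) (Z γ)) =
      ∫ z, ∫ γ in Ioo t₃ t₄, u z γ * e γ := by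
    rw [← integral_integral_swap hfi]
    congr 1
    ext γ
    rw [cv, integral_mul_const, hu]
    simp only
    rw [integral_const_mul]
    ring
  rw [e1]
  have hWd : ∀ z γ, γ ∈ Ioo t₃ t₄ → HasDerivAt (fun γ => W (Z γ - z))
      (fderiv ℝ W (Z γ - z) (deriv Z γ)) γ := fun z γ hγ =>
    ((hW.diff (Z γ - z)).hasFDerivAt).comp_hasDerivAt γ ((hZ.diff γ hγ).hasDerivAt.sub_const z)
  have hud : ∀ z γ, γ ∈ Ioo t₃ t₄ → HasDerivAt (u z) (deriv c γ * (W (Z γ - z) * g γ z) +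
      c γ * (fderiv ℝ W (Z γ - z) (deriv Z γ) * g γ z + W (Z γ - z) * g' γ z)) γ := fun z γ hγ =>
    (hc.diff γ hγ).hasDerivAt.mul ((hWd z γ hγ).mul (hg.deriv z γ (hsub' γ hγ)))
  have huc : ∀ z, ContinuousOn (u z) (Icc t₃ t₄) := fun z =>
    hc.cont.mul ((hW.toKer.cont.comp_continuousOn (hZ.cont.sub continuousOn_const)).mul
      ((hg.cont z).mono hsub))
  have hgm : Measurable (fun q : ℝ × E3 => gradKer W (Z q.1 - q.2)) :=
    hW.gradKer.cont.measurable.comp hZz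
  have hjm : Measurable (fun q : ℝ × E3 => ENNReal.ofReal (jap q.1)⁻¹) := by
    unfold jap; fun_prop
  have hMm := measurable_add_three (w := fun γ => ENNReal.ofReal (jap γ)⁻¹)
    (a := fun γ z => W (Z γ - z)) (b := fun γ z => gradKer W (Z γ - z)) hjm hWZ hgm hg.meas hg.meas' V
  have hz : ∀ z, ‖∫ γ in Ioo t₃ t₄, u z γ * e γ‖ₑ ≤
      Λ * (‖W (Z t₃ - z)‖ₑ * ‖g t₃ z‖ₑ) + Λ * (‖W (Z t₄ - z)‖ₑ * ‖g t₄ z‖ₑ) +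
        Λ * ∫⁻ γ in Ioo t₃ t₄, (ENNReal.ofReal (jap γ)⁻¹ * (‖W (Z γ - z)‖ₑ * ‖g γ z‖ₑ) + ‖W (Z γ - z)‖ₑ * ‖g' γ z‖ₑ +
          ENNReal.ofReal V * (‖gradKer W (Z γ - z)‖ₑ * ‖g γ z‖ₑ)) := by
    intro z
    refine (enorm_integral_osc_le hσ h34 (huc z) fun γ hγ => (hud z γ hγ).differentiableAt).trans ?_
    have hend : ∀ γ ∈ Icc t₃ t₄, ‖u z γ‖ₑ ≤ Λ * (‖W (Z γ - z)‖ₑ * ‖g γ z‖ₑ) := fun γ hγ => by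
      rw [hu]
      simp only
      rw [enorm_mul, enorm_mul]
      exact mul_le_mul_left (hc.bound γ hγ) _
    refine add_le_add (add_le_add (hend _ (left_mem_Icc.2 h34)) (hend _ (right_mem_Icc.2 h34))) ?_
    rw [← lintegral_const_mul _ (hMm.of_uncurry_right (y := z))]
    refine lintegral_mono_ae ?_
    filter_upwards [hc.dbound, ae_restrict_mem measurableSet_Ioo] with γ h1 hγ
    rw [(hud z γ hγ).deriv]
    refine (enorm_add_le _ _).trans ?_
    rw [enorm_mul, enorm_mul, enorm_mul (c γ)]
    have h2 := hc.bound γ (Ioo_subset_Icc_self hγ)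
    have h3 : ‖fderiv ℝ W (Z γ - z) (deriv Z γ)‖ₑ ≤ ENNReal.ofReal V * ‖gradKer W (Z γ - z)‖ₑ := by
      rw [enorm_gradKer, ← ofReal_norm, ← ofReal_norm, ← ENNReal.ofReal_mul
        ((norm_nonneg _).trans (hZ.bound γ hγ))]
      refine ENNReal.ofReal_le_ofReal (((fderiv ℝ W (Z γ - z)).le_opNorm _).trans ?_)
      rw [mul_comm]
      gcongr
      exact hZ.bound γ hγ
    calc _ ≤ Λ * ENNReal.ofReal (jap γ)⁻¹ * (‖W (Z γ - z)‖ₑ * ‖g γ z‖ₑ) +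
          Λ * (ENNReal.ofReal V * ‖gradKer W (Z γ - z)‖ₑ * ‖g γ z‖ₑ + ‖W (Z γ - z)‖ₑ * ‖g' γ z‖ₑ) := by
          refine add_le_add (mul_le_mul_left h1 _) (mul_le_mul' h2 ((enorm_add_le _ _).trans ?_))
          rw [enorm_mul, enorm_mul]
          exact add_le_add_left (mul_le_mul_left h3 _) _
      _ = _ := by ring
  refine (enorm_integral_le_lintegral_enorm _).trans ((lintegral_mono hz).trans (le_of_eq ?_))
  exact lintegral_ibp_majorant (w := fun γ => ENNReal.ofReal (jap γ)⁻¹)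
    (a := fun γ z => W (Z γ - z)) (b := fun γ z => gradKer W (Z γ - z)) hjm hWZ hgm hg.meas hg.meas' V Λ

/-- The integral of a kernel of frequency `2^k` along a path that moves with speed at least `q`: the path
spends the time `2^{-k}/q` within the distance `2^{-k}` of `z`. -/
lemma lintegral_ker_line_le {k : ℤ} {B : ℝ} {W : E3 → ℂ} (hW : Ker k B W) {t₃ t₄ q : ℝ}
    (h34 : t₃ ≤ t₄) (hq : 0 < q) {Z : ℝ → E3} (hZc : ContinuousOn Z (Icc t₃ t₄))
    (hZ : ∀ γ ∈ Icc t₃ t₄, ∀ γ' ∈ Icc t₃ t₄, q * |γ - γ'| ≤ ‖Z γ - Z γ'‖) (z : E3) :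
    ∫⁻ γ in Ioo t₃ t₄, ‖W (Z γ - z)‖ₑ ≤ ENNReal.ofReal (2 * Real.pi * B * (2 ^ (2 * k) / q)) := by
  -- `γ₀` is the time of closest approach to `z`, so that `|Z γ - z| ≥ (q/2) |γ - γ₀|`
  obtain ⟨γ₀, hγ₀, hmin⟩ := isCompact_Icc.exists_isMinOn (nonempty_Icc.2 h34)
    (hZc.sub (continuousOn_const (c := z))).norm
  have h2 := zpow_two_pos k
  have hB := hW.nonneg
  set a : ℝ := 2 ^ k * (q / 2) with ha
  have ha0 : 0 < a := by positivity
  have hpt : ∀ γ ∈ Ioo t₃ t₄, ‖W (Z γ - z)‖ₑ ≤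
      ENNReal.ofReal (B * (2 ^ k) ^ 3 * (1 + (a * (γ - γ₀)) ^ 2)⁻¹) := by
    intro γ hγ
    have hγ' := Ioo_subset_Icc_self hγ
    rw [← ofReal_norm]
    refine ENNReal.ofReal_le_ofReal ((hW.bound _).trans ?_)
    rw [bump, mul_comm (3 : ℤ) k, zpow_mul, mul_assoc]
    norm_cast
    have h1 : q / 2 * |γ - γ₀| ≤ ‖Z γ - z‖ := by
      have e1 : ‖Z γ₀ - z‖ ≤ ‖Z γ - z‖ := hmin hγ'
      have e2 := hZ γ hγ' γ₀ hγ₀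
      have e3 : ‖Z γ - Z γ₀‖ ≤ ‖Z γ - z‖ + ‖Z γ₀ - z‖ := by
        have := norm_sub_le (Z γ - z) (Z γ₀ - z)
        rwa [sub_sub_sub_cancel_right] at this
      linarith
    have h3 : 0 ≤ 2 ^ k * ‖Z γ - z‖ := by positivity
    have h4 : (a * (γ - γ₀)) ^ 2 ≤ (2 ^ k * ‖Z γ - z‖) ^ 2 := by
      rw [← sq_abs, abs_mul, abs_of_pos ha0, ha, mul_assoc]
      gcongr
    gcongr
    nlinarith [pow_nonneg h3 3, pow_nonneg h3 4, sq_nonneg (2 ^ k * ‖Z γ - z‖)]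
  refine (setLIntegral_mono' measurableSet_Ioo hpt).trans ((setLIntegral_le_lintegral _ _).trans ?_)
  have hint : Integrable fun γ : ℝ => (1 + (a * (γ - γ₀)) ^ 2)⁻¹ :=
    (integrable_inv_one_add_sq.comp_mul_left' ha0.ne').comp_sub_right γ₀
  have hval : ∫ γ : ℝ, (1 + (a * (γ - γ₀)) ^ 2)⁻¹ = a⁻¹ * Real.pi := by
    rw [integral_sub_right_eq_self (fun γ : ℝ => (1 + (a * γ) ^ 2)⁻¹) γ₀,
      Measure.integral_comp_mul_left (fun γ : ℝ => (1 + γ ^ 2)⁻¹) a, integral_univ_inv_one_add_sq,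
      abs_of_pos (inv_pos.2 ha0), smul_eq_mul]
  rw [← ofReal_integral_eq_lintegral_ofReal (hint.const_mul _)
    (Filter.Eventually.of_forall fun γ => by positivity), integral_const_mul, hval]
  refine ENNReal.ofReal_le_ofReal (le_of_eq ?_)
  rw [ha, mul_comm 2 k, zpow_mul]
  field_simp

/-- The straight line estimate: along a path of speed at least `q` the time integral of a
convolution costs only the `L¹` norms of the initial value and of the time derivative. -/
lemma lintegral_nconv_line_le {T t₃ t₄ q B D D' : ℝ} {k : ℤ} (h0 : 0 ≤ t₃) (h34 : t₃ ≤ t₄)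
    (h4 : t₄ ≤ T) (hq : 0 < q) {W : E3 → ℂ} (hW : Ker k B W) {β β' : ℝ → ℝ}
    {g g' : ℝ → E3 → ℂ} (hg : OscPiece T β β' g g') (hD : β t₃ ≤ D)
    (hD' : ∀ γ ∈ Ioo t₃ t₄, β' γ ≤ D') (hD0 : 0 ≤ D') {Z : ℝ → E3} (hZm : Measurable Z)
    (hZc : ContinuousOn Z (Icc t₃ t₄))
    (hZ : ∀ γ ∈ Icc t₃ t₄, ∀ γ' ∈ Icc t₃ t₄, q * |γ - γ'| ≤ ‖Z γ - Z γ'‖) :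
    ∫⁻ γ in Ioo t₃ t₄, nconv W (g γ) (Z γ) ≤
      ENNReal.ofReal (2 * Real.pi * B * (2 ^ (2 * k) / q) * (D + (t₄ - t₃) * D')) := by
  have hsub : ∀ γ ∈ Icc t₃ t₄, γ ∈ Icc 0 T := fun γ hγ => ⟨h0.trans hγ.1, hγ.2.trans h4⟩
  have hsub' : ∀ γ ∈ Ioo t₃ t₄, γ ∈ Ioo 0 T := fun γ hγ => ⟨h0.trans_lt hγ.1, hγ.2.trans_le h4⟩
  -- `G` bounds `g γ` for all times at once, so that only the kernel depends on the time
  set G : E3 → ℝ≥0∞ := fun z => ‖g t₃ z‖ₑ + ∫⁻ γ in Ioo t₃ t₄, ‖g' γ z‖ₑ with hG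
  have hg'm : Measurable (Function.uncurry fun γ z => ‖g' γ z‖ₑ) := hg.meas'.enorm
  have hG2 : Measurable fun z => ∫⁻ γ in Ioo t₃ t₄, ‖g' γ z‖ₑ := hg'm.lintegral_prod_left'
  have hg3 : Measurable fun z => ‖g t₃ z‖ₑ := (hg.meas.of_uncurry_left (x := t₃)).enorm
  have hGm : Measurable G := hg3.add hG2
  have hgG : ∀ γ ∈ Ioo t₃ t₄, ∀ z, ‖g γ z‖ₑ ≤ G z := by
    intro γ hγ z
    have h1 := enorm_sub_le_lintegral_deriv (u := fun r => g r z) hγ.1.le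
      (((hg.cont z).mono hsub).mono (Icc_subset_Icc_right hγ.2.le))
      fun r hr => (hg.deriv z r (hsub' r ⟨hr.1, hr.2.trans hγ.2⟩)).differentiableAt
    have h2 : ∫⁻ r in Ioo t₃ γ, ‖deriv (fun r => g r z) r‖ₑ ≤ ∫⁻ r in Ioo t₃ t₄, ‖g' r z‖ₑ := by
      refine (setLIntegral_mono' measurableSet_Ioo fun r hr => ?_).trans
        (lintegral_mono_set (Ioo_subset_Ioo_right hγ.2.le))
      rw [(hg.deriv z r (hsub' r ⟨hr.1, hr.2.trans hγ.2⟩)).deriv]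
    calc ‖g γ z‖ₑ = ‖g t₃ z + (g γ z - g t₃ z)‖ₑ := by rw [add_sub_cancel]
      _ ≤ _ := (enorm_add_le _ _).trans (add_le_add_right (h1.trans h2) _)
  have hWZ : Measurable (fun q : ℝ × E3 => W (Z q.1 - q.2)) :=
    hW.cont.measurable.comp ((hZm.comp measurable_fst).sub measurable_snd)
  have hWG : Measurable (Function.uncurry fun γ z => ‖W (Z γ - z)‖ₑ * G z) :=
    hWZ.enorm.mul (hGm.comp measurable_snd)
  calc _ ≤ ∫⁻ γ in Ioo t₃ t₄, ∫⁻ z, ‖W (Z γ - z)‖ₑ * G z :=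
        setLIntegral_mono' measurableSet_Ioo fun γ hγ =>
          lintegral_mono fun z => mul_le_mul_right (hgG γ hγ z) _
    _ = ∫⁻ z, ∫⁻ γ in Ioo t₃ t₄, ‖W (Z γ - z)‖ₑ * G z :=
        lintegral_lintegral_swap (μ := volume.restrict (Ioo t₃ t₄)) hWG.aemeasurable
    _ ≤ ∫⁻ z, ENNReal.ofReal (2 * Real.pi * B * (2 ^ (2 * k) / q)) * G z := by
        refine lintegral_mono fun z => ?_
        have hWz : Measurable fun γ => ‖W (Z γ - z)‖ₑ :=
          (hW.cont.measurable.comp (hZm.sub_const z)).enorm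
        rw [lintegral_mul_const _ hWz]
        exact mul_le_mul_left (lintegral_ker_line_le hW h34 hq hZc hZ z) _
    _ = ENNReal.ofReal (2 * Real.pi * B * (2 ^ (2 * k) / q)) * ∫⁻ z, G z :=
        lintegral_const_mul _ hGm
    _ ≤ ENNReal.ofReal (2 * Real.pi * B * (2 ^ (2 * k) / q) * (D + (t₄ - t₃) * D')) := by
        have hD3 := (hg.bn t₃ (hsub _ (left_mem_Icc.2 h34)))
        have hB := hW.nonneg
        rw [ENNReal.ofReal_mul (p := 2 * Real.pi * B * (2 ^ (2 * k) / q)) (by positivity)]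
        refine mul_le_mul' le_rfl ?_
        rw [hG, lintegral_add_left hg3, ← lintegral_lintegral_swap
          (μ := volume.restrict (Ioo t₃ t₄)) (ν := volume) hg'm.aemeasurable,
          ENNReal.ofReal_add (hD3.nonneg.trans hD) (mul_nonneg (sub_nonneg.2 h34) hD0)]
        refine add_le_add (hD3.int.trans (ENNReal.ofReal_le_ofReal hD)) ?_
        calc _ ≤ ∫⁻ _ in Ioo t₃ t₄, ENNReal.ofReal D' :=
              setLIntegral_mono' measurableSet_Ioo fun γ hγ =>
                (hg.bn' γ (hsub' γ hγ)).int.trans (ENNReal.ofReal_le_ofReal (hD' γ hγ))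
          _ = _ := by
              rw [setLIntegral_const, Real.volume_Ioo, mul_comm,
                ENNReal.ofReal_mul (sub_nonneg.2 h34)]

/-! ### Majorants for the time integrals of one frequency -/

/-- The perturbed characteristics `Y₁` at time `τ` and `Y₂ γ` at time `γ`, with the properties of
the curves `γ ↦ Y₂ γ y v` for velocities in the window of index `j`. -/
structure Chars (s τ : ℝ) (j : ℕ) (Y₁ : E3 → E3 → E3) (Y₂ : ℝ → E3 → E3 → E3) : Prop where
  flow₁ : IsFlow s τ Y₁
  flow₂ : ∀ γ ∈ Icc 0 s, IsFlow s γ (Y₂ γ)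
  meas : Measurable (fun p : ℝ × E3 × E3 => Y₂ p.1 p.2.1 p.2.2)
  path : ∀ y, ∀ v ∈ win j, IsPath 0 s (33 * 2 ^ j) (fun γ => Y₂ γ y v)
  anti : 6 ≤ j → ∀ y, ∀ v ∈ win j, ∀ γ ∈ Icc 0 s, ∀ γ' ∈ Icc 0 s,
    2 ^ j / 64 * |γ - γ'| ≤ ‖Y₂ γ y v - Y₂ γ' y v‖

/-- The time interval `[t₃,t₄]` lies in the dyadic block of size `n`, inside `[0,s]`. -/
structure Block (n s τ t₃ t₄ : ℝ) : Prop where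
  one_le : 1 ≤ n
  tau_nonneg : 0 ≤ τ
  tau_le : τ ≤ s
  le : t₃ ≤ t₄
  lower : n - 1 ≤ t₃
  upper : t₄ ≤ 2 * n
  le_s : t₄ ≤ s

lemma IsPath.mono {a b t₃ t₄ V : ℝ} {Z : ℝ → E3} (h : IsPath a b V Z) (h3 : a ≤ t₃) (h4 : t₄ ≤ b) :
    IsPath t₃ t₄ V Z :=
  ⟨h.meas, h.cont.mono (Icc_subset_Icc h3 h4), fun γ hγ => h.diff γ (Ioo_subset_Ioo h3 h4 hγ),
    fun γ hγ => h.bound γ (Ioo_subset_Ioo h3 h4 hγ)⟩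

section rates

variable {n s τ t₃ t₄ : ℝ}

lemma Block.nonneg (h : Block n s τ t₃ t₄) : 0 ≤ t₃ := by linarith [h.one_le, h.lower]

lemma Block.mem (h : Block n s τ t₃ t₄) {γ : ℝ} (hγ : γ ∈ Icc t₃ t₄) : γ ∈ Icc 0 s :=
  ⟨h.nonneg.trans hγ.1, hγ.2.trans h.le_s⟩

lemma Block.jap_ge (h : Block n s τ t₃ t₄) {γ : ℝ} (hγ : γ ∈ Icc t₃ t₄) : n / 2 ≤ jap γ := by
  refine Real.le_sqrt_of_sq_le ?_
  nlinarith [h.lower, hγ.1, h.one_le, h.nonneg, sq_nonneg (γ - 1)]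

lemma Block.jap_le (h : Block n s τ t₃ t₄) {γ : ℝ} (hγ : γ ∈ Icc t₃ t₄) : jap γ ≤ 3 * n := by
  refine Real.sqrt_le_iff.2 ⟨by linarith [h.one_le], ?_⟩
  nlinarith [h.upper, hγ.1, hγ.2, h.one_le, h.nonneg]

lemma Block.drift_le (h : Block n s τ t₃ t₄) {γ : ℝ} (hγ : γ ∈ Icc t₃ t₄) :
    drift γ ≤ 2 * (n ^ (2 * del) / n) := by
  have hn : 0 < n := by linarith [h.one_le]
  have h1 := h.jap_ge hγ
  have h2 : (n / 2) ^ (1 - 2 * del) ≤ jap γ ^ (1 - 2 * del) :=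
    Real.rpow_le_rpow (by positivity) h1 (by norm_num [del])
  have h3 : (2 : ℝ) ^ (1 - 2 * del) ≤ 2 := by
    conv_rhs => rw [← Real.rpow_one 2]
    exact Real.rpow_le_rpow_of_exponent_le one_le_two (by norm_num [del])
  have h4 : n ^ (1 - 2 * del) = n / n ^ (2 * del) := by rw [Real.rpow_sub hn, Real.rpow_one]
  rw [Real.div_rpow hn.le two_pos.le, h4] at h2
  have h5 : 0 < n ^ (2 * del) := Real.rpow_pos_of_pos hn _
  unfold drift
  calc _ ≤ (n / n ^ (2 * del) / 2 ^ (1 - 2 * del))⁻¹ := inv_anti₀ (by positivity) h2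
    _ = 2 ^ (1 - 2 * del) * (n ^ (2 * del) / n) := by
        have : (2 : ℝ) ^ (1 - 2 * del) ≠ 0 := (Real.rpow_pos_of_pos two_pos _).ne'
        field_simp
    _ ≤ _ := by gcongr

lemma Block.oscRate_le (h : Block n s τ t₃ t₄) {γ : ℝ} (hγ : γ ∈ Icc t₃ t₄) (k : ℤ) :
    oscRate k γ ≤ 3 * n ^ del := by
  have hn : 0 < n := by linarith [h.one_le]
  refine (min_le_left _ _).trans ?_
  calc jap γ ^ del ≤ (3 * n) ^ del :=
        Real.rpow_le_rpow (jap_pos γ).le (h.jap_le hγ) (by norm_num [del])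
    _ = 3 ^ del * n ^ del := Real.mul_rpow (by norm_num) hn.le
    _ ≤ 3 * n ^ del := by
        gcongr
        conv_rhs => rw [← Real.rpow_one 3]
        exact Real.rpow_le_rpow_of_exponent_le (by norm_num) (by norm_num [del])

lemma Block.oscRate_le' (h : Block n s τ t₃ t₄) {γ : ℝ} (hγ : γ ∈ Icc t₃ t₄) (k : ℤ) :
    oscRate k γ ≤ 2 * ((2 ^ k)⁻¹ * (n ^ (2 * del) / n)) := by
  have := zpow_two_pos k
  calc oscRate k γ ≤ (2 ^ k)⁻¹ * drift γ := min_le_right _ _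
    _ ≤ (2 ^ k)⁻¹ * (2 * (n ^ (2 * del) / n)) := by gcongr; exact h.drift_le hγ
    _ = _ := by ring

/-- The common size of the frequencies `2^{k₁}`, `2^{k₂}` and of the inverse `1/N` of the larger
time. -/
noncomputable def mu (N : ℝ) (k₁ k₂ : ℤ) : ℝ := min (2 ^ k₁) (min (2 ^ k₂) N⁻¹)

/-- On a block the gain `min(2^k, ⟨t⟩⁻¹)` of two factors can be expressed by `n` and `⟨τ⟩` alone. -/
lemma Block.mm_le (h : Block n s τ t₃ t₄) {γ : ℝ} (hγ : γ ∈ Icc t₃ t₄) (k₁ k₂ : ℤ) :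
    min (mm k₁ τ) (mm k₂ γ) ≤ 2 * mu (max n (jap τ)) k₁ k₂ := by
  have h1 := zpow_two_pos k₁
  have h2 := zpow_two_pos k₂
  have hτ := jap_pos τ
  have hn : 0 < n := by linarith [h.one_le]
  have hg : (jap γ)⁻¹ ≤ 2 * n⁻¹ := by
    rw [← div_eq_mul_inv, inv_le_comm₀ (jap_pos γ) (by positivity), inv_div]
    exact h.jap_ge hγ
  have e1 : min (mm k₁ τ) (mm k₂ γ) ≤ 2 ^ k₁ := (min_le_left _ _).trans (min_le_left _ _)
  have e2 : min (mm k₁ τ) (mm k₂ γ) ≤ 2 ^ k₂ := (min_le_right _ _).trans (min_le_left _ _)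
  have e3 : min (mm k₁ τ) (mm k₂ γ) ≤ (jap τ)⁻¹ := (min_le_left _ _).trans (min_le_right _ _)
  have e4 : min (mm k₁ τ) (mm k₂ γ) ≤ (jap γ)⁻¹ := (min_le_right _ _).trans (min_le_right _ _)
  have e5 : 0 < (jap τ)⁻¹ := inv_pos.2 hτ
  unfold mu
  rw [mul_min_of_nonneg _ _ two_pos.le, mul_min_of_nonneg _ _ two_pos.le]
  refine le_min (by linarith) (le_min (by linarith) ?_)
  rcases max_choice n (jap τ) with e | e <;> rw [e] <;> linarith

/-- The bound that the time integrals of one frequency obey, up to the size of the kernel and of the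
density; `X` is the frequency. The power `9/4` of `μ`, instead of the full power `3`, leaves the factor
`μ^{3/4} ≤ N^{-3/4}` to pay for the length of the time interval and for the low frequencies; the small
negative power of `X` makes the sums over the frequencies converge. -/
noncomputable def gain (N X μ : ℝ) : ℝ := N ^ (1 / 8 + 2 * del) * X ^ (-(1 / 100) : ℝ) * μ ^ (9 / 4 : ℝ)

lemma gain_pos {N X μ : ℝ} (hN : 0 < N) (hX : 0 < X) (hμ : 0 < μ) : 0 < gain N X μ := by
  unfold gain; positivity

/-- In exponential form, inequalities between products of powers are linear inequalities for the
logarithms. -/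
lemma exists_eq_exp {x : ℝ} (h : 0 < x) : ∃ r, x = Real.exp r := ⟨Real.log x, (Real.exp_log h).symm⟩

/-- The stationary part decays fast enough without any oscillation. -/
lemma stat_le_gain {N X μ n : ℝ} (hn : 1 ≤ n) (hN : n ≤ N) (hX : 0 < X) (hμ : 0 < μ) (hμN : μ ≤ N⁻¹) :
    (1 + X)⁻¹ * n ^ (2 * del) * μ ^ 3 ≤ gain N X μ := by
  have h1 : (1 + X)⁻¹ ≤ X ^ (-(1 / 100) : ℝ) := by
    rcases le_total 1 X with h | h
    · calc (1 + X)⁻¹ ≤ X⁻¹ := inv_anti₀ hX (by linarith)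
        _ = X ^ (-1 : ℝ) := (Real.rpow_neg_one X).symm
        _ ≤ _ := Real.rpow_le_rpow_of_exponent_le h (by norm_num)
    · calc (1 + X)⁻¹ ≤ 1 := inv_le_one_of_one_le₀ (by linarith)
        _ ≤ _ := Real.one_le_rpow_of_pos_of_le_one_of_nonpos hX h (by norm_num)
  have h2 : n ^ (2 * del) * μ ^ 3 ≤ N ^ (1 / 8 + 2 * del) * μ ^ (9 / 4 : ℝ) := by
    obtain ⟨ν, rfl⟩ := exists_eq_exp (by linarith : 0 < n)
    obtain ⟨M, rfl⟩ := exists_eq_exp (by linarith : 0 < N)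
    obtain ⟨m, rfl⟩ := exists_eq_exp hμ
    rw [← Real.exp_neg, Real.exp_le_exp] at hμN
    rw [Real.exp_le_exp] at hN
    rw [Real.one_le_exp_iff] at hn
    simp only [← Real.exp_mul, ← Real.exp_add, ← Real.exp_nat_mul, Real.exp_le_exp, del]
    push_cast
    linarith
  unfold gain
  calc _ = (1 + X)⁻¹ * (n ^ (2 * del) * μ ^ 3) := by ring
    _ ≤ X ^ (-(1 / 100) : ℝ) * (N ^ (1 / 8 + 2 * del) * μ ^ (9 / 4 : ℝ)) := by gcongr
    _ = _ := by ring

/-- High frequencies: no oscillation is needed. -/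
lemma high_le_gain {N X μ n : ℝ} (hn : 1 ≤ n) (hN : n ≤ N) (hX : n ^ (-(7 / 8) : ℝ) ≤ X) (hμ : 0 < μ)
    (hμN : μ ≤ N⁻¹) : X⁻¹ * n ^ (2 * del) * μ ^ 3 ≤ gain N X μ := by
  have hX0 : 0 < X := (Real.rpow_pos_of_pos (by linarith) _).trans_le hX
  obtain ⟨ν, rfl⟩ := exists_eq_exp (by linarith : 0 < n)
  obtain ⟨M, rfl⟩ := exists_eq_exp (by linarith : 0 < N)
  obtain ⟨m, rfl⟩ := exists_eq_exp hμ
  obtain ⟨x, rfl⟩ := exists_eq_exp hX0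
  rw [← Real.exp_neg, Real.exp_le_exp] at hμN
  rw [← Real.exp_mul, Real.exp_le_exp] at hX
  rw [Real.exp_le_exp] at hN
  rw [Real.one_le_exp_iff] at hn
  simp only [gain, ← Real.exp_neg, ← Real.exp_mul, ← Real.exp_add, ← Real.exp_nat_mul,
    Real.exp_le_exp, del]
  push_cast
  linarith

/-- Low frequencies and moderate velocities: the bounds for the terms of the integration by parts. -/
lemma low_le_gain {N X μ n J : ℝ} (hn : 1 ≤ n) (hN : n ≤ N) (hX0 : 0 < X) (hX : X ≤ n ^ (-(7 / 8) : ℝ))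
    (hJ : J ≤ 32 * n ^ (3 / 4 : ℝ)) (hμ : 0 < μ) (hμN : μ ≤ N⁻¹) :
    n ^ del * μ ^ 3 ≤ gain N X μ ∧ n ^ (2 * del) * μ ^ 3 ≤ gain N X μ ∧
      n * J * X * n ^ del * μ ^ 3 ≤ 32 * gain N X μ := by
  have h1 : n * J * X * n ^ del * μ ^ 3 ≤ n * (32 * n ^ (3 / 4 : ℝ)) * X * n ^ del * μ ^ 3 := by
    gcongr
  refine ⟨?_, ?_, h1.trans ?_⟩
  all_goals
    obtain ⟨ν, rfl⟩ := exists_eq_exp (by linarith : 0 < n)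
    obtain ⟨M, rfl⟩ := exists_eq_exp (by linarith : 0 < N)
    obtain ⟨m, rfl⟩ := exists_eq_exp hμ
    obtain ⟨x, rfl⟩ := exists_eq_exp hX0
    rw [← Real.exp_neg, Real.exp_le_exp] at hμN
    rw [← Real.exp_mul, Real.exp_le_exp] at hX
    rw [Real.exp_le_exp] at hN
    rw [Real.one_le_exp_iff] at hn
  · simp only [gain, ← Real.exp_mul, ← Real.exp_add, ← Real.exp_nat_mul, Real.exp_le_exp, del]
    push_cast
    linarith
  · simp only [gain, ← Real.exp_mul, ← Real.exp_add, ← Real.exp_nat_mul, Real.exp_le_exp, del]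
    push_cast
    linarith
  · have e : ∀ a b c d e : ℝ, a * (32 * b) * c * d * e = 32 * (a * b * c * d * e) := by
      intros; ring
    rw [e]
    refine mul_le_mul_of_nonneg_left ?_ (by norm_num)
    simp only [gain, ← Real.exp_mul, ← Real.exp_add, ← Real.exp_nat_mul, Real.exp_le_exp, del]
    push_cast
    linarith

/-- Low frequencies and large velocities: the straight line estimate and the trivial estimate are
interpolated with weights `1/4` and `3/4`. -/
lemma line_le_gain {N X μ n J : ℝ} (hn : 1 ≤ n) (hN : n ≤ N) (hX0 : 0 < X)
    (hX : X ≤ n ^ (-(7 / 8) : ℝ)) (hJ : 32 * n ^ (3 / 4 : ℝ) ≤ J) (hμ : 0 < μ) :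
    min (X ^ 2 / J * n ^ (2 * del)) (n * n ^ del * μ ^ 3) ≤ gain N X μ := by
  have hn0 : 0 < n := by linarith
  have hJ' : n ^ (3 / 4 : ℝ) ≤ J := by
    have := Real.rpow_pos_of_pos hn0 (3 / 4 : ℝ)
    linarith
  have h0 : X ^ 2 / J ≤ X ^ 2 / n ^ (3 / 4 : ℝ) := by gcongr
  -- the weighted geometric mean, raised to the fourth power: `X² J⁻¹ (n μ³)³ ≤ n^{1/2} μ⁹` up to powers
  -- of size `δ`, since `X ≤ n^{-7/8}` and `J ≥ n^{3/4}`
  have h1 : X ^ 2 / J * n ^ (2 * del) * (n * n ^ del * μ ^ 3) ^ 3 ≤ gain N X μ ^ 4 := by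
    calc _ ≤ X ^ 2 / n ^ (3 / 4 : ℝ) * n ^ (2 * del) * (n * n ^ del * μ ^ 3) ^ 3 := by gcongr
      _ ≤ _ := by
        obtain ⟨ν, rfl⟩ := exists_eq_exp (by linarith : 0 < n)
        obtain ⟨M, rfl⟩ := exists_eq_exp (by linarith : 0 < N)
        obtain ⟨m, rfl⟩ := exists_eq_exp hμ
        obtain ⟨x, rfl⟩ := exists_eq_exp hX0
        rw [← Real.exp_mul, Real.exp_le_exp] at hX
        rw [Real.exp_le_exp] at hN
        rw [Real.one_le_exp_iff] at hn
        simp only [gain, ← Real.exp_mul, ← Real.exp_add, ← Real.exp_nat_mul, ← Real.exp_sub,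
          Real.exp_le_exp, del]
        push_cast
        linarith
  by_contra h
  rw [not_le, lt_min_iff] at h
  have hg := gain_pos (by linarith : 0 < N) hX0 hμ
  have h2 : gain N X μ * gain N X μ ^ 3 <
      X ^ 2 / J * n ^ (2 * del) * (n * n ^ del * μ ^ 3) ^ 3 :=
    mul_lt_mul h.1 (pow_le_pow_left₀ hg.le h.2.le 3) (by positivity) (hg.le.trans h.1.le)
  have h3 : gain N X μ * gain N X μ ^ 3 = gain N X μ ^ 4 := by ring
  linarith

end rates

/-- The constant in the bound for the contribution of one time. -/
noncomputable def atomConst : ℝ := 8 * tbConst * (bumpMass + 1)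

lemma tbConst_le_atomConst : tbConst ≤ atomConst := by
  have := tbConst_pos
  have := bumpMass_pos
  unfold atomConst
  nlinarith

lemma atomConst_pos : 0 < atomConst := tbConst_pos.trans_le tbConst_le_atomConst

lemma mu_pos {N : ℝ} (hN : 0 < N) (k₁ k₂ : ℤ) : 0 < mu N k₁ k₂ :=
  lt_min (zpow_two_pos _) (lt_min (zpow_two_pos _) (inv_pos.2 hN))

lemma TB.mul_nconv {n s τ t₃ t₄ γ p B β : ℝ} (hb : Block n s τ t₃ t₄) (hγ : γ ∈ Icc t₃ t₄)
    {Y₁ Y₂ : E3 → E3 → E3} (hY₁ : IsFlow s τ Y₁) (hY₂ : IsFlow s γ Y₂) (j : ℕ) {k₁ k₂ : ℤ}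
    {W h : E3 → ℂ} (hW : Ker k₂ B W) (hh : Bn γ β h) {f : E3 → ℝ≥0∞} (hf : Maj τ k₁ p f) :
    TB s j (ENNReal.ofReal (atomConst * (p * B * β * mu (max n (jap τ)) k₁ k₂ ^ 3)))
      (fun y v => f (Y₁ y v) * nconv W h (Y₂ y v)) := by
  have hs := hb.mem hγ
  refine (TB.mul_comp_flow hb.tau_nonneg hb.tau_le hs.1 hs.2 hY₁ hY₂ j hf (maj_nconv hW hh)).mono
    (ENNReal.ofReal_le_ofReal ?_) fun _ _ _ => le_rfl
  have h1 := hb.mm_le hγ k₁ k₂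
  have h2 : 0 < min (mm k₁ τ) (mm k₂ γ) := lt_min (mm_pos _ _) (mm_pos _ _)
  have h3 : min (mm k₁ τ) (mm k₂ γ) ^ 3 ≤ (2 * mu (max n (jap τ)) k₁ k₂) ^ 3 :=
    pow_le_pow_left₀ h2.le h1 3
  have := tbConst_pos
  have := bumpMass_pos
  have := hW.nonneg
  have := hh.nonneg
  have := hf.nonneg
  calc _ ≤ tbConst * (p * ((bumpMass + 1) * B * β) * (2 * mu (max n (jap τ)) k₁ k₂) ^ 3) := by gcongr
    _ = _ := by unfold atomConst; ring

section time

variable {n s τ t₃ t₄ : ℝ} {j : ℕ} {Y₁ : E3 → E3 → E3} {Y₂ : ℝ → E3 → E3 → E3}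

lemma Chars.measurable_path (hY : Chars s τ j Y₁ Y₂) {H : ℝ → E3 → ℝ≥0∞}
    (hH : Measurable (fun q : ℝ × E3 => H q.1 q.2)) :
    Measurable (fun p : ℝ × E3 × E3 => H p.1 (Y₂ p.1 p.2.1 p.2.2)) :=
  hH.comp (measurable_fst.prodMk hY.meas)

lemma measurable_nconv_path {W : E3 → ℂ} (hW : Measurable W) {h : ℝ → E3 → ℂ}
    (hh : Measurable (fun p : ℝ × E3 => h p.1 p.2)) (hY : Chars s τ j Y₁ Y₂) :
    Measurable (fun p : ℝ × E3 × E3 => nconv W (h p.1) (Y₂ p.1 p.2.1 p.2.2)) :=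
  hY.measurable_path (H := fun γ z => nconv W (h γ) z) (measurable_nconv_param hW hh)

lemma measurable_lintegral_path {H : ℝ → E3 → E3 → ℝ≥0∞}
    (hH : Measurable (fun p : ℝ × E3 × E3 => H p.1 p.2.1 p.2.2)) (S : Set ℝ) :
    Measurable (fun p : E3 × E3 => ∫⁻ γ in S, H γ p.1 p.2) := by
  have h1 : Measurable (Function.uncurry fun (γ : ℝ) (p : E3 × E3) => H γ p.1 p.2) := hH
  exact h1.lintegral_prod_left'

lemma measurable_at_time {H : ℝ → E3 → E3 → ℝ≥0∞}
    (hH : Measurable (fun p : ℝ × E3 × E3 => H p.1 p.2.1 p.2.2)) (γ : ℝ) :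
    Measurable (fun p : E3 × E3 => H γ p.1 p.2) := by
  have h1 : Measurable (Function.uncurry fun (γ : ℝ) (p : E3 × E3) => H γ p.1 p.2) := hH
  exact h1.of_uncurry_left

lemma measurable_in_time {H : ℝ → E3 → E3 → ℝ≥0∞}
    (hH : Measurable (fun p : ℝ × E3 × E3 => H p.1 p.2.1 p.2.2)) (y v : E3) :
    Measurable (fun γ : ℝ => H γ y v) := by
  have h1 : Measurable (Function.uncurry fun (γ : ℝ) (p : E3 × E3) => H γ p.1 p.2) := hH
  exact h1.of_uncurry_right (y := (y, v))

lemma Chars.measurable_comp (hY : Chars s τ j Y₁ Y₂) {f : E3 → ℝ≥0∞} (hf : Measurable f) :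
    Measurable (fun p : E3 × E3 => f (Y₁ p.1 p.2)) := hf.comp hY.flow₁.meas

/-- The trivial bound for a time integral: the length `2n` of the interval times the bound at one time. -/
lemma TB.mul_lintegral_nconv {p B β : ℝ} (hb : Block n s τ t₃ t₄) (hY : Chars s τ j Y₁ Y₂)
    {k₁ k₂ : ℤ} {W : E3 → ℂ} (hW : Ker k₂ B W) {h : ℝ → E3 → ℂ}
    (hm : Measurable (fun p : ℝ × E3 => h p.1 p.2)) (hh : ∀ γ ∈ Ioo t₃ t₄, Bn γ β (h γ))
    {f : E3 → ℝ≥0∞} (hf : Maj τ k₁ p f) :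
    TB s j (ENNReal.ofReal (2 * n * (atomConst * (p * B * β * mu (max n (jap τ)) k₁ k₂ ^ 3))))
      (fun y v => f (Y₁ y v) * ∫⁻ γ in Ioo t₃ t₄, nconv W (h γ) (Y₂ γ y v)) := by
  have hm' := measurable_nconv_path hW.cont.measurable hm hY
  have hf' : Measurable (fun q : ℝ × E3 × E3 => f (Y₁ q.2.1 q.2.2)) :=
    (hY.measurable_comp hf.meas).comp measurable_snd
  have h1 := TB.setLIntegral (S := Ioo t₃ t₄) (H := fun γ y v => f (Y₁ y v) *
    nconv W (h γ) (Y₂ γ y v)) measurableSet_Ioo (fun γ hγ =>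
      TB.mul_nconv hb (Ioo_subset_Icc_self hγ) hY.flow₁
        (hY.flow₂ γ (hb.mem (Ioo_subset_Icc_self hγ))) j hW (hh γ hγ) hf) (hf'.mul hm')
  refine h1.mono ?_ fun y v _ => ?_
  · have := hb.one_le
    have := hb.nonneg
    have := hb.upper
    rw [Real.volume_Ioo, ENNReal.ofReal_mul (p := 2 * n) (by linarith)]
    gcongr
    linarith
  · have h2 := measurable_in_time (H := fun γ y v => nconv W (h γ) (Y₂ γ y v)) hm' y v
    exact (lintegral_const_mul (f (Y₁ y v)) h2).ge

lemma TB.min {β β' : ℝ} {H : E3 → E3 → ℝ≥0∞} (h : TB s j (ENNReal.ofReal β) H)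
    (h' : TB s j (ENNReal.ofReal β') H) : TB s j (ENNReal.ofReal (min β β')) H := by
  rcases min_choice β β' with e | e <;> rwa [e]

/-- `Jm` dominates, for all admissible amplitudes, the time integrals of `F`, a function
along the characteristics, and its product with functions of frequency `2^{k₁}` is small. -/
structure TimeMaj (n s τ t₃ t₄ : ℝ) (j : ℕ) (Y₁ : E3 → E3 → E3) (k₂ : ℤ) (b : ℝ)
    (F : ℝ → E3 → E3 → ℂ) (Jm : E3 → E3 → ℝ≥0∞) : Prop where
  meas : Measurable (fun p : E3 × E3 => Jm p.1 p.2)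
  le : ∀ y, ∀ v ∈ win j, ∀ Λ : ℝ≥0∞, Λ ≠ ⊤ → ∀ c, Amp t₃ t₄ Λ c →
    ‖∫ γ in Ioo t₃ t₄, c γ * F γ y v‖ₑ ≤ Λ * Jm y v
  tb : ∀ k₁ p f, Maj τ k₁ p f → TB s j (ENNReal.ofReal (b * (p *
    gain (max n (jap τ)) (2 ^ k₂) (mu (max n (jap τ)) k₁ k₂)))) (fun y v => f (Y₁ y v) * Jm y v)

/-- For the stationary pieces the trivial bound suffices, because their size decays like `⟨t⟩^{-1+2δ}`. -/
lemma exists_stat_majorant (hb : Block n s τ t₃ t₄) (hY : Chars s τ j Y₁ Y₂) {k : ℤ} {W : E3 → ℂ}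
    {B D : ℝ} (hW : Ker k B W) {S : ℝ → E3 → ℂ} (hm : Measurable (fun p : ℝ × E3 => S p.1 p.2))
    (hS : ∀ t ∈ Icc 0 s, Bn t (D * ((1 + 2 ^ k)⁻¹ * drift t)) (S t)) (hD : 0 ≤ D) :
    ∃ Jm, TimeMaj n s τ t₃ t₄ j Y₁ k (4 * atomConst * (B * D))
      (fun γ y v => cv W (S γ) (Y₂ γ y v)) Jm := by
  have hm' := measurable_nconv_path hW.cont.measurable hm hY
  have hn : 0 < n := by linarith [hb.one_le]
  have h2 := zpow_two_pos k
  have hN : 0 < max n (jap τ) := lt_max_of_lt_left hn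
  have hn2 : 0 < n ^ (2 * del) := Real.rpow_pos_of_pos hn _
  refine ⟨fun y v => ∫⁻ γ in Ioo t₃ t₄, nconv W (S γ) (Y₂ γ y v), measurable_lintegral_path (H := fun γ y v => nconv W (S γ) (Y₂ γ y v)) hm' _, ?_,
         fun k₁ p f hf => ?_⟩
  · intro y v hv Λ _ c hc
    have h3 := measurable_in_time (H := fun γ y v => nconv W (S γ) (Y₂ γ y v)) hm' y v
    exact enorm_integral_amp_le hc h3 fun γ _ => enorm_cv_le _ _ _
  · have h3 := TB.mul_lintegral_nconv (β := D * ((1 + 2 ^ k)⁻¹ * (2 * (n ^ (2 * del) / n)))) hb hY hW hm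
      (fun γ hγ => ?_) hf
    · refine h3.mono (ENNReal.ofReal_le_ofReal ?_) fun _ _ _ => le_rfl
      have h4 := stat_le_gain hb.one_le (le_max_left n (jap τ)) h2 (mu_pos hN k₁ k)
        ((min_le_right _ _).trans (min_le_right _ _))
      have := hW.nonneg
      have := hf.nonneg
      have := atomConst_pos
      calc _ = 4 * atomConst * (B * D) * (p * ((1 + 2 ^ k)⁻¹ * n ^ (2 * del) *
            mu (max n (jap τ)) k₁ k ^ 3)) := by field_simp; ring
        _ ≤ _ := by gcongr
    · have hγ' := Ioo_subset_Icc_self hγ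
      refine (hS γ (hb.mem hγ')).mono ?_
      gcongr
      exact hb.drift_le hγ'

/-- The three regimes for the oscillating pieces: high frequencies, where no oscillation is used;
low frequencies with moderate velocities, where one integrates by parts in time; and low frequencies
with large velocities, where the straight line estimate helps. -/
lemma exists_osc_majorant (hb : Block n s τ t₃ t₄) (hY : Chars s τ j Y₁ Y₂) {k : ℤ} {W : E3 → ℂ}
    {B D : ℝ} (hW : KerD k B W) {g g' : ℝ → E3 → ℂ} (hD : 0 ≤ D)
    (hg : OscPiece s (fun t => D * oscRate k t) (fun t => D * drift t) g g') {σ : ℝ} (hσ : |σ| = 1) :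
    ∃ Jm, TimeMaj n s τ t₃ t₄ j Y₁ k (6400 * atomConst * (B * D))
      (fun γ y v => Complex.exp (Complex.I * ((σ * γ : ℝ) : ℂ)) * cv W (g γ) (Y₂ γ y v)) Jm := by
  have hm' := measurable_nconv_path hW.cont.measurable hg.meas hY
  have hn : 0 < n := by linarith [hb.one_le]
  have h2 := zpow_two_pos k
  have hN : 0 < max n (jap τ) := lt_max_of_lt_left hn
  have hn1 : 0 < n ^ del := Real.rpow_pos_of_pos hn _
  have hn2 : 0 < n ^ (2 * del) := Real.rpow_pos_of_pos hn _
  have hB := hW.toKer.nonneg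
  have hat := atomConst_pos
  have hpath : ∀ y, ∀ v ∈ win j, IsPath t₃ t₄ (33 * 2 ^ j) (fun γ => Y₂ γ y v) := fun y v hv =>
    (hY.path y v hv).mono hb.nonneg hb.le_s
  have hgo : ∀ γ ∈ Icc t₃ t₄, Bn γ (D * (3 * n ^ del)) (g γ) := fun γ hγ =>
    (hg.bn γ (hb.mem hγ)).mono (mul_le_mul_of_nonneg_left (hb.oscRate_le hγ k) hD)
  have hgp : ∀ γ ∈ Ioo t₃ t₄, Bn γ (D * (2 * (n ^ (2 * del) / n))) (g' γ) := fun γ hγ =>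
    (hg.bn' γ ⟨hb.nonneg.trans_lt hγ.1, hγ.2.trans_le hb.le_s⟩).mono
      (mul_le_mul_of_nonneg_left (hb.drift_le (Ioo_subset_Icc_self hγ)) hD)
  -- the majorant without integration by parts, for the first and for the last regime
  have htriv : ∀ y, ∀ v ∈ win j, ∀ Λ : ℝ≥0∞, Λ ≠ ⊤ → ∀ c, Amp t₃ t₄ Λ c →
      ‖∫ γ in Ioo t₃ t₄, c γ * (Complex.exp (Complex.I * ((σ * γ : ℝ) : ℂ)) *
        cv W (g γ) (Y₂ γ y v))‖ₑ ≤ Λ * ∫⁻ γ in Ioo t₃ t₄, nconv W (g γ) (Y₂ γ y v) := by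
    intro y v hv Λ _ c hc
    have h3 := measurable_in_time (H := fun γ y v => nconv W (g γ) (Y₂ γ y v)) hm' y v
    refine enorm_integral_amp_le hc h3 fun γ _ => ?_
    rw [enorm_mul, ← ofReal_norm (Complex.exp _), mul_comm Complex.I, Complex.norm_exp_ofReal_mul_I,
      ENNReal.ofReal_one, one_mul]
    exact enorm_cv_le _ _ _
  -- high frequencies: the bound `2^{-k} ⟨t⟩^{-1+2δ}` of the piece compensates for the length of the interval
  rcases le_total (n ^ (-(7 / 8) : ℝ)) (2 ^ k) with hX | hX
  · refine ⟨_, measurable_lintegral_path (H := fun γ y v => nconv W (g γ) (Y₂ γ y v)) hm' _, htriv, fun k₁ p f hf => ?_⟩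
    have h3 := TB.mul_lintegral_nconv (β := D * (2 * ((2 ^ k)⁻¹ * (n ^ (2 * del) / n)))) hb hY
      hW.toKer hg.meas (fun γ hγ => (hg.bn γ (hb.mem (Ioo_subset_Icc_self hγ))).mono
        (mul_le_mul_of_nonneg_left (hb.oscRate_le' (Ioo_subset_Icc_self hγ) k) hD))
      hf
    refine h3.mono (ENNReal.ofReal_le_ofReal ?_) fun _ _ _ => le_rfl
    have h4 := high_le_gain hb.one_le (le_max_left n (jap τ)) hX (mu_pos hN k₁ k)
      ((min_le_right _ _).trans (min_le_right _ _))
    have := hf.nonneg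
    have h5 := gain_pos hN h2 (mu_pos hN k₁ k)
    calc _ = 4 * atomConst * (B * D) * (p * ((2 ^ k)⁻¹ * n ^ (2 * del) *
          mu (max n (jap τ)) k₁ k ^ 3)) := by field_simp; ring
      _ ≤ 4 * atomConst * (B * D) * (p * gain (max n (jap τ)) (2 ^ k) (mu (max n (jap τ)) k₁ k)) := by
        gcongr
      _ ≤ _ := by gcongr; norm_num
  -- low frequencies, moderate velocities: the terms of the integration by parts, the worst of which has
  -- the factor `n 2^j 2^k ≤ 32 n^{7/8}` from the derivative of the kernel along the path
  rcases le_or_gt ((2 : ℝ) ^ j) (32 * n ^ (3 / 4 : ℝ)) with hJ | hJ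
  · set V : ℝ := 33 * 2 ^ j with hV
    have hgm := measurable_nconv_path hW.gradKer.cont.measurable hg.meas hY
    have hpm := measurable_nconv_path hW.cont.measurable hg.meas' hY
    have hI1 := measurable_lintegral_path (H := fun γ y v => nconv W (g γ) (Y₂ γ y v)) hm'
      (Ioo t₃ t₄)
    have hI2 := measurable_lintegral_path (H := fun γ y v => nconv W (g' γ) (Y₂ γ y v)) hpm
      (Ioo t₃ t₄)
    have hI3 := measurable_lintegral_path (H := fun γ y v => nconv (gradKer W) (g γ) (Y₂ γ y v)) hgm
      (Ioo t₃ t₄)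
    have h3m := measurable_at_time (H := fun γ y v => nconv W (g γ) (Y₂ γ y v)) hm' t₃
    have h4m := measurable_at_time (H := fun γ y v => nconv W (g γ) (Y₂ γ y v)) hm' t₄
    refine ⟨fun y v => nconv W (g t₃) (Y₂ t₃ y v) + nconv W (g t₄) (Y₂ t₄ y v) +
      ENNReal.ofReal (2 / n) * (∫⁻ γ in Ioo t₃ t₄, nconv W (g γ) (Y₂ γ y v)) +
      (∫⁻ γ in Ioo t₃ t₄, nconv W (g' γ) (Y₂ γ y v)) +
      ENNReal.ofReal V * ∫⁻ γ in Ioo t₃ t₄, nconv (gradKer W) (g γ) (Y₂ γ y v),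
      (((h3m.add h4m).add (hI1.const_mul _)).add hI2).add (hI3.const_mul _), ?_, fun k₁ p f hf => ?_⟩
    · intro y v hv Λ hΛ c hc
      refine (enorm_integral_cv_le_ibp hσ hb.nonneg hb.le hb.le_s hW hg (fun γ hγ =>
        mul_le_mul_of_nonneg_left (hb.oscRate_le hγ k) hD) hΛ hc (hpath y v hv)).trans ?_
      refine mul_le_mul' le_rfl ?_
      have m1 := measurable_in_time (H := fun γ y v => nconv W (g γ) (Y₂ γ y v)) hm' y v
      have m2 := measurable_in_time (H := fun γ y v => nconv W (g' γ) (Y₂ γ y v)) hpm y v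
      have m3 := measurable_in_time (H := fun γ y v => nconv (gradKer W) (g γ) (Y₂ γ y v)) hgm y v
      have key : ∫⁻ γ in Ioo t₃ t₄, (ENNReal.ofReal (jap γ)⁻¹ * nconv W (g γ) (Y₂ γ y v) +
            nconv W (g' γ) (Y₂ γ y v) + ENNReal.ofReal V * nconv (gradKer W) (g γ) (Y₂ γ y v)) ≤
          ENNReal.ofReal (2 / n) * (∫⁻ γ in Ioo t₃ t₄, nconv W (g γ) (Y₂ γ y v)) +
          (∫⁻ γ in Ioo t₃ t₄, nconv W (g' γ) (Y₂ γ y v)) +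
          ENNReal.ofReal V * ∫⁻ γ in Ioo t₃ t₄, nconv (gradKer W) (g γ) (Y₂ γ y v) := by
        rw [← lintegral_const_mul _ m1, ← lintegral_const_mul _ m3,
          ← lintegral_add_left (m1.const_mul _), ← lintegral_add_right _ (m3.const_mul _)]
        refine setLIntegral_mono' measurableSet_Ioo fun γ hγ => ?_
        refine add_le_add (add_le_add (mul_le_mul' (ENNReal.ofReal_le_ofReal ?_) le_rfl) le_rfl) le_rfl
        rw [inv_le_comm₀ (jap_pos γ) (by positivity), inv_div]
        exact hb.jap_ge (Ioo_subset_Icc_self hγ)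
      exact (add_le_add le_rfl key).trans (le_of_eq (by simp only [add_assoc]))
    · have hfm := hY.measurable_comp hf.meas
      have hp0 := hf.nonneg
      set μ := mu (max n (jap τ)) k₁ k with hμ
      have hμ0 : 0 < μ := mu_pos hN k₁ k
      set G := gain (max n (jap τ)) (2 ^ k) μ with hG
      have hG0 : 0 < G := gain_pos hN h2 hμ0
      obtain ⟨l1, l2, l3⟩ := low_le_gain hb.one_le (le_max_left n (jap τ)) h2 hX hJ hμ0
        ((min_le_right _ _).trans (min_le_right _ _))
      have a3 := TB.mul_nconv hb (left_mem_Icc.2 hb.le) hY.flow₁ (hY.flow₂ t₃ (hb.mem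
        (left_mem_Icc.2 hb.le))) j hW.toKer (hgo t₃ (left_mem_Icc.2 hb.le)) hf
      have a4 := TB.mul_nconv hb (right_mem_Icc.2 hb.le) hY.flow₁ (hY.flow₂ t₄ (hb.mem
        (right_mem_Icc.2 hb.le))) j hW.toKer (hgo t₄ (right_mem_Icc.2 hb.le)) hf
      have b1 := (TB.mul_lintegral_nconv hb hY hW.toKer hg.meas (fun γ hγ =>
        hgo γ (Ioo_subset_Icc_self hγ)) hf).const_mul
        (c := ENNReal.ofReal (2 / n)) ENNReal.ofReal_ne_top
      have b2 := TB.mul_lintegral_nconv hb hY hW.toKer hg.meas' hgp hf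
      have b3 := (TB.mul_lintegral_nconv hb hY hW.gradKer hg.meas (fun γ hγ =>
        hgo γ (Ioo_subset_Icc_self hγ)) hf).const_mul
        (c := ENNReal.ofReal V) ENNReal.ofReal_ne_top
      rw [← ENNReal.ofReal_mul (by positivity)] at b1 b3
      have hall := (((a3.add a4 (hfm.mul h3m)).add b1 ((hfm.mul h3m).add (hfm.mul h4m))).add b2
        (((hfm.mul h3m).add (hfm.mul h4m)).add ((hfm.mul hI1).const_mul _))).add b3
        ((((hfm.mul h3m).add (hfm.mul h4m)).add ((hfm.mul hI1).const_mul _)).add (hfm.mul hI2))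
      refine hall.mono ?_ fun y v _ => le_of_eq (by ring)
      rw [← ENNReal.ofReal_add (by positivity) (by positivity),
        ← ENNReal.ofReal_add (by positivity) (by positivity),
        ← ENNReal.ofReal_add (by positivity) (by positivity),
        ← ENNReal.ofReal_add (by positivity) (by positivity)]
      refine ENNReal.ofReal_le_ofReal ?_
      calc _ = atomConst * (B * D) * p * (18 * (n ^ del * μ ^ 3) + 4 * (n ^ (2 * del) * μ ^ 3) +
            198 * (n * 2 ^ j * 2 ^ k * n ^ del * μ ^ 3)) := by
            rw [hV]; field_simp; ring
        _ ≤ atomConst * (B * D) * p * (18 * G + 4 * G + 198 * (32 * G)) := by gcongr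
        _ ≤ _ := by
            have : 0 ≤ atomConst * (B * D) * p * G := by positivity
            nlinarith
  -- low frequencies, large velocities; only from `j = 6` on is the velocity bounded below
  · have hj : 6 ≤ j := by
      by_contra h
      have h3 : (2 : ℝ) ^ j ≤ 2 ^ 5 := pow_le_pow_right₀ one_le_two (by omega)
      have h4 : 1 ≤ n ^ (3 / 4 : ℝ) := Real.one_le_rpow hb.one_le (by norm_num)
      linarith
    have hb1 := hb.one_le
    have hb2 := hb.nonneg
    have hb3 := hb.upper
    set L : ℝ := 3000 * (B * D) * ((2 ^ k) ^ 2 / 2 ^ j * n ^ (2 * del)) with hL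
    have hline : ∀ y, ∀ v ∈ win j,
        ∫⁻ γ in Ioo t₃ t₄, nconv W (g γ) (Y₂ γ y v) ≤ ENNReal.ofReal L := by
      intro y v hv
      have hP := hpath y v hv
      refine (lintegral_nconv_line_le hb.nonneg hb.le hb.le_s (q := 2 ^ j / 64) (by positivity)
        hW.toKer hg (D := D * (3 * n ^ del)) (D' := D * (2 * (n ^ (2 * del) / n)))
        (mul_le_mul_of_nonneg_left (hb.oscRate_le (left_mem_Icc.2 hb.le) k) hD)
        (fun γ hγ => mul_le_mul_of_nonneg_left (hb.drift_le (Ioo_subset_Icc_self hγ)) hD)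
        (by positivity) hP.meas hP.cont fun γ hγ γ' hγ' =>
          hY.anti hj y v hv γ (hb.mem hγ) γ' (hb.mem hγ')).trans (ENNReal.ofReal_le_ofReal ?_)
      have e1 : n ^ del ≤ n ^ (2 * del) :=
        Real.rpow_le_rpow_of_exponent_le hb.one_le (by norm_num [del])
      have e2 : (t₄ - t₃) * (D * (2 * (n ^ (2 * del) / n))) ≤
          2 * n * (D * (2 * (n ^ (2 * del) / n))) := by
        refine mul_le_mul_of_nonneg_right ?_ (by positivity)
        linarith
      have e3 : 2 * n * (D * (2 * (n ^ (2 * del) / n))) = 4 * (D * n ^ (2 * del)) := by field_simp; ring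
      have e4 : D * (3 * n ^ del) ≤ 3 * (D * n ^ (2 * del)) := by
        have := mul_le_mul_of_nonneg_left e1 hD
        linarith
      have hpi := Real.pi_lt_d2
      have hpi0 := Real.pi_pos
      calc _ ≤ 2 * Real.pi * B * (2 ^ (2 * k) / (2 ^ j / 64)) * (7 * (D * n ^ (2 * del))) := by
            gcongr
            linarith
        _ = 896 * Real.pi * ((B * D) * ((2 ^ k) ^ 2 / 2 ^ j * n ^ (2 * del))) := by
            rw [mul_comm 2 k, zpow_mul]
            field_simp
            norm_cast
            ring
        _ ≤ 3000 * ((B * D) * ((2 ^ k) ^ 2 / 2 ^ j * n ^ (2 * del))) := by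
            gcongr
            linarith
        _ = L := by rw [hL]; ring
    refine ⟨_, measurable_lintegral_path (H := fun γ y v => nconv W (g γ) (Y₂ γ y v)) hm' _, htriv,
      fun k₁ p f hf => ?_⟩
    have hp0 := hf.nonneg
    have h3 := ((TB.comp_flow hb.tau_nonneg hb.tau_le hY.flow₁ j hf).const_mul
      (c := ENNReal.ofReal L) ENNReal.ofReal_ne_top).mono le_rfl
      (H' := fun y v => f (Y₁ y v) * ∫⁻ γ in Ioo t₃ t₄, nconv W (g γ) (Y₂ γ y v)) fun y v hv => by
        rw [mul_comm]
        exact mul_le_mul' (hline y v hv) le_rfl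
    rw [← ENNReal.ofReal_mul (by positivity)] at h3
    have h4 := TB.mul_lintegral_nconv hb hY hW.toKer hg.meas (fun γ hγ =>
      hgo γ (Ioo_subset_Icc_self hγ)) hf
    -- the better one of the straight line bound and the trivial bound
    refine (h3.min h4).mono (ENNReal.ofReal_le_ofReal ?_) fun _ _ _ => le_rfl
    have h5 := line_le_gain hb.one_le (le_max_left n (jap τ)) h2 hX hJ.le (mu_pos hN k₁ k)
    set μ := mu (max n (jap τ)) k₁ k with hμ
    have hμ0 : 0 < μ := mu_pos hN k₁ k
    calc _ ≤ min (6400 * atomConst * (B * D) * p * ((2 ^ k) ^ 2 / 2 ^ j * n ^ (2 * del)))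
          (6400 * atomConst * (B * D) * p * (n * n ^ del * μ ^ 3)) := by
          refine min_le_min ?_ ?_
          · have e5 : 0 ≤ (B * D) * p * ((2 ^ k) ^ 2 / 2 ^ j * n ^ (2 * del)) := by positivity
            have e6 := mul_le_mul_of_nonneg_right tbConst_le_atomConst e5
            have e7 : 0 ≤ atomConst * ((B * D) * p * ((2 ^ k) ^ 2 / 2 ^ j * n ^ (2 * del))) := by
              positivity
            rw [hL]
            linarith
          · have e5 : 0 ≤ atomConst * (B * D) * p * (n * n ^ del * μ ^ 3) := by positivity
            linarith
      _ = 6400 * atomConst * (B * D) * p * min ((2 ^ k) ^ 2 / 2 ^ j * n ^ (2 * del))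
          (n * n ^ del * μ ^ 3) := (mul_min_of_nonneg _ _ (by positivity)).symm
      _ ≤ 6400 * atomConst * (B * D) * p * gain (max n (jap τ)) (2 ^ k) μ := by gcongr
      _ = _ := by ring

end time

/-! ### The characteristics of the trilinear operators -/

/-- A function with bounded partial derivatives in two variables of `ℝ³` and one of `[0,s]` is jointly
continuous. -/
lemma Admissible.continuous_P₂ {φ : ℝ → ℝ} {A ε₁ s : ℝ} {j : ℕ} {k : ℤ} {K : E3 → E3 → ℂ}
    {P₁ : E3 → E3 → E3} {P₂ : E3 → E3 → ℝ → E3} (H : Admissible φ A ε₁ s j k K P₁ P₂) (hs : 0 ≤ s) :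
    Continuous (fun p : ℝ × E3 × E3 => P₂ p.2.1 p.2.2 (clamp s p.1)) := by
  have hj := jap_pos s
  set L : ℝ := A * ε₁ * (2 + jap s) with hL
  have hb : ∀ γ ∈ Icc 0 s, ∀ y v, ‖fderiv ℝ (fun z => P₂ z v γ) y‖ ≤ L ∧
      ‖fderiv ℝ (fun w => P₂ y w γ) v‖ ≤ L ∧ ‖derivWithin (P₂ y v) (Icc 0 s) γ‖ ≤ L := by
    intro γ hγ y v
    have h := H.P₂_bound γ hγ y v
    have h1 := norm_nonneg (fderiv ℝ (fun z => P₂ z v γ) y)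
    have h2 := norm_nonneg (fderiv ℝ (fun w => P₂ y w γ) v)
    have h3 := norm_nonneg (derivWithin (P₂ y v) (Icc 0 s) γ)
    have h4 : 0 ≤ (jap s)⁻¹ * ‖fderiv ℝ (fun w => P₂ y w γ) v‖ := by positivity
    have h5 : 0 ≤ A * ε₁ := by linarith
    have h6 : 0 ≤ A * ε₁ * jap s := by positivity
    refine ⟨by rw [hL]; linarith, ?_, by rw [hL]; linarith⟩
    have h7 : (jap s)⁻¹ * ‖fderiv ℝ (fun w => P₂ y w γ) v‖ ≤ A * ε₁ := by linarith
    rw [inv_mul_le_iff₀ hj] at h7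
    rw [hL]; linarith
  have h1 : ∀ γ ∈ Icc 0 s, ∀ y y' v, ‖P₂ y v γ - P₂ y' v γ‖ ≤ L * ‖y - y'‖ := fun γ hγ y y' v =>
    convex_univ.norm_image_sub_le_of_norm_fderiv_le (𝕜 := ℝ)
      (fun x _ => (H.P₂_diff_y γ hγ v) x) (fun x _ => (hb γ hγ x v).1) (mem_univ y') (mem_univ y)
  have h2 : ∀ γ ∈ Icc 0 s, ∀ y v v', ‖P₂ y v γ - P₂ y v' γ‖ ≤ L * ‖v - v'‖ := fun γ hγ y v v' =>
    convex_univ.norm_image_sub_le_of_norm_fderiv_le (𝕜 := ℝ)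
      (fun x _ => (H.P₂_diff_v γ hγ y) x) (fun x _ => (hb γ hγ y x).2.1) (mem_univ v') (mem_univ v)
  have h3 : ∀ γ ∈ Icc 0 s, ∀ γ' ∈ Icc 0 s, ∀ y v, ‖P₂ y v γ - P₂ y v γ'‖ ≤ L * ‖γ - γ'‖ :=
    fun γ hγ γ' hγ' y v => (convex_Icc 0 s).norm_image_sub_le_of_norm_derivWithin_le
      (H.P₂_diff_time y v) (fun r hr => (hb r hr y v).2.2) hγ' hγ
  rw [continuous_iff_continuousAt]
  rintro ⟨γ₀, y₀, v₀⟩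
  rw [ContinuousAt, tendsto_iff_norm_sub_tendsto_zero]
  have hlim : Filter.Tendsto (fun p : ℝ × E3 × E3 => L * ‖p.2.1 - y₀‖ + L * ‖p.2.2 - v₀‖ +
      L * ‖clamp s p.1 - clamp s γ₀‖) (nhds (γ₀, y₀, v₀)) (nhds 0) := by
    have hc : Continuous (fun p : ℝ × E3 × E3 => L * ‖p.2.1 - y₀‖ + L * ‖p.2.2 - v₀‖ +
        L * ‖clamp s p.1 - clamp s γ₀‖) := by
      have := continuous_clamp s
      fun_prop
    simpa using hc.tendsto (γ₀, y₀, v₀)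
  refine squeeze_zero (fun _ => norm_nonneg _) (fun p => ?_) hlim
  have m1 := clamp_mem hs p.1
  have m2 := clamp_mem hs γ₀
  have e : P₂ p.2.1 p.2.2 (clamp s p.1) - P₂ y₀ v₀ (clamp s γ₀) =
      (P₂ p.2.1 p.2.2 (clamp s p.1) - P₂ y₀ p.2.2 (clamp s p.1)) +
      (P₂ y₀ p.2.2 (clamp s p.1) - P₂ y₀ v₀ (clamp s p.1)) +
      (P₂ y₀ v₀ (clamp s p.1) - P₂ y₀ v₀ (clamp s γ₀)) := by abel
  simp only
  rw [e]
  exact (norm_add₃_le).trans (add_le_add (add_le_add (h1 _ m1 _ _ _) (h2 _ m1 _ _ _))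
    (h3 _ m1 _ m2 _ _))

/-- The characteristics of an admissible family, with the time clamped to `[0,s]`. -/
lemma Admissible.chars {φ : ℝ → ℝ} {A ε₁ s τ : ℝ} {j : ℕ} {k : ℤ} {K : E3 → E3 → ℂ}
    {P₁ : E3 → E3 → E3} {P₂ : E3 → E3 → ℝ → E3} (H : Admissible φ A ε₁ s j k K P₁ P₂)
    (hA : A * ε₁ ≤ 1 / 16) (hτ : 0 ≤ τ) (hτs : τ ≤ s) :
    Chars s τ j (fun y v => y - (s - τ) • v + P₁ y v)
      (fun γ y v => y - (s - clamp s γ) • v + P₂ y v (clamp s γ)) := by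
  have hs : 0 ≤ s := hτ.trans hτs
  have hcl : ∀ γ ∈ Icc 0 s, clamp s γ = γ := fun γ hγ => clamp_eq hγ
  have hPt : ∀ γ ∈ Icc 0 s, ∀ y v, ‖derivWithin (P₂ y v) (Icc 0 s) γ‖ ≤ 1 / 16 := by
    intro γ hγ y v
    have h := H.P₂_bound γ hγ y v
    have h1 := norm_nonneg (fderiv ℝ (fun z => P₂ z v γ) y)
    have h2 : 0 ≤ (jap s)⁻¹ * ‖fderiv ℝ (fun w => P₂ y w γ) v‖ := by
      have := jap_pos s
      positivity
    linarith
  -- the velocity of the curve is `v + ∂_γ P₂`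
  have hder : ∀ y v, ∀ γ ∈ Ioo 0 s, HasDerivAt (fun γ => y - (s - clamp s γ) • v +
      P₂ y v (clamp s γ)) (v + derivWithin (P₂ y v) (Icc 0 s) γ) γ := by
    intro y v γ hγ
    have hγ' := Ioo_subset_Icc_self hγ
    have h1 : HasDerivAt (P₂ y v) (derivWithin (P₂ y v) (Icc 0 s) γ) γ :=
      ((H.P₂_diff_time y v) γ hγ').hasDerivWithinAt.hasDerivAt (Icc_mem_nhds hγ.1 hγ.2)
    have h2 : HasDerivAt (fun γ : ℝ => y - (s - γ) • v) v γ := by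
      have h3 := ((((hasDerivAt_id γ).const_sub s).smul_const v).const_sub y)
      simpa using h3
    refine (h2.add h1).congr_of_eventuallyEq ?_
    filter_upwards [Icc_mem_nhds hγ.1 hγ.2] with r hr
    simp [hcl r hr]
  have hcont : Continuous (fun p : ℝ × E3 × E3 => p.2.1 - (s - clamp s p.1) • p.2.2 +
      P₂ p.2.1 p.2.2 (clamp s p.1)) := by
    have h1 := H.continuous_P₂ hs
    have h2 := continuous_clamp s
    have h3 : Continuous (fun p : ℝ × E3 × E3 => p.2.1 - (s - clamp s p.1) • p.2.2) := by fun_prop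
    exact h3.add h1
  refine ⟨IsFlow.of_perturbation hτs hA H.P₁_diff_y H.P₁_diff_v H.P₁_bound, fun γ hγ => ?_,
    hcont.measurable, fun y v hv => ?_, fun hj y v hv γ hγ γ' hγ' => ?_⟩
  · rw [hcl γ hγ]
    refine IsFlow.of_perturbation hγ.2 hA (P := fun y v => P₂ y v γ) (H.P₂_diff_y γ hγ)
      (H.P₂_diff_v γ hγ) fun y v => le_trans ?_ (H.P₂_bound γ hγ y v)
    linarith [norm_nonneg (derivWithin (P₂ y v) (Icc 0 s) γ)]
  · have hc1 : Continuous (fun γ => y - (s - clamp s γ) • v + P₂ y v (clamp s γ)) :=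
      hcont.comp (by fun_prop : Continuous fun γ : ℝ => (γ, y, v))
    refine ⟨hc1.measurable, hc1.continuousOn, fun γ hγ => (hder y v γ hγ).differentiableAt,
      fun γ hγ => ?_⟩
    rw [(hder y v γ hγ).deriv]
    refine (norm_add_le _ _).trans ((add_le_add hv.1 (hPt γ (Ioo_subset_Icc_self hγ) y v)).trans ?_)
    have : (1 : ℝ) ≤ 2 ^ j := one_le_pow₀ one_le_two
    rw [pow_add]
    linarith
  · rw [hcl γ hγ, hcl γ' hγ']
    have h1 := (convex_Icc 0 s).norm_image_sub_le_of_norm_derivWithin_le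
      (H.P₂_diff_time y v) (fun r hr => hPt r hr y v) hγ' hγ
    have e : (γ - γ') • v = (y - (s - γ) • v + P₂ y v γ - (y - (s - γ') • v + P₂ y v γ')) -
        (P₂ y v γ - P₂ y v γ') := by module
    have h2 := norm_sub_le (y - (s - γ) • v + P₂ y v γ - (y - (s - γ') • v + P₂ y v γ'))
      (P₂ y v γ - P₂ y v γ')
    rw [← e, norm_smul, Real.norm_eq_abs] at h2
    rw [Real.norm_eq_abs] at h1
    -- the perturbation `1/16` is at most half of the lower bound `2^j / 32` for the velocity
    have h3 : (2 : ℝ) ^ j / 32 ≤ ‖v‖ := by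
      refine le_trans (le_of_eq ?_) (hv.2 hj)
      rw [div_eq_iff (by norm_num), show (32 : ℝ) = 2 ^ 5 by norm_num, ← pow_add]
      congr 1; omega
    have h4 : (2 : ℝ) ^ 6 ≤ 2 ^ j := pow_le_pow_right₀ one_le_two hj
    have h5 : |γ - γ'| * (2 ^ j / 32) ≤ |γ - γ'| * ‖v‖ := by gcongr
    have h6 : |γ - γ'| * 2 ^ 6 ≤ |γ - γ'| * 2 ^ j := by gcongr
    have h7 := abs_nonneg (γ - γ')
    linarith

/-! ### Bounds for the trilinear operators -/

/-- The function that dominates the operators: `A |bump_k| * (∫ w_j H dv)`. -/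
noncomputable def theta (A : ℝ) (k : ℤ) (j : ℕ) (H : E3 → E3 → ℝ≥0∞) (x : E3) : ℝ≥0∞ :=
  ∫⁻ y, ENNReal.ofReal (A * bump k (x - y)) * ∫⁻ v, wt j v * H y v

lemma measurable_lintegral_wt {j : ℕ} {H : E3 → E3 → ℝ≥0∞}
    (hH : Measurable (fun p : E3 × E3 => H p.1 p.2)) : Measurable fun y => ∫⁻ v, wt j v * H y v :=
  (measurable_wt_mul hH).lintegral_prod_right'

lemma measurable_bump_ofReal (A : ℝ) (k : ℤ) : Measurable fun z => ENNReal.ofReal (A * bump k z) :=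
  ((continuous_bump k).measurable.const_mul A).ennreal_ofReal

lemma lintegral_bump_ofReal {A : ℝ} (hA : 0 ≤ A) (k : ℤ) :
    ∫⁻ z, ENNReal.ofReal (A * bump k z) = ENNReal.ofReal (A * bumpMass) := by
  rw [← ofReal_integral_eq_lintegral_ofReal ((integrable_bump k).const_mul A)
    (Filter.Eventually.of_forall fun z => mul_nonneg hA (bump_pos k z).le), integral_const_mul,
    integral_bump]

lemma lintegral_bump_sub_mul {A : ℝ} (hA : 0 ≤ A) (k : ℤ) (x : E3) (c : ℝ≥0∞) :
    ∫⁻ y, ENNReal.ofReal (A * bump k (x - y)) * c = ENNReal.ofReal (A * bumpMass) * c := by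
  have hm : Measurable fun y => ENNReal.ofReal (A * bump k (x - y)) :=
    (measurable_bump_ofReal A k).comp (measurable_const.sub measurable_id)
  rw [lintegral_mul_const c hm,
    lintegral_sub_left_eq_self (fun z => ENNReal.ofReal (A * bump k z)) x, lintegral_bump_ofReal hA]

lemma lintegral_theta_le {A s : ℝ} (hA : 0 ≤ A) (k : ℤ) {j : ℕ} {β : ℝ≥0∞} {H : E3 → E3 → ℝ≥0∞}
    (hH : Measurable (fun p : E3 × E3 => H p.1 p.2)) (h : TB s j β H) :
    ∫⁻ x, theta A k j H x ≤ ENNReal.ofReal (A * bumpMass) * β := by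
  unfold theta
  rw [lintegral_conv_le (measurable_bump_ofReal A k) (measurable_lintegral_wt hH),
    lintegral_bump_ofReal hA]
  exact mul_le_mul' le_rfl h.1

lemma theta_le {A s : ℝ} (hA : 0 ≤ A) (k : ℤ) {j : ℕ} {β : ℝ≥0∞} {H : E3 → E3 → ℝ≥0∞}
    (h : TB s j β H) (x : E3) :
    ENNReal.ofReal (jap s ^ 3) * theta A k j H x ≤ ENNReal.ofReal (A * bumpMass) * β := by
  unfold theta
  rw [← lintegral_const_mul' _ _ ENNReal.ofReal_ne_top]
  calc _ ≤ ∫⁻ y, ENNReal.ofReal (A * bump k (x - y)) * β := by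
        refine lintegral_mono fun y => ?_
        rw [mul_left_comm]
        exact mul_le_mul' le_rfl (h.2 y)
    _ = _ := lintegral_bump_sub_mul hA k x β

lemma measurable_theta {A : ℝ} {k : ℤ} {j : ℕ} {H : E3 → E3 → ℝ≥0∞}
    (hH : Measurable (fun p : E3 × E3 => H p.1 p.2)) : Measurable (theta A k j H) := by
  have h1 : Measurable (fun p : E3 × E3 => ENNReal.ofReal (A * bump k (p.1 - p.2)) *
      ∫⁻ v, wt j v * H p.2 v) :=
    ((measurable_bump_ofReal A k).comp (measurable_fst.sub measurable_snd)).mul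
      ((measurable_lintegral_wt hH).comp measurable_snd)
  exact h1.lintegral_prod_right'

lemma mul_eLpNorm_top_le {c : ℝ} (hc : 0 < c) {b : ℝ≥0∞} {F : E3 → ℂ}
    (h : ∀ᵐ x, ENNReal.ofReal c * ‖F x‖ₑ ≤ b) :
    ENNReal.ofReal c * eLpNorm F ∞ volume ≤ b := by
  have hc0 : ENNReal.ofReal c ≠ 0 := by simpa using hc
  rw [eLpNorm_exponent_top, mul_comm, ← ENNReal.le_div_iff_mul_le (Or.inl hc0)
    (Or.inl ENNReal.ofReal_ne_top)]
  refine eLpNormEssSup_le_of_ae_enorm_bound ?_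
  filter_upwards [h] with x hx
  rwa [ENNReal.le_div_iff_mul_le (Or.inl hc0) (Or.inl ENNReal.ofReal_ne_top), mul_comm]

/-- A function dominated by `Λ · theta` is bounded in `B⁰_s`. -/
lemma exists_normB0_le {φ : ℝ → ℝ} (hφ : IsCutoff φ) : ∃ C : ℝ, 0 < C ∧ ∀ (A s : ℝ) (k : ℤ) (j : ℕ)
    (β Λ : ℝ≥0∞) (H : E3 → E3 → ℝ≥0∞) (O : E3 → ℂ), 0 ≤ A → Λ ≠ ⊤ →
    Measurable (fun p : E3 × E3 => H p.1 p.2) → TB s j β H →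
    (∀ᵐ x, ‖O x‖ₑ ≤ Λ * theta A k j H x) → normB0 φ s O ≤ ENNReal.ofReal (C * A) * β * Λ := by
  obtain ⟨B, hB, hker⟩ := exists_kerD_homog hφ Homog.one
  have hM := bumpMass_pos
  refine ⟨2 * (B * bumpMass * bumpMass), by positivity, fun A s k j β Λ H O hA hΛ hH h hO => ?_⟩
  unfold normB0 besovSup
  refine iSup_le fun l => ?_
  have hW : Ker l B (ker φ l fun _ => 1) := by
    have := (hker (fun _ => 1) isMichlin_one l).toKer
    simpa using this
  have hWe : ∀ z, ‖ker φ l (fun _ => 1) z‖ₑ ≤ ENNReal.ofReal (B * bump l z) := fun z => by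
    rw [← ofReal_norm]; exact ENNReal.ofReal_le_ofReal (hW.bound z)
  have hθ := measurable_theta (A := A) (k := k) (j := j) hH
  have hpt : ∀ x, ‖lpProj φ l O x‖ₑ ≤
      ∫⁻ y, ENNReal.ofReal (B * bump l (x - y)) * (Λ * theta A k j H y) := by
    intro x
    refine (enorm_cv_le _ _ x).trans (lintegral_mono_ae ?_)
    filter_upwards [hO] with y hy
    exact mul_le_mul' (hWe _) hy
  have e : ENNReal.ofReal (2 * (B * bumpMass * bumpMass) * A) * β * Λ =
      ENNReal.ofReal (B * bumpMass) * (Λ * (ENNReal.ofReal (A * bumpMass) * β)) +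
      ENNReal.ofReal (B * bumpMass) * (Λ * (ENNReal.ofReal (A * bumpMass) * β)) := by
    rw [show 2 * (B * bumpMass * bumpMass) * A = 2 * ((B * bumpMass) * (A * bumpMass)) by ring,
      ENNReal.ofReal_mul two_pos.le, ENNReal.ofReal_mul (by positivity), ENNReal.ofReal_ofNat]
    ring
  rw [e]
  refine add_le_add ?_ ?_
  · refine mul_eLpNorm_top_le (pow_pos (jap_pos s) 3) (Filter.Eventually.of_forall fun x => ?_)
    refine (mul_le_mul' le_rfl (hpt x)).trans ?_
    rw [← lintegral_const_mul' _ _ ENNReal.ofReal_ne_top]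
    calc _ ≤ ∫⁻ y, ENNReal.ofReal (B * bump l (x - y)) *
          (Λ * (ENNReal.ofReal (A * bumpMass) * β)) := by
          refine lintegral_mono fun y => ?_
          rw [mul_left_comm, mul_left_comm _ Λ]
          exact mul_le_mul' le_rfl (mul_le_mul' le_rfl (theta_le hA k h y))
      _ = _ := lintegral_bump_sub_mul hB.le l x _
  · rw [eLpNorm_one_eq_lintegral_enorm]
    refine (lintegral_mono hpt).trans ?_
    rw [lintegral_conv_le (measurable_bump_ofReal B l) (hθ.const_mul Λ), lintegral_bump_ofReal hB.le,
      lintegral_const_mul _ hθ]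
    exact mul_le_mul' le_rfl (mul_le_mul' le_rfl (lintegral_theta_le hA k hH h))

/-- The kernel of an admissible family is integrated against `H`. -/
lemma Admissible.lintegral_K_le {φ : ℝ → ℝ} (hφ : IsCutoff φ) {A ε₁ s : ℝ} (hA : 0 < A) {j : ℕ} {k : ℤ}
    {K : E3 → E3 → ℂ} {P₁ : E3 → E3 → E3} {P₂ : E3 → E3 → ℝ → E3}
    (hK : Admissible φ A ε₁ s j k K P₁ P₂) {H : E3 → E3 → ℝ≥0∞}
    (hH : Measurable (fun p : E3 × E3 => H p.1 p.2)) (x : E3) :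
    ∫⁻ p : E3 × E3, ‖K (x - p.1) p.2‖ₑ * H p.1 p.2 ≤ theta A k j H x := by
  have hb : Measurable (fun p : E3 × E3 => ENNReal.ofReal (A * bump k (x - p.1))) :=
    (measurable_bump_ofReal A k).comp (measurable_const.sub measurable_fst)
  calc _ ≤ ∫⁻ p : E3 × E3, ENNReal.ofReal (A * bump k (x - p.1)) * (wt j p.2 * H p.1 p.2) := by
        refine lintegral_mono fun p => ?_
        rw [← mul_assoc]
        exact mul_le_mul' (hK.enorm_K_le hφ hA _ _) le_rfl
    _ = ∫⁻ y, ∫⁻ v, ENNReal.ofReal (A * bump k (x - y)) * (wt j v * H y v) :=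
        lintegral_prod _ (hb.mul (measurable_wt_mul hH)).aemeasurable
    _ = theta A k j H x :=
        lintegral_congr fun y => lintegral_const_mul' _ _ ENNReal.ofReal_ne_top

lemma Admissible.measurable_K_sub {φ : ℝ → ℝ} {A ε₁ s : ℝ} {j : ℕ} {k : ℤ}
    {K : E3 → E3 → ℂ} {P₁ : E3 → E3 → E3} {P₂ : E3 → E3 → ℝ → E3}
    (hK : Admissible φ A ε₁ s j k K P₁ P₂) (x : E3) :
    Measurable (fun p : E3 × E3 => K (x - p.1) p.2) :=
  hK.K_meas.comp ((measurable_const.sub measurable_fst).prodMk measurable_snd)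

lemma Admissible.integrable_K {φ : ℝ → ℝ} (hφ : IsCutoff φ) {A ε₁ s : ℝ} (hA : 0 < A) {j : ℕ} {k : ℤ}
    {K : E3 → E3 → ℂ} {P₁ : E3 → E3 → E3} {P₂ : E3 → E3 → ℝ → E3}
    (hK : Admissible φ A ε₁ s j k K P₁ P₂) (x : E3) :
    Integrable (fun p : E3 × E3 => K (x - p.1) p.2) := by
  refine ⟨(hK.measurable_K_sub x).aestronglyMeasurable, ?_⟩
  have h := hK.lintegral_K_le hφ hA (H := fun _ _ => 1) measurable_const x
  simp only [mul_one] at h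
  rw [hasFiniteIntegral_iff_enorm]
  refine h.trans_lt ?_
  unfold theta
  simp only [mul_one]
  rw [lintegral_bump_sub_mul hA.le]
  exact ENNReal.mul_lt_top ENNReal.ofReal_lt_top
    ((lintegral_wt_le j).trans_lt ENNReal.ofReal_lt_top)

lemma Admissible.K_eq_zero {φ : ℝ → ℝ} (hφ : IsCutoff φ) {A ε₁ s : ℝ} (hA : 0 < A) {j : ℕ} {k : ℤ}
    {K : E3 → E3 → ℂ} {P₁ : E3 → E3 → E3} {P₂ : E3 → E3 → ℝ → E3}
    (hK : Admissible φ A ε₁ s j k K P₁ P₂) (y : E3) {v : E3} (hv : v ∉ win j) : K y v = 0 := by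
  have h := hK.enorm_K_le hφ hA y v
  rw [wt, indicator_of_notMem hv, mul_zero] at h
  simpa using h

lemma le_on_Icc_of_ae {a b : ℝ} (hab : a < b) {c : ℝ → ℂ} (hc : ContinuousOn c (Icc a b)) {Λ : ℝ≥0∞}
    (hΛ : Λ ≠ ⊤) (h : ∀ᵐ γ ∂volume.restrict (Ioo a b), ‖c γ‖ₑ ≤ Λ) : ∀ γ ∈ Icc a b, ‖c γ‖ₑ ≤ Λ := by
  have e : ∀ z : ℂ, ‖z‖ₑ ≤ Λ ↔ max ‖z‖ Λ.toReal = Λ.toReal := fun z => by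
    rw [max_eq_right_iff, ← ofReal_norm, ENNReal.ofReal_le_iff_le_toReal hΛ]
  have h1 : (fun γ => max ‖c γ‖ Λ.toReal) =ᵐ[volume.restrict (Icc a b)] fun _ => Λ.toReal := by
    rw [← restrict_Ioo_eq_restrict_Icc]
    filter_upwards [h] with γ hγ
    exact (e _).1 hγ
  have h2 := Measure.eqOn_Icc_of_ae_eq volume hab.ne h1 (hc.norm.sup continuousOn_const)
    continuousOn_const
  exact fun γ hγ => (e _).2 (h2 hγ)

/-- For almost every `(x,y,v)` the function `γ ↦ C(x,y,v,γ)` is an admissible amplitude. The norms in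
`lamStar` bound `C` at each `γ` outside a null set that depends on `γ`, so the quantifiers have to be
exchanged; continuity in `γ` then gives the bound for every `γ`. -/
lemma ae_amp {s t₃ t₄ : ℝ} (h3 : 0 ≤ t₃) (h34 : t₃ < t₄) (h4 : t₄ ≤ s) {C : E3 → E3 → E3 → ℝ → ℂ}
    (hC : Measurable (fun p : E3 × E3 × E3 × ℝ => C p.1 p.2.1 p.2.2.1 p.2.2.2))
    (hd : ∀ x y v, DifferentiableOn ℝ (C x y v) (Icc 0 s)) (hΛ : lamStar C s t₃ t₄ ≠ ⊤) :
    ∀ᵐ x : E3, ∀ᵐ p : E3 × E3, Amp t₃ t₄ (lamStar C s t₃ t₄) (C x p.1 p.2) := by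
  set Λ := lamStar C s t₃ t₄ with hΛdef
  have hsub : ∀ γ ∈ Ioo t₃ t₄, γ ∈ Ioo 0 s := fun γ hγ => ⟨h3.trans_lt hγ.1, hγ.2.trans_le h4⟩
  have hm1 : Measurable (fun q : (E3 × E3 × E3) × ℝ => C q.1.1 q.1.2.1 q.1.2.2 q.2) :=
    hC.comp (by fun_prop : Measurable fun q : (E3 × E3 × E3) × ℝ => (q.1.1, q.1.2.1, q.1.2.2, q.2))
  -- set to zero outside the interior, the derivative is jointly measurable
  set D : E3 × E3 × E3 → ℝ → ℂ := fun q => (Ioo 0 s).indicator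
    (fun r => derivWithin (C q.1 q.2.1 q.2.2) (Icc 0 s) r) with hD
  have hm2 : Measurable (fun q : (E3 × E3 × E3) × ℝ => D q.1 q.2) :=
    measurable_derivWithin_param (u := fun q : E3 × E3 × E3 => C q.1 q.2.1 q.2.2) hm1
      fun q => hd _ _ _
  have hlam : ∀ γ ∈ Icc t₃ t₄, lamC C s γ ≤ Λ := fun γ hγ => le_iSup₂_of_le γ hγ le_rfl
  have key : ∀ γ ∈ Ioo t₃ t₄, ∀ᵐ q : E3 × E3 × E3, ‖C q.1 q.2.1 q.2.2 γ‖ₑ ≤ Λ ∧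
      ‖D q γ‖ₑ ≤ Λ * ENNReal.ofReal (jap γ)⁻¹ := by
    intro γ hγ
    have hl := hlam γ (Ioo_subset_Icc_self hγ)
    have hj := jap_pos γ
    have e1 := ae_le_eLpNormEssSup (f := fun p : E3 × E3 × E3 => C p.1 p.2.1 p.2.2 γ)
      (μ := (volume : Measure (E3 × E3 × E3)))
    have e2 := ae_le_eLpNormEssSup (f := fun p : E3 × E3 × E3 => (jap γ : ℂ) *
      derivWithin (C p.1 p.2.1 p.2.2) (Icc 0 s) γ) (μ := (volume : Measure (E3 × E3 × E3)))
    filter_upwards [e1, e2] with q h1 h2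
    refine ⟨h1.trans ((le_of_eq ?_).trans ((le_add_of_nonneg_right zero_le).trans hl)), ?_⟩
    · rw [supC, eLpNorm_exponent_top]
    · have h3 : ‖(jap γ : ℂ) * derivWithin (C q.1 q.2.1 q.2.2) (Icc 0 s) γ‖ₑ ≤ Λ := by
        refine h2.trans ((le_of_eq ?_).trans ((le_add_of_nonneg_left zero_le).trans hl))
        rw [supC, eLpNorm_exponent_top]
      rw [enorm_mul] at h3
      have hjn : ‖(jap γ : ℂ)‖ₑ = ENNReal.ofReal (jap γ) := by
        rw [← ofReal_norm, Complex.norm_real, Real.norm_of_nonneg hj.le]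
      rw [hjn] at h3
      rw [hD]
      simp only
      rw [indicator_of_mem (hsub γ hγ), ENNReal.ofReal_inv_of_pos hj, ← div_eq_mul_inv,
        ENNReal.le_div_iff_mul_le (Or.inl (by simpa using hj)) (Or.inl ENNReal.ofReal_ne_top), mul_comm]
      exact h3
  have hjm : Measurable (fun q : (E3 × E3 × E3) × ℝ => Λ * ENNReal.ofReal (jap q.2)⁻¹) := by
    unfold jap; fun_prop
  have hset : MeasurableSet {q : (E3 × E3 × E3) × ℝ | ‖C q.1.1 q.1.2.1 q.1.2.2 q.2‖ₑ ≤ Λ ∧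
      ‖D q.1 q.2‖ₑ ≤ Λ * ENNReal.ofReal (jap q.2)⁻¹} :=
    (measurableSet_le hm1.enorm measurable_const).inter (measurableSet_le hm2.enorm hjm)
  have h5 : ∀ᵐ q : E3 × E3 × E3, ∀ᵐ γ ∂volume.restrict (Ioo t₃ t₄),
      ‖C q.1 q.2.1 q.2.2 γ‖ₑ ≤ Λ ∧ ‖D q γ‖ₑ ≤ Λ * ENNReal.ofReal (jap γ)⁻¹ := by
    refine (Measure.ae_ae_comm (ν := volume.restrict (Ioo t₃ t₄)) hset).2 ?_
    filter_upwards [ae_restrict_mem measurableSet_Ioo] with γ hγ using key γ hγ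
  have hmq : ∀ q : E3 × E3 × E3, Measurable (C q.1 q.2.1 q.2.2) := fun q =>
    hm1.comp (by fun_prop : Measurable fun γ : ℝ => (q, γ))
  have h6 : ∀ᵐ q : E3 × E3 × E3, Amp t₃ t₄ Λ (C q.1 q.2.1 q.2.2) := by
    filter_upwards [h5] with q hq
    have hcont : ContinuousOn (C q.1 q.2.1 q.2.2) (Icc t₃ t₄) :=
      (hd _ _ _).continuousOn.mono (Icc_subset_Icc h3 h4)
    have hdiff : ∀ γ ∈ Ioo t₃ t₄, DifferentiableAt ℝ (C q.1 q.2.1 q.2.2) γ := fun γ hγ =>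
      ((hd q.1 q.2.1 q.2.2) γ (Ioo_subset_Icc_self (hsub γ hγ))).differentiableAt
        (Icc_mem_nhds (hsub γ hγ).1 (hsub γ hγ).2)
    refine ⟨hmq q, hcont, hdiff,
      le_on_Icc_of_ae h34 hcont hΛ (hq.mono fun γ h => h.1), ?_⟩
    filter_upwards [hq, ae_restrict_mem measurableSet_Ioo] with γ h hγ
    have h7 := h.2
    rw [hD] at h7
    simp only at h7
    rwa [indicator_of_mem (hsub γ hγ), (hdiff γ hγ).derivWithin
      ((uniqueDiffOn_Icc (h3.trans_lt (h34.trans_le h4))) γ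
        (Ioo_subset_Icc_self (hsub γ hγ)))] at h7
  exact Measure.ae_ae_of_ae_prod h6

/-- The operator `opB` is dominated by `theta`, once the time integral along each characteristic is
dominated by `H`. -/
lemma Admissible.enorm_opB_le {φ : ℝ → ℝ} (hφ : IsCutoff φ) {A ε₁ s τ : ℝ} (hA : 0 < A) {j : ℕ} {k : ℤ}
    {K : E3 → E3 → ℂ} {P₁ : E3 → E3 → E3} {P₂ : E3 → E3 → ℝ → E3}
    (hK : Admissible φ A ε₁ s j k K P₁ P₂) {t₃ t₄ : ℝ} (h3 : 0 ≤ t₃) (h34 : t₃ < t₄) (h4 : t₄ ≤ s)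
    {C : E3 → E3 → E3 → ℝ → ℂ}
    (hC : Measurable (fun p : E3 × E3 × E3 × ℝ => C p.1 p.2.1 p.2.2.1 p.2.2.2))
    (hd : ∀ x y v, DifferentiableOn ℝ (C x y v) (Icc 0 s)) (hΛ : lamStar C s t₃ t₄ ≠ ⊤)
    {Y₁ : E3 → E3 → E3} {Y₂ : ℝ → E3 → E3 → E3} (hY : Chars s τ j Y₁ Y₂)
    (hY₁ : ∀ y v, y - (s - τ) • v + P₁ y v = Y₁ y v)
    (hY₂ : ∀ γ ∈ Icc 0 s, ∀ y v, y - (s - γ) • v + P₂ y v γ = Y₂ γ y v)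
    {F G : ℝ → E3 → ℂ} {F' : E3 → ℂ} {G' : ℝ → E3 → ℂ} (hF : ∀ z, F τ z = F' z)
    (hG : ∀ γ ∈ Icc 0 s, ∀ z, G γ z = G' γ z) (hFm : Measurable F')
    (hGm : Measurable (fun q : ℝ × E3 => G' q.1 q.2)) {QF QG : ℝ} (hFb : ∀ z, ‖F' z‖ ≤ QF)
    (hGb : ∀ γ z, ‖G' γ z‖ ≤ QG) {H : E3 → E3 → ℝ≥0∞}
    (hH : Measurable (fun p : E3 × E3 => H p.1 p.2))
    (hmaj : ∀ y, ∀ v ∈ win j, ∀ Λ : ℝ≥0∞, Λ ≠ ⊤ → ∀ c, Amp t₃ t₄ Λ c →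
      ‖F' (Y₁ y v)‖ₑ * ‖∫ γ in Ioo t₃ t₄, c γ * G' γ (Y₂ γ y v)‖ₑ ≤ Λ * H y v) :
    ∀ᵐ x, ‖opB K P₁ P₂ F G C t₃ t₄ τ s x‖ₑ ≤ lamStar C s t₃ t₄ * theta A k j H x := by
  filter_upwards [ae_amp h3 h34 h4 hC hd hΛ] with x hx
  set Λ := lamStar C s t₃ t₄
  have hKx := hK.integrable_K hφ hA x
  have e1 : opB K P₁ P₂ F G C t₃ t₄ τ s x = ∫ γ in Ioo t₃ t₄, ∫ p : E3 × E3,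
      K (x - p.1) p.2 * F' (Y₁ p.1 p.2) * (C x p.1 p.2 γ * G' γ (Y₂ γ p.1 p.2)) := by
    unfold opB opQ
    rw [intervalIntegral.integral_of_le h34.le, integral_Ioc_eq_integral_Ioo]
    refine setIntegral_congr_fun measurableSet_Ioo fun γ hγ => ?_
    have hγ' : γ ∈ Icc 0 s := ⟨h3.trans hγ.1.le, hγ.2.le.trans h4⟩
    refine integral_congr_ae (Filter.Eventually.of_forall fun p => ?_)
    simp only
    rw [hY₁, hY₂ γ hγ', hF, hG γ hγ']
    ring
  have hCx : Measurable (fun q : ℝ × E3 × E3 => C x q.2.1 q.2.2 q.1) :=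
    hC.comp (by fun_prop : Measurable fun q : ℝ × E3 × E3 => (x, q.2.1, q.2.2, q.1))
  have hGY : Measurable (fun q : ℝ × E3 × E3 => G' q.1 (Y₂ q.1 q.2.1 q.2.2)) :=
    hGm.comp (measurable_fst.prodMk hY.meas)
  have hKF : Measurable (fun p : E3 × E3 => K (x - p.1) p.2 * F' (Y₁ p.1 p.2)) :=
    (hK.measurable_K_sub x).mul (hFm.comp hY.flow₁.meas)
  have hfm : Measurable (Function.uncurry fun (γ : ℝ) (p : E3 × E3) =>
      K (x - p.1) p.2 * F' (Y₁ p.1 p.2) * (C x p.1 p.2 γ * G' γ (Y₂ γ p.1 p.2))) :=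
    (hKF.comp measurable_snd).mul (hCx.mul hGY)
  have hQF : 0 ≤ QF := (norm_nonneg _).trans (hFb 0)
  have hfi : Integrable (Function.uncurry fun (γ : ℝ) (p : E3 × E3) =>
      K (x - p.1) p.2 * F' (Y₁ p.1 p.2) * (C x p.1 p.2 γ * G' γ (Y₂ γ p.1 p.2)))
      ((volume.restrict (Ioo t₃ t₄)).prod volume) := by
    have hdom : Integrable (fun q : ℝ × E3 × E3 => ‖K (x - q.2.1) q.2.2‖ * (QF * (Λ.toReal * QG)))
        ((volume.restrict (Ioo t₃ t₄)).prod volume) :=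
      (hKx.norm.comp_snd (volume.restrict (Ioo t₃ t₄))).mul_const _
    refine hdom.mono' hfm.aestronglyMeasurable ?_
    have h5 : ∀ᵐ q : ℝ × E3 × E3 ∂(volume.restrict (Ioo t₃ t₄)).prod volume,
        Amp t₃ t₄ Λ (C x q.2.1 q.2.2) := Measure.quasiMeasurePreserving_snd.ae hx
    have h6 : ∀ᵐ q : ℝ × E3 × E3 ∂(volume.restrict (Ioo t₃ t₄)).prod volume, q.1 ∈ Ioo t₃ t₄ :=
      Measure.quasiMeasurePreserving_fst.ae (ae_restrict_mem measurableSet_Ioo)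
    filter_upwards [h5, h6] with q hq hq'
    simp only [Function.uncurry]
    rw [norm_mul, norm_mul, norm_mul, mul_assoc]
    have h7 := hq.bound q.1 (Ioo_subset_Icc_self hq')
    rw [← ofReal_norm, ENNReal.ofReal_le_iff_le_toReal hΛ] at h7
    gcongr
    · exact hFb _
    · exact hGb _ _
  -- by Fubini the time integral is taken first, along each characteristic
  rw [e1, integral_integral_swap hfi]
  refine (enorm_integral_le_lintegral_enorm _).trans ?_
  refine le_trans ?_ (mul_le_mul' le_rfl (hK.lintegral_K_le hφ hA hH x))
  have hKH : Measurable (fun p : E3 × E3 => ‖K (x - p.1) p.2‖ₑ * H p.1 p.2) :=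
    (hK.measurable_K_sub x).enorm.mul hH
  rw [← lintegral_const_mul Λ hKH]
  refine lintegral_mono_ae ?_
  filter_upwards [hx] with p hp
  rw [integral_const_mul, enorm_mul, enorm_mul]
  by_cases hv : p.2 ∈ win j
  · rw [mul_assoc, mul_left_comm Λ]
    exact mul_le_mul' le_rfl (hmaj p.1 p.2 hv Λ hΛ _ hp)
  · rw [hK.K_eq_zero hφ hA _ hv]
    simp

/-! ### The decomposition of the density at one frequency -/

/-- `S + e^{-it} g / 2 + e^{it} ḡ / 2`, i.e. `S + Re (e^{-it} g)` written without real parts. -/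
noncomputable def modulate (S g : ℝ → E3 → ℂ) (t : ℝ) (x : E3) : ℂ :=
  S t x + (Complex.exp (-(Complex.I * (t : ℂ))) / 2 * g t x +
    Complex.exp (Complex.I * (t : ℂ)) / 2 * (starRingEnd ℂ) (g t x))

/-- A stationary piece `S k` and an oscillating piece `g k` at each frequency `2^k`, with the decay in
time that the bootstrap norms provide; together they give the part of the functions `r t` at
the frequencies `2^{k-1}`, `2^k`, `2^{k+1}`. -/
structure Pieces (φ : ℝ → ℝ) (T D : ℝ) (r : ℝ → E3 → ℂ) (S g g' : ℤ → ℝ → E3 → ℂ) : Prop where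
  nonneg : 0 ≤ D
  meas : ∀ k, Measurable (fun p : ℝ × E3 => S k p.1 p.2)
  stat : ∀ k, ∀ t ∈ Icc 0 T, Bn t (D * ((1 + 2 ^ k)⁻¹ * drift t)) (S k t)
  osc : ∀ k, OscPiece T (fun t => D * oscRate k t) (fun t => D * drift t) (g k) (g' k)
  eq : ∀ k, ∀ t ∈ Icc 0 T, ∀ x, ∑ i ∈ Finset.Icc (k - 1) (k + 1), lpProj φ i (r t) x =
    modulate (S k) (g k) t x

lemma OscPiece.mono {T T' : ℝ} {β β' γ γ' : ℝ → ℝ} {g g' : ℝ → E3 → ℂ} (H : OscPiece T β β' g g')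
    (hT : T' ≤ T) (h : ∀ t ∈ Icc 0 T', β t ≤ γ t) (h' : ∀ t ∈ Ioo 0 T', β' t ≤ γ' t) :
    OscPiece T' γ γ' g g' :=
  ⟨H.meas, H.meas', fun t ht => (H.bn t ⟨ht.1, ht.2.trans hT⟩).mono (h t ht),
    fun t ht => (H.bn' t ⟨ht.1, ht.2.trans_le hT⟩).mono (h' t ht),
    fun x => (H.cont x).mono (Icc_subset_Icc_right hT),
    fun x t ht => H.deriv x t ⟨ht.1, ht.2.trans_le hT⟩⟩

lemma OscPiece.sum {ι : Type*} (s : Finset ι) {T : ℝ} {β β' : ι → ℝ → ℝ} {g g' : ι → ℝ → E3 → ℂ}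
    (H : ∀ i ∈ s, OscPiece T (β i) (β' i) (g i) (g' i)) :
    OscPiece T (fun t => ∑ i ∈ s, β i t) (fun t => ∑ i ∈ s, β' i t) (fun t x => ∑ i ∈ s, g i t x)
      (fun t x => ∑ i ∈ s, g' i t x) :=
  ⟨Finset.measurable_sum _ fun i hi => (H i hi).meas, Finset.measurable_sum _ fun i hi => (H i hi).meas',
    fun t ht => Bn.sum s fun i hi => (H i hi).bn t ht, fun t ht => Bn.sum s fun i hi => (H i hi).bn' t ht,
    fun x => continuousOn_finsetSum _ fun i hi => (H i hi).cont x,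
    fun x t ht => HasDerivAt.fun_sum fun i hi => (H i hi).deriv x t ht⟩

lemma Pieces.restrict {φ : ℝ → ℝ} {T T' D : ℝ} {r : ℝ → E3 → ℂ} {S g g' : ℤ → ℝ → E3 → ℂ}
    (H : Pieces φ T D r S g g') (hT : T' ≤ T) : Pieces φ T' D r S g g' :=
  ⟨H.nonneg, H.meas, fun k t ht => H.stat k t ⟨ht.1, ht.2.trans hT⟩,
    fun k => (H.osc k).mono hT (fun _ _ => le_rfl) fun _ _ => le_rfl,
    fun k t ht => H.eq k t ⟨ht.1, ht.2.trans hT⟩⟩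

lemma two_zpow_le_of_mem {i k : ℤ} (h : i ∈ Finset.Icc (k - 1) (k + 1)) :
    ((2 : ℝ) ^ i)⁻¹ ≤ 2 * ((2 : ℝ) ^ k)⁻¹ := by
  rw [Finset.mem_Icc] at h
  have h1 : (2 : ℝ) ^ (k - 1) ≤ 2 ^ i := zpow_le_zpow_right₀ one_le_two h.1
  rw [zpow_sub_one₀ two_ne_zero] at h1
  have h2 := zpow_two_pos k
  rw [← div_eq_mul_inv, inv_le_comm₀ (zpow_two_pos i) (by positivity), inv_div, div_eq_mul_inv]
  exact h1

lemma one_add_two_zpow_inv_le {i k : ℤ} (h : i ∈ Finset.Icc (k - 1) (k + 1)) :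
    (1 + (2 : ℝ) ^ i)⁻¹ ≤ 2 * (1 + (2 : ℝ) ^ k)⁻¹ := by
  rw [Finset.mem_Icc] at h
  have h1 : (2 : ℝ) ^ (k - 1) ≤ 2 ^ i := zpow_le_zpow_right₀ one_le_two h.1
  rw [zpow_sub_one₀ two_ne_zero] at h1
  have h2 := zpow_two_pos k
  have h3 := zpow_two_pos i
  rw [← div_eq_mul_inv, inv_le_comm₀ (by positivity) (by positivity), inv_div]
  linarith

lemma oscRate_le_of_mem {i k : ℤ} (h : i ∈ Finset.Icc (k - 1) (k + 1)) (t : ℝ) :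
    oscRate i t ≤ 2 * oscRate k t := by
  have h1 := two_zpow_le_of_mem h
  have h2 := drift_pos t
  have h3 : 0 < jap t ^ del := Real.rpow_pos_of_pos (jap_pos t) _
  unfold oscRate
  rw [mul_min_of_nonneg _ _ two_pos.le]
  refine min_le_min (by linarith) ?_
  rw [← mul_assoc]
  gcongr

lemma card_Icc_three (k : ℤ) : (Finset.Icc (k - 1) (k + 1)).card = 3 := by
  rw [Int.card_Icc]; omega

/-- The density has pieces of size proportional to `ε₁`. -/
lemma exists_pieces_fat {φ : ℝ → ℝ} (hφ : IsCutoff φ) : ∃ C : ℝ, 0 < C ∧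
    ∀ (T ε₀ ε₁ : ℝ) (f : ℝ → E3 → E3 → ℝ) (ρstat : ℝ → E3 → ℝ) (ρosc : ℝ → E3 → ℂ), 0 < T →
      Bootstrap φ T ε₀ ε₁ f ρstat ρosc →
      ∃ S g g', Pieces φ T (C * ε₁) (fun t y => (density f t y : ℂ)) S g g' := by
  obtain ⟨C, hC, h⟩ := exists_pieces hφ
  refine ⟨6 * C, by positivity, fun T ε₀ ε₁ f ρstat ρosc hT hB => ?_⟩
  obtain ⟨S, g, g', hm, hS, hg, heq⟩ := h T ε₀ ε₁ f ρstat ρosc hT hB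
  have hε := hB.eps_pos
  have hsum : ∀ (k : ℤ) (a : ℤ → ℝ) (b : ℝ), (∀ i ∈ Finset.Icc (k - 1) (k + 1), a i ≤ 2 * b) →
      ∑ i ∈ Finset.Icc (k - 1) (k + 1), C * ε₁ * a i ≤ 6 * C * ε₁ * b := by
    intro k a b hab
    calc _ ≤ ∑ _i ∈ Finset.Icc (k - 1) (k + 1), C * ε₁ * (2 * b) :=
          Finset.sum_le_sum fun i hi => mul_le_mul_of_nonneg_left (hab i hi) (by positivity)
      _ = _ := by rw [Finset.sum_const, card_Icc_three, nsmul_eq_mul]; push_cast; ring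
  refine ⟨fun k t x => ∑ i ∈ Finset.Icc (k - 1) (k + 1), S i t x,
    fun k t x => ∑ i ∈ Finset.Icc (k - 1) (k + 1), g i t x,
    fun k t x => ∑ i ∈ Finset.Icc (k - 1) (k + 1), g' i t x, by positivity,
    fun k => Finset.measurable_sum _ fun i _ => hm i, fun k t ht => ?_, fun k => ?_,
    fun k t ht x => ?_⟩
  · refine (Bn.sum _ fun i _ => hS i t ht).mono ?_
    refine hsum k (fun i => (1 + 2 ^ i)⁻¹ * drift t) _ fun i hi => ?_
    rw [← mul_assoc]
    exact mul_le_mul_of_nonneg_right (one_add_two_zpow_inv_le hi) (drift_pos t).le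
  · refine (OscPiece.sum _ fun i _ => hg i).mono le_rfl (fun t _ => ?_) fun t _ => ?_
    · exact hsum k (fun i => oscRate i t) _ fun i hi => oscRate_le_of_mem hi t
    · exact hsum k (fun _ => drift t) _ fun i hi => by linarith [drift_pos t]
  · rw [Finset.sum_congr rfl fun i _ => heq i t ht x, modulate, map_sum, Finset.mul_sum, Finset.mul_sum,
      ← Finset.sum_add_distrib, ← Finset.sum_add_distrib]

lemma norm_cv_le_of_bn {k : ℤ} {B t β : ℝ} {W h : E3 → ℂ} (hW : Ker k B W) (hh : Bn t β h) (z : E3) :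
    ‖cv W h z‖ ≤ (bumpMass + 1) * B * β * mm k t ^ 3 := by
  have h1 := (enorm_cv_le W h z).trans ((maj_nconv hW hh).sup z)
  have := (maj_nconv hW hh).nonneg
  have := mm_pos k t
  rw [← ofReal_norm] at h1
  exact (ENNReal.ofReal_le_ofReal_iff (by positivity)).1 h1

lemma cv_modulate {W : E3 → ℂ} (hW : Integrable W) {S g : ℝ → E3 → ℂ} {t β β' : ℝ}
    (hS : Bn t β (S t)) (hg : Bn t β' (g t)) (z : E3) :
    cv W (modulate S g t) z = cv W (S t) z + (Complex.exp (-(Complex.I * (t : ℂ))) / 2 * cv W (g t) z +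
      Complex.exp (Complex.I * (t : ℂ)) / 2 * cv W (fun y => (starRingEnd ℂ) (g t y)) z) := by
  have h1 := integrable_cv hW hS.meas.aestronglyMeasurable hS.sup z
  have h2 := integrable_cv hW hg.meas.aestronglyMeasurable hg.sup z
  have h3 := integrable_cv hW hg.conj.meas.aestronglyMeasurable hg.conj.sup z
  set a := Complex.exp (-(Complex.I * (t : ℂ))) / 2
  set b := Complex.exp (Complex.I * (t : ℂ)) / 2
  have h4 : Integrable fun y => a * (W (z - y) * g t y) + b * (W (z - y) * (starRingEnd ℂ) (g t y)) :=
    (h2.const_mul a).add (h3.const_mul b)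
  unfold cv modulate
  rw [← integral_const_mul, ← integral_const_mul, ← integral_add (h2.const_mul _) (h3.const_mul _),
    ← integral_add h1 h4]
  congr 1
  ext y
  ring

/-- A kernel of frequency `2^k` only sees the part of the density that the pieces of index `k` describe. -/
lemma Pieces.cv_eq {φ : ℝ → ℝ} (hφ : IsCutoff φ) {T D : ℝ} {r : ℝ → E3 → ℂ} {S g g' : ℤ → ℝ → E3 → ℂ}
    (H : Pieces φ T D r S g g') {k : ℤ} {m : E3 → ℂ} (hm : ContinuousOn m {0}ᶜ)
    (hW : Integrable (ker φ k m)) {t : ℝ} (ht : t ∈ Icc 0 T) (hr : Measurable (r t)) {Q : ℝ}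
    (hQ : ∀ x, ‖r t x‖ ≤ Q) (z : E3) :
    cv (ker φ k m) (r t) z = cv (ker φ k m) (S k t) z +
      (Complex.exp (-(Complex.I * (t : ℂ))) / 2 * cv (ker φ k m) (g k t) z +
      Complex.exp (Complex.I * (t : ℂ)) / 2 * cv (ker φ k m) (fun y => (starRingEnd ℂ) (g k t y)) z) := by
  obtain ⟨B, hB, hker⟩ := exists_kerD_homog hφ Homog.one
  have hK : ∀ i, Ker i B (ker φ i fun _ => 1) := fun i => by
    have := (hker (fun _ => 1) isMichlin_one i).toKer
    simpa using this
  rw [cv_ker_eq_sum_proj hφ hm hW hr.aestronglyMeasurable hQ z,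
    ← cv_modulate hW (H.stat k t ht) ((H.osc k).bn t ht) z]
  unfold cv
  rw [← integral_finsetSum]
  · congr 1
    ext y
    rw [← Finset.mul_sum]
    congr 1
    exact H.eq k t ht y
  · intro i _
    exact integrable_cv hW (measurable_cv (hK i).cont.measurable hr).aestronglyMeasurable
      (Filter.Eventually.of_forall (norm_cv_le (hK i) hQ)) z

/-- The decay in the frequency that the sizes of all pieces have in common. -/
noncomputable def dec (k : ℤ) : ℝ := min 1 ((2 : ℝ) ^ k)⁻¹

lemma dec_pos (k : ℤ) : 0 < dec k := lt_min one_pos (inv_pos.2 (zpow_two_pos k))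

lemma one_le_japdel (t : ℝ) : 1 ≤ jap t ^ del := Real.one_le_rpow (one_le_jap t) (by norm_num [del])

lemma drift_le_one (t : ℝ) : drift t ≤ 1 :=
  inv_le_one_of_one_le₀ (Real.one_le_rpow (one_le_jap t) (by norm_num [del]))

lemma stat_rate_le (k : ℤ) (t : ℝ) : (1 + 2 ^ k)⁻¹ * drift t ≤ dec k * jap t ^ del := by
  have h := zpow_two_pos k
  have h1 : (1 + (2 : ℝ) ^ k)⁻¹ ≤ dec k := by
    refine le_min (inv_le_one_of_one_le₀ (by linarith)) (inv_anti₀ h (by linarith))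
  exact mul_le_mul h1 ((drift_le_one t).trans (one_le_japdel t)) (drift_pos t).le (dec_pos k).le

lemma oscRate_le_dec (k : ℤ) (t : ℝ) : oscRate k t ≤ dec k * jap t ^ del := by
  have h1 := one_le_japdel t
  have h2 := inv_pos.2 (zpow_two_pos k)
  unfold oscRate dec
  rw [min_mul_of_nonneg _ _ (by linarith), one_mul]
  exact min_le_min le_rfl (mul_le_mul_of_nonneg_left ((drift_le_one t).trans h1) h2.le)

lemma norm_half_exp (t : ℝ) : ‖Complex.exp (-(Complex.I * (t : ℂ))) / 2‖ = 1 / 2 ∧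
    ‖Complex.exp (Complex.I * (t : ℂ)) / 2‖ = 1 / 2 := by
  constructor
  · rw [norm_div, show -(Complex.I * (t : ℂ)) = ((-t : ℝ) : ℂ) * Complex.I by push_cast; ring,
      Complex.norm_exp_ofReal_mul_I]
    norm_num
  · rw [norm_div, mul_comm, Complex.norm_exp_ofReal_mul_I]
    norm_num

section family

variable {φ : ℝ → ℝ} {T D B : ℝ} {r : ℝ → E3 → ℂ} {S g g' : ℤ → ℝ → E3 → ℂ} {k : ℤ} {m : E3 → ℂ} {t : ℝ}

lemma Maj.add {t β β' : ℝ} {k : ℤ} {f f' : E3 → ℝ≥0∞} (h : Maj t k β f) (h' : Maj t k β' f') :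
    Maj t k (β + β') (fun z => f z + f' z) := by
  have hm := mm_pos k t
  refine ⟨add_nonneg h.nonneg h'.nonneg, h.meas.add h'.meas, ?_, fun z => ?_⟩
  · rw [lintegral_add_left h.meas, ENNReal.ofReal_add h.nonneg h'.nonneg]
    exact add_le_add h.int h'.int
  · rw [add_mul, ENNReal.ofReal_add (mul_nonneg h.nonneg (by positivity))
      (mul_nonneg h'.nonneg (by positivity))]
    exact add_le_add (h.sup z) (h'.sup z)

lemma Maj.mono {t β β' : ℝ} {k : ℤ} {f : E3 → ℝ≥0∞} (h : Maj t k β f) (hβ : β ≤ β') : Maj t k β' f := by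
  have hm := mm_pos k t
  refine ⟨h.nonneg.trans hβ, h.meas, h.int.trans (ENNReal.ofReal_le_ofReal hβ), fun z => (h.sup z).trans
    (ENNReal.ofReal_le_ofReal ?_)⟩
  gcongr

/-- The majorant of the convolution of a kernel of frequency `2^k` with the density at a fixed time. -/
lemma Pieces.exists_maj (hφ : IsCutoff φ) (H : Pieces φ T D r S g g') (hm : ContinuousOn m {0}ᶜ)
    (hW : Ker k B (ker φ k m)) (ht : t ∈ Icc 0 T) (hr : Measurable (r t)) {Q : ℝ}
    (hQ : ∀ x, ‖r t x‖ ≤ Q) :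
    ∃ f, Maj t k ((bumpMass + 1) * B * D * ((1 + 2 ^ k)⁻¹ * drift t + oscRate k t)) f ∧
      ∀ z, ‖cv (ker φ k m) (r t) z‖ₑ ≤ f z := by
  refine ⟨fun z => nconv (ker φ k m) (S k t) z + nconv (ker φ k m) (g k t) z,
    ((maj_nconv hW (H.stat k t ht)).add (maj_nconv hW ((H.osc k).bn t ht))).mono (le_of_eq (by ring)),
    fun z => ?_⟩
  rw [H.cv_eq hφ hm hW.integrable ht hr hQ z]
  obtain ⟨e1, e2⟩ := norm_half_exp t
  have hc : nconv (ker φ k m) (fun y => (starRingEnd ℂ) (g k t y)) z = nconv (ker φ k m) (g k t) z := by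
    unfold nconv
    congr 1
    ext y
    rw [← ofReal_norm ((starRingEnd ℂ) _), Complex.norm_conj, ofReal_norm]
  have n1 : ‖Complex.exp (-(Complex.I * (t : ℂ))) / 2‖ₑ = ENNReal.ofReal (1 / 2) := by
    rw [← ofReal_norm, e1]
  have n2 : ‖Complex.exp (Complex.I * (t : ℂ)) / 2‖ₑ = ENNReal.ofReal (1 / 2) := by
    rw [← ofReal_norm, e2]
  refine (enorm_add_le _ _).trans (add_le_add (enorm_cv_le _ _ _) ((enorm_add_le _ _).trans ?_))
  rw [enorm_mul, enorm_mul, n1, n2]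
  calc _ ≤ ENNReal.ofReal (1 / 2) * nconv (ker φ k m) (g k t) z +
        ENNReal.ofReal (1 / 2) * nconv (ker φ k m) (g k t) z :=
        add_le_add (mul_le_mul' le_rfl (enorm_cv_le _ _ _))
          (mul_le_mul' le_rfl ((enorm_cv_le _ _ _).trans hc.le))
    _ = _ := by
        rw [← add_mul, ← ENNReal.ofReal_add (by norm_num) (by norm_num)]
        norm_num

lemma integrableOn_amp_mul {t₃ t₄ Q : ℝ} {Λ : ℝ≥0∞} (hΛ : Λ ≠ ⊤) {c F : ℝ → ℂ} (hc : Amp t₃ t₄ Λ c)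
    (hF : Measurable F) (hQ : ∀ γ ∈ Ioo t₃ t₄, ‖F γ‖ ≤ Q) :
    IntegrableOn (fun γ => c γ * F γ) (Ioo t₃ t₄) := by
  refine Integrable.mono' (g := fun _ => Λ.toReal * Q) (integrable_const _)
    (hc.meas.mul hF).aestronglyMeasurable ?_
  filter_upwards [ae_restrict_mem measurableSet_Ioo] with γ hγ
  have h1 := hc.bound γ (Ioo_subset_Icc_self hγ)
  rw [← ofReal_norm, ENNReal.ofReal_le_iff_le_toReal hΛ] at h1
  rw [norm_mul]
  exact mul_le_mul h1 (hQ γ hγ) (norm_nonneg _) ENNReal.toReal_nonneg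

lemma measurable_along {H : ℝ → E3 → ℂ} (hH : Measurable (fun q : ℝ × E3 => H q.1 q.2))
    {Z : ℝ → E3} (hZ : Measurable Z) : Measurable fun γ => H γ (Z γ) :=
  hH.comp (measurable_id.prodMk hZ)

lemma integral_add_half {μ : Measure ℝ} {F₁ F₂ F₃ : ℝ → ℂ} (h₁ : Integrable F₁ μ) (h₂ : Integrable F₂ μ)
    (h₃ : Integrable F₃ μ) : ∫ γ, (F₁ γ + ((1 / 2 : ℂ) * F₂ γ + (1 / 2 : ℂ) * F₃ γ)) ∂μ =
      (∫ γ, F₁ γ ∂μ) + ((1 / 2 : ℂ) * (∫ γ, F₂ γ ∂μ) + (1 / 2 : ℂ) * ∫ γ, F₃ γ ∂μ) := by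
  have h4 : Integrable (fun γ => (1 / 2 : ℂ) * F₂ γ + (1 / 2 : ℂ) * F₃ γ) μ :=
    (h₂.const_mul _).add (h₃.const_mul _)
  rw [integral_add h₁ h4, integral_add (h₂.const_mul _) (h₃.const_mul _), integral_const_mul,
    integral_const_mul]

/-- The majorant for the time integrals of the convolution of a kernel of frequency `2^k` with the
density. -/
lemma Pieces.exists_time_majorant (hφ : IsCutoff φ) {n s τ t₃ t₄ : ℝ} {j : ℕ} {Y₁ : E3 → E3 → E3}
    {Y₂ : ℝ → E3 → E3 → E3} (hb : Block n s τ t₃ t₄) (hY : Chars s τ j Y₁ Y₂)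
    (H : Pieces φ s D r S g g') (hm : ContinuousOn m {0}ᶜ) (hW : KerD k B (ker φ k m))
    (hr : Measurable (fun p : ℝ × E3 => r p.1 p.2)) (hQ : ∀ t, ∃ Q, ∀ x, ‖r t x‖ ≤ Q) :
    ∃ Jm, TimeMaj n s τ t₃ t₄ j Y₁ k (6404 * atomConst * (B * D))
      (fun γ y v => cv (ker φ k m) (r γ) (Y₂ γ y v)) Jm := by
  have hB := hW.toKer.nonneg
  have hD := H.nonneg
  have hWm := hW.toKer.cont.measurable
  have hcm : Measurable (fun p : ℝ × E3 => (starRingEnd ℂ) (g k p.1 p.2)) := (H.osc k).conj.meas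
  obtain ⟨J₁, h₁⟩ := exists_stat_majorant hb hY hW.toKer (H.meas k) (H.stat k) hD
  -- the real part of `e^{-it} g` contains `g` with the phase `-1` and its conjugate with the phase `1`
  obtain ⟨J₂, h₂⟩ := exists_osc_majorant hb hY hW hD (H.osc k) (σ := -1) (by norm_num)
  obtain ⟨J₃, h₃⟩ := exists_osc_majorant hb hY hW hD (H.osc k).conj (σ := 1) (by norm_num)
  have hhalf : ENNReal.ofReal (1 / 2) ≠ ⊤ := ENNReal.ofReal_ne_top
  refine ⟨fun y v => J₁ y v + (ENNReal.ofReal (1 / 2) * J₂ y v + ENNReal.ofReal (1 / 2) * J₃ y v),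
    h₁.meas.add ((h₂.meas.const_mul _).add (h₃.meas.const_mul _)), fun y v hv Λ hΛ c hc => ?_,
    fun k₁ p f hf => ?_⟩
  · have hsec : ∀ {h : ℝ → E3 → ℂ}, Measurable (fun p : ℝ × E3 => h p.1 p.2) →
        Measurable fun γ => cv (ker φ k m) (h γ) (Y₂ γ y v) := fun {h} hh =>
      measurable_along (H := fun γ z => cv (ker φ k m) (h γ) z) (measurable_cv_param hWm hh)
        (hY.path y v hv).meas
    have hbd : ∀ {h : ℝ → E3 → ℂ} {β : ℝ}, (∀ γ ∈ Icc t₃ t₄, Bn γ β (h γ)) → ∀ γ ∈ Ioo t₃ t₄,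
        ‖cv (ker φ k m) (h γ) (Y₂ γ y v)‖ ≤ (bumpMass + 1) * B * β * (2 ^ k) ^ 3 := by
      intro h β hh γ hγ
      have h1 := hh γ (Ioo_subset_Icc_self hγ)
      refine (norm_cv_le_of_bn hW.toKer h1 _).trans ?_
      have := h1.nonneg
      have := bumpMass_pos
      have := mm_pos k γ
      gcongr
      exact min_le_left _ _
    have e2 : ∀ γ : ℝ, Complex.exp (-(Complex.I * (γ : ℂ))) =
        Complex.exp (Complex.I * ((-1 * γ : ℝ) : ℂ)) := fun γ => by congr 1; push_cast; ring
    have e3 : ∀ γ : ℝ, Complex.exp (Complex.I * (γ : ℂ)) =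
        Complex.exp (Complex.I * ((1 * γ : ℝ) : ℂ)) := fun γ => by congr 1; push_cast; ring
    have hem : ∀ σ : ℝ, Measurable fun γ : ℝ => Complex.exp (Complex.I * ((σ * γ : ℝ) : ℂ)) :=
      fun σ => by fun_prop
    have hen : ∀ σ γ : ℝ, ∀ z : ℂ, ‖Complex.exp (Complex.I * ((σ * γ : ℝ) : ℂ)) * z‖ = ‖z‖ := fun σ γ z => by
      rw [norm_mul, mul_comm Complex.I, Complex.norm_exp_ofReal_mul_I, one_mul]
    have hsb : ∀ γ ∈ Icc t₃ t₄, Bn γ (D * (2 * (n ^ (2 * del) / n))) (S k γ) := fun γ hγ => by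
      refine (H.stat k γ (hb.mem hγ)).mono (mul_le_mul_of_nonneg_left ?_ hD)
      refine le_trans ?_ (hb.drift_le hγ)
      have := zpow_two_pos k
      exact mul_le_of_le_one_left (drift_pos γ).le (inv_le_one_of_one_le₀ (by linarith))
    have hgb : ∀ γ ∈ Icc t₃ t₄, Bn γ (D * (3 * n ^ del)) (g k γ) := fun γ hγ =>
      ((H.osc k).bn γ (hb.mem hγ)).mono (mul_le_mul_of_nonneg_left (hb.oscRate_le hγ k) hD)
    have i1 := integrableOn_amp_mul hΛ hc (hsec (H.meas k)) (hbd hsb)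
    have i2 := integrableOn_amp_mul hΛ hc ((hem (-1)).mul (hsec (H.osc k).meas)) fun γ hγ =>
      (hen (-1) γ _).le.trans (hbd hgb γ hγ)
    have i3 := integrableOn_amp_mul hΛ hc ((hem 1).mul (hsec hcm)) fun γ hγ =>
      (hen 1 γ _).le.trans (hbd (fun γ hγ => (hgb γ hγ).conj) γ hγ)
    have e : ∫ γ in Ioo t₃ t₄, c γ * cv (ker φ k m) (r γ) (Y₂ γ y v) =
        (∫ γ in Ioo t₃ t₄, c γ * cv (ker φ k m) (S k γ) (Y₂ γ y v)) +
        ((1 / 2 : ℂ) * (∫ γ in Ioo t₃ t₄, c γ * (Complex.exp (Complex.I * ((-1 * γ : ℝ) : ℂ)) *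
          cv (ker φ k m) (g k γ) (Y₂ γ y v))) +
        (1 / 2 : ℂ) * ∫ γ in Ioo t₃ t₄, c γ * (Complex.exp (Complex.I * ((1 * γ : ℝ) : ℂ)) *
          cv (ker φ k m) (fun y => (starRingEnd ℂ) (g k γ y)) (Y₂ γ y v))) := by
      simp only [Pi.mul_apply] at i2 i3
      rw [← integral_add_half i1 i2 i3]
      refine setIntegral_congr_fun measurableSet_Ioo fun γ hγ => ?_
      obtain ⟨Q, hQ'⟩ := hQ γ
      rw [H.cv_eq hφ hm hW.toKer.integrable (hb.mem (Ioo_subset_Icc_self hγ))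
        (hr.of_uncurry_left (x := γ)) hQ', e2, e3]
      ring_nf
    have hh : ‖(1 / 2 : ℂ)‖ₑ = ENNReal.ofReal (1 / 2) := by
      rw [← ofReal_norm]; norm_num
    rw [e]
    refine (enorm_add_le _ _).trans ?_
    rw [mul_add]
    refine add_le_add (h₁.le y v hv Λ hΛ c hc) ((enorm_add_le _ _).trans ?_)
    rw [enorm_mul, enorm_mul, hh, mul_add, mul_left_comm Λ, mul_left_comm Λ]
    exact add_le_add (mul_le_mul' le_rfl (h₂.le y v hv Λ hΛ c hc))
      (mul_le_mul' le_rfl (h₃.le y v hv Λ hΛ c hc))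
  · have hfm := hY.measurable_comp hf.meas
    have hn : 0 < n := by linarith [hb.one_le]
    have hN : 0 < max n (jap τ) := lt_max_of_lt_left hn
    have hg0 := gain_pos hN (zpow_two_pos k) (mu_pos hN k₁ k)
    have hp := hf.nonneg
    have hat := atomConst_pos
    have t := (h₁.tb k₁ p f hf).add (((h₂.tb k₁ p f hf).const_mul hhalf).add
      ((h₃.tb k₁ p f hf).const_mul hhalf) ((hfm.mul h₂.meas).const_mul _)) (hfm.mul h₁.meas)
    refine t.mono (le_of_eq ?_) fun y v _ => le_of_eq (by ring)
    rw [← ENNReal.ofReal_mul (by norm_num), ← ENNReal.ofReal_add (by positivity) (by positivity),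
      ← ENNReal.ofReal_add (by positivity) (by positivity)]
    congr 1
    ring

end family

/-! ### Summation over the frequencies -/

/-- The factor `min(2^k, 1/N)^{9/8}` that one frequency contributes. -/
noncomputable def half (N : ℝ) (k : ℤ) : ℝ := min ((2 : ℝ) ^ k) N⁻¹ ^ (9 / 8 : ℝ)

lemma half_pos {N : ℝ} (hN : 0 < N) (k : ℤ) : 0 < half N k :=
  Real.rpow_pos_of_pos (lt_min (zpow_two_pos k) (inv_pos.2 hN)) _

/-- Writing `μ^{9/4} = μ^{9/8} μ^{9/8}` separates the two frequencies, so that the double sum over them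
factorises. -/
lemma gain_le_half {N : ℝ} (hN : 0 < N) (k₁ k₂ : ℤ) : gain N (2 ^ k₂) (mu N k₁ k₂) ≤
    N ^ (1 / 8 + 2 * del) * (half N k₁ * (((2 : ℝ) ^ k₂) ^ (-(1 / 100) : ℝ) * half N k₂)) := by
  have hμ := mu_pos hN k₁ k₂
  have h1 : mu N k₁ k₂ ≤ min ((2 : ℝ) ^ k₁) N⁻¹ := min_le_min le_rfl (min_le_right _ _)
  have h2 : mu N k₁ k₂ ≤ min ((2 : ℝ) ^ k₂) N⁻¹ := min_le_right _ _
  have e : mu N k₁ k₂ ^ (9 / 4 : ℝ) = mu N k₁ k₂ ^ (9 / 8 : ℝ) * mu N k₁ k₂ ^ (9 / 8 : ℝ) := by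
    rw [← Real.rpow_add hμ]; norm_num
  have h3 : mu N k₁ k₂ ^ (9 / 8 : ℝ) ≤ half N k₁ := Real.rpow_le_rpow hμ.le h1 (by norm_num)
  have h4 : mu N k₁ k₂ ^ (9 / 8 : ℝ) ≤ half N k₂ := Real.rpow_le_rpow hμ.le h2 (by norm_num)
  have h5 := zpow_two_pos k₂
  have h6 := half_pos hN k₁
  unfold gain
  rw [e]
  calc _ ≤ N ^ (1 / 8 + 2 * del) * ((2 : ℝ) ^ k₂) ^ (-(1 / 100) : ℝ) * (half N k₁ * half N k₂) := by
        gcongr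
    _ = _ := by ring

lemma summable_two_sided {c e : ℝ} (hc : 0 < c) (hce : c < e) :
    Summable fun i : ℤ => ((2 : ℝ) ^ i) ^ (-c) * min ((2 : ℝ) ^ i) 2 ^ e := by
  have h2 : ∀ a : ℝ, 0 < a → Summable fun n : ℕ => ((2 : ℝ) ^ (-a)) ^ n := fun a ha =>
    summable_geometric_of_lt_one (by positivity)
      (Real.rpow_lt_one_of_one_lt_of_neg one_lt_two (by linarith))
  have hsw : ∀ (a : ℝ) (n : ℕ), ((2 : ℝ) ^ (-a)) ^ n = ((2 : ℝ) ^ n) ^ (-a) := fun a n => by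
    rw [← Real.rpow_natCast, ← Real.rpow_natCast, ← Real.rpow_mul two_pos.le, ← Real.rpow_mul two_pos.le,
      mul_comm]
  refine Summable.of_nat_of_neg ?_ ?_
  · refine Summable.of_nonneg_of_le (fun n => by positivity) (fun n => ?_) ((h2 c hc).mul_left (2 ^ e))
    rw [hsw, mul_comm, zpow_natCast]
    gcongr
    · linarith
    · exact min_le_right _ _
  · refine Summable.of_nonneg_of_le (fun n => by positivity) (fun n => ?_) (h2 (e - c) (by linarith))
    have hp : (0 : ℝ) < 2 ^ (-(n : ℤ)) := zpow_two_pos _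
    calc _ ≤ ((2 : ℝ) ^ (-(n : ℤ))) ^ (-c) * ((2 : ℝ) ^ (-(n : ℤ))) ^ e := by
          gcongr
          · linarith
          · exact min_le_left _ _
      _ = ((2 : ℝ) ^ (-(n : ℤ))) ^ (e - c) := by rw [← Real.rpow_add hp]; congr 1; ring
      _ = _ := by rw [hsw, zpow_neg, zpow_natCast, Real.inv_rpow (by positivity), ← Real.rpow_neg (by positivity)]

/-- The sums over the frequencies are geometric, with the largest term at `2^k ≈ 1/N`. -/
lemma exists_tsum_half_le {c : ℝ} (hc : 0 < c) (hce : c < 9 / 8) : ∃ Q : ℝ, 0 < Q ∧ ∀ N : ℝ, 0 < N →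
    ∑' k : ℤ, ENNReal.ofReal (((2 : ℝ) ^ k) ^ (-c) * half N k) ≤ ENNReal.ofReal (Q * N ^ (c - 9 / 8)) := by
  have hs := summable_two_sided hc hce
  have hpos : ∀ i : ℤ, 0 ≤ ((2 : ℝ) ^ i) ^ (-c) * min ((2 : ℝ) ^ i) 2 ^ (9 / 8 : ℝ) := fun i => by
    have := zpow_two_pos i
    positivity
  set Q₀ := ∑' i : ℤ, ((2 : ℝ) ^ i) ^ (-c) * min ((2 : ℝ) ^ i) 2 ^ (9 / 8 : ℝ) with hQ
  have hQ0 : 0 ≤ Q₀ := tsum_nonneg hpos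
  refine ⟨Q₀ + 1, by linarith, fun N hN => ?_⟩
  have hx : 0 < N⁻¹ := inv_pos.2 hN
  -- shifting the index by `k₀`, with `2^{k₀} ≈ 1/N`, takes the dependence on `N` out of the sum
  obtain ⟨k₀, h1, h2⟩ := exists_mem_Ico_zpow hx one_lt_two
  rw [← (Equiv.addRight k₀).tsum_eq]
  have hy := zpow_two_pos k₀
  rw [zpow_add_one₀ two_ne_zero] at h2
  have hpt : ∀ i : ℤ, ((2 : ℝ) ^ (i + k₀)) ^ (-c) * half N (i + k₀) ≤
      (N⁻¹) ^ (9 / 8 - c) * (((2 : ℝ) ^ i) ^ (-c) * min ((2 : ℝ) ^ i) 2 ^ (9 / 8 : ℝ)) := by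
    intro i
    have hi := zpow_two_pos i
    have h3 : half N (i + k₀) ≤ (min ((2 : ℝ) ^ i) 2 * 2 ^ k₀) ^ (9 / 8 : ℝ) := by
      refine Real.rpow_le_rpow (lt_min (zpow_two_pos _) hx).le ?_ (by norm_num)
      rw [min_mul_of_nonneg _ _ hy.le, zpow_add₀ two_ne_zero]
      exact min_le_min le_rfl (by linarith)
    calc _ ≤ ((2 : ℝ) ^ (i + k₀)) ^ (-c) * (min ((2 : ℝ) ^ i) 2 * 2 ^ k₀) ^ (9 / 8 : ℝ) := by
          have := zpow_two_pos (i + k₀)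
          gcongr
      _ = ((2 : ℝ) ^ k₀) ^ (9 / 8 - c) * (((2 : ℝ) ^ i) ^ (-c) * min ((2 : ℝ) ^ i) 2 ^ (9 / 8 : ℝ)) := by
          rw [zpow_add₀ two_ne_zero, Real.mul_rpow hi.le hy.le, Real.mul_rpow (by positivity) hy.le,
            show (9 / 8 - c : ℝ) = -c + 9 / 8 by ring, Real.rpow_add hy]
          ring
      _ ≤ _ := by
          gcongr
  calc _ ≤ ∑' i : ℤ, ENNReal.ofReal ((N⁻¹) ^ (9 / 8 - c) *
        (((2 : ℝ) ^ i) ^ (-c) * min ((2 : ℝ) ^ i) 2 ^ (9 / 8 : ℝ))) :=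
        ENNReal.tsum_le_tsum fun i => ENNReal.ofReal_le_ofReal (hpt i)
    _ = ENNReal.ofReal ((N⁻¹) ^ (9 / 8 - c) * Q₀) := by
        rw [← ENNReal.ofReal_tsum_of_nonneg (fun i => mul_nonneg (by positivity) (hpos i))
          (hs.mul_left _), tsum_mul_left]
    _ ≤ _ := by
        refine ENNReal.ofReal_le_ofReal ?_
        rw [Real.inv_rpow hN.le, ← Real.rpow_neg hN.le, neg_sub, mul_comm]
        gcongr
        linarith

/-- A field at time `τ`, split into its dyadic pieces `Fk` with majorants `f`. -/
structure SpaceFam (τ : ℝ) (p : ℤ → ℝ) (Fk : ℤ → E3 → ℂ) (f : ℤ → E3 → ℝ≥0∞) : Prop where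
  meas : ∀ k, Measurable (Fk k)
  maj : ∀ k, Maj τ k (p k) (f k)
  le : ∀ k z, ‖Fk k z‖ₑ ≤ f k z
  summ : Summable fun k => p k * mm k τ ^ 3

/-- A field on a time interval, split into its dyadic pieces `Gk`, with majorants `Jm` for the time
integrals along the characteristics. -/
structure TimeFam (n s τ t₃ t₄ : ℝ) (j : ℕ) (Y₁ : E3 → E3 → E3) (Y₂ : ℝ → E3 → E3 → E3) (b q : ℤ → ℝ)
    (Gk : ℤ → ℝ → E3 → ℂ) (Jm : ℤ → E3 → E3 → ℝ≥0∞) : Prop where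
  nonneg : ∀ k, 0 ≤ b k
  meas : ∀ k, Measurable (fun p : ℝ × E3 => Gk k p.1 p.2)
  bound : ∀ k γ z, ‖Gk k γ z‖ ≤ q k
  summ : Summable q
  maj : ∀ k, TimeMaj n s τ t₃ t₄ j Y₁ k (b k) (fun γ y v => Gk k γ (Y₂ γ y v)) (Jm k)

section

variable {n s τ t₃ t₄ : ℝ} {j : ℕ} {Y₁ : E3 → E3 → E3} {Y₂ : ℝ → E3 → E3 → E3} {p b q : ℤ → ℝ}
  {Fk : ℤ → E3 → ℂ} {f : ℤ → E3 → ℝ≥0∞} {Gk : ℤ → ℝ → E3 → ℂ} {Jm : ℤ → E3 → E3 → ℝ≥0∞}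

lemma SpaceFam.norm_le (H : SpaceFam τ p Fk f) (k : ℤ) (z : E3) : ‖Fk k z‖ ≤ p k * mm k τ ^ 3 := by
  have h1 := (H.le k z).trans ((H.maj k).sup z)
  have := (H.maj k).nonneg
  have := mm_pos k τ
  rw [← ofReal_norm] at h1
  exact (ENNReal.ofReal_le_ofReal_iff (by positivity)).1 h1

lemma TimeFam.enorm_integral_le (H : TimeFam n s τ t₃ t₄ j Y₁ Y₂ b q Gk Jm)
    (hY : Chars s τ j Y₁ Y₂) (y : E3) {v : E3} (hv : v ∈ win j) {Λ : ℝ≥0∞} (hΛ : Λ ≠ ⊤) {c : ℝ → ℂ}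
    (hc : Amp t₃ t₄ Λ c) :
    ‖∫ γ in Ioo t₃ t₄, c γ * ∑' k, Gk k γ (Y₂ γ y v)‖ₑ ≤ Λ * ∑' k, Jm k y v := by
  have hZ := (hY.path y v hv).meas
  have e : ∫ γ in Ioo t₃ t₄, c γ * ∑' k, Gk k γ (Y₂ γ y v) =
      ∑' k, ∫ γ in Ioo t₃ t₄, c γ * Gk k γ (Y₂ γ y v) := by
    rw [← integral_tsum]
    · simp only [tsum_mul_left]
    · exact fun k => (hc.meas.mul (measurable_along (H.meas k) hZ)).aestronglyMeasurable
    · have hq0 : ∀ k, 0 ≤ q k := fun k => (norm_nonneg _).trans (H.bound k 0 0)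
      refine ne_top_of_le_ne_top ?_ (ENNReal.tsum_le_tsum fun k =>
        setLIntegral_mono' (g := fun _ => Λ * ENNReal.ofReal (q k)) measurableSet_Ioo fun γ hγ => ?_)
      · simp only [setLIntegral_const]
        rw [ENNReal.tsum_mul_right, ENNReal.tsum_mul_left, ← ENNReal.ofReal_tsum_of_nonneg hq0 H.summ]
        refine ENNReal.mul_ne_top (ENNReal.mul_ne_top hΛ ENNReal.ofReal_ne_top) ?_
        simp
      · rw [enorm_mul, ← ofReal_norm (Gk k γ _)]
        exact mul_le_mul' (hc.bound γ (Ioo_subset_Icc_self hγ)) (ENNReal.ofReal_le_ofReal (H.bound k _ _))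
  rw [e, ← ENNReal.tsum_mul_left]
  exact (enorm_tsum_le_tsum_enorm).trans (ENNReal.tsum_le_tsum fun k => (H.maj k).le y v hv Λ hΛ c hc)

/-- The double sum over the frequencies of the two fields. -/
lemma SpaceFam.tb_mul (hF : SpaceFam τ p Fk f) (hG : TimeFam n s τ t₃ t₄ j Y₁ Y₂ b q Gk Jm)
    (hb : Block n s τ t₃ t₄) (hY : Chars s τ j Y₁ Y₂) :
    TB s j (ENNReal.ofReal ((max n (jap τ)) ^ (1 / 8 + 2 * del)) *
      ((∑' k, ENNReal.ofReal (p k * half (max n (jap τ)) k)) *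
        ∑' k, ENNReal.ofReal (b k * (((2 : ℝ) ^ k) ^ (-(1 / 100) : ℝ) * half (max n (jap τ)) k))))
      (fun y v => (∑' k, f k (Y₁ y v)) * ∑' k, Jm k y v) := by
  set N := max n (jap τ) with hNdef
  have hN : 0 < N := lt_max_of_lt_left (by linarith [hb.one_le])
  have hfm : ∀ k, Measurable (fun q : E3 × E3 => f k (Y₁ q.1 q.2)) := fun k =>
    hY.measurable_comp (hF.maj k).meas
  have h1 := fun k₁ => TB.tsum (fun k₂ => (hG.maj k₂).tb k₁ (p k₁) (f k₁) (hF.maj k₁))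
    fun k₂ => (hfm k₁).mul (hG.maj k₂).meas
  have h2 := TB.tsum h1 fun k₁ => Measurable.tsum fun k₂ => (hfm k₁).mul (hG.maj k₂).meas
  refine h2.mono ?_ fun y v _ => le_of_eq ?_
  · rw [← ENNReal.tsum_mul_right, ← ENNReal.tsum_mul_left]
    refine ENNReal.tsum_le_tsum fun k₁ => ?_
    rw [← ENNReal.tsum_mul_left, ← ENNReal.tsum_mul_left]
    refine ENNReal.tsum_le_tsum fun k₂ => ?_
    have hp := (hF.maj k₁).nonneg
    have hb0 := hG.nonneg k₂
    have hh := half_pos hN k₁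
    rw [← ENNReal.ofReal_mul (by positivity), ← ENNReal.ofReal_mul (by positivity)]
    refine ENNReal.ofReal_le_ofReal ?_
    calc _ ≤ b k₂ * (p k₁ * (N ^ (1 / 8 + 2 * del) *
          (half N k₁ * (((2 : ℝ) ^ k₂) ^ (-(1 / 100) : ℝ) * half N k₂)))) := by
          gcongr
          exact gain_le_half hN k₁ k₂
      _ = _ := by ring
  · rw [← ENNReal.tsum_mul_right]
    exact tsum_congr fun k₁ => ENNReal.tsum_mul_left.symm

end

/-- The operator `opB` applied to two fields that are split into dyadic pieces. -/
lemma exists_normB0_opB_le {φ : ℝ → ℝ} (hφ : IsCutoff φ) : ∃ C : ℝ, 0 < C ∧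
    ∀ {A ε₁ s τ n t₃ t₄ : ℝ} {j : ℕ} {k : ℤ} {K : E3 → E3 → ℂ} {P₁ : E3 → E3 → E3}
      {P₂ : E3 → E3 → ℝ → E3} {C₀ : E3 → E3 → E3 → ℝ → ℂ} {p b q : ℤ → ℝ} {Fk : ℤ → E3 → ℂ}
      {f : ℤ → E3 → ℝ≥0∞} {Gk : ℤ → ℝ → E3 → ℂ} {Jm : ℤ → E3 → E3 → ℝ≥0∞} {F G : ℝ → E3 → ℂ},
    0 < A → A * ε₁ ≤ 1 / 16 → Admissible φ A ε₁ s j k K P₁ P₂ → Block n s τ t₃ t₄ →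
    Measurable (fun p : E3 × E3 × E3 × ℝ => C₀ p.1 p.2.1 p.2.2.1 p.2.2.2) →
    (∀ x y v, DifferentiableOn ℝ (C₀ x y v) (Icc 0 s)) → lamStar C₀ s t₃ t₄ ≠ ⊤ →
    SpaceFam τ p Fk f →
    TimeFam n s τ t₃ t₄ j (fun y v => y - (s - τ) • v + P₁ y v)
      (fun γ y v => y - (s - clamp s γ) • v + P₂ y v (clamp s γ)) b q Gk Jm →
    (∀ z, F τ z = ∑' k, Fk k z) → (∀ γ ∈ Icc 0 s, ∀ z, G γ z = ∑' k, Gk k γ z) →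
    normB0 φ s (opB K P₁ P₂ F G C₀ t₃ t₄ τ s) ≤ ENNReal.ofReal (C * A) *
      (ENNReal.ofReal ((max n (jap τ)) ^ (1 / 8 + 2 * del)) *
      ((∑' k, ENNReal.ofReal (p k * half (max n (jap τ)) k)) *
        ∑' k, ENNReal.ofReal (b k * (((2 : ℝ) ^ k) ^ (-(1 / 100) : ℝ) * half (max n (jap τ)) k)))) *
      lamStar C₀ s t₃ t₄ := by
  obtain ⟨C, hC, hnorm⟩ := exists_normB0_le hφ
  refine ⟨C, hC, ?_⟩
  intro A ε₁ s τ n t₃ t₄ j k K P₁ P₂ C₀ p b q Fk f Gk Jm F G hA hAε hK hb hCm hCd hΛ hF hG hFe hGe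
  have hY := hK.chars hAε hb.tau_nonneg hb.tau_le
  have hHm : Measurable (fun p : E3 × E3 => (∑' k, f k (p.1 - (s - τ) • p.2 + P₁ p.1 p.2)) *
      ∑' k, Jm k p.1 p.2) :=
    (Measurable.tsum fun k => hY.measurable_comp (hF.maj k).meas).mul
      (Measurable.tsum fun k => (hG.maj k).meas)
  refine hnorm A s k j _ _ (fun y v => (∑' k, f k (y - (s - τ) • v + P₁ y v)) * ∑' k, Jm k y v) _ hA.le hΛ
    hHm (hF.tb_mul hG hb hY) ?_
  -- the time integral over a single point vanishes
  rcases hb.le.eq_or_lt with h34 | h34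
  · refine Filter.Eventually.of_forall fun x => ?_
    simp [opB, h34]
  · refine hK.enorm_opB_le hφ hA hb.nonneg h34 hb.le_s hCm hCd hΛ hY (fun _ _ => rfl)
      (fun γ hγ y v => by simp only [clamp_eq hγ]) hFe hGe
      (Measurable.tsum hF.meas) (Measurable.tsum hG.meas)
      (fun z => tsum_of_norm_bounded hF.summ.hasSum fun k => hF.norm_le k z)
      (fun γ z => tsum_of_norm_bounded hG.summ.hasSum fun k => hG.bound k γ z) hHm ?_
    intro y v hv Λ hΛ' c hc
    rw [mul_left_comm Λ]
    exact mul_le_mul' ((enorm_tsum_le_tsum_enorm).trans (ENNReal.tsum_le_tsum fun k => hF.le k _))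
      (hG.enorm_integral_le hY y hv hΛ' hc)

/-! ### The dyadic families of the fields -/

lemma mm_le_mm_zero (k : ℤ) (t : ℝ) : mm k t ≤ mm k 0 := by
  refine min_le_min le_rfl ((inv_le_one_of_one_le₀ (one_le_jap t)).trans ?_)
  simp [jap]

lemma dec_le_rpow (k : ℤ) : dec k ≤ ((2 : ℝ) ^ k) ^ (-(1 / 100) : ℝ) := by
  have h := zpow_two_pos k
  rcases le_total 1 ((2 : ℝ) ^ k) with h1 | h1
  · refine (min_le_right _ _).trans ?_
    rw [← Real.rpow_neg_one]
    exact Real.rpow_le_rpow_of_exponent_le h1 (by norm_num)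
  · exact (min_le_left _ _).trans (Real.one_le_rpow_of_pos_of_le_one_of_nonpos h h1 (by norm_num))

lemma summable_dec {d : ℤ} (hd : d = 0 ∨ d = -1) :
    Summable fun k : ℤ => (2 : ℝ) ^ (k * d) * (dec k * mm k 0 ^ 3) := by
  have hg : Summable fun n : ℕ => ((1 : ℝ) / 2) ^ n := summable_geometric_two
  have h0 : jap 0 = 1 := by simp [jap]
  have hm : ∀ k, 0 < mm k 0 := fun k => mm_pos k 0
  have hm1 : ∀ k, mm k 0 ≤ 1 := fun k => (min_le_right _ _).trans (by simp [h0])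
  have hd' := dec_pos
  refine Summable.of_nat_of_neg ?_ ?_
  · refine Summable.of_nonneg_of_le (fun n => ?_) (fun n => ?_) hg
    · have := hd' n; have := hm n; positivity
    · have h1 : (2 : ℝ) ^ ((n : ℤ) * d) ≤ 1 :=
        zpow_le_one_of_nonpos₀ one_le_two (by rcases hd with rfl | rfl <;> simp)
      have h2 : dec n ≤ (1 / 2) ^ n := (min_le_right _ _).trans (by simp)
      have h3 : mm n 0 ^ 3 ≤ 1 := pow_le_one₀ (hm _).le (hm1 _)
      have := hd' n; have := hm n
      calc _ ≤ 1 * ((1 / 2 : ℝ) ^ n * 1) := by gcongr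
        _ = _ := by ring
  · refine Summable.of_nonneg_of_le (fun n => ?_) (fun n => ?_) hg
    · have := hd' (-n); have := hm (-n); positivity
    · have h1 : (2 : ℝ) ^ (-(n : ℤ) * d) ≤ 2 ^ n := by
        rw [← zpow_natCast]
        refine zpow_le_zpow_right₀ one_le_two ?_
        rcases hd with rfl | rfl <;> simp
      have h2 : dec (-n) ≤ 1 := min_le_left _ _
      have h4 : mm (-n) 0 ≤ (1 / 2) ^ n := (min_le_left _ _).trans (by simp)
      have h3 : mm (-n) 0 ^ 3 ≤ ((1 / 2 : ℝ) ^ n) ^ 3 := pow_le_pow_left₀ (hm _).le h4 3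
      have := hd' (-n); have := hm (-n)
      calc _ ≤ (2 : ℝ) ^ n * (1 * ((1 / 2 : ℝ) ^ n) ^ 3) := by gcongr
        _ = ((1 / 2 : ℝ) ^ n) ^ 2 := by
            rw [one_mul, one_div, inv_pow]
            field_simp
        _ ≤ _ := pow_le_of_le_one (by positivity) (pow_le_one₀ (by norm_num) (by norm_num)) two_ne_zero

/-- For a symbol of degree `d` each term carries the factor `2^{kd}`; the sum converges for `d = 0, -1`
because `-d + 1/100 < 9/8`. -/
lemma exists_tsum_dec_le {d : ℤ} (hd : d = 0 ∨ d = -1) : ∃ Q : ℝ, 0 < Q ∧ ∀ N : ℝ, 0 < N →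
    ∑' k : ℤ, ENNReal.ofReal ((2 : ℝ) ^ (k * d) * ((2 : ℝ) ^ k) ^ (-(1 / 100) : ℝ) * half N k) ≤
      ENNReal.ofReal (Q * N ^ ((-d + 1 / 100 : ℝ) - 9 / 8)) := by
  obtain ⟨Q, hQ, h⟩ := exists_tsum_half_le (c := (-d + 1 / 100 : ℝ))
    (by rcases hd with rfl | rfl <;> norm_num) (by rcases hd with rfl | rfl <;> norm_num)
  refine ⟨Q, hQ, fun N hN => le_trans (le_of_eq (tsum_congr fun k => ?_)) (h N hN)⟩
  rw [neg_add, neg_neg, Real.rpow_add (zpow_two_pos k), Real.rpow_intCast, ← zpow_mul]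

section

variable {φ : ℝ → ℝ} {D : ℝ} {r : ℝ → E3 → ℂ} {S g g' : ℤ → ℝ → E3 → ℂ}

lemma KerD.mono {k : ℤ} {B B' : ℝ} {W : E3 → ℂ} (h : KerD k B W) (hB : B ≤ B') : KerD k B' W := by
  refine ⟨h.toKer.mono hB, h.diff, h.contd, fun x => (h.dbound x).trans ?_⟩
  have := bump_pos k x
  have := zpow_two_pos k
  gcongr

/-- Uniform kernel bounds for finitely many homogeneous symbols. -/
lemma exists_kerD_family (hφ : IsCutoff φ) {ι : Type*} [Fintype ι] {d : ℤ} {m : ι → E3 → ℂ}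
    (hm : ∀ i, Homog d (m i)) : ∃ C : ℝ, 0 < C ∧ ∀ i (R : E3 → ℂ), IsMichlin R → ∀ k : ℤ,
      KerD k (C * 2 ^ (k * d)) (ker φ k fun ξ => R ξ * m i ξ) := by
  choose C hC h using fun i => exists_kerD_homog hφ (hm i)
  refine ⟨1 + ∑ i, C i, add_pos_of_pos_of_nonneg one_pos (Finset.sum_nonneg fun i _ => (hC i).le),
    fun i R hR k => (h i R hR k).mono ?_⟩
  have h1 : C i ≤ ∑ i, C i := Finset.single_le_sum (fun i _ => (hC i).le) (Finset.mem_univ i)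
  have := zpow_two_pos (k * d)
  gcongr
  linarith

lemma michlin_mul_continuousOn {d : ℤ} {m R : E3 → ℂ} (hm : Homog d m) (hR : IsMichlin R) :
    ContinuousOn (fun ξ => R ξ * m ξ) {0}ᶜ := hR.contDiffOn.continuousOn.mul hm.smooth.continuousOn

lemma rate_add_le (k : ℤ) (t : ℝ) :
    (1 + 2 ^ k)⁻¹ * drift t + oscRate k t ≤ 2 * (dec k * jap t ^ del) := by
  linarith [stat_rate_le k t, oscRate_le_dec k t]

/-- The field with symbol `R m`, `m` homogeneous of degree `0` or `-1`, at a fixed time. -/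
lemma exists_spaceFam (hφ : IsCutoff φ) {ι : Type*} [Fintype ι] {d : ℤ} (hd : d = 0 ∨ d = -1)
    {m : ι → E3 → ℂ} (hm : ∀ i, Homog d (m i)) : ∃ Q : ℝ, 0 < Q ∧
    ∀ {T D t : ℝ} {r : ℝ → E3 → ℂ} {S g g' : ℤ → ℝ → E3 → ℂ}, Pieces φ T D r S g g' → t ∈ Icc 0 T →
      Measurable (r t) → (∃ Q', ∀ x, ‖r t x‖ ≤ Q') → ∀ i (R : E3 → ℂ), IsMichlin R →
      ∃ p f, SpaceFam t p (fun k => cv (ker φ k fun ξ => R ξ * m i ξ) (r t)) f ∧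
        ∀ N, jap t ≤ N → ∑' k, ENNReal.ofReal (p k * half N k) ≤
          ENNReal.ofReal (Q * D * (N ^ del * N ^ ((-d + 1 / 100 : ℝ) - 9 / 8))) := by
  obtain ⟨C, hC, hker⟩ := exists_kerD_family hφ hm
  obtain ⟨Q, hQ, hsum⟩ := exists_tsum_dec_le hd
  have hM := bumpMass_pos
  refine ⟨2 * (bumpMass + 1) * C * Q, by positivity, ?_⟩
  rintro T D t r S g g' H ht hr ⟨Q', hQ'⟩ i R hR
  have hD := H.nonneg
  have hJ := one_le_japdel t
  choose f hf hle using fun k => H.exists_maj hφ (michlin_mul_continuousOn (hm i) hR)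
    (hker i R hR k).toKer ht hr hQ'
  set P : ℝ := 2 * (bumpMass + 1) * C * D * jap t ^ del with hP
  have hP0 : 0 ≤ P := by positivity
  refine ⟨fun k => P * (2 ^ (k * d) * dec k), f, ⟨fun k => measurable_cv
    (hker i R hR k).toKer.cont.measurable hr, fun k => (hf k).mono ?_, hle, ?_⟩, fun N hN => ?_⟩
  · have := zpow_two_pos (k * d)
    calc _ ≤ (bumpMass + 1) * (C * 2 ^ (k * d)) * D * (2 * (dec k * jap t ^ del)) := by
          gcongr
          exact rate_add_le k t
      _ = _ := by rw [hP]; ring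
  · refine Summable.of_nonneg_of_le (fun k => ?_) (fun k => ?_) ((summable_dec hd).mul_left P)
    · have := dec_pos k; have := mm_pos k t; have := zpow_two_pos (k * d)
      positivity
    · have := dec_pos k; have := mm_pos k t; have := zpow_two_pos (k * d)
      have h3 := pow_le_pow_left₀ (mm_pos k t).le (mm_le_mm_zero k t) 3
      calc P * (2 ^ (k * d) * dec k) * mm k t ^ 3 ≤
          P * (2 ^ (k * d) * dec k) * mm k 0 ^ 3 :=
          mul_le_mul_of_nonneg_left h3 (by positivity)
        _ = P * (2 ^ (k * d) * (dec k * mm k 0 ^ 3)) := by ring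
  · have hN0 : 0 < N := (jap_pos t).trans_le hN
    calc _ ≤ ∑' k : ℤ, ENNReal.ofReal P * ENNReal.ofReal ((2 : ℝ) ^ (k * d) *
          ((2 : ℝ) ^ k) ^ (-(1 / 100) : ℝ) * half N k) := by
          refine ENNReal.tsum_le_tsum fun k => ?_
          rw [← ENNReal.ofReal_mul hP0, mul_assoc P]
          have := half_pos hN0 k
          have := zpow_two_pos (k * d)
          gcongr
          exact dec_le_rpow k
      _ ≤ ENNReal.ofReal P * ENNReal.ofReal (Q * N ^ ((-d + 1 / 100 : ℝ) - 9 / 8)) := by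
          rw [ENNReal.tsum_mul_left]
          exact mul_le_mul' le_rfl (hsum N hN0)
      _ ≤ _ := by
          rw [← ENNReal.ofReal_mul hP0]
          refine ENNReal.ofReal_le_ofReal ?_
          have h1 : jap t ^ del ≤ N ^ del := Real.rpow_le_rpow (jap_pos t).le hN (by norm_num [del])
          calc _ = 2 * (bumpMass + 1) * C * Q * D *
                (jap t ^ del * N ^ ((-d + 1 / 100 : ℝ) - 9 / 8)) := by rw [hP]; ring
            _ ≤ _ := by gcongr

/-- The second derivatives of the field at one frequency `2^l`. All derivatives fall on this single
frequency, where their factor `2^l` is compensated by the decay `2^{-l} ⟨t⟩^{-1+2δ}` of both pieces of the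
density. -/
lemma exists_spaceFam_proj (hφ : IsCutoff φ) {ι : Type*} [Fintype ι] {m : ι → E3 → ℂ}
    (hm : ∀ i, Homog 1 (m i)) : ∃ Q : ℝ, 0 < Q ∧
    ∀ {T D t : ℝ} {r : ℝ → E3 → ℂ} {S g g' : ℤ → ℝ → E3 → ℂ}, Pieces φ T D r S g g' → t ∈ Icc 0 T →
      Measurable (r t) → (∃ Q', ∀ x, ‖r t x‖ ≤ Q') → ∀ i (R : E3 → ℂ), IsMichlin R → ∀ l : ℤ,
      ∃ p f, SpaceFam t p (fun k => cv (cv (ker φ k R) (ker φ l (m i))) (r t)) f ∧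
        ∀ N, 0 < N → ∑' k, ENNReal.ofReal (p k * half N k) ≤
          ENNReal.ofReal (Q * D * (drift t * N ^ (-(9 / 8) : ℝ))) := by
  obtain ⟨C, hC, hker⟩ := exists_kerD_family hφ hm
  obtain ⟨C₁, hC₁, hker₁⟩ := exists_kerD_homog hφ Homog.one
  have hM := bumpMass_pos
  refine ⟨3 * ((bumpMass + 1) * C₁ * ((bumpMass + 1) * C * 2)), by positivity, ?_⟩
  rintro T D t r S g g' H ht hr ⟨Q', hQ'⟩ i R hR l
  have hD := H.nonneg
  have hl := zpow_two_pos l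
  have hdr := drift_pos t
  have hKl : KerD l (C * 2 ^ l) (ker φ l (m i)) := by
    have := hker i _ isMichlin_one l
    simpa only [one_mul, mul_one] using this
  have hKR : ∀ k, Ker k C₁ (ker φ k R) := fun k => by
    have := (hker₁ R hR k).toKer
    simpa using this
  have hmc : ContinuousOn (m i) {0}ᶜ := (hm i).smooth.continuousOn
  have hRc : ContinuousOn R {0}ᶜ := hR.contDiffOn.continuousOn
  obtain ⟨f₀, hf₀, hle₀⟩ := H.exists_maj hφ hmc hKl.toKer ht hr hQ'
  set h := cv (ker φ l (m i)) (r t) with hh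
  set p₀ : ℝ := (bumpMass + 1) * C * 2 * D * drift t with hp₀
  have hp₀0 : 0 ≤ p₀ := by positivity
  have hpl : (bumpMass + 1) * (C * 2 ^ l) * D * ((1 + 2 ^ l)⁻¹ * drift t + oscRate l t) ≤ p₀ := by
    have e1 : (1 + (2 : ℝ) ^ l)⁻¹ ≤ ((2 : ℝ) ^ l)⁻¹ := inv_anti₀ hl (by linarith)
    calc _ ≤ (bumpMass + 1) * (C * 2 ^ l) * D * ((2 ^ l)⁻¹ * drift t + (2 ^ l)⁻¹ * drift t) := by
          gcongr
          exact min_le_right _ _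
      _ = _ := by rw [hp₀]; field_simp; ring
  have hf := hf₀.mono hpl
  have hBn : Bn t p₀ h := by
    refine ⟨measurable_cv hKl.toKer.cont.measurable hr, (lintegral_mono hle₀).trans hf.int,
      Filter.Eventually.of_forall fun x => ?_⟩
    have h1 := (hle₀ x).trans (hf.sup x)
    have hmm := mm_pos l t
    rw [← ofReal_norm] at h1
    refine ((ENNReal.ofReal_le_ofReal_iff (by positivity)).1 h1).trans ?_
    rw [← inv_pow]
    gcongr
    exact min_le_right _ _
  have hassoc : ∀ k, cv (cv (ker φ k R) (ker φ l (m i))) (r t) = cv (ker φ k R) h := fun k =>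
    funext fun x => (cv_assoc_of_bdd (hKR k).integrable hKl.toKer.integrable hr.aestronglyMeasurable
      hQ' x).symm
  set q₀ : ℝ := (bumpMass + 1) * C₁ * p₀ with hq₀
  have hq₀0 : 0 ≤ q₀ := by positivity
  -- only the neighbours of `l` contribute to the sum over `k`
  have hzero : ∀ k, k ∉ Finset.Icc (l - 1) (l + 1) → cv (ker φ k R) h = 0 := by
    intro k hk
    rw [← hassoc, cv_ker_ker_eq_zero hφ hRc hmc (hKR k).integrable (by
      rw [Finset.mem_Icc] at hk ⊢; omega)]
    ext x
    simp [cv]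
  refine ⟨fun k => if k ∈ Finset.Icc (l - 1) (l + 1) then q₀ else 0,
    fun k => if k ∈ Finset.Icc (l - 1) (l + 1) then nconv (ker φ k R) h else 0,
    ⟨fun k => ?_, fun k => ?_, fun k z => ?_, ?_⟩, fun N hN => ?_⟩
  · rw [hassoc]
    exact measurable_cv (hKR k).cont.measurable hBn.meas
  · split_ifs with hk
    · exact maj_nconv (hKR k) hBn
    · exact ⟨le_rfl, measurable_const, by simp, by simp⟩
  · rw [hassoc]
    split_ifs with hk
    · exact enorm_cv_le _ _ _
    · rw [hzero k hk]; simp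
  · refine summable_of_ne_finset_zero (s := Finset.Icc (l - 1) (l + 1)) fun k hk => ?_
    rw [if_neg hk, zero_mul]
  · rw [tsum_eq_sum (s := Finset.Icc (l - 1) (l + 1)) fun k hk => by
      simp only [if_neg hk, zero_mul, ENNReal.ofReal_zero]]
    have hhalf : ∀ k, half N k ≤ N ^ (-(9 / 8) : ℝ) := fun k => by
      rw [Real.rpow_neg hN.le, ← Real.inv_rpow hN.le]
      exact Real.rpow_le_rpow (lt_min (zpow_two_pos k) (inv_pos.2 hN)).le (min_le_right _ _)
        (by norm_num)
    calc _ ≤ ∑ _k ∈ Finset.Icc (l - 1) (l + 1), ENNReal.ofReal (q₀ * N ^ (-(9 / 8) : ℝ)) := by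
          refine Finset.sum_le_sum fun k hk => ?_
          simp only [if_pos hk]
          exact ENNReal.ofReal_le_ofReal (mul_le_mul_of_nonneg_left (hhalf k) hq₀0)
      _ = ENNReal.ofReal (3 * (q₀ * N ^ (-(9 / 8) : ℝ))) := by
          rw [Finset.sum_const, card_Icc_three, nsmul_eq_mul, ENNReal.ofReal_mul (p := 3) (by norm_num)]
          simp
      _ ≤ _ := ENNReal.ofReal_le_ofReal (le_of_eq (by rw [hq₀, hp₀]; ring))

/-- The field with symbol `R m`, `m` homogeneous of degree `0` or `-1`, on a time interval; the
functions `r` do not change outside `[0,s]`. -/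
lemma exists_timeFam (hφ : IsCutoff φ) {ι : Type*} [Fintype ι] {d : ℤ} (hd : d = 0 ∨ d = -1)
    {m : ι → E3 → ℂ} (hm : ∀ i, Homog d (m i)) : ∃ Q : ℝ, 0 < Q ∧
    ∀ {n s τ t₃ t₄ D : ℝ} {j : ℕ} {Y₁ : E3 → E3 → E3} {Y₂ : ℝ → E3 → E3 → E3} {r : ℝ → E3 → ℂ}
      {S g g' : ℤ → ℝ → E3 → ℂ}, Block n s τ t₃ t₄ → Chars s τ j Y₁ Y₂ → Pieces φ s D r S g g' →
      Measurable (fun p : ℝ × E3 => r p.1 p.2) → (∀ t, ∃ Q', ∀ x, ‖r t x‖ ≤ Q') →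
      (∀ t, r t = r (clamp s t)) → ∀ i (R : E3 → ℂ), IsMichlin R →
      ∃ b q Jm, TimeFam n s τ t₃ t₄ j Y₁ Y₂ b q
        (fun k t => cv (ker φ k fun ξ => R ξ * m i ξ) (r t)) Jm ∧
        ∀ N, 0 < N → ∑' k, ENNReal.ofReal (b k * (((2 : ℝ) ^ k) ^ (-(1 / 100) : ℝ) * half N k)) ≤
          ENNReal.ofReal (Q * D * N ^ ((-d + 1 / 100 : ℝ) - 9 / 8)) := by
  obtain ⟨C, hC, hker⟩ := exists_kerD_family hφ hm
  obtain ⟨Q, hQ, hsum⟩ := exists_tsum_dec_le hd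
  have hM := bumpMass_pos
  have hat := atomConst_pos
  refine ⟨6404 * atomConst * C * Q, by positivity, ?_⟩
  intro n s τ t₃ t₄ D j Y₁ Y₂ r S g g' hb hY H hr hbd hcl i R hR
  have hD := H.nonneg
  have hs : 0 ≤ s := hb.tau_nonneg.trans hb.tau_le
  have hmc := michlin_mul_continuousOn (hm i) hR
  choose Jm hJm using fun k => H.exists_time_majorant hφ hb hY hmc (hker i R hR k) hr hbd
  refine ⟨fun k => 6404 * atomConst * (C * 2 ^ (k * d) * D),
    fun k => 2 * (bumpMass + 1) * C * D * jap s ^ del * (2 ^ (k * d) * (dec k * mm k 0 ^ 3)), Jm,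
    ⟨fun k => ?_, fun k => measurable_cv_param (hker i R hR k).toKer.cont.measurable hr,
      fun k t z => ?_, (summable_dec hd).mul_left _, hJm⟩, fun N hN => ?_⟩
  · have := zpow_two_pos (k * d)
    positivity
  · rw [hcl t]
    have ht := clamp_mem hs t
    generalize clamp s t = t' at ht ⊢
    obtain ⟨Q', hQ'⟩ := hbd t'
    obtain ⟨f, hf, hle⟩ := H.exists_maj hφ hmc (hker i R hR k).toKer ht (hr.of_uncurry_left (x := t')) hQ'
    have h1 := (hle z).trans (hf.sup z)
    have hf0 := hf.nonneg
    have h2 := mm_pos k t'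
    have h3 := zpow_two_pos (k * d)
    have h4 := dec_pos k
    rw [← ofReal_norm] at h1
    refine ((ENNReal.ofReal_le_ofReal_iff (by positivity)).1 h1).trans ?_
    have h5 : jap t' ^ del ≤ jap s ^ del := by
      refine Real.rpow_le_rpow (jap_pos t').le (Real.sqrt_le_sqrt ?_) (by norm_num [del])
      have : t' ^ 2 ≤ s ^ 2 := pow_le_pow_left₀ ht.1 ht.2 2
      linarith
    calc _ ≤ (bumpMass + 1) * (C * 2 ^ (k * d)) * D * (2 * (dec k * jap s ^ del)) * mm k 0 ^ 3 := by
          have := jap_pos s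
          refine mul_le_mul (mul_le_mul_of_nonneg_left ((rate_add_le k t').trans ?_) (by positivity))
            (pow_le_pow_left₀ h2.le (mm_le_mm_zero k t') 3) (by positivity) (by positivity)
          gcongr
      _ = _ := by ring
  · calc _ = ∑' k : ℤ, ENNReal.ofReal (6404 * atomConst * C * D) * ENNReal.ofReal ((2 : ℝ) ^ (k * d) *
          ((2 : ℝ) ^ k) ^ (-(1 / 100) : ℝ) * half N k) := by
          refine tsum_congr fun k => ?_
          rw [← ENNReal.ofReal_mul (by positivity)]
          congr 1
          ring
      _ ≤ ENNReal.ofReal (6404 * atomConst * C * D) *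
          ENNReal.ofReal (Q * N ^ ((-d + 1 / 100 : ℝ) - 9 / 8)) := by
          rw [ENNReal.tsum_mul_left]
          exact mul_le_mul' le_rfl (hsum N hN)
      _ ≤ _ := by
          rw [← ENNReal.ofReal_mul (by positivity)]
          exact ENNReal.ofReal_le_ofReal (le_of_eq (by ring))

end

/-! ### The density and the fields of a solution -/

/-- The density of a solution on `[0,s]`, extended as a constant outside that interval, together
with its pieces. -/
structure Source (φ : ℝ → ℝ) (s D : ℝ) (f : ℝ → E3 → E3 → ℝ) (r : ℝ → E3 → ℂ)
    (S g g' : ℤ → ℝ → E3 → ℂ) : Prop where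
  pieces : Pieces φ s D r S g g'
  meas : Measurable (fun p : ℝ × E3 => r p.1 p.2)
  bdd : ∀ t, ∃ Q, ∀ x, ‖r t x‖ ≤ Q
  clamped : ∀ t, r t = r (clamp s t)
  eq : ∀ t ∈ Icc 0 s, r t = fun y => (density f t y : ℂ)
  dens : ∀ t ∈ Icc 0 s, Dens (density f t)

/-- The density of a solution of the bootstrap system is a source of size proportional to `ε₁`. -/
lemma exists_source {φ : ℝ → ℝ} (hφ : IsCutoff φ) : ∃ C : ℝ, 0 < C ∧
    ∀ (T ε₀ ε₁ : ℝ) (f : ℝ → E3 → E3 → ℝ) (ρstat : ℝ → E3 → ℝ) (ρosc : ℝ → E3 → ℂ), 0 < T →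
      Bootstrap φ T ε₀ ε₁ f ρstat ρosc → ∀ s ∈ Icc 0 T,
      ∃ r S g g', Source φ s (C * ε₁) f r S g g' := by
  obtain ⟨C, hC, h⟩ := exists_pieces_fat hφ
  refine ⟨C, hC, fun T ε₀ ε₁ f ρstat ρosc hT hB s hs => ?_⟩
  obtain ⟨S, g, g', H⟩ := h T ε₀ ε₁ f ρstat ρosc hT hB
  have hsol := hB.solution
  have hsub : ∀ t ∈ Icc 0 s, t ∈ Icc 0 T := fun t ht => ⟨ht.1, ht.2.trans hs.2⟩
  have hdens : ∀ t ∈ Icc 0 s, Dens (density f t) := fun t ht =>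
    ⟨hsol.density_cont.comp_continuous (f := fun x : E3 => (t, x)) (by fun_prop)
      fun x => ⟨hsub t ht, mem_univ _⟩, hsol.density_bdd t (hsub t ht), hsol.density_L2 t (hsub t ht)⟩
  have hcont := continuous_clamped hs.1
    (hsol.density_cont.mono (prod_mono (Icc_subset_Icc_right hs.2) Subset.rfl))
  refine ⟨fun t y => (density f (clamp s t) y : ℂ), S, g, g', ⟨?_, ?_, ?_, ?_, ?_⟩,
    (Complex.continuous_ofReal.comp hcont).measurable, fun t => ?_, fun t => ?_, fun t ht => ?_,
    hdens⟩
  · exact (H.restrict hs.2).nonneg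
  · exact (H.restrict hs.2).meas
  · exact (H.restrict hs.2).stat
  · exact (H.restrict hs.2).osc
  · intro k t ht x
    rw [clamp_eq ht]
    exact (H.restrict hs.2).eq k t ht x
  · obtain ⟨Q, hQ⟩ := (hdens _ (clamp_mem hs.1 t)).bdd
    exact ⟨Q, fun x => by rw [Complex.norm_real]; exact hQ x⟩
  · simp only [clamp_eq (clamp_mem hs.1 t)]
  · simp only [clamp_eq ht]

section

variable {φ : ℝ → ℝ} {s D t : ℝ} {f : ℝ → E3 → E3 → ℝ} {r : ℝ → E3 → ℂ} {S g g' : ℤ → ℝ → E3 → ℂ}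

lemma Source.measurable_slice (H : Source φ s D f r S g g') (t : ℝ) : Measurable (r t) :=
  H.meas.of_uncurry_left (x := t)

lemma Source.field_eq (H : Source φ s D f r S g g') (ht : t ∈ Icc 0 s) (c : Fin 3) :
    (fun x => (elField f t x c : ℂ)) = cv (rk c) (r t) := by
  rw [H.eq t ht]
  exact funext fun x => (H.dens t ht).gradInvLap_eq c x

/-- The dyadic series that defines the operator applied to the field, in terms of the density. -/
lemma Source.mulE_eq (hφ : IsCutoff φ) (H : Source φ s D f r S g g') (ht : t ∈ Icc 0 s) {R : E3 → ℂ}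
    (hR : IsMichlin R) (c : Fin 3) (z : E3) :
    mulE φ R f c t z = ∑' k, cv (ker φ k (fun ξ => R ξ * rSym c ξ)) (r t) z := by
  obtain ⟨C, -, hker⟩ := exists_kerD_homog hφ Homog.one
  refine tsum_congr fun k => ?_
  have hk := (hker R hR k).toKer
  simp only [mul_one] at hk
  rw [H.field_eq ht, H.eq t ht,
    ← (H.dens t ht).dyadicOp_field hφ hR.contDiffOn.continuousOn hk c]
  rfl

/-- The decay of the dyadic pieces of the density at high frequencies, at a fixed time. -/
lemma Source.exists_lpProj_le (hφ : IsCutoff φ) (H : Source φ s D f r S g g') (ht : t ∈ Icc 0 s) :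
    ∃ D' : ℝ, ∀ (k : ℕ) (x : E3), ‖lpProj φ k (r t) x‖ ≤ D' * ((2 : ℝ) ^ k)⁻¹ := by
  obtain ⟨C, hC, hker⟩ := exists_kerD_homog hφ Homog.one
  obtain ⟨Q, hQ⟩ := H.bdd t
  have hD := H.pieces.nonneg
  have hM := bumpMass_pos
  refine ⟨(bumpMass + 1) * C * D * (2 * jap t ^ del), fun k x => ?_⟩
  have hk := (hker _ isMichlin_one k).toKer
  simp only [mul_one, mul_zero, zpow_zero] at hk
  obtain ⟨F, hF, hle⟩ := H.pieces.exists_maj hφ continuousOn_const hk ht (H.measurable_slice t) hQ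
  have h1 := (hle x).trans (hF.sup x)
  have hF0 := hF.nonneg
  have hmm := mm_pos k t
  have hm1 : mm k t ≤ 1 := (min_le_right _ _).trans (inv_le_one_of_one_le₀ (one_le_jap t))
  have hJ := one_le_japdel t
  rw [← ofReal_norm] at h1
  refine ((ENNReal.ofReal_le_ofReal_iff (by positivity)).1 h1).trans ?_
  have h2 : dec k ≤ ((2 : ℝ) ^ k)⁻¹ := (min_le_right _ _).trans (by simp)
  refine (mul_le_of_le_one_right hF0 (pow_le_one₀ hmm.le hm1)).trans ?_
  calc _ ≤ (bumpMass + 1) * C * D * (2 * (((2 : ℝ) ^ k)⁻¹ * jap t ^ del)) := by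
        refine mul_le_mul_of_nonneg_left ((rate_add_le k t).trans ?_) (by positivity)
        gcongr
    _ = _ := by ring

lemma Source.mulDE_eq (hφ : IsCutoff φ) (H : Source φ s D f r S g g') (ht : t ∈ Icc 0 s) {R : E3 → ℂ}
    (hR : IsMichlin R) (a c : Fin 3) (z : E3) :
    mulDE φ R f a c t z = ∑' k, cv (ker φ k (fun ξ => R ξ * (dSym a ξ * rSym c ξ))) (r t) z := by
  obtain ⟨D', hD'⟩ := H.exists_lpProj_le hφ ht
  rw [H.eq t ht] at hD'
  refine tsum_congr fun k => ?_
  rw [H.field_eq ht, H.eq t ht, ← (H.dens t ht).dyadicOp_pd_field hφ hD' hR k a c]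
  rfl

lemma Source.mulDDPE_eq (hφ : IsCutoff φ) (H : Source φ s D f r S g g') (ht : t ∈ Icc 0 s)
    {R : E3 → ℂ} (hR : IsMichlin R) (l : ℤ) (a b c : Fin 3) (z : E3) :
    mulDDPE φ R f l a b c t z = ∑' k, cv (cv (ker φ k R)
      (ker φ l (fun ξ => dSym a ξ * (dSym b ξ * rSym c ξ)))) (r t) z := by
  refine tsum_congr fun k => ?_
  rw [H.field_eq ht, H.eq t ht, ← (H.dens t ht).dyadicOp_pd_pd_proj_field hφ hR k l a b c]
  rfl

end

/-! ### The bounds on the time integrals -/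

lemma rpow_neg_le_rate {a : ℝ} (ha : 0 ≤ a) (m : ℕ) (τ : ℝ) :
    (max ((2 : ℝ) ^ m) (jap τ)) ^ (-a) ≤ rate a m τ := by
  have h2 : (0 : ℝ) < 2 ^ m := by positivity
  refine le_min ?_ (Real.rpow_le_rpow_of_nonpos (jap_pos τ) (le_max_right _ _) (by linarith))
  rw [mul_comm, Real.rpow_mul zero_le_two, Real.rpow_natCast]
  exact Real.rpow_le_rpow_of_nonpos h2 (le_max_left _ _) (by linarith)

lemma rate_pos (a : ℝ) (m : ℕ) (τ : ℝ) : 0 < rate a m τ :=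
  lt_min (by positivity) (Real.rpow_pos_of_pos (jap_pos τ) _)

lemma drift_le_inv_mul {t N : ℝ} (hN : jap t ≤ N) : drift t ≤ (jap t)⁻¹ * N ^ (2 * del) := by
  have h := jap_pos t
  have e : drift t = (jap t)⁻¹ * jap t ^ (2 * del) := by
    rw [drift, Real.rpow_sub h, Real.rpow_one, inv_div, div_eq_inv_mul]
  rw [e]
  gcongr
  norm_num [del]

/-- Collects the constants and the powers of `N = max(2^m, ⟨τ⟩)` from the bounds for the two sums. -/
lemma bound_of_families {M q₁ q₂ w₁ w₂ w D N : ℝ} {n₀ S₁ S₂ Λ : ℝ≥0∞} (hM : 0 ≤ M) (hq₁ : 0 ≤ q₁)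
    (hq₂ : 0 ≤ q₂) (hD : 0 ≤ D) (hw₁ : 0 ≤ w₁) (hN : 0 ≤ N)
    (h : n₀ ≤ ENNReal.ofReal M * (ENNReal.ofReal N * (S₁ * S₂)) * Λ)
    (h₁ : S₁ ≤ ENNReal.ofReal (q₁ * D * w₁)) (h₂ : S₂ ≤ ENNReal.ofReal (q₂ * D * w₂))
    (hw : N * w₁ * w₂ ≤ w) : n₀ ≤ ENNReal.ofReal (M * q₁ * q₂ * D ^ 2 * w) * Λ := by
  refine h.trans (mul_le_mul' ?_ le_rfl)
  calc _ ≤ ENNReal.ofReal M * (ENNReal.ofReal N *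
        (ENNReal.ofReal (q₁ * D * w₁) * ENNReal.ofReal (q₂ * D * w₂))) := by gcongr
    _ = ENNReal.ofReal (M * q₁ * q₂ * D ^ 2 * (N * w₁ * w₂)) := by
        rw [← ENNReal.ofReal_mul (by positivity), ← ENNReal.ofReal_mul hN, ← ENNReal.ofReal_mul hM]
        congr 1
        ring
    _ ≤ _ := ENNReal.ofReal_le_ofReal (mul_le_mul_of_nonneg_left hw (by positivity))

/-- If the norm of the amplitude is infinite, the bound holds trivially. -/
lemma le_ofReal_mul_lamStar {n₀ Λ : ℝ≥0∞} {w : ℝ} (hw : 0 < w)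
    (h : Λ ≠ ⊤ → n₀ ≤ ENNReal.ofReal w * Λ) : n₀ ≤ ENNReal.ofReal w * Λ := by
  by_cases hΛ : Λ = ⊤
  · rw [hΛ, ENNReal.mul_top (by simpa using hw)]
    exact le_top
  · exact h hΛ

/-- The bound on `𝓑` for two fields with homogeneous symbols of degree `0` or `-1`. -/
lemma exists_normB0_field_field {φ : ℝ → ℝ} (hφ : IsCutoff φ) {A : ℝ} (hA : 0 < A) {ι₁ ι₂ : Type}
    [Fintype ι₁] [Fintype ι₂] {d₁ d₂ : ℤ} (hd₁ : d₁ = 0 ∨ d₁ = -1) (hd₂ : d₂ = 0 ∨ d₂ = -1)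
    {m₁ : ι₁ → E3 → ℂ} {m₂ : ι₂ → E3 → ℂ} (hm₁ : ∀ i, Homog d₁ (m₁ i)) (hm₂ : ∀ i, Homog d₂ (m₂ i)) :
    ∃ M : ℝ, 0 < M ∧ ∀ {ε₁ s τ t₃ t₄ D a : ℝ} {m j : ℕ} {k : ℤ} {K : E3 → E3 → ℂ}
      {P₁ : E3 → E3 → E3} {P₂ : E3 → E3 → ℝ → E3} {C : E3 → E3 → E3 → ℝ → ℂ} {R₁ R₂ : E3 → ℂ}
      {F G : ℝ → E3 → ℂ} {f : ℝ → E3 → E3 → ℝ} {r : ℝ → E3 → ℂ} {S g g' : ℤ → ℝ → E3 → ℂ},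
    A * ε₁ ≤ 1 / 16 → Admissible φ A ε₁ s j k K P₁ P₂ → Block (2 ^ m) s τ t₃ t₄ →
    Measurable (fun p : E3 × E3 × E3 × ℝ => C p.1 p.2.1 p.2.2.1 p.2.2.2) →
    (∀ x y v, DifferentiableOn ℝ (C x y v) (Icc 0 s)) → IsMichlin R₁ → IsMichlin R₂ →
    Source φ s D f r S g g' → 0 < D → 0 ≤ a → a ≤ 2.1 + d₁ + d₂ → ∀ i₁ i₂,
    (∀ z, F τ z = ∑' k, cv (ker φ k fun ξ => R₁ ξ * m₁ i₁ ξ) (r τ) z) →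
    (∀ γ ∈ Icc 0 s, ∀ z, G γ z = ∑' k, cv (ker φ k fun ξ => R₂ ξ * m₂ i₂ ξ) (r γ) z) →
    normB0 φ s (opB K P₁ P₂ F G C t₃ t₄ τ s) ≤
      ENNReal.ofReal (M * D ^ 2 * rate a m τ) * lamStar C s t₃ t₄ := by
  obtain ⟨CB, hCB, hB⟩ := exists_normB0_opB_le hφ
  obtain ⟨Q₁, hQ₁, hsp⟩ := exists_spaceFam hφ hd₁ hm₁
  obtain ⟨Q₂, hQ₂, htm⟩ := exists_timeFam hφ hd₂ hm₂
  refine ⟨CB * A * Q₁ * Q₂, by positivity, ?_⟩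
  intro ε₁ s τ t₃ t₄ D a m j k K P₁ P₂ C R₁ R₂ F G f r S g g' hAε hK hb hC hCd hR₁ hR₂ H hD ha ha'
    i₁ i₂ hF hG
  refine le_ofReal_mul_lamStar (by have := rate_pos a m τ; positivity) fun hΛ => ?_
  have hτ : τ ∈ Icc 0 s := ⟨hb.tau_nonneg, hb.tau_le⟩
  obtain ⟨p, fm, hfm, hp⟩ := hsp H.pieces hτ (H.measurable_slice τ) (H.bdd τ) i₁ R₁ hR₁
  obtain ⟨b, q, Jm, hJ, hq⟩ := htm hb (hK.chars hAε hb.tau_nonneg hb.tau_le) H.pieces H.meas H.bdd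
    H.clamped i₂ R₂ hR₂
  set N := max ((2 : ℝ) ^ m) (jap τ) with hN
  have hN1 : 1 ≤ N := (one_le_jap τ).trans (le_max_right _ _)
  have hN0 : 0 < N := one_pos.trans_le hN1
  refine bound_of_families (by positivity) hQ₁.le hQ₂.le hD.le (by positivity) (by positivity)
    (hB hA hAε hK hb hC hCd hΛ hfm hJ hF hG) (hp N (le_max_right _ _)) (hq N hN0)
    (le_trans ?_ (rpow_neg_le_rate ha m τ))
  -- the exponent of `N` is `-(2.125 + d₁ + d₂)` up to `2/100 + 3δ`, below `-(2.1 + d₁ + d₂)`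
  rw [← hN, ← Real.rpow_add hN0, ← Real.rpow_add hN0, ← Real.rpow_add hN0]
  refine Real.rpow_le_rpow_of_exponent_le hN1 ?_
  norm_num [del] at ha' ⊢
  linarith

/-- The bound on `𝓑` when the first factor is a field of order `1` at one frequency. -/
lemma exists_normB0_proj_field {φ : ℝ → ℝ} (hφ : IsCutoff φ) {A : ℝ} (hA : 0 < A) {ι₁ ι₂ : Type}
    [Fintype ι₁] [Fintype ι₂] {d₂ : ℤ} (hd₂ : d₂ = 0 ∨ d₂ = -1)
    {m₁ : ι₁ → E3 → ℂ} {m₂ : ι₂ → E3 → ℂ} (hm₁ : ∀ i, Homog 1 (m₁ i)) (hm₂ : ∀ i, Homog d₂ (m₂ i)) :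
    ∃ M : ℝ, 0 < M ∧ ∀ {ε₁ s τ t₃ t₄ D a : ℝ} {m j : ℕ} {k l : ℤ} {K : E3 → E3 → ℂ}
      {P₁ : E3 → E3 → E3} {P₂ : E3 → E3 → ℝ → E3} {C : E3 → E3 → E3 → ℝ → ℂ} {R₁ R₂ : E3 → ℂ}
      {F G : ℝ → E3 → ℂ} {f : ℝ → E3 → E3 → ℝ} {r : ℝ → E3 → ℂ} {S g g' : ℤ → ℝ → E3 → ℂ},
    A * ε₁ ≤ 1 / 16 → Admissible φ A ε₁ s j k K P₁ P₂ → Block (2 ^ m) s τ t₃ t₄ →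
    Measurable (fun p : E3 × E3 × E3 × ℝ => C p.1 p.2.1 p.2.2.1 p.2.2.2) →
    (∀ x y v, DifferentiableOn ℝ (C x y v) (Icc 0 s)) → IsMichlin R₁ → IsMichlin R₂ →
    Source φ s D f r S g g' → 0 < D → 0 ≤ a → a ≤ 2.1 + d₂ → ∀ i₁ i₂,
    (∀ z, F τ z = ∑' k, cv (cv (ker φ k R₁) (ker φ l (m₁ i₁))) (r τ) z) →
    (∀ γ ∈ Icc 0 s, ∀ z, G γ z = ∑' k, cv (ker φ k fun ξ => R₂ ξ * m₂ i₂ ξ) (r γ) z) →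
    normB0 φ s (opB K P₁ P₂ F G C t₃ t₄ τ s) ≤
      ENNReal.ofReal (M * D ^ 2 * ((jap τ)⁻¹ * rate a m τ)) * lamStar C s t₃ t₄ := by
  obtain ⟨CB, hCB, hB⟩ := exists_normB0_opB_le hφ
  obtain ⟨Q₁, hQ₁, hsp⟩ := exists_spaceFam_proj hφ hm₁
  obtain ⟨Q₂, hQ₂, htm⟩ := exists_timeFam hφ hd₂ hm₂
  refine ⟨CB * A * Q₁ * Q₂, by positivity, ?_⟩
  intro ε₁ s τ t₃ t₄ D a m j k l K P₁ P₂ C R₁ R₂ F G f r S g g' hAε hK hb hC hCd hR₁ hR₂ H hD ha ha'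
    i₁ i₂ hF hG
  have hj := jap_pos τ
  have hdr := drift_pos τ
  refine le_ofReal_mul_lamStar (by have := rate_pos a m τ; positivity) fun hΛ => ?_
  have hτ : τ ∈ Icc 0 s := ⟨hb.tau_nonneg, hb.tau_le⟩
  obtain ⟨p, fm, hfm, hp⟩ := hsp H.pieces hτ (H.measurable_slice τ) (H.bdd τ) i₁ R₁ hR₁ l
  obtain ⟨b, q, Jm, hJ, hq⟩ := htm hb (hK.chars hAε hb.tau_nonneg hb.tau_le) H.pieces H.meas H.bdd
    H.clamped i₂ R₂ hR₂
  set N := max ((2 : ℝ) ^ m) (jap τ) with hN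
  have hN1 : 1 ≤ N := (one_le_jap τ).trans (le_max_right _ _)
  have hN0 : 0 < N := one_pos.trans_le hN1
  refine bound_of_families (by positivity) hQ₁.le hQ₂.le hD.le (by positivity) (by positivity)
    (hB hA hAε hK hb hC hCd hΛ hfm hJ hF hG) (hp N hN0) (hq N hN0) ?_
  rw [← hN]
  -- the decay `⟨τ⟩^{-1+2δ}` of the first factor is kept as `⟨τ⟩⁻¹ N^{2δ}`
  calc _ ≤ N ^ (1 / 8 + 2 * del) * ((jap τ)⁻¹ * N ^ (2 * del) * N ^ (-(9 / 8) : ℝ)) *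
        N ^ ((-d₂ + 1 / 100 : ℝ) - 9 / 8) := by
        gcongr
        exact drift_le_inv_mul (le_max_right _ _)
    _ = (jap τ)⁻¹ * (N ^ (1 / 8 + 2 * del) * N ^ (2 * del) * N ^ (-(9 / 8) : ℝ) *
        N ^ ((-d₂ + 1 / 100 : ℝ) - 9 / 8)) := by ring
    _ = (jap τ)⁻¹ * N ^ (1 / 8 + 2 * del + 2 * del + -(9 / 8) + ((-d₂ + 1 / 100 : ℝ) - 9 / 8)) := by
        rw [← Real.rpow_add hN0, ← Real.rpow_add hN0, ← Real.rpow_add hN0]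
    _ ≤ (jap τ)⁻¹ * N ^ (-a) := by
        refine mul_le_mul_of_nonneg_left (Real.rpow_le_rpow_of_exponent_le hN1 ?_) (by positivity)
        norm_num [del] at ha' ⊢
        linarith
    _ ≤ _ := by
        gcongr
        exact rpow_neg_le_rate ha m τ

/-! ### The bound at a fixed time -/

/-- The sizes of the two pieces together, in the form of a single fraction. -/
lemma rate_add_le_inv (k : ℤ) (t : ℝ) : (1 + 2 ^ k)⁻¹ * drift t + oscRate k t ≤
    3 * (jap t ^ (1 - 2 * del) * 2 ^ k + jap t ^ (-del))⁻¹ := by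
  have hX := zpow_two_pos k
  have hj := jap_pos t
  have ha : 1 ≤ jap t ^ (1 - 2 * del) := Real.one_le_rpow (one_le_jap t) (by norm_num [del])
  have hb : 1 ≤ jap t ^ del := one_le_japdel t
  rw [Real.rpow_neg hj.le, drift, oscRate, drift]
  generalize jap t ^ (1 - 2 * del) = a at ha ⊢
  generalize jap t ^ del = b at hb ⊢
  generalize (2 : ℝ) ^ k = X at hX ⊢
  have ha0 : 0 < a := by linarith
  have hb0 : 0 < b := by linarith
  have hb1 : b⁻¹ ≤ 1 := inv_le_one_of_one_le₀ hb
  have h1 : (1 + X)⁻¹ * a⁻¹ ≤ (a * X + b⁻¹)⁻¹ := by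
    rw [← mul_inv]
    exact inv_anti₀ (by positivity) (by nlinarith)
  have h2 : min b (X⁻¹ * a⁻¹) ≤ 2 * (a * X + b⁻¹)⁻¹ := by
    rw [← div_eq_mul_inv 2, le_div_iff₀ (by positivity)]
    have h3 : min b (X⁻¹ * a⁻¹) * (a * X) ≤ 1 := by
      calc _ ≤ X⁻¹ * a⁻¹ * (a * X) := by gcongr; exact min_le_right _ _
        _ = 1 := by field_simp
    have h4 : min b (X⁻¹ * a⁻¹) * b⁻¹ ≤ 1 := by
      calc _ ≤ b * b⁻¹ := by gcongr; exact min_le_left _ _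
        _ = 1 := mul_inv_cancel₀ hb0.ne'
    linarith
  linarith

lemma min_mm_le (k₁ k₂ : ℤ) (τ γ : ℝ) :
    min (mm k₁ τ) (mm k₂ γ) ≤ min ((2 : ℝ) ^ (min k₁ k₂)) (min (jap τ)⁻¹ (jap γ)⁻¹) := by
  unfold mm
  refine le_min ?_ (le_min ?_ ?_)
  · rcases le_total k₁ k₂ with h | h
    · rw [min_eq_left h]; exact (min_le_left _ _).trans (min_le_left _ _)
    · rw [min_eq_right h]; exact (min_le_right _ _).trans (min_le_left _ _)
  · exact (min_le_left _ _).trans (min_le_right _ _)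
  · exact (min_le_right _ _).trans (min_le_right _ _)

lemma ae_enorm_le_supC (C : E3 → E3 → E3 → ℝ → ℂ) (γ : ℝ) :
    ∀ᵐ x : E3, ∀ᵐ p : E3 × E3, ‖C x p.1 p.2 γ‖ₑ ≤ supC C γ := by
  refine Measure.ae_ae_of_ae_prod (μ := (volume : Measure E3))
    (ν := (volume : Measure (E3 × E3))) (p := fun q => ‖C q.1 q.2.1 q.2.2 γ‖ₑ ≤ supC C γ) ?_
  unfold supC
  rw [eLpNorm_exponent_top]
  exact ae_le_eLpNormEssSup

/-- The operator at a fixed time: the bilinear transport bound alone, without any use of oscillations or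
summation over frequencies. -/
lemma exists_opQ_le {φ : ℝ → ℝ} (hφ : IsCutoff φ) {A : ℝ} (hA : 0 < A) :
    ∃ M : ℝ, 0 < M ∧ ∀ {ε₁ s τ γ D : ℝ} {j : ℕ} {k k₁ k₂ : ℤ} {K : E3 → E3 → ℂ}
      {P₁ : E3 → E3 → E3} {P₂ : E3 → E3 → ℝ → E3} {C : E3 → E3 → E3 → ℝ → ℂ} {R₁ R₂ : E3 → ℂ}
      {f : ℝ → E3 → E3 → ℝ} {r : ℝ → E3 → ℂ} {S g g' : ℤ → ℝ → E3 → ℂ},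
    A * ε₁ ≤ 1 / 16 → Admissible φ A ε₁ s j k K P₁ P₂ → τ ∈ Icc 0 s → γ ∈ Icc 0 s →
    IsMichlin R₁ → IsMichlin R₂ → Source φ s D f r S g g' →
    eLpNorm (opQ K P₁ P₂ (mulPRho φ R₁ f k₁) (mulPRho φ R₂ f k₂) C γ τ s) 1 volume +
      ENNReal.ofReal (jap s ^ 3) *
        eLpNorm (opQ K P₁ P₂ (mulPRho φ R₁ f k₁) (mulPRho φ R₂ f k₂) C γ τ s) ∞ volume ≤
    ENNReal.ofReal (M * D ^ 2 * ((jap τ ^ (1 - 2 * del) * 2 ^ k₁ + jap τ ^ (-del))⁻¹ *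
      (min ((2 : ℝ) ^ (min k₁ k₂)) (min (jap τ)⁻¹ (jap γ)⁻¹) ^ 3 *
        (jap γ ^ (1 - 2 * del) * 2 ^ k₂ + jap γ ^ (-del))⁻¹))) * supC C γ := by
  obtain ⟨B, hB, hker⟩ := exists_kerD_homog hφ Homog.one
  have hM := bumpMass_pos
  have ht := tbConst_pos
  refine ⟨2 * (A * bumpMass) * (tbConst * (3 * ((bumpMass + 1) * B)) ^ 2), by positivity, ?_⟩
  intro ε₁ s τ γ D j k k₁ k₂ K P₁ P₂ C R₁ R₂ f r S g g' hAε hK hτ hγ hR₁ hR₂ H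
  have hD := H.pieces.nonneg
  have hjτ := jap_pos τ
  have hjγ := jap_pos γ
  have hY := hK.chars hAε hτ.1 hτ.2
  have hkr : ∀ R, IsMichlin R → ∀ k, Ker k B (ker φ k R) := fun R hR k => by
    simpa using (hker R hR k).toKer
  obtain ⟨Q₁, hQ₁⟩ := H.bdd τ
  obtain ⟨Q₂, hQ₂⟩ := H.bdd γ
  obtain ⟨f₁, hf₁, hle₁⟩ := H.pieces.exists_maj hφ hR₁.contDiffOn.continuousOn (hkr R₁ hR₁ k₁) hτ
    (H.measurable_slice τ) hQ₁
  obtain ⟨f₂, hf₂, hle₂⟩ := H.pieces.exists_maj hφ hR₂.contDiffOn.continuousOn (hkr R₂ hR₂ k₂) hγ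
    (H.measurable_slice γ) hQ₂
  have hY₂ := hY.flow₂ γ hγ
  set Y₁ : E3 → E3 → E3 := fun y v => y - (s - τ) • v + P₁ y v with hY₁def
  set Y₂ : E3 → E3 → E3 := fun y v => y - (s - clamp s γ) • v + P₂ y v (clamp s γ) with hY₂def
  have hTB := TB.mul_comp_flow hτ.1 hτ.2 hγ.1 hγ.2 hY.flow₁ hY₂ j hf₁ hf₂
  set Hm : E3 → E3 → ℝ≥0∞ := fun y v => f₁ (Y₁ y v) * f₂ (Y₂ y v) with hHm
  have hHmeas : Measurable (fun p : E3 × E3 => Hm p.1 p.2) :=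
    (hf₁.meas.comp hY.flow₁.meas).mul (hf₂.meas.comp hY₂.meas)
  set O := opQ K P₁ P₂ (mulPRho φ R₁ f k₁) (mulPRho φ R₂ f k₂) C γ τ s with hO
  have hpt : ∀ᵐ x, ‖O x‖ₑ ≤ supC C γ * theta A k j Hm x := by
    filter_upwards [ae_enorm_le_supC C γ] with x hx
    have hKm := hK.measurable_K_sub x
    calc _ ≤ ∫⁻ p : E3 × E3, ‖K (x - p.1) p.2 * C x p.1 p.2 γ *
          mulPRho φ R₁ f k₁ τ (p.1 - (s - τ) • p.2 + P₁ p.1 p.2) *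
          mulPRho φ R₂ f k₂ γ (p.1 - (s - γ) • p.2 + P₂ p.1 p.2 γ)‖ₑ := enorm_integral_le_lintegral_enorm _
      _ ≤ ∫⁻ p : E3 × E3, supC C γ * (‖K (x - p.1) p.2‖ₑ * Hm p.1 p.2) := by
          refine lintegral_mono_ae ?_
          filter_upwards [hx] with p hp
          have e₁ : ‖mulPRho φ R₁ f k₁ τ (p.1 - (s - τ) • p.2 + P₁ p.1 p.2)‖ₑ ≤ f₁ (Y₁ p.1 p.2) := by
            have := hle₁ (Y₁ p.1 p.2)
            rw [H.eq τ hτ] at this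
            exact this
          have e₂ : ‖mulPRho φ R₂ f k₂ γ (p.1 - (s - γ) • p.2 + P₂ p.1 p.2 γ)‖ₑ ≤
              f₂ (Y₂ p.1 p.2) := by
            have := hle₂ (Y₂ p.1 p.2)
            rw [H.eq γ hγ] at this
            simp only [hY₂def, clamp_eq hγ] at this ⊢
            exact this
          simp only [enorm_mul]
          calc _ ≤ ‖K (x - p.1) p.2‖ₑ * supC C γ * f₁ (Y₁ p.1 p.2) * f₂ (Y₂ p.1 p.2) :=
                mul_le_mul' (mul_le_mul' (mul_le_mul' le_rfl hp) e₁) e₂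
            _ = _ := by rw [hHm]; ring
      _ = supC C γ * ∫⁻ p : E3 × E3, ‖K (x - p.1) p.2‖ₑ * Hm p.1 p.2 :=
          lintegral_const_mul _ (hKm.enorm.mul hHmeas)
      _ ≤ _ := mul_le_mul' le_rfl (hK.lintegral_K_le hφ hA hHmeas x)
  set β := ENNReal.ofReal (tbConst * ((bumpMass + 1) * B * D * ((1 + 2 ^ k₁)⁻¹ * drift τ + oscRate k₁ τ) *
    ((bumpMass + 1) * B * D * ((1 + 2 ^ k₂)⁻¹ * drift γ + oscRate k₂ γ)) *
    min (mm k₁ τ) (mm k₂ γ) ^ 3)) with hβ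
  have h1 : eLpNorm O 1 volume ≤ supC C γ * (ENNReal.ofReal (A * bumpMass) * β) := by
    rw [eLpNorm_one_eq_lintegral_enorm]
    refine (lintegral_mono_ae hpt).trans ?_
    rw [lintegral_const_mul _ (measurable_theta hHmeas)]
    exact mul_le_mul' le_rfl (lintegral_theta_le hA.le k hHmeas hTB)
  have h2 : ENNReal.ofReal (jap s ^ 3) * eLpNorm O ∞ volume ≤
      supC C γ * (ENNReal.ofReal (A * bumpMass) * β) := by
    refine mul_eLpNorm_top_le (pow_pos (jap_pos s) 3) ?_
    filter_upwards [hpt] with x hx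
    calc _ ≤ ENNReal.ofReal (jap s ^ 3) * (supC C γ * theta A k j Hm x) := mul_le_mul' le_rfl hx
      _ = supC C γ * (ENNReal.ofReal (jap s ^ 3) * theta A k j Hm x) := mul_left_comm _ _ _
      _ ≤ _ := mul_le_mul' le_rfl (theta_le hA.le k hTB x)
  refine (add_le_add h1 h2).trans ?_
  rw [← mul_add, mul_comm, ← two_mul]
  refine mul_le_mul' ?_ le_rfl
  rw [hβ, ← ENNReal.ofReal_mul (by positivity), ← ENNReal.ofReal_ofNat 2,
    ← ENNReal.ofReal_mul (by norm_num)]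
  refine ENNReal.ofReal_le_ofReal ?_
  have r₁ := rate_add_le_inv k₁ τ
  have r₂ := rate_add_le_inv k₂ γ
  have r₃ := pow_le_pow_left₀ (le_min (mm_pos k₁ τ).le (mm_pos k₂ γ).le) (min_mm_le k₁ k₂ τ γ) 3
  have n₁ : 0 ≤ (1 + 2 ^ k₁)⁻¹ * drift τ + oscRate k₁ τ := by
    have := drift_pos τ
    have := oscRate_pos k₁ τ
    positivity
  have n₂ : 0 ≤ (1 + 2 ^ k₂)⁻¹ * drift γ + oscRate k₂ γ := by
    have := drift_pos γ
    have := oscRate_pos k₂ γ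
    positivity
  have n₃ : 0 ≤ min (mm k₁ τ) (mm k₂ γ) ^ 3 := pow_nonneg (le_min (mm_pos k₁ τ).le (mm_pos k₂ γ).le) 3
  generalize (1 + 2 ^ k₁)⁻¹ * drift τ + oscRate k₁ τ = x₁ at r₁ n₁ ⊢
  generalize (1 + 2 ^ k₂)⁻¹ * drift γ + oscRate k₂ γ = x₂ at r₂ n₂ ⊢
  generalize min (mm k₁ τ) (mm k₂ γ) ^ 3 = x₃ at r₃ n₃ ⊢
  generalize (jap τ ^ (1 - 2 * del) * 2 ^ k₁ + jap τ ^ (-del))⁻¹ = y₁ at r₁ ⊢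
  generalize (jap γ ^ (1 - 2 * del) * 2 ^ k₂ + jap γ ^ (-del))⁻¹ = y₂ at r₂ ⊢
  have hx : x₁ * x₂ * x₃ ≤ (3 * y₁) * (3 * y₂) * min ((2 : ℝ) ^ (min k₁ k₂)) (min (jap τ)⁻¹ (jap γ)⁻¹) ^ 3 :=
    mul_le_mul (mul_le_mul r₁ r₂ n₂ (n₁.trans r₁)) r₃ n₃ (mul_nonneg (n₁.trans r₁) (n₂.trans r₂))
  calc _ = 2 * (A * bumpMass) * (tbConst * ((bumpMass + 1) * B) ^ 2) * D ^ 2 * (x₁ * x₂ * x₃) := by ring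
    _ ≤ 2 * (A * bumpMass) * (tbConst * ((bumpMass + 1) * B) ^ 2) * D ^ 2 * ((3 * y₁) * (3 * y₂) *
          min ((2 : ℝ) ^ (min k₁ k₂)) (min (jap τ)⁻¹ (jap γ)⁻¹) ^ 3) :=
        mul_le_mul_of_nonneg_left hx (by positivity)
    _ = _ := by ring

/-! ### Smallness of the perturbation -/

lemma pos_of_rpow_pos {x : ℝ} (h : 0 < x ^ (3 / 4 : ℝ)) : 0 < x := by
  by_contra! hx
  rcases hx.lt_or_eq with hx | rfl
  · -- on the negative axis `x ^ (3/4)` has the sign of `cos (3π/4)`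
    rw [Real.rpow_def_of_neg hx] at h
    have hpi := Real.pi_pos
    have : Real.cos (3 / 4 * Real.pi) < 0 :=
      Real.cos_neg_of_pi_div_two_lt_of_lt (by linarith) (by linarith)
    have := Real.exp_pos (Real.log x * (3 / 4))
    nlinarith
  · rw [Real.zero_rpow (by norm_num)] at h
    exact h.false

/-- The smallness of `ε₀` makes `A ε₁`, the size of the perturbation of the characteristics, at most `1/16`. -/
lemma mul_eps_le {A ε₀ ε₁ : ℝ} (hA : 0 < A) (h₀ : ε₀ ≤ min 1 ((16 * A)⁻¹ ^ (4 / 3 : ℝ))) (h₁ : 0 < ε₁)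
    (h : ε₁ ≤ ε₀ ^ (3 / 4 : ℝ)) : A * ε₁ ≤ 1 / 16 := by
  have hε := pos_of_rpow_pos (h₁.trans_le h)
  have h2 : ε₀ ^ (3 / 4 : ℝ) ≤ (16 * A)⁻¹ := by
    calc _ ≤ ((16 * A)⁻¹ ^ (4 / 3 : ℝ)) ^ (3 / 4 : ℝ) :=
          Real.rpow_le_rpow hε.le (h₀.trans (min_le_right _ _)) (by norm_num)
      _ = _ := by
          rw [← Real.rpow_mul (by positivity)]
          norm_num
  calc A * ε₁ ≤ A * (16 * A)⁻¹ := by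
        gcongr
        exact h.trans h2
    _ = 1 / 16 := by field_simp


end VPPoisson

open VPPoisson
theorem lemma5p1 (φ : ℝ → ℝ) (hφ : IsCutoff φ) (A : ℝ) (hA : 0 < A) :
    ∃ εbar : ℝ, 0 < εbar ∧ εbar ≤ 1 ∧ ∃ M : ℝ, 0 < M ∧
      ∀ (T ε₀ ε₁ : ℝ) (f : ℝ → E3 → E3 → ℝ) (ρstat : ℝ → E3 → ℝ) (ρosc : ℝ → E3 → ℂ),
        0 < T → ε₀ ≤ εbar → Bootstrap φ T ε₀ ε₁ f ρstat ρosc →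
      ∀ (s τ : ℝ), s ∈ Icc 0 T → τ ∈ Icc 0 s →
      ∀ (j : ℕ) (k : ℤ) (K : E3 → E3 → ℂ) (P₁ : E3 → E3 → E3) (P₂ : E3 → E3 → ℝ → E3),
        Admissible φ A ε₁ s j k K P₁ P₂ →
      ∀ (R₁ R₂ : E3 → ℂ), IsMichlin R₁ → IsMichlin R₂ →
      ∀ C : E3 → E3 → E3 → ℝ → ℂ,
        Measurable (fun p : E3 × E3 × E3 × ℝ => C p.1 p.2.1 p.2.2.1 p.2.2.2) →
      -- the bounds on `B_{j,k}`
      (∀ (m₂ : ℕ) (t₃ t₄ : ℝ), (2 : ℝ) ^ ((m₂ : ℝ) - 1) ≤ s → t₃ ≤ t₄ →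
        t₃ ∈ Icc ((2 : ℝ) ^ m₂ - 1) ((2 : ℝ) ^ (m₂ + 1)) ∩ Icc 0 s →
        t₄ ∈ Icc ((2 : ℝ) ^ m₂ - 1) ((2 : ℝ) ^ (m₂ + 1)) ∩ Icc 0 s →
        (∀ x y v, DifferentiableOn ℝ (C x y v) (Icc 0 s)) →
        ∀ a b c d : Fin 3,
          normB0 φ s (opB K P₁ P₂ (mulDE φ R₁ f a b) (mulE φ R₂ f c) C t₃ t₄ τ s)
            ≤ ENNReal.ofReal (M * ε₁ ^ 2 * rate 1.1 m₂ τ) * lamStar C s t₃ t₄ ∧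
          normB0 φ s (opB K P₁ P₂ (mulE φ R₁ f a) (mulDE φ R₂ f b c) C t₃ t₄ τ s)
            ≤ ENNReal.ofReal (M * ε₁ ^ 2 * rate 1.1 m₂ τ) * lamStar C s t₃ t₄ ∧
          normB0 φ s (opB K P₁ P₂ (mulE φ R₁ f a) (mulE φ R₂ f b) C t₃ t₄ τ s)
            ≤ ENNReal.ofReal (M * ε₁ ^ 2 * rate 0.1 m₂ τ) * lamStar C s t₃ t₄ ∧
          normB0 φ s (opB K P₁ P₂ (mulDE φ R₁ f a b) (mulDE φ R₂ f c d) C t₃ t₄ τ s)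
            ≤ ENNReal.ofReal (M * ε₁ ^ 2 * rate 2.1 m₂ τ) * lamStar C s t₃ t₄ ∧
          ∀ (k₁ : ℤ) (e : Fin 3),
            normB0 φ s (opB K P₁ P₂ (mulDDPE φ R₁ f k₁ a b c) (mulE φ R₂ f d) C t₃ t₄ τ s)
              ≤ ENNReal.ofReal (M * ε₁ ^ 2 * (jap τ)⁻¹ * rate 1.1 m₂ τ)
                * lamStar C s t₃ t₄ ∧
            normB0 φ s (opB K P₁ P₂ (mulDDPE φ R₁ f k₁ a b c) (mulDE φ R₂ f d e) C t₃ t₄ τ s)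
              ≤ ENNReal.ofReal (M * ε₁ ^ 2 * (jap τ)⁻¹ * rate 2.1 m₂ τ)
                * lamStar C s t₃ t₄) ∧
      -- the bounds on `Q_{j,k}`
      (∀ (k₁ k₂ : ℤ) (γ : ℝ), γ ∈ Icc 0 s →
        eLpNorm (opQ K P₁ P₂ (mulPRho φ R₁ f k₁) (mulPRho φ R₂ f k₂) C γ τ s) 1 volume +
          ENNReal.ofReal (jap s ^ 3) *
            eLpNorm (opQ K P₁ P₂ (mulPRho φ R₁ f k₁) (mulPRho φ R₂ f k₂) C γ τ s) ∞ volume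
          ≤ ENNReal.ofReal (M *
              (ε₁ ^ 2 / (jap τ ^ (1 - 2 * del) * (2 : ℝ) ^ k₁ + jap τ ^ (-del))) *
              (min ((2 : ℝ) ^ (min k₁ k₂)) (min (jap τ)⁻¹ (jap γ)⁻¹) ^ 3 /
                (jap γ ^ (1 - 2 * del) * (2 : ℝ) ^ k₂ + jap γ ^ (-del))))
            * supC C γ) := by
  have hE := homog_rSym
  have hDE : ∀ i : Fin 3 × Fin 3, Homog 0 (fun ξ => dSym i.1 ξ * rSym i.2 ξ) := fun i =>
    (homog_dSym i.1).mul (homog_rSym i.2)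
  have hDDE : ∀ i : Fin 3 × Fin 3 × Fin 3,
      Homog 1 (fun ξ => dSym i.1 ξ * (dSym i.2.1 ξ * rSym i.2.2 ξ)) := fun i =>
    (homog_dSym i.1).mul ((homog_dSym i.2.1).mul (homog_rSym i.2.2))
  obtain ⟨CP, hCP, hsrc⟩ := exists_source hφ
  -- the four bounds for the field and its gradient, by the degrees `0` and `-1` of the two factors
  obtain ⟨M₁, hM₁, h₁⟩ := exists_normB0_field_field hφ hA (.inl rfl) (.inr rfl) hDE hE
  obtain ⟨M₂, hM₂, h₂⟩ := exists_normB0_field_field hφ hA (.inr rfl) (.inl rfl) hE hDE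
  obtain ⟨M₃, hM₃, h₃⟩ := exists_normB0_field_field hφ hA (.inr rfl) (.inr rfl) hE hE
  obtain ⟨M₄, hM₄, h₄⟩ := exists_normB0_field_field hφ hA (.inl rfl) (.inl rfl) hDE hDE
  obtain ⟨M₅, hM₅, h₅⟩ := exists_normB0_proj_field hφ hA (.inr rfl) hDDE hE
  obtain ⟨M₆, hM₆, h₆⟩ := exists_normB0_proj_field hφ hA (.inl rfl) hDDE hDE
  obtain ⟨M₇, hM₇, h₇⟩ := exists_opQ_le hφ hA
  -- `ε₁ ≤ ε₀^{3/4}`, so this bound for `ε₀` makes `A ε₁ ≤ 1/16`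
  refine ⟨min 1 ((16 * A)⁻¹ ^ (4 / 3 : ℝ)), by positivity, min_le_left _ _,
    (M₁ + M₂ + M₃ + M₄ + M₅ + M₆ + M₇) * CP ^ 2, by positivity, ?_⟩
  intro T ε₀ ε₁ f ρstat ρosc hT hε₀ hB s τ hs hτ j k K P₁ P₂ hK R₁ R₂ hR₁ hR₂ C hC
  have hε₁ := hB.eps_pos
  have hAε := mul_eps_le hA hε₀ hε₁ hB.eps_le
  obtain ⟨r, S, g, g', H⟩ := hsrc T ε₀ ε₁ f ρstat ρosc hT hB s hs
  have hD : 0 < CP * ε₁ := mul_pos hCP hε₁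
  have hle : ∀ {M' w w' : ℝ}, M' ≤ M₁ + M₂ + M₃ + M₄ + M₅ + M₆ + M₇ → 0 ≤ w → w = w' →
      ENNReal.ofReal (M' * (CP * ε₁) ^ 2 * w) ≤
        ENNReal.ofReal ((M₁ + M₂ + M₃ + M₄ + M₅ + M₆ + M₇) * CP ^ 2 * ε₁ ^ 2 * w') := by
    intro M' w w' hM' hw hww
    subst hww
    refine ENNReal.ofReal_le_ofReal ?_
    rw [mul_pow, ← mul_assoc]
    gcongr
  have hjτ := jap_pos τ
  have hj' := inv_pos.2 hjτ
  refine ⟨?_, ?_⟩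
  · intro m₂ t₃ t₄ _ h34 ht₃ ht₄ hCd a b c d
    have hb : Block (2 ^ m₂) s τ t₃ t₄ := ⟨one_le_pow₀ one_le_two, hτ.1, hτ.2, h34, ht₃.1.1,
      ht₄.1.2.trans (pow_succ' _ _).le, ht₄.2.2⟩
    have hr := fun a => (rate_pos a m₂ τ).le
    have eE := fun {R} (hR : IsMichlin R) c t (ht : t ∈ Icc 0 s) => H.mulE_eq hφ ht hR c
    have eDE := fun {R} (hR : IsMichlin R) a c t (ht : t ∈ Icc 0 s) => H.mulDE_eq hφ ht hR a c
    refine ⟨?_, ?_, ?_, ?_, fun k₁ e => ⟨?_, ?_⟩⟩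
    · exact (h₁ hAε hK hb hC hCd hR₁ hR₂ H hD (by norm_num) (by norm_num) (a, b) c
        (eDE hR₁ a b τ hτ) (eE hR₂ c)).trans
        (mul_le_mul' (hle (by linarith) (hr _) rfl) le_rfl)
    · exact (h₂ hAε hK hb hC hCd hR₁ hR₂ H hD (by norm_num) (by norm_num) a (b, c)
        (eE hR₁ a τ hτ) (eDE hR₂ b c)).trans
        (mul_le_mul' (hle (by linarith) (hr _) rfl) le_rfl)
    · exact (h₃ hAε hK hb hC hCd hR₁ hR₂ H hD (by norm_num) (by norm_num) a b
        (eE hR₁ a τ hτ) (eE hR₂ b)).trans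
        (mul_le_mul' (hle (by linarith) (hr _) rfl) le_rfl)
    · exact (h₄ hAε hK hb hC hCd hR₁ hR₂ H hD (by norm_num) (by norm_num) (a, b) (c, d)
        (eDE hR₁ a b τ hτ) (eDE hR₂ c d)).trans
        (mul_le_mul' (hle (by linarith) (hr _) rfl) le_rfl)
    · rw [mul_assoc _ (jap τ)⁻¹]
      exact (h₅ hAε hK hb hC hCd hR₁ hR₂ H hD (by norm_num) (by norm_num) (a, b, c) d
        (H.mulDDPE_eq hφ hτ hR₁ k₁ a b c) (eE hR₂ d)).trans
        (mul_le_mul' (hle (by linarith) (mul_nonneg hj'.le (hr _)) rfl) le_rfl)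
    · rw [mul_assoc _ (jap τ)⁻¹]
      exact (h₆ hAε hK hb hC hCd hR₁ hR₂ H hD (by norm_num) (by norm_num) (a, b, c) (d, e)
        (H.mulDDPE_eq hφ hτ hR₁ k₁ a b c) (eDE hR₂ d e)).trans
        (mul_le_mul' (hle (by linarith) (mul_nonneg hj'.le (hr _)) rfl) le_rfl)
  · intro k₁ k₂ γ hγ
    have hjγ := jap_pos γ
    have hj'' := inv_pos.2 hjγ
    refine (h₇ hAε hK hτ hγ hR₁ hR₂ H).trans (mul_le_mul' (le_trans (hle (w' := _) (by linarith)
      (by positivity) rfl) (le_of_eq ?_)) le_rfl)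
    congr 1
    rw [div_eq_mul_inv, div_eq_mul_inv]
    ring
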